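/- **Setting.** Let $p\ge 0$ be an integer. Let $\overline{\mathbb C^*}\cong S^1\times[0,\infty]$ be the compact annulus, i.e. the real oriented blow-up of $\mathbb P^1$ at $0$ and $\infty$, with $\mathbb C^*\cong S^1\times(0,\infty)$ as its interior through $t=\rho u$. On $\overline X:=(\overline{\mathbb C^*})^p$ use the coordinates $t=(t_1,\dots,t_p)$ of $(\mathbb C^*)^p$. For $Y=\mathbb C^p/\mathbb Z^p$ or $Y$ a point, let $\mathcal A^{<0}_{\overline X\times Y}$ be the sheaf on $\overline X\times Y$ of functions which are holomorphic on $(\mathbb C^*)^p\times Y$, and which together with their extension by $0$ to the boundary have rapid decay: every point of the open set of definition has a neighbourhood on which, for each $N\in\mathbb N$, $|f|\le C_N\prod_j\max(|t_j|,|t_j|^{-1})^{-N}$ in the interior, for some constant $C_N$. Write $\mathcal A^{<0}_{\overline X}$ when $Y$ is a point. Let $r_1:\overline X\times\mathbb C^p/\mathbb Z^p\to\overline X$ and $r_2:\overline X\times\mathbb C^p/\mathbb Z^p\to\mathbb C^p/\mathbb Z^p$ be the projections, and let $\mathcal O=\mathcal O_{\mathbb C^p/\mathbb Z^p}$ be the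 sheaf of holomorphic functions. Let $\mathrm D=\mathbb C[t_1^{\pm1},\dots,t_p^{\pm1}]\langle t_1\partial_{t_1},\dots,t_p\partial_{t_p}\rangle$ be the algebra of algebraic differential operators on $(\mathbb C^*)^p$. It acts on $\mathcal A^{<0}_{\overline X}$, $r_1^{-1}\mathcal A^{<0}_{\overline X}$ and $\mathcal A^{<0}_{\overline X\times\mathbb C^p/\mathbb Z^p}$ by differentiation in $t$ and multiplication, and the action on the last sheaf commutes with multiplication by sections of $r_2^{-1}\mathcal O$. **Theorem 2.** Let $\mathcal M$ be a coherent algebraic $\mathcal D_{(\mathbb C^*)^p}$-module, and let $\mathrm M$ be its module of global sections, a finitely generated left $\mathrm D$-module. View $\mathrm D$ and $\mathrm M$ as constant sheaves. Suppose that every cohomology sheaf of $\mathbf R\mathcal Hom_{\mathrm D}(\mathrm M,\mathcal A^{<0}_{\overline X})$ is $\mathbb C$-constructible on $(\mathbb C^*)^p$ and $\mathbb R$-constructible on $\overline X$ (constructible sheaves are understood to have finite dimensional stalks). Then $$\mathbf R\mathcal Hom_{\mathrm D}(\mathrm M,r_1^{-1}\mathcal A^{<0}_{\overline X})\otimes^{\mathbf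 L}_{\mathbb C}r_2^{-1}\mathcal O\qquad\text{and}\qquad \mathbf R\mathcal Hom_{\mathrm D}(\mathrm M,\mathcal A^{<0}_{\overline X\times\mathbb C^p/\mathbb Z^p})$$ have bounded cohomology, and the canonical morphism from the first to the second, induced by the multiplication $h\otimes g\mapsto (g\circ r_2)\cdot h$, is an isomorphism in the bounded derived category of sheaves of $r_2^{-1}\mathcal O$-modules on $\overline X\times\mathbb C^p/\mathbb Z^p$. -/

import Mathlib

open CategoryTheory TopologicalSpace Opposite Topology
open scoped ENNReal TensorProduct

namespace RapidDecay

noncomputable section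

/-! ### The compactified annulus and the parameter space -/

/-- The `p`-th power of the compact annulus, i.e. of the real oriented blow-up of the projective
line at `0` and `∞`, in polar coordinates: the point `(u, ρ)` of a factor with `0 < ρ < ∞` is
`t = ρ u`, and `ρ = 0`, `ρ = ∞` are the two boundary circles. -/
abbrev CBar (p : ℕ) : Type := Fin p → Circle × ℝ≥0∞

/-- The open subset `(ℂ^*)^p` of the compactified annulus. -/
def torus (p : ℕ) : Set (CBar p) := {x | ∀ j, (x j).2 ≠ 0 ∧ (x j).2 ≠ ⊤}

/-- The coordinates `t_j = ρ_j u_j`, meaningful on `torus p`. -/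
def coord {p : ℕ} (x : CBar p) : Fin p → ℂ := fun j => ((x j).2.toReal : ℂ) * ((x j).1 : ℂ)

/-- The inclusion of `(ℂ^*)^p`; meaningful when no `t j` vanishes. -/
def incl {p : ℕ} (t : Fin p → ℂ) : CBar p :=
  fun j => (Circle.exp (t j).arg, ENNReal.ofReal ‖t j‖)

/-- The lattice `ℤ^q` in `ℂ^q`. -/
def lattice (q : ℕ) : AddSubgroup (Fin q → ℂ) where
  carrier := {s | ∀ j, ∃ n : ℤ, s j = n}
  zero_mem' := fun _ => ⟨0, by simp⟩
  add_mem' := by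
    intro a b ha hb j
    obtain ⟨m, hm⟩ := ha j
    obtain ⟨n, hn⟩ := hb j
    exact ⟨m + n, by simp [hm, hn]⟩
  neg_mem' := by
    intro a ha j
    obtain ⟨m, hm⟩ := ha j
    exact ⟨-m, by simp [hm]⟩

/-- The parameter space `ℂ^q/ℤ^q` with its quotient topology; it is a point for `q = 0`. -/
abbrev Par (q : ℕ) : Type := (Fin q → ℂ) ⧸ lattice q

/-- The projection `ℂ^q → ℂ^q/ℤ^q`. -/
abbrev proj {q : ℕ} (s : Fin q → ℂ) : Par q := QuotientAddGroup.mk s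

lemma coord_incl {p : ℕ} (t : Fin p → ℂ) : coord (incl t) = t := by
  funext j
  simp [coord, incl, Complex.norm_mul_exp_arg_mul_I]

lemma incl_coord {p : ℕ} {x : CBar p} (hx : x ∈ torus p) : incl (coord x) = x := by
  funext j
  obtain ⟨h0, h1⟩ := hx j
  have hpos : 0 < (x j).2.toReal := ENNReal.toReal_pos h0 h1
  refine Prod.ext ?_ ?_
  · apply Subtype.ext
    have : ((x j).2.toReal : ℂ) * ((x j).1 : ℂ) ≠ 0 := by
      simp [hpos.ne']
    have h2 := Complex.norm_mul_exp_arg_mul_I (((x j).2.toReal : ℂ) * ((x j).1 : ℂ))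
    rw [norm_mul, Circle.norm_coe, mul_one, Complex.norm_real, Real.norm_of_nonneg hpos.le] at h2
    have h3 := mul_left_cancel₀ (by exact_mod_cast hpos.ne') h2
    simpa [incl, coord] using h3
  · have : ‖((x j).2.toReal : ℂ) * ((x j).1 : ℂ)‖ = (x j).2.toReal := by
      rw [norm_mul, Circle.norm_coe, mul_one, Complex.norm_real, Real.norm_of_nonneg hpos.le]
    simp only [incl, coord]
    rw [this, ENNReal.ofReal_toReal h1]

lemma coord_ne_zero {p : ℕ} {x : CBar p} (hx : x ∈ torus p) (j : Fin p) : coord x j ≠ 0 := by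
  obtain ⟨h0, h1⟩ := hx j
  have hpos : 0 < (x j).2.toReal := ENNReal.toReal_pos h0 h1
  simp [coord, hpos.ne']

lemma incl_mem_torus {p : ℕ} {t : Fin p → ℂ} (ht : ∀ j, t j ≠ 0) : incl t ∈ torus p := by
  intro j
  simp [incl, ht j]

lemma isOpen_torus (p : ℕ) : IsOpen (torus p) := by
  have : torus p = ⋂ j, {x : CBar p | (x j).2 ≠ 0} ∩ {x : CBar p | (x j).2 ≠ ⊤} := by
    ext x; simp [torus]
  rw [this]
  refine isOpen_iInter_of_finite fun j => IsOpen.inter ?_ ?_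
  · exact isOpen_ne_fun (by fun_prop) continuous_const
  · exact isOpen_ne_fun (by fun_prop) continuous_const

lemma continuousAt_circle_exp_arg {z : ℂ} (hz : z ≠ 0) :
    ContinuousAt (fun w : ℂ => Circle.exp w.arg) z := by
  have hind : Topology.IsInducing (fun u : Circle => (u : ℂ)) := ⟨rfl⟩
  rw [hind.continuousAt_iff]
  have h : (fun w : ℂ => w / ‖w‖) =ᶠ[𝓝 z] ((fun u : Circle => (u : ℂ)) ∘ fun w : ℂ => Circle.exp w.arg) := by
    filter_upwards [isOpen_ne.mem_nhds hz] with w hw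
    have h2 := Complex.norm_mul_exp_arg_mul_I w
    have h3 : (‖w‖ : ℂ) ≠ 0 := by simpa using hw
    simp only [Function.comp]
    rw [div_eq_iff h3]
    exact (by rw [mul_comm]; exact h2.symm)
  refine ContinuousAt.congr ?_ h
  refine ContinuousAt.div continuousAt_id (by fun_prop) (by simpa using hz)

lemma continuousAt_incl {p : ℕ} {t : Fin p → ℂ} (ht : ∀ j, t j ≠ 0) :
    ContinuousAt (incl : (Fin p → ℂ) → CBar p) t := by
  refine continuousAt_pi.2 fun j => ContinuousAt.prodMk ?_ ?_
  · exact ContinuousAt.comp (f := fun t : Fin p → ℂ => t j) (continuousAt_circle_exp_arg (ht j))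
      (continuousAt_apply j t)
  · exact (ENNReal.continuous_ofReal.comp (by fun_prop)).continuousAt

lemma isOpen_ne_zero (p : ℕ) : IsOpen {t : Fin p → ℂ | ∀ j, t j ≠ 0} := by
  simp only [Set.ofPred_forall]
  exact isOpen_iInter_of_finite fun j => isOpen_ne_fun (by fun_prop) continuous_const

/-! ### Holomorphic functions with rapid decay -/

/-- The weight `∏ max(|t_j|, 1/|t_j|)`, which tends to `∞` at the boundary of the annulus. -/
def weight {p : ℕ} (x : CBar p) : ℝ := ∏ j, max ‖coord x j‖ ‖coord x j‖⁻¹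

/-- The function `F` in the coordinates `(t, s)`. -/
def lift {p q : ℕ} (F : CBar p × Par q → ℂ) : (Fin p → ℂ) × (Fin q → ℂ) → ℂ :=
  fun v => F (incl v.1, proj v.2)

/-- The part in `(ℂ^*)^p × ℂ^q` of a subset of `CBar p × Par q`. -/
def liftDom {p q : ℕ} (U : Set (CBar p × Par q)) : Set ((Fin p → ℂ) × (Fin q → ℂ)) :=
  {v | (∀ j, v.1 j ≠ 0) ∧ (incl v.1, proj v.2) ∈ U}

/-- On the open set `U`, the function `F` is holomorphic in the interior of the annulus, vanishes
on the boundary and is, locally uniformly, smaller than every power of `1 / weight` near it. -/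
structure RapidDecayOn {p q : ℕ} (U : Set (CBar p × Par q)) (F : CBar p × Par q → ℂ) : Prop where
  boundary : ∀ z ∈ U, z.1 ∉ torus p → F z = 0
  holo : AnalyticOnNhd ℂ (lift F) (liftDom U)
  decay : ∀ z ∈ U, ∀ N : ℕ, ∃ C : ℝ, ∀ᶠ w in 𝓝 z, w.1 ∈ torus p → ‖F w‖ * weight w.1 ^ N ≤ C

lemma isOpen_liftDom {p q : ℕ} {U : Set (CBar p × Par q)} (hU : IsOpen U) :
    IsOpen (liftDom U) := by
  rw [isOpen_iff_mem_nhds]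
  rintro v ⟨hv, hvU⟩
  have h1 : ContinuousAt (fun v : (Fin p → ℂ) × (Fin q → ℂ) => (incl v.1, proj v.2)) v :=
    ContinuousAt.prodMk (ContinuousAt.comp (continuousAt_incl hv) continuousAt_fst)
      (continuous_quotient_mk'.comp continuous_snd).continuousAt
  filter_upwards [h1 (hU.mem_nhds hvU),
    continuousAt_fst ((isOpen_ne_zero p).mem_nhds hv)] with w hw1 hw2
  exact ⟨hw2, hw1⟩

lemma weight_pos {p : ℕ} {x : CBar p} (hx : x ∈ torus p) : 0 < weight x :=
  Finset.prod_pos fun j _ => lt_max_of_lt_left (norm_pos_iff.2 (coord_ne_zero hx j))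

lemma one_le_max_inv {a : ℝ} (ha : 0 < a) : 1 ≤ max a a⁻¹ := by
  rcases le_total 1 a with h | h
  · exact le_max_of_le_left h
  · exact le_max_of_le_right ((one_le_inv₀ ha).2 h)

lemma max_le_weight {p : ℕ} {x : CBar p} (hx : x ∈ torus p) (j : Fin p) :
    max ‖coord x j‖ ‖coord x j‖⁻¹ ≤ weight x := by
  unfold weight
  rw [← Finset.mul_prod_erase _ _ (Finset.mem_univ j)]
  refine le_mul_of_one_le_right (le_max_of_le_left (norm_nonneg _)) ?_
  exact Finset.prod_induction _ (fun a => 1 ≤ a) (fun _ _ => one_le_mul_of_one_le_of_one_le) le_rfl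
    fun k _ => one_le_max_inv (norm_pos_iff.2 (coord_ne_zero hx k))

lemma update_ne_zero {p : ℕ} {t : Fin p → ℂ} (ht : ∀ k, t k ≠ 0) {j : Fin p} {ζ : ℂ} (hζ : ζ ≠ 0) :
    ∀ k, Function.update t j ζ k ≠ 0 := by
  intro k
  rcases eq_or_ne k j with rfl | h
  · simpa using hζ
  · simpa [h] using ht k

lemma weight_le_update {p : ℕ} {x : CBar p} (hx : x ∈ torus p) (j : Fin p) {ζ : ℂ}
    (h1 : ‖coord x j‖ / 2 ≤ ‖ζ‖) (h2 : ‖ζ‖ ≤ 2 * ‖coord x j‖) :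
    weight x ≤ 2 * weight (incl (Function.update (coord x) j ζ)) := by
  have ht : 0 < ‖coord x j‖ := norm_pos_iff.2 (coord_ne_zero hx j)
  have hζ : 0 < ‖ζ‖ := by linarith
  unfold weight
  rw [coord_incl, ← Finset.mul_prod_erase _ _ (Finset.mem_univ j),
    ← Finset.mul_prod_erase (a := j) _ (fun k => max ‖Function.update (coord x) j ζ k‖
      ‖Function.update (coord x) j ζ k‖⁻¹) (Finset.mem_univ j), ← mul_assoc]
  have : ∏ k ∈ Finset.univ.erase j, max ‖Function.update (coord x) j ζ k‖
      ‖Function.update (coord x) j ζ k‖⁻¹ =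
      ∏ k ∈ Finset.univ.erase j, max ‖coord x k‖ ‖coord x k‖⁻¹ := by
    refine Finset.prod_congr rfl fun k hk => ?_
    rw [Function.update_of_ne (Finset.ne_of_mem_erase hk)]
  rw [this]
  refine mul_le_mul_of_nonneg_right ?_
    (Finset.prod_nonneg fun k _ => le_max_of_le_left (norm_nonneg _))
  rw [Function.update_self]
  refine max_le ?_ ?_
  · calc ‖coord x j‖ ≤ 2 * ‖ζ‖ := by linarith
      _ ≤ _ := by gcongr; exact le_max_left _ _
  · calc ‖coord x j‖⁻¹ ≤ 2 * ‖ζ‖⁻¹ := by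
          rw [← div_eq_mul_inv, le_div_iff₀ hζ, inv_mul_le_iff₀ ht]; linarith
      _ ≤ _ := by gcongr; exact le_max_right _ _

/-! ### The differential operators on functions -/

/-- Multiplication by `t_j`. -/
def mulOp {p q : ℕ} (j : Fin p) (F : CBar p × Par q → ℂ) : CBar p × Par q → ℂ :=
  fun z => coord z.1 j * F z

/-- Multiplication by `1 / t_j`. -/
def invOp {p q : ℕ} (j : Fin p) (F : CBar p × Par q → ℂ) : CBar p × Par q → ℂ :=
  fun z => (coord z.1 j)⁻¹ * F z

open Classical in
/-- The operator `t_j ∂/∂t_j` in the interior of the annulus, extended by zero to the boundary. -/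
def thetaOp {p q : ℕ} (j : Fin p) (F : CBar p × Par q → ℂ) : CBar p × Par q → ℂ :=
  fun z => if z.1 ∈ torus p then
    coord z.1 j *
      deriv (fun ζ : ℂ => F (incl (Function.update (coord z.1) j ζ), z.2)) (coord z.1 j)
  else 0

namespace RapidDecayOn

variable {p q : ℕ} {U : Set (CBar p × Par q)} {F G : CBar p × Par q → ℂ}

lemma congr (hU : IsOpen U) (h : RapidDecayOn U F) (hFG : ∀ z ∈ U, F z = G z) :
    RapidDecayOn U G where
  boundary z hz hb := by rw [← hFG z hz, h.boundary z hz hb]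
  holo v hv := by
    refine (h.holo v hv).congr ?_
    filter_upwards [(isOpen_liftDom hU).mem_nhds hv] with w hw
    exact hFG _ hw.2
  decay z hz N := by
    obtain ⟨C, hC⟩ := h.decay z hz N
    refine ⟨C, ?_⟩
    filter_upwards [hC, hU.mem_nhds hz] with w hw hwU ht
    rw [← hFG w hwU]
    exact hw ht

lemma mono {V : Set (CBar p × Par q)} (h : RapidDecayOn U F) (hV : V ⊆ U) : RapidDecayOn V F where
  boundary z hz := h.boundary z (hV hz)
  holo v hv := h.holo v ⟨hv.1, hV hv.2⟩
  decay z hz := h.decay z (hV hz)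

lemma of_local (h : ∀ z ∈ U, ∃ V, z ∈ V ∧ RapidDecayOn V F) : RapidDecayOn U F where
  boundary z hz := by
    obtain ⟨V, hzV, hV⟩ := h z hz
    exact hV.boundary z hzV
  holo v hv := by
    obtain ⟨V, hzV, hV⟩ := h _ hv.2
    exact hV.holo v ⟨hv.1, hzV⟩
  decay z hz := by
    obtain ⟨V, hzV, hV⟩ := h z hz
    exact hV.decay z hzV

lemma zero : RapidDecayOn U (0 : CBar p × Par q → ℂ) where
  boundary _ _ _ := rfl
  holo _ _ := analyticAt_const
  decay _ _ _ := ⟨0, by simp⟩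

lemma add (hF : RapidDecayOn U F) (hG : RapidDecayOn U G) : RapidDecayOn U (F + G) where
  boundary z hz hb := by simp [hF.boundary z hz hb, hG.boundary z hz hb]
  holo v hv := (hF.holo v hv).add (hG.holo v hv)
  decay z hz N := by
    obtain ⟨C, hC⟩ := hF.decay z hz N
    obtain ⟨C', hC'⟩ := hG.decay z hz N
    refine ⟨C + C', ?_⟩
    filter_upwards [hC, hC'] with w h1 h2 ht
    have := weight_pos ht
    calc ‖(F + G) w‖ * weight w.1 ^ N ≤ (‖F w‖ + ‖G w‖) * weight w.1 ^ N := by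
          gcongr; exact norm_add_le _ _
      _ ≤ C + C' := by rw [add_mul]; exact add_le_add (h1 ht) (h2 ht)

/-- Multiplication by a function that is holomorphic in the interior and has moderate growth. -/
lemma mul (hF : RapidDecayOn U F) (hG : AnalyticOnNhd ℂ (lift G) (liftDom U))
    (hgr : ∀ z ∈ U, ∃ (C : ℝ) (m : ℕ), ∀ᶠ w in 𝓝 z, w.1 ∈ torus p → ‖G w‖ ≤ C * weight w.1 ^ m) :
    RapidDecayOn U (G * F) where
  boundary z hz hb := by simp [hF.boundary z hz hb]
  holo v hv := (hG v hv).mul (hF.holo v hv)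
  decay z hz N := by
    obtain ⟨C, m, hC⟩ := hgr z hz
    obtain ⟨C', hC'⟩ := hF.decay z hz (N + m)
    refine ⟨|C| * C', ?_⟩
    filter_upwards [hC, hC'] with w h1 h2 ht
    have := weight_pos ht
    calc ‖(G * F) w‖ * weight w.1 ^ N = ‖G w‖ * (‖F w‖ * weight w.1 ^ N) := by
          simp [mul_assoc]
      _ ≤ (|C| * weight w.1 ^ m) * (‖F w‖ * weight w.1 ^ N) := by
          gcongr
          exact (h1 ht).trans (by gcongr; exact le_abs_self C)
      _ = |C| * (‖F w‖ * weight w.1 ^ (N + m)) := by ring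
      _ ≤ |C| * C' := by gcongr; exact h2 ht

lemma smul (c : ℂ) (hF : RapidDecayOn U F) : RapidDecayOn U (c • F) := by
  have := hF.mul (G := fun _ => c) (fun _ _ => analyticAt_const)
    (fun _ _ => ⟨‖c‖, 0, by simp⟩)
  exact this

lemma mulOp (j : Fin p) (hF : RapidDecayOn U F) : RapidDecayOn U (mulOp j F) := by
  refine hF.mul (G := fun z => coord z.1 j) (fun v hv => ?_) (fun z hz => ⟨1, 1, ?_⟩)
  · unfold lift; simp only [coord_incl]
    exact ((ContinuousLinearMap.proj (R := ℂ) (φ := fun _ : Fin p => ℂ) j).comp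
      (ContinuousLinearMap.fst ℂ (Fin p → ℂ) (Fin q → ℂ))).analyticAt v
  · refine Filter.Eventually.of_forall fun w ht => ?_
    simpa using (le_max_left _ _).trans (max_le_weight ht j)

lemma invOp (j : Fin p) (hF : RapidDecayOn U F) : RapidDecayOn U (invOp j F) := by
  refine hF.mul (G := fun z => (coord z.1 j)⁻¹) (fun v hv => ?_) (fun z hz => ⟨1, 1, ?_⟩)
  · unfold lift; simp only [coord_incl]
    exact (((ContinuousLinearMap.proj (R := ℂ) (φ := fun _ : Fin p => ℂ) j).comp
      (ContinuousLinearMap.fst ℂ (Fin p → ℂ) (Fin q → ℂ))).analyticAt v).inv (hv.1 j)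
  · refine Filter.Eventually.of_forall fun w ht => ?_
    simpa using (le_max_right _ _).trans (max_le_weight ht j)

lemma lift_thetaOp (j : Fin p) (hF : RapidDecayOn U F) {v : (Fin p → ℂ) × (Fin q → ℂ)}
    (hv : v ∈ liftDom U) :
    lift (thetaOp j F) v = v.1 j * fderiv ℂ (lift F) v (Pi.single j 1, 0) := by
  simp only [lift, thetaOp, if_pos (incl_mem_torus hv.1), coord_incl]
  congr 1
  have h1 : HasDerivAt (fun ζ : ℂ => (Function.update v.1 j ζ, v.2)) (Pi.single j 1, 0) (v.1 j) :=
    (hasDerivAt_update v.1 j (v.1 j)).prodMk (hasDerivAt_const _ _)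
  have h2 : HasFDerivAt (lift F) (fderiv ℂ (lift F) v)
      ((fun ζ : ℂ => (Function.update v.1 j ζ, v.2)) (v.1 j)) := by
    simpa using (hF.holo v hv).differentiableAt.hasFDerivAt
  exact (h2.comp_hasDerivAt _ h1).deriv

/-- Small relative changes of one coordinate stay in a given neighbourhood, uniformly up to the
boundary of the annulus. -/
lemma eventually_update_mem {z : CBar p × Par q} {W : Set (CBar p × Par q)} (hW : W ∈ 𝓝 z)
    (j : Fin p) : ∃ c : ℝ, 0 < c ∧ c ≤ 1 / 2 ∧ ∀ᶠ w in 𝓝 z, w.1 ∈ torus p →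
      ∀ ζ : ℂ, ‖ζ - coord w.1 j‖ ≤ c * ‖coord w.1 j‖ →
        (incl (Function.update (coord w.1) j ζ), w.2) ∈ W := by
  let m : ℂ × (CBar p × Par q) → CBar p × Par q := fun a =>
    (Function.update a.2.1 j (Circle.exp a.1.arg * (a.2.1 j).1,
      ENNReal.ofReal ‖a.1‖ * (a.2.1 j).2), a.2.2)
  have hm1 : m (1, z) = z := by simp [m]
  have hmc : ContinuousAt m (1, z) := by
    refine ContinuousAt.prodMk ?_ (by fun_prop)
    refine ContinuousAt.update (by fun_prop) j (ContinuousAt.prodMk ?_ ?_)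
    · refine ContinuousAt.mul ?_ (by fun_prop)
      exact ContinuousAt.comp (f := Prod.fst) (continuousAt_circle_exp_arg one_ne_zero)
        continuousAt_fst
    · refine ENNReal.Tendsto.mul ?_ (by simp) ?_ (by simp)
      · exact (ENNReal.continuous_ofReal.comp (by fun_prop)).continuousAt
      · exact (show Continuous fun a : ℂ × (CBar p × Par q) => (a.2.1 j).2 by fun_prop).continuousAt
  have hpre : m ⁻¹' W ∈ 𝓝 ((1 : ℂ), z) := hmc (by rw [hm1]; exact hW)
  rw [nhds_prod_eq, Filter.mem_prod_iff] at hpre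
  obtain ⟨A, hA, B, hB, hAB⟩ := hpre
  obtain ⟨ε, hε, hεA⟩ := Metric.mem_nhds_iff.1 hA
  refine ⟨min (ε / 2) (1 / 2), by positivity, min_le_right _ _, ?_⟩
  filter_upwards [hB] with w hw ht ζ hζ
  have htj := coord_ne_zero ht j
  have h0 : 0 < ‖coord w.1 j‖ := norm_pos_iff.2 htj
  have hlam : ζ / coord w.1 j ∈ A := by
    apply hεA
    rw [Metric.mem_ball, dist_eq_norm]
    have : ζ / coord w.1 j - 1 = (ζ - coord w.1 j) / coord w.1 j := by field_simp
    rw [this, norm_div, div_lt_iff₀ h0]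
    have : min (ε / 2) (1 / 2) < ε := lt_of_le_of_lt (min_le_left _ _) (by linarith)
    nlinarith
  have hmem : m (ζ / coord w.1 j, w) ∈ W := hAB (Set.mk_mem_prod hlam hw)
  have hζ0 : ζ ≠ 0 := by
    rintro rfl
    rw [zero_sub, norm_neg] at hζ
    have : min (ε / 2) (1 / 2) ≤ 1 / 2 := min_le_right _ _
    nlinarith
  have hlam0 : ζ / coord w.1 j ≠ 0 := div_ne_zero hζ0 htj
  have hmt : (m (ζ / coord w.1 j, w)).1 ∈ torus p := by
    intro k
    rcases eq_or_ne k j with rfl | hk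
    · have := ht k
      simp only [m, Function.update_self]
      refine ⟨mul_ne_zero ?_ this.1, ENNReal.mul_ne_top (by simp) this.2⟩
      exact (ENNReal.ofReal_pos.2 (norm_pos_iff.2 hlam0)).ne'
    · simpa [m, hk] using ht k
  have heq : m (ζ / coord w.1 j, w) = (incl (Function.update (coord w.1) j ζ), w.2) := by
    refine Prod.ext ?_ rfl
    rw [← incl_coord hmt]
    congr 1
    funext k
    rcases eq_or_ne k j with rfl | hk
    · have e1 := Complex.norm_mul_exp_arg_mul_I (ζ / coord w.1 k)
      have e2 : ζ / coord w.1 k * coord w.1 k = ζ := div_mul_cancel₀ _ htj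
      simp only [coord, m, Function.update_self, ENNReal.toReal_mul,
        ENNReal.toReal_ofReal (norm_nonneg _), Circle.coe_mul, Circle.coe_exp, Complex.ofReal_mul]
      rw [← e1] at e2
      nth_rewrite 3 [← e2]
      simp only [coord]
      ring
    · simp [coord, m, hk]
  rw [← heq]
  exact hmem

lemma thetaOp (j : Fin p) (hU : IsOpen U) (hF : RapidDecayOn U F) :
    RapidDecayOn U (thetaOp j F) where
  boundary z _ hb := if_neg hb
  holo := by
    have h1 : AnalyticOnNhd ℂ (fun v : (Fin p → ℂ) × (Fin q → ℂ) =>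
        v.1 j * fderiv ℂ (lift F) v (Pi.single j 1, 0)) (liftDom U) := by
      intro v hv
      refine AnalyticAt.mul ?_ ?_
      · exact ((ContinuousLinearMap.proj (R := ℂ) (φ := fun _ : Fin p => ℂ) j).comp
          (ContinuousLinearMap.fst ℂ (Fin p → ℂ) (Fin q → ℂ))).analyticAt v
      · exact ((ContinuousLinearMap.apply ℂ ℂ
          ((Pi.single j 1, 0) : (Fin p → ℂ) × (Fin q → ℂ))).analyticAt _).comp (hF.holo v hv).fderiv
    intro v hv
    refine (h1 v hv).congr ?_
    filter_upwards [(isOpen_liftDom hU).mem_nhds hv] with w hw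
    exact (hF.lift_thetaOp j hw).symm
  decay z hz N := by
    obtain ⟨C, hC⟩ := hF.decay z hz N
    obtain ⟨c, hc0, hc1, hc⟩ := eventually_update_mem (Filter.inter_mem hC (hU.mem_nhds hz)) j
    refine ⟨2 ^ N * C / c, ?_⟩
    filter_upwards [hc] with w hw ht
    have h0 : 0 < ‖coord w.1 j‖ := norm_pos_iff.2 (coord_ne_zero ht j)
    have hwt := weight_pos ht
    obtain ⟨s, hs⟩ := QuotientAddGroup.mk_surjective w.2
    have hball : ∀ ζ : ℂ, ‖ζ - coord w.1 j‖ ≤ c * ‖coord w.1 j‖ →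
        ‖coord w.1 j‖ / 2 ≤ ‖ζ‖ ∧ ‖ζ‖ ≤ 2 * ‖coord w.1 j‖ := by
      intro ζ hζ
      have e1 := norm_sub_norm_le (coord w.1 j) ζ
      have e2 := norm_sub_norm_le ζ (coord w.1 j)
      rw [norm_sub_rev] at e1
      constructor <;> nlinarith
    have hne : ∀ ζ : ℂ, ‖ζ - coord w.1 j‖ ≤ c * ‖coord w.1 j‖ → ζ ≠ 0 := by
      intro ζ hζ h
      have := (hball ζ hζ).1
      rw [h, norm_zero] at this
      linarith
    set D := 2 ^ N * C / weight w.1 ^ N with hD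
    have hbound : ∀ ζ : ℂ, ‖ζ - coord w.1 j‖ ≤ c * ‖coord w.1 j‖ →
        ‖F (incl (Function.update (coord w.1) j ζ), w.2)‖ ≤ D := by
      intro ζ hζ
      have htor := incl_mem_torus (update_ne_zero (j := j) (coord_ne_zero ht) (hne ζ hζ))
      have h2 := (hw ht ζ hζ).1 htor
      have h3 := weight_le_update ht j (hball ζ hζ).1 (hball ζ hζ).2
      rw [hD, le_div_iff₀ (by positivity)]
      calc _ ≤ ‖F (incl (Function.update (coord w.1) j ζ), w.2)‖ *
            (2 * weight (incl (Function.update (coord w.1) j ζ))) ^ N := by gcongr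
        _ = 2 ^ N * (‖F (incl (Function.update (coord w.1) j ζ), w.2)‖ *
            weight (incl (Function.update (coord w.1) j ζ)) ^ N) := by rw [mul_pow]; ring
        _ ≤ 2 ^ N * C := by gcongr
    have hdiff : DifferentiableOn ℂ
        (fun ζ : ℂ => F (incl (Function.update (coord w.1) j ζ), w.2))
        (Metric.closedBall (coord w.1 j) (c * ‖coord w.1 j‖)) := by
      intro ζ hζ
      rw [mem_closedBall_iff_norm] at hζ
      have hmem : (Function.update (coord w.1) j ζ, s) ∈ liftDom U := by
        refine ⟨update_ne_zero (coord_ne_zero ht) (hne ζ hζ), ?_⟩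
        have := (hw ht ζ hζ).2
        rwa [← hs] at this
      have h1 : DifferentiableAt ℂ (fun ζ : ℂ => (Function.update (coord w.1) j ζ, s)) ζ :=
        ((hasDerivAt_update (coord w.1) j ζ).prodMk (hasDerivAt_const _ _)).differentiableAt
      have h2 := (hF.holo _ hmem).differentiableAt.comp ζ h1
      have h3 : (fun ζ : ℂ => F (incl (Function.update (coord w.1) j ζ), w.2)) =
          lift F ∘ fun ζ : ℂ => (Function.update (coord w.1) j ζ, s) := by
        funext ζ
        simp [lift, ← hs]
      rw [h3]
      exact h2.differentiableWithinAt
    have hcauchy := Complex.norm_deriv_le_of_forall_mem_sphere_norm_le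
      (c := coord w.1 j) (R := c * ‖coord w.1 j‖) (C := D)
      (f := fun ζ : ℂ => F (incl (Function.update (coord w.1) j ζ), w.2)) (by positivity)
      (DifferentiableOn.diffContOnCl (hdiff.mono Metric.closure_ball_subset_closedBall))
      (fun ζ hζ => hbound ζ (by rw [mem_sphere_iff_norm] at hζ; exact hζ.le))
    simp only [RapidDecay.thetaOp, if_pos ht, norm_mul]
    calc ‖coord w.1 j‖ * ‖deriv (fun ζ : ℂ => F (incl (Function.update (coord w.1) j ζ), w.2))
          (coord w.1 j)‖ * weight w.1 ^ N
        ≤ ‖coord w.1 j‖ * (D / (c * ‖coord w.1 j‖)) * weight w.1 ^ N := by gcongr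
      _ = 2 ^ N * C / c := by rw [hD]; field_simp

end RapidDecayOn

end

noncomputable section

/-! ### The algebra of differential operators -/

/-- Generators of the algebra of differential operators: `t_j`, `1/t_j` and `t_j ∂/∂t_j`. -/
inductive Gen (p : ℕ) : Type
  | t (j : Fin p) : Gen p
  | tInv (j : Fin p) : Gen p
  | theta (j : Fin p) : Gen p

open FreeAlgebra in
/-- The relations of the algebra `ℂ[t, t⁻¹]⟨t ∂_t⟩`. -/
inductive Rel (p : ℕ) : FreeAlgebra ℂ (Gen p) → FreeAlgebra ℂ (Gen p) → Prop
  | t_comm (i j : Fin p) :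
      Rel p (ι ℂ (Gen.t i) * ι ℂ (Gen.t j)) (ι ℂ (Gen.t j) * ι ℂ (Gen.t i))
  | t_tInv (j : Fin p) : Rel p (ι ℂ (Gen.t j) * ι ℂ (Gen.tInv j)) 1
  | tInv_t (j : Fin p) : Rel p (ι ℂ (Gen.tInv j) * ι ℂ (Gen.t j)) 1
  | theta_comm (i j : Fin p) :
      Rel p (ι ℂ (Gen.theta i) * ι ℂ (Gen.theta j)) (ι ℂ (Gen.theta j) * ι ℂ (Gen.theta i))
  | theta_t_self (j : Fin p) :
      Rel p (ι ℂ (Gen.theta j) * ι ℂ (Gen.t j))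
        (ι ℂ (Gen.t j) * ι ℂ (Gen.theta j) + ι ℂ (Gen.t j))
  | theta_t (i j : Fin p) (h : i ≠ j) :
      Rel p (ι ℂ (Gen.theta i) * ι ℂ (Gen.t j)) (ι ℂ (Gen.t j) * ι ℂ (Gen.theta i))

/-- The algebra `D = ℂ[t, t⁻¹]⟨t ∂_t⟩` of algebraic differential operators on `(ℂ^*)^p`. -/
abbrev DAlg (p : ℕ) : Type := RingQuot (Rel p)

/-- The image of a generator in `D`. -/
def DAlg.gen {p : ℕ} (g : Gen p) : DAlg p := RingQuot.mkAlgHom ℂ (Rel p) (FreeAlgebra.ι ℂ g)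

lemma DAlg.induction {p : ℕ} {P : DAlg p → Prop} (halg : ∀ c : ℂ, P (algebraMap ℂ (DAlg p) c))
    (hgen : ∀ g : Gen p, P (DAlg.gen g)) (hadd : ∀ a b, P a → P b → P (a + b))
    (hmul : ∀ a b, P a → P b → P (a * b)) (d : DAlg p) : P d := by
  obtain ⟨x, rfl⟩ := RingQuot.mkAlgHom_surjective ℂ (Rel p) d
  induction x using FreeAlgebra.induction with
  | grade0 c => simpa using halg c
  | grade1 g => exact hgen g
  | mul a b ha hb => rw [map_mul]; exact hmul _ _ ha hb
  | add a b ha hb => rw [map_add]; exact hadd _ _ ha hb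

/-! ### Sections of the sheaf of functions with rapid decay -/

open Classical in
/-- Extension by zero of a function on an open set. -/
def ext {Z : Type} [TopologicalSpace Z] {U : Opens Z} (f : U → ℂ) : Z → ℂ :=
  fun z => if h : z ∈ U then f ⟨z, h⟩ else 0

lemma ext_apply {Z : Type} [TopologicalSpace Z] {U : Opens Z} (f : U → ℂ) (z : U) :
    ext f z = f z := by
  simp [ext]

lemma ext_of_mem {Z : Type} [TopologicalSpace Z] {U : Opens Z} (f : U → ℂ) {z : Z} (h : z ∈ U) :
    ext f z = f ⟨z, h⟩ := by
  simp [ext, h]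

lemma ext_add {Z : Type} [TopologicalSpace Z] {U : Opens Z} (f g : U → ℂ) :
    ext (f + g) = ext f + ext g := by
  funext z
  by_cases h : z ∈ U <;> simp [ext, h]

lemma ext_smul {Z : Type} [TopologicalSpace Z] {U : Opens Z} (c : ℂ) (f : U → ℂ) :
    ext (c • f) = c • ext f := by
  funext z
  by_cases h : z ∈ U <;> simp [ext, h]

lemma ext_zero {Z : Type} [TopologicalSpace Z] {U : Opens Z} :
    ext (0 : U → ℂ) = 0 := by
  funext z
  by_cases h : z ∈ U <;> simp [ext, h]

/-- The sections over `U` of the sheaf of holomorphic functions with rapid decay. -/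
def rapidSections (p q : ℕ) (U : Opens (CBar p × Par q)) : Submodule ℂ (U → ℂ) where
  carrier := {f | RapidDecayOn U (ext f)}
  zero_mem' := by
    change RapidDecayOn _ _
    rw [ext_zero]
    exact RapidDecayOn.zero
  add_mem' {f g} hf hg := by
    change RapidDecayOn _ _
    rw [ext_add]
    exact RapidDecayOn.add hf hg
  smul_mem' c f hf := by
    change RapidDecayOn _ _
    rw [ext_smul]
    exact RapidDecayOn.smul c hf

namespace RapidDecayOn

variable {p q : ℕ} {U : Set (CBar p × Par q)} {F G : CBar p × Par q → ℂ}

lemma eq_of_lift (hF : RapidDecayOn U F) (hG : RapidDecayOn U G)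
    (h : ∀ v ∈ liftDom U, lift F v = lift G v) : ∀ z ∈ U, F z = G z := by
  intro z hz
  by_cases ht : z.1 ∈ torus p
  · obtain ⟨s, hs⟩ := QuotientAddGroup.mk_surjective z.2
    have hz' : (incl (coord z.1), proj s) = z := by
      rw [incl_coord ht, proj, hs]
    have := h (coord z.1, s) ⟨coord_ne_zero ht, by rw [hz']; exact hz⟩
    simpa [lift, hz'] using this
  · rw [hF.boundary z hz ht, hG.boundary z hz ht]

lemma thetaOp_add (hU : IsOpen U) (j : Fin p) (hF : RapidDecayOn U F) (hG : RapidDecayOn U G) :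
    ∀ z ∈ U, RapidDecay.thetaOp j (F + G) z =
      RapidDecay.thetaOp j F z + RapidDecay.thetaOp j G z := by
  refine eq_of_lift ((hF.add hG).thetaOp j hU) ((hF.thetaOp j hU).add (hG.thetaOp j hU)) ?_
  intro v hv
  have e : lift (F + G) = lift F + lift G := rfl
  have e' : lift (RapidDecay.thetaOp j F + RapidDecay.thetaOp j G) v =
    lift (RapidDecay.thetaOp j F) v + lift (RapidDecay.thetaOp j G) v := rfl
  refine Eq.trans ?_ e'.symm
  rw [(hF.add hG).lift_thetaOp j hv, hF.lift_thetaOp j hv, hG.lift_thetaOp j hv, e,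
    fderiv_add (hF.holo v hv).differentiableAt (hG.holo v hv).differentiableAt]
  simp [mul_add]

lemma thetaOp_thetaOp (hU : IsOpen U) (i j : Fin p) (hF : RapidDecayOn U F) :
    ∀ z ∈ U, RapidDecay.thetaOp i (RapidDecay.thetaOp j F) z =
      RapidDecay.thetaOp j (RapidDecay.thetaOp i F) z := by
  refine eq_of_lift ((hF.thetaOp j hU).thetaOp i hU) ((hF.thetaOp i hU).thetaOp j hU) ?_
  have key : ∀ (i j : Fin p), ∀ v ∈ liftDom U, lift (RapidDecay.thetaOp i (RapidDecay.thetaOp j F)) v =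
      v.1 i * ((Pi.single i 1 : Fin p → ℂ) j * fderiv ℂ (lift F) v (Pi.single j 1, 0) +
        v.1 j * fderiv ℂ (fderiv ℂ (lift F)) v (Pi.single i 1, 0) (Pi.single j 1, 0)) := by
    intro i j v hv
    rw [(hF.thetaOp j hU).lift_thetaOp i hv]
    have h1 : lift (RapidDecay.thetaOp j F) =ᶠ[𝓝 v]
        fun v => v.1 j * fderiv ℂ (lift F) v (Pi.single j 1, 0) := by
      filter_upwards [(isOpen_liftDom hU).mem_nhds hv] with w hw
      exact hF.lift_thetaOp j hw
    have h2 : HasFDerivAt (fun v : (Fin p → ℂ) × (Fin q → ℂ) => v.1 j)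
        ((ContinuousLinearMap.proj (R := ℂ) (φ := fun _ : Fin p => ℂ) j).comp
          (ContinuousLinearMap.fst ℂ (Fin p → ℂ) (Fin q → ℂ))) v :=
      ((ContinuousLinearMap.proj (R := ℂ) (φ := fun _ : Fin p => ℂ) j).comp
          (ContinuousLinearMap.fst ℂ (Fin p → ℂ) (Fin q → ℂ))).hasFDerivAt
    have h3 : HasFDerivAt (fun v => fderiv ℂ (lift F) v ((Pi.single j 1, 0) :
        (Fin p → ℂ) × (Fin q → ℂ))) _ v :=
      ((hF.holo v hv).fderiv.differentiableAt.hasFDerivAt).clm_apply (hasFDerivAt_const _ _)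
    rw [h1.fderiv_eq]
    refine (congrArg (fun L => v.1 i * L (Pi.single i 1, 0)) (h2.mul h3).fderiv).trans ?_
    simp only [mul_eq_mul_left_iff]
    left
    simp
    ring
  intro v hv
  rw [key i j v hv, key j i v hv]
  have hsymm := ContDiffAt.isSymmSndFDerivAt_of_omega (𝕜 := ℂ) ((hF.holo v hv).contDiffAt)
  have := hsymm (Pi.single i 1, 0) (Pi.single j 1, 0)
  rw [this]
  rcases eq_or_ne i j with rfl | hij
  · rfl
  · simp [hij, hij.symm]
    ring

lemma thetaOp_mulOp (hU : IsOpen U) (i j : Fin p) (hF : RapidDecayOn U F) :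
    ∀ z ∈ U, RapidDecay.thetaOp i (RapidDecay.mulOp j F) z =
      RapidDecay.mulOp j (RapidDecay.thetaOp i F) z +
        (Pi.single i 1 : Fin p → ℂ) j * RapidDecay.mulOp j F z := by
  refine eq_of_lift ((hF.mulOp j).thetaOp i hU)
    (((hF.thetaOp i hU).mulOp j).add ((hF.mulOp j).smul ((Pi.single i 1 : Fin p → ℂ) j))) ?_
  intro v hv
  rw [(hF.mulOp j).lift_thetaOp i hv]
  have h2 : HasFDerivAt (fun v : (Fin p → ℂ) × (Fin q → ℂ) => v.1 j)
      ((ContinuousLinearMap.proj (R := ℂ) (φ := fun _ : Fin p => ℂ) j).comp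
        (ContinuousLinearMap.fst ℂ (Fin p → ℂ) (Fin q → ℂ))) v :=
    ((ContinuousLinearMap.proj (R := ℂ) (φ := fun _ : Fin p => ℂ) j).comp
        (ContinuousLinearMap.fst ℂ (Fin p → ℂ) (Fin q → ℂ))).hasFDerivAt
  have e1 : lift (RapidDecay.mulOp j F) = fun v => v.1 j * lift F v := by
    funext v
    simp [lift, RapidDecay.mulOp, coord_incl]
  have e2 : lift (RapidDecay.mulOp j (RapidDecay.thetaOp i F) +
      (Pi.single i 1 : Fin p → ℂ) j • RapidDecay.mulOp j F) v =
      v.1 j * lift (RapidDecay.thetaOp i F) v + (Pi.single i 1 : Fin p → ℂ) j * (v.1 j * lift F v) := by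
    simp [lift, RapidDecay.mulOp, coord_incl]
  have h3 := h2.mul (hF.holo v hv).differentiableAt.hasFDerivAt
  refine Eq.trans ?_ e2.symm
  rw [e1, hF.lift_thetaOp i hv]
  refine (congrArg (fun L => v.1 i * L (Pi.single i 1, 0)) h3.fderiv).trans ?_
  rcases eq_or_ne i j with rfl | hij
  · simp; ring
  · simp [hij]; ring

end RapidDecayOn

section operators

variable {p q : ℕ} {U : Opens (CBar p × Par q)}

/-- `thetaOp` only depends on the germ of the function. -/
lemma thetaOp_congr {F G : CBar p × Par q → ℂ} {z : CBar p × Par q} (j : Fin p)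
    (h : F =ᶠ[𝓝 z] G) : thetaOp j F z = thetaOp j G z := by
  unfold thetaOp
  split_ifs with ht
  · congr 1
    apply Filter.EventuallyEq.deriv_eq
    have hc : ContinuousAt
        (fun ζ : ℂ => ((incl (Function.update (coord z.1) j ζ), z.2) : CBar p × Par q))
        (coord z.1 j) := by
      refine ContinuousAt.prodMk ?_ continuousAt_const
      have h1 : ContinuousAt (fun ζ : ℂ => Function.update (coord z.1) j ζ) (coord z.1 j) :=
        (hasDerivAt_update (coord z.1) j (coord z.1 j)).continuousAt
      refine ContinuousAt.comp_of_eq (continuousAt_incl (coord_ne_zero ht)) h1 ?_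
      simp
    have hz : (incl (Function.update (coord z.1) j (coord z.1 j)), z.2) = z := by
      rw [Function.update_eq_self, incl_coord ht]
    have h' : ∀ᶠ w in 𝓝 ((incl (Function.update (coord z.1) j (coord z.1 j)), z.2) :
        CBar p × Par q), F w = G w := by rw [hz]; exact h
    exact hc.eventually h'
  · rfl

lemma ext_op_eqOn (op : (CBar p × Par q → ℂ) → (CBar p × Par q → ℂ)) (f : U → ℂ) :
    ∀ z ∈ (U : Set (CBar p × Par q)), op (ext f) z = ext (fun w : U => op (ext f) w) z := by
  intro z hz
  rw [ext_of_mem _ hz]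

/-- Multiplication by `t_j` on sections. -/
def secMul (U : Opens (CBar p × Par q)) (j : Fin p) : Module.End ℂ (rapidSections p q U) where
  toFun f := ⟨fun z => mulOp j (ext f.1) z,
    (RapidDecayOn.mulOp j f.2).congr U.isOpen (ext_op_eqOn _ _)⟩
  map_add' f g := by
    ext z
    simp [mulOp, ext_apply, mul_add]
  map_smul' c f := by
    ext z
    simp [mulOp, ext_apply]
    ring

/-- Multiplication by `1 / t_j` on sections. -/
def secInv (U : Opens (CBar p × Par q)) (j : Fin p) : Module.End ℂ (rapidSections p q U) where
  toFun f := ⟨fun z => invOp j (ext f.1) z,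
    (RapidDecayOn.invOp j f.2).congr U.isOpen (ext_op_eqOn _ _)⟩
  map_add' f g := by
    ext z
    simp [invOp, ext_apply, mul_add]
  map_smul' c f := by
    ext z
    simp [invOp, ext_apply]
    ring

lemma thetaOp_smul (c : ℂ) (j : Fin p) (F : CBar p × Par q → ℂ) (z : CBar p × Par q) :
    thetaOp j (c • F) z = c * thetaOp j F z := by
  unfold thetaOp
  split_ifs with h
  · simp only [Pi.smul_apply, smul_eq_mul, deriv_const_mul_field]
    ring
  · simp

/-- The derivation `t_j ∂/∂t_j` on sections. -/
def secTheta (U : Opens (CBar p × Par q)) (j : Fin p) : Module.End ℂ (rapidSections p q U) where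
  toFun f := ⟨fun z => thetaOp j (ext f.1) z,
    (RapidDecayOn.thetaOp j U.isOpen f.2).congr U.isOpen (ext_op_eqOn _ _)⟩
  map_add' f g := by
    ext z
    simp only [Submodule.coe_add, ext_add, Pi.add_apply]
    exact RapidDecayOn.thetaOp_add U.isOpen j f.2 g.2 z z.2
  map_smul' c f := by
    ext z
    simp only [Submodule.coe_smul, ext_smul, thetaOp_smul]
    simp

lemma secMul_apply (j : Fin p) (f : rapidSections p q U) (z : U) :
    (secMul U j f).1 z = coord z.1.1 j * f.1 z := by
  simp [secMul, mulOp, ext_apply]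

lemma secInv_apply (j : Fin p) (f : rapidSections p q U) (z : U) :
    (secInv U j f).1 z = (coord z.1.1 j)⁻¹ * f.1 z := by
  simp [secInv, invOp, ext_apply]

lemma secTheta_apply (j : Fin p) (f : rapidSections p q U) (z : U) :
    (secTheta U j f).1 z = thetaOp j (ext f.1) z := rfl

lemma eq_zero_of_notMem_torus (f : rapidSections p q U) (z : U) (h : z.1.1 ∉ torus p) :
    f.1 z = 0 := by
  rw [← ext_apply f.1 z]
  exact f.2.boundary z z.2 h

lemma ext_secTheta_eventuallyEq (j : Fin p) (f : rapidSections p q U) (z : U) :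
    ext (secTheta U j f).1 =ᶠ[𝓝 z.1] thetaOp j (ext f.1) := by
  filter_upwards [U.isOpen.mem_nhds z.2] with w hw
  exact (ext_op_eqOn (thetaOp j) f.1 w hw).symm

lemma ext_secMul_eventuallyEq (j : Fin p) (f : rapidSections p q U) (z : U) :
    ext (secMul U j f).1 =ᶠ[𝓝 z.1] mulOp j (ext f.1) := by
  filter_upwards [U.isOpen.mem_nhds z.2] with w hw
  exact (ext_op_eqOn (mulOp j) f.1 w hw).symm

/-- The operator on sections attached to a generator of `D`. -/
def genAct (U : Opens (CBar p × Par q)) : Gen p → Module.End ℂ (rapidSections p q U)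
  | Gen.t j => secMul U j
  | Gen.tInv j => secInv U j
  | Gen.theta j => secTheta U j

lemma genAct_rel (U : Opens (CBar p × Par q)) ⦃a b : FreeAlgebra ℂ (Gen p)⦄ (h : Rel p a b) :
    FreeAlgebra.lift ℂ (genAct U) a = FreeAlgebra.lift ℂ (genAct U) b := by
  have hθt : ∀ (i j : Fin p) (f : rapidSections p q U) (z : U),
      (secTheta U i (secMul U j f)).1 z = coord z.1.1 j * (secTheta U i f).1 z +
        (Pi.single i 1 : Fin p → ℂ) j * (coord z.1.1 j * f.1 z) := by
    intro i j f z
    rw [secTheta_apply, thetaOp_congr i (ext_secMul_eventuallyEq j f z),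
      RapidDecayOn.thetaOp_mulOp U.isOpen i j f.2 z z.2]
    simp [mulOp, secTheta_apply, ext_apply]
  cases h with
  | t_comm i j =>
    ext f z
    simp [genAct, secMul_apply]
    ring
  | t_tInv j =>
    ext f z
    simp only [genAct, map_mul, FreeAlgebra.lift_ι_apply, Module.End.mul_apply, secMul_apply,
      secInv_apply, map_one, Module.End.one_apply]
    by_cases ht : z.1.1 ∈ torus p
    · rw [mul_inv_cancel_left₀ (coord_ne_zero ht j)]
    · simp [eq_zero_of_notMem_torus f z ht]
  | tInv_t j =>
    ext f z
    simp only [genAct, map_mul, FreeAlgebra.lift_ι_apply, Module.End.mul_apply, secMul_apply,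
      secInv_apply, map_one, Module.End.one_apply]
    by_cases ht : z.1.1 ∈ torus p
    · rw [inv_mul_cancel_left₀ (coord_ne_zero ht j)]
    · simp [eq_zero_of_notMem_torus f z ht]
  | theta_comm i j =>
    ext f z
    simp only [genAct, map_mul, FreeAlgebra.lift_ι_apply, Module.End.mul_apply, secTheta_apply]
    rw [thetaOp_congr i (ext_secTheta_eventuallyEq j f z),
      thetaOp_congr j (ext_secTheta_eventuallyEq i f z)]
    exact RapidDecayOn.thetaOp_thetaOp U.isOpen i j f.2 z z.2
  | theta_t_self j =>
    ext f z
    simp [genAct, hθt, secMul_apply]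
  | theta_t i j hij =>
    ext f z
    simp [genAct, hθt, secMul_apply, hij]

/-- The action of `D` on sections. -/
def act (U : Opens (CBar p × Par q)) : DAlg p →ₐ[ℂ] Module.End ℂ (rapidSections p q U) :=
  RingQuot.liftAlgHom ℂ ⟨FreeAlgebra.lift ℂ (genAct U), genAct_rel U⟩

instance : Module (DAlg p) (rapidSections p q U) := Module.compHom _ (act U).toRingHom

lemma gen_smul (g : Gen p) (f : rapidSections p q U) : DAlg.gen g • f = genAct U g f := by
  change act U (DAlg.gen g) f = _
  simp [act, DAlg.gen]

lemma algebraMap_smul' (c : ℂ) (f : rapidSections p q U) :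
    algebraMap ℂ (DAlg p) c • f = c • f := by
  change act U (algebraMap ℂ (DAlg p) c) f = _
  simp

instance : IsScalarTower ℂ (DAlg p) (rapidSections p q U) where
  smul_assoc c d f := by
    rw [Algebra.smul_def, mul_smul, algebraMap_smul']

/-- An additive map between modules over `D` is `D`-linear if it commutes with scalars and with the
generators. -/
lemma smul_of_gen {N N' : Type} [AddCommGroup N] [AddCommGroup N'] [Module (DAlg p) N]
    [Module (DAlg p) N'] (φ : N →+ N')
    (h0 : ∀ (c : ℂ) (x : N), φ (algebraMap ℂ (DAlg p) c • x) = algebraMap ℂ (DAlg p) c • φ x)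
    (h1 : ∀ (g : Gen p) (x : N), φ (DAlg.gen g • x) = DAlg.gen g • φ x) (d : DAlg p) (x : N) :
    φ (d • x) = d • φ x := by
  induction d using DAlg.induction generalizing x with
  | halg c => exact h0 c x
  | hgen g => exact h1 g x
  | hadd a b ha hb => rw [add_smul, map_add, ha, hb, add_smul]
  | hmul a b ha hb => rw [mul_smul, ha, hb, mul_smul]

/-- Restriction of sections. -/
def res {U V : Opens (CBar p × Par q)} (h : V ≤ U) :
    rapidSections p q U →ₗ[DAlg p] rapidSections p q V :=
  let φ : rapidSections p q U →+ rapidSections p q V :=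
    { toFun := fun f => ⟨fun z => f.1 ⟨z.1, h z.2⟩,
        (RapidDecayOn.mono f.2 h).congr V.isOpen (by
          intro z hz
          rw [ext_of_mem _ hz, ext_of_mem _ (h hz)])⟩
      map_zero' := rfl
      map_add' := fun _ _ => rfl }
  { toFun := φ
    map_add' := φ.map_add
    map_smul' := by
      refine smul_of_gen φ ?_ ?_
      · intro c f
        rw [algebraMap_smul', algebraMap_smul']
        rfl
      · intro g f
        rw [gen_smul, gen_smul]
        ext z
        cases g with
        | t j => exact (secMul_apply j f _).trans (secMul_apply j (φ f) z).symm
        | tInv j => exact (secInv_apply j f _).trans (secInv_apply j (φ f) z).symm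
        | theta j =>
          change thetaOp j (ext f.1) z.1 = thetaOp j (ext (φ f).1) z.1
          refine thetaOp_congr j ?_
          filter_upwards [V.isOpen.mem_nhds z.2] with w hw
          rw [ext_of_mem _ hw, ext_of_mem _ (h hw)]
          rfl }

@[simp] lemma res_apply {U V : Opens (CBar p × Par q)} (h : V ≤ U) (f : rapidSections p q U)
    (z : V) : (res h f).1 z = f.1 ⟨z.1, h z.2⟩ := rfl

end operators

end

noncomputable section

/-! ### The sheaves -/

/-- The space `CBar p × ℂ^q/ℤ^q`. -/
abbrev Tot (p q : ℕ) : TopCat.{0} := TopCat.of (CBar p × Par q)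

/-- The compactified annulus as an object of the category of topological spaces. -/
abbrev Base (p : ℕ) : TopCat.{0} := TopCat.of (CBar p)

/-- The presheaf of `D`-modules of holomorphic functions with rapid decay. -/
def rapidPresheaf (p q : ℕ) : TopCat.Presheaf (ModuleCat.{0} (DAlg p)) (Tot p q) where
  obj U := ModuleCat.of (DAlg p) (rapidSections p q U.unop)
  map i := ModuleCat.ofHom (res i.unop.le)

/-- Rapid decay as a local predicate. -/
def rapidLocal (p q : ℕ) : TopCat.LocalPredicate (X := Tot p q) (fun _ => ℂ) where
  pred {U} f := RapidDecayOn (p := p) (q := q) (U : Set (CBar p × Par q)) (ext (U := U) f)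
  res {U V} i f h := by
    refine (RapidDecayOn.mono h i.le).congr U.isOpen ?_
    intro z hz
    rw [ext_of_mem _ hz, ext_of_mem _ (i.le hz)]
    rfl
  locality {U} f h := by
    refine RapidDecayOn.of_local ?_
    intro z hz
    obtain ⟨V, hzV, i, hV⟩ := h ⟨z, hz⟩
    refine ⟨V, hzV, hV.congr V.isOpen ?_⟩
    intro w hw
    rw [ext_of_mem _ hw, ext_of_mem _ (i.le hw)]
    rfl

/-- Criterion for being a sheaf, for a presheaf of functions cut out by a local predicate. -/
lemma isSheaf_of_local {C : Type 1} [LargeCategory C] [Limits.HasLimits C]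
    {FC : C → C → Type} {CC : C → Type} [∀ X Y, FunLike (FC X Y) (CC X) (CC Y)]
    [ConcreteCategory C FC] [(forget C).ReflectsIsomorphisms] [Limits.PreservesLimits (forget C)]
    {X : TopCat.{0}} (P : TopCat.LocalPredicate (X := X) (fun _ => ℂ)) (F : TopCat.Presheaf C X)
    (e : F ⋙ forget C ≅ TopCat.subpresheafToTypes P.toPrelocalPredicate) : F.IsSheaf := by
  rw [TopCat.Presheaf.isSheaf_iff_isSheaf_comp (forget C)]
  exact TopCat.Presheaf.isSheaf_of_iso e.symm (TopCat.subpresheafToTypes.isSheaf P)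

/-- The sheaf of `D`-modules `𝒜^{<0}` on `CBar p × ℂ^q/ℤ^q`: functions which are holomorphic
inside, with rapid decay at the boundary of the annulus, locally uniformly in the parameter. -/
def rapidSheaf (p q : ℕ) : TopCat.Sheaf (ModuleCat.{0} (DAlg p)) (Tot p q) :=
  ⟨rapidPresheaf p q, isSheaf_of_local (rapidLocal p q) _
    (NatIso.ofComponents (fun _ => Iso.refl _) (fun _ => rfl))⟩

/-- The sheaf `𝒜^{<0}` on `CBar p`, obtained from the one on `CBar p × {point}`. -/
def rapidSheafBase (p : ℕ) : TopCat.Sheaf (ModuleCat.{0} (DAlg p)) (Base p) :=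
  (TopCat.Sheaf.pushforward _ (TopCat.ofHom ⟨Prod.fst, continuous_fst⟩ : Tot p 0 ⟶ Base p)).obj
    (rapidSheaf p 0)

variable {p q : ℕ}

/-- Near `z`, the function `F` is the pullback by the projection `r₁` to `CBar p` of a
holomorphic function with rapid decay (a section of `𝒜^{<0}` on `CBar p × {point}`). -/
def IsPullbackAt (F : CBar p × Par q → ℂ) (z : CBar p × Par q) : Prop :=
  ∃ (V : Opens (CBar p × Par 0)) (H : CBar p × Par 0 → ℂ), (z.1, 0) ∈ V ∧
    RapidDecayOn (V : Set (CBar p × Par 0)) H ∧ ∀ᶠ w in 𝓝 z, F w = H (w.1, 0)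

namespace IsPullbackAt

variable {F G : CBar p × Par q → ℂ} {z : CBar p × Par q}

lemma congr (h : IsPullbackAt F z) (hFG : F =ᶠ[𝓝 z] G) : IsPullbackAt G z := by
  obtain ⟨V, H, hz, hH, hF⟩ := h
  exact ⟨V, H, hz, hH, by filter_upwards [hF, hFG] with w h1 h2; rw [← h2, h1]⟩

lemma add (hF : IsPullbackAt F z) (hG : IsPullbackAt G z) : IsPullbackAt (F + G) z := by
  obtain ⟨V, H, hz, hH, hF⟩ := hF
  obtain ⟨V', H', hz', hH', hG⟩ := hG
  refine ⟨V ⊓ V', H + H', ⟨hz, hz'⟩, (hH.mono fun _ h => h.1).add (hH'.mono fun _ h => h.2), ?_⟩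
  filter_upwards [hF, hG] with w h1 h2
  simp [h1, h2]

lemma zero : IsPullbackAt (0 : CBar p × Par q → ℂ) z :=
  ⟨⊤, 0, trivial, RapidDecayOn.zero, by simp⟩

lemma smul (c : ℂ) (hF : IsPullbackAt F z) : IsPullbackAt (c • F) z := by
  obtain ⟨V, H, hz, hH, hF⟩ := hF
  refine ⟨V, c • H, hz, hH.smul c, ?_⟩
  filter_upwards [hF] with w h1
  simp [h1]

lemma mulOp (j : Fin p) (hF : IsPullbackAt F z) : IsPullbackAt (mulOp j F) z := by
  obtain ⟨V, H, hz, hH, hF⟩ := hF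
  refine ⟨V, RapidDecay.mulOp j H, hz, hH.mulOp j, ?_⟩
  filter_upwards [hF] with w h1
  simp [RapidDecay.mulOp, h1]

lemma invOp (j : Fin p) (hF : IsPullbackAt F z) : IsPullbackAt (invOp j F) z := by
  obtain ⟨V, H, hz, hH, hF⟩ := hF
  refine ⟨V, RapidDecay.invOp j H, hz, hH.invOp j, ?_⟩
  filter_upwards [hF] with w h1
  simp [RapidDecay.invOp, h1]

lemma thetaOp (j : Fin p) (hF : IsPullbackAt F z) : IsPullbackAt (thetaOp j F) z := by
  obtain ⟨V, H, hz, hH, hF⟩ := hF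
  refine ⟨V, RapidDecay.thetaOp j H, hz, hH.thetaOp j V.isOpen, ?_⟩
  filter_upwards [eventually_eventually_nhds.2 hF] with w h1
  rw [thetaOp_congr j h1]
  rfl

end IsPullbackAt

/-- The sections over `U` of the inverse image `r₁⁻¹𝒜^{<0}`, inside those of `𝒜^{<0}`. -/
def pullbackSections (p q : ℕ) (U : Opens (CBar p × Par q)) :
    Submodule (DAlg p) (rapidSections p q U) where
  carrier := {f | ∀ z ∈ U, IsPullbackAt (ext f.1) z}
  zero_mem' z _ := by
    change IsPullbackAt (ext 0) z
    rw [ext_zero]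
    exact IsPullbackAt.zero
  add_mem' {f g} hf hg z hz := by
    change IsPullbackAt (ext (f.1 + g.1)) z
    rw [ext_add]
    exact (hf z hz).add (hg z hz)
  smul_mem' d f hf := by
    induction d using DAlg.induction generalizing f with
    | halg c =>
      intro z hz
      rw [algebraMap_smul']
      change IsPullbackAt (ext (c • f.1)) z
      rw [ext_smul]
      exact (hf z hz).smul c
    | hgen g =>
      intro z hz
      rw [gen_smul]
      cases g with
      | t j =>
        refine ((hf z hz).mulOp j).congr ?_
        filter_upwards [U.isOpen.mem_nhds hz] with w hw
        exact ext_op_eqOn (mulOp j) f.1 w hw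
      | tInv j =>
        refine ((hf z hz).invOp j).congr ?_
        filter_upwards [U.isOpen.mem_nhds hz] with w hw
        exact ext_op_eqOn (invOp j) f.1 w hw
      | theta j =>
        refine ((hf z hz).thetaOp j).congr ?_
        filter_upwards [U.isOpen.mem_nhds hz] with w hw
        exact ext_op_eqOn (thetaOp j) f.1 w hw
    | hadd a b ha hb =>
      intro z hz
      rw [add_smul]
      change IsPullbackAt (ext ((a • f).1 + (b • f).1)) z
      rw [ext_add]
      exact (ha f hf z hz).add (hb f hf z hz)
    | hmul a b ha hb =>
      rw [mul_smul]
      exact ha _ (hb f hf)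

lemma res_mem_pullbackSections {U V : Opens (CBar p × Par q)} (h : V ≤ U)
    {f : rapidSections p q U} (hf : f ∈ pullbackSections p q U) :
    res h f ∈ pullbackSections p q V := by
  intro z hz
  refine (hf z (h hz)).congr ?_
  filter_upwards [V.isOpen.mem_nhds hz] with w hw
  rw [ext_of_mem _ hw, ext_of_mem _ (h hw)]
  rfl

/-- The local predicate defining `r₁⁻¹𝒜^{<0}`. -/
def pullbackLocal (p q : ℕ) : TopCat.LocalPredicate (X := Tot p q) (fun _ => ℂ) where
  pred {U} f := (rapidLocal p q).pred f ∧ ∀ z ∈ U, IsPullbackAt (ext (U := U) f) z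
  res {U V} i f h := by
    refine ⟨(rapidLocal p q).res i f h.1, fun z hz => (h.2 z (i.le hz)).congr ?_⟩
    filter_upwards [U.isOpen.mem_nhds hz] with w hw
    rw [ext_of_mem _ hw, ext_of_mem _ (i.le hw)]
    rfl
  locality {U} f h := by
    refine ⟨(rapidLocal p q).locality f fun x => ?_, fun z hz => ?_⟩
    · obtain ⟨V, hV, i, hi⟩ := h x
      exact ⟨V, hV, i, hi.1⟩
    · obtain ⟨V, hV, i, hi⟩ := h ⟨z, hz⟩
      refine (hi.2 z hV).congr ?_
      filter_upwards [V.isOpen.mem_nhds hV] with w hw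
      rw [ext_of_mem _ hw, ext_of_mem _ (i.le hw)]
      rfl

/-- The sheaf of `D`-modules `r₁⁻¹𝒜^{<0}` on `CBar p × ℂ^q/ℤ^q`, for the projection `r₁` to
`CBar p`.  As `r₁` is open and surjective, the inverse image is the sheaf of functions which are
locally of the form `h ∘ r₁` with `h` a section of `𝒜^{<0}`. -/
def pullbackSheaf (p q : ℕ) : TopCat.Sheaf (ModuleCat.{0} (DAlg p)) (Tot p q) :=
  ⟨{  obj := fun U => ModuleCat.of (DAlg p) (pullbackSections p q U.unop)
      map := fun i => ModuleCat.ofHom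
        ((res i.unop.le).restrict fun _ h => res_mem_pullbackSections i.unop.le h) },
    isSheaf_of_local (pullbackLocal p q) _
      (NatIso.ofComponents (fun U =>
        { hom := ↾fun (f : pullbackSections p q U.unop) =>
            (⟨f.1.1, f.1.2, f.2⟩ : { f : U.unop → ℂ // (pullbackLocal p q).pred f })
          inv := ↾fun (f : { f : U.unop → ℂ // (pullbackLocal p q).pred f }) =>
            (⟨⟨f.1, f.2.1⟩, f.2.2⟩ : pullbackSections p q U.unop) }) (fun _ => rfl))⟩

/-- Near `z`, the function `G` is the pullback by the projection `r₂` of a holomorphic function on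
an open subset of `ℂ^q/ℤ^q`. -/
def IsParamHoloAt (G : CBar p × Par q → ℂ) (z : CBar p × Par q) : Prop :=
  ∃ (V : Opens (Par q)) (g : Par q → ℂ), z.2 ∈ V ∧
    AnalyticOnNhd ℂ (fun s : Fin q → ℂ => g (proj s)) {s | proj s ∈ V} ∧
    ∀ᶠ w in 𝓝 z, G w = g w.2

namespace IsParamHoloAt

variable {F G : CBar p × Par q → ℂ} {z : CBar p × Par q}

lemma congr (h : IsParamHoloAt F z) (hFG : F =ᶠ[𝓝 z] G) : IsParamHoloAt G z := by
  obtain ⟨V, g, hz, hg, hF⟩ := h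
  exact ⟨V, g, hz, hg, by filter_upwards [hF, hFG] with w h1 h2; rw [← h2, h1]⟩

lemma add (hF : IsParamHoloAt F z) (hG : IsParamHoloAt G z) : IsParamHoloAt (F + G) z := by
  obtain ⟨V, g, hz, hg, hF⟩ := hF
  obtain ⟨V', g', hz', hg', hG⟩ := hG
  refine ⟨V ⊓ V', g + g', ⟨hz, hz'⟩, fun s hs => (hg s hs.1).add (hg' s hs.2), ?_⟩
  filter_upwards [hF, hG] with w h1 h2
  simp [h1, h2]

lemma mul (hF : IsParamHoloAt F z) (hG : IsParamHoloAt G z) : IsParamHoloAt (F * G) z := by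
  obtain ⟨V, g, hz, hg, hF⟩ := hF
  obtain ⟨V', g', hz', hg', hG⟩ := hG
  refine ⟨V ⊓ V', g * g', ⟨hz, hz'⟩, fun s hs => (hg s hs.1).mul (hg' s hs.2), ?_⟩
  filter_upwards [hF, hG] with w h1 h2
  simp [h1, h2]

lemma const (c : ℂ) : IsParamHoloAt (fun _ : CBar p × Par q => c) z :=
  ⟨⊤, fun _ => c, trivial, fun _ _ => analyticAt_const, by simp⟩

lemma lift_analyticAt {v : (Fin p → ℂ) × (Fin q → ℂ)} (hv : ∀ j, v.1 j ≠ 0)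
    (h : IsParamHoloAt G (incl v.1, proj v.2)) : AnalyticAt ℂ (lift G) v := by
  obtain ⟨V, g, hz, hg, hG⟩ := h
  have h1 : AnalyticAt ℂ (fun v : (Fin p → ℂ) × (Fin q → ℂ) => g (proj v.2)) v :=
    AnalyticAt.comp (g := fun s : Fin q → ℂ => g (proj s)) (f := Prod.snd) (hg v.2 hz)
      analyticAt_snd
  refine h1.congr ?_
  have hc : ContinuousAt (fun v : (Fin p → ℂ) × (Fin q → ℂ) => (incl v.1, proj v.2)) v :=
    ContinuousAt.prodMk (ContinuousAt.comp (continuousAt_incl hv) continuousAt_fst)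
      (continuous_quotient_mk'.comp continuous_snd).continuousAt
  filter_upwards [hc.eventually hG] with w hw
  exact hw.symm

lemma bounded (h : IsParamHoloAt G z) : ∃ C : ℝ, ∀ᶠ w in 𝓝 z, ‖G w‖ ≤ C := by
  obtain ⟨V, g, hz, hg, hG⟩ := h
  obtain ⟨s, hs⟩ := QuotientAddGroup.mk_surjective z.2
  have h1 : ContinuousAt g z.2 := by
    rw [← hs]
    have h2 : ContinuousAt (fun s : Fin q → ℂ => g (proj s)) s :=
      (hg s (by change (s : Par q) ∈ V; rw [hs]; exact hz)).continuousAt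
    rw [ContinuousAt, ← QuotientAddGroup.isOpenMap_coe.map_nhds_eq
      (QuotientAddGroup.continuous_mk).continuousAt, Filter.tendsto_map'_iff]
    exact h2
  have h3 : ContinuousAt (fun w : CBar p × Par q => ‖g w.2‖) z :=
    (ContinuousAt.comp (f := Prod.snd) h1 continuousAt_snd).norm
  refine ⟨‖g z.2‖ + 1, ?_⟩
  filter_upwards [hG, h3.eventually (gt_mem_nhds (lt_add_one _))] with w e1 e2
  rw [e1]
  exact e2.le

lemma thetaOp_mul (j : Fin p) (hG : IsParamHoloAt G z) :
    thetaOp j (G * F) z = G z * thetaOp j F z := by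
  obtain ⟨V, g, hz, hg, hG⟩ := hG
  have h1 : G * F =ᶠ[𝓝 z] fun w => g w.2 * F w := by
    filter_upwards [hG] with w hw
    simp [hw]
  rw [thetaOp_congr j h1, hG.self_of_nhds]
  unfold thetaOp
  split_ifs
  · simp only [deriv_const_mul_field]
    ring
  · simp

end IsParamHoloAt

/-- The sections over `U` of the sheaf of rings `r₂⁻¹𝒪`: the functions which are locally pullbacks
of holomorphic functions of the parameter. -/
def paramSections (p q : ℕ) (U : Opens (CBar p × Par q)) : Subalgebra ℂ (U → ℂ) where
  carrier := {f | ∀ z ∈ U, IsParamHoloAt (ext f) z}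
  add_mem' {f g} hf hg z hz := by
    rw [ext_add]
    exact (hf z hz).add (hg z hz)
  mul_mem' {f g} hf hg z hz := by
    refine ((hf z hz).mul (hg z hz)).congr ?_
    filter_upwards [U.isOpen.mem_nhds hz] with w hw
    simp [ext_of_mem _ hw]
  algebraMap_mem' c z hz := by
    refine (IsParamHoloAt.const c).congr ?_
    filter_upwards [U.isOpen.mem_nhds hz] with w hw
    simp [ext_of_mem _ hw]

/-- Restriction of sections of `r₂⁻¹𝒪`. -/
def paramRes {U V : Opens (CBar p × Par q)} (h : V ≤ U) :
    paramSections p q U →ₐ[ℂ] paramSections p q V where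
  toFun f := ⟨fun z => f.1 ⟨z.1, h z.2⟩, fun z hz => (f.2 z (h hz)).congr (by
    filter_upwards [V.isOpen.mem_nhds hz] with w hw
    rw [ext_of_mem _ hw, ext_of_mem _ (h hw)])⟩
  map_one' := rfl
  map_mul' _ _ := rfl
  map_zero' := rfl
  map_add' _ _ := rfl
  commutes' _ := rfl

/-- The local predicate defining `r₂⁻¹𝒪`. -/
def paramLocal (p q : ℕ) : TopCat.LocalPredicate (X := Tot p q) (fun _ => ℂ) where
  pred {U} f := ∀ z ∈ U, IsParamHoloAt (ext (U := U) f) z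
  res {U V} i f h z hz := (h z (i.le hz)).congr (by
    filter_upwards [U.isOpen.mem_nhds hz] with w hw
    rw [ext_of_mem _ hw, ext_of_mem _ (i.le hw)]
    rfl)
  locality {U} f h z hz := by
    obtain ⟨V, hV, i, hi⟩ := h ⟨z, hz⟩
    refine (hi z hV).congr ?_
    filter_upwards [V.isOpen.mem_nhds hV] with w hw
    rw [ext_of_mem _ hw, ext_of_mem _ (i.le hw)]
    rfl

/-- The sheaf of rings `r₂⁻¹𝒪` on `CBar p × ℂ^q/ℤ^q`, for the projection `r₂` to `ℂ^q/ℤ^q`. -/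
def paramSheaf (p q : ℕ) : Sheaf (Opens.grothendieckTopology (Tot p q)) RingCat.{0} :=
  ⟨{  obj := fun U => RingCat.of (paramSections p q U.unop)
      map := fun i => RingCat.ofHom (paramRes i.unop.le).toRingHom },
    isSheaf_of_local (paramLocal p q) _
      (NatIso.ofComponents (fun _ => Iso.refl _) (fun _ => rfl))⟩

section

variable {U : Opens (CBar p × Par q)}

lemma ext_mul_eventuallyEq (g f : U → ℂ) {z : CBar p × Par q} (hz : z ∈ U) :
    ext g * ext f =ᶠ[𝓝 z] ext (g * f) := by
  filter_upwards [U.isOpen.mem_nhds hz] with w hw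
  simp [ext_of_mem _ hw]

/-- Sections of `𝒜^{<0}` form a module over sections of `r₂⁻¹𝒪`, by multiplication. -/
instance : Module (paramSections p q U) (rapidSections p q U) where
  smul g f := ⟨g.1 * f.1, by
    have h : RapidDecayOn (U : Set (CBar p × Par q)) (ext g.1 * ext f.1) := by
      refine RapidDecayOn.mul f.2 (fun v hv => (g.2 _ hv.2).lift_analyticAt hv.1) ?_
      intro z hz
      obtain ⟨C, hC⟩ := (g.2 z hz).bounded
      refine ⟨C, 0, ?_⟩
      filter_upwards [hC] with w hw _
      simpa using hw
    refine h.congr U.isOpen ?_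
    intro z hz
    simp [ext_of_mem _ hz]⟩
  one_smul f := Subtype.ext (one_mul f.1)
  mul_smul a b f := Subtype.ext (mul_assoc a.1 b.1 f.1)
  smul_zero a := Subtype.ext (mul_zero a.1)
  smul_add a f g := Subtype.ext (mul_add a.1 f.1 g.1)
  add_smul a b f := Subtype.ext (add_mul a.1 b.1 f.1)
  zero_smul f := Subtype.ext (zero_mul f.1)

lemma param_smul_apply (g : paramSections p q U) (f : rapidSections p q U) (z : U) :
    (g • f).1 z = g.1 z * f.1 z := rfl

instance : SMulCommClass (DAlg p) (paramSections p q U) (rapidSections p q U) where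
  smul_comm d g f := by
    let φ : rapidSections p q U →+ rapidSections p q U :=
      { toFun := fun f => g • f, map_zero' := smul_zero g, map_add' := smul_add g }
    refine (smul_of_gen φ ?_ ?_ d f).symm
    · intro c f
      rw [algebraMap_smul', algebraMap_smul']
      ext z
      change g.1 z * (c * f.1 z) = c * (g.1 z * f.1 z)
      ring
    · intro a f
      rw [gen_smul, gen_smul]
      ext z
      change g.1 z * _ = _
      cases a with
      | t j =>
        change g.1 z * (secMul U j f).1 z = (secMul U j (g • f)).1 z
        rw [secMul_apply, secMul_apply, param_smul_apply]
        ring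
      | tInv j =>
        change g.1 z * (secInv U j f).1 z = (secInv U j (g • f)).1 z
        rw [secInv_apply, secInv_apply, param_smul_apply]
        ring
      | theta j =>
        change g.1 z * thetaOp j (ext f.1) z = thetaOp j (ext (g.1 * f.1)) z
        rw [← thetaOp_congr j (ext_mul_eventuallyEq g.1 f.1 z.2),
          (g.2 z z.2).thetaOp_mul j, ext_apply]

instance : IsScalarTower ℂ (paramSections p q U) (rapidSections p q U) where
  smul_assoc c g f := by
    ext z
    exact mul_assoc c (g.1 z) (f.1 z)

lemma res_param_smul {V : Opens (CBar p × Par q)} (h : V ≤ U) (g : paramSections p q U)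
    (f : rapidSections p q U) : res h (g • f) = paramRes h g • res h f := rfl

end

end

noncomputable section

/-! ### Sheaf Hom out of constant sheaves of `D`-modules -/

/-- For a sheaf of `D`-modules `F`, the functor sending a `D`-module `P`, viewed as a constant sheaf,
to the sheaf of complex vector spaces `ℋom_D(P, F) : U ↦ Hom_D(P, F(U))`. -/
def sheafHom {p : ℕ} {X : TopCat.{0}} (F : TopCat.Sheaf (ModuleCat.{0} (DAlg p)) X) :
    (ModuleCat.{0} (DAlg p))ᵒᵖ ⥤ TopCat.Sheaf (ModuleCat.{0} ℂ) X where
  obj P := ⟨F.presheaf ⋙ (linearCoyoneda ℂ (ModuleCat.{0} (DAlg p))).obj P, by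
    have h := F.property P.unop
    rw [← isSheaf_iff_isSheaf_of_type] at h
    exact (TopCat.Presheaf.isSheaf_iff_isSheaf_comp (forget (ModuleCat.{0} ℂ)) _).2 h⟩
  map f := ⟨Functor.whiskerLeft F.presheaf
    ((linearCoyoneda ℂ (ModuleCat.{0} (DAlg p))).map f)⟩

instance {p : ℕ} {X : TopCat.{0}} (F : TopCat.Sheaf (ModuleCat.{0} (DAlg p)) X) :
    (sheafHom F).Additive where
  map_add {P Q} f g := by
    apply ObjectProperty.hom_ext
    ext U φ
    exact Preadditive.add_comp _ _ _ f.unop g.unop φ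

variable {p q : ℕ}

/-! ### Extension of scalars from `ℂ` to `r₂⁻¹𝒪` -/

/-- The restriction maps of `U ↦ r₂⁻¹𝒪(U) ⊗ K(U)`. -/
def tensorRes (K : TopCat.Presheaf (ModuleCat.{0} ℂ) (Tot p q)) {U V : (Opens (Tot p q))ᵒᵖ}
    (i : U ⟶ V) : paramSections p q U.unop ⊗[ℂ] (K.obj U : Type) →ₗ[ℂ]
      paramSections p q V.unop ⊗[ℂ] (K.obj V : Type) :=
  TensorProduct.map (paramRes i.unop.le).toLinearMap (K.map i).hom

lemma tensorRes_smul (K : TopCat.Presheaf (ModuleCat.{0} ℂ) (Tot p q)) {U V : (Opens (Tot p q))ᵒᵖ}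
    (i : U ⟶ V) (r : paramSections p q U.unop)
    (m : paramSections p q U.unop ⊗[ℂ] (K.obj U : Type)) :
    tensorRes K i (r • m) = paramRes i.unop.le r • tensorRes K i m := by
  induction m with
  | zero => simp
  | add a b ha hb => rw [smul_add, map_add, ha, hb, map_add, smul_add]
  | tmul a b => simp [tensorRes, TensorProduct.smul_tmul']

/-- The presheaf of abelian groups `U ↦ r₂⁻¹𝒪(U) ⊗ K(U)`. -/
def tensorAb (K : TopCat.Presheaf (ModuleCat.{0} ℂ) (Tot p q)) : (Opens (Tot p q))ᵒᵖ ⥤ Ab.{0} where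
  obj U := AddCommGrpCat.of (paramSections p q U.unop ⊗[ℂ] (K.obj U : Type))
  map i := AddCommGrpCat.ofHom (tensorRes K i).toAddMonoidHom
  map_id U := by
    ext x
    change tensorRes K (𝟙 U) x = x
    induction x using TensorProduct.induction_on with
    | zero => simp
    | add a b ha hb => rw [map_add, ha, hb]
    | tmul a b =>
      simp only [tensorRes, TensorProduct.map_tmul, CategoryTheory.Functor.map_id]
      rfl
  map_comp {U V W} f g := by
    ext x
    change tensorRes K (f ≫ g) x = tensorRes K g (tensorRes K f x)
    induction x using TensorProduct.induction_on with
    | zero => simp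
    | add a b ha hb => rw [map_add, ha, hb, map_add, map_add]
    | tmul a b =>
      simp only [tensorRes, TensorProduct.map_tmul, CategoryTheory.Functor.map_comp]
      rfl

instance (K : TopCat.Presheaf (ModuleCat.{0} ℂ) (Tot p q)) (U : (Opens (Tot p q))ᵒᵖ) :
    Module ((paramSheaf p q).obj.obj U) ((tensorAb K).obj U) :=
  inferInstanceAs (Module (paramSections p q U.unop)
    (paramSections p q U.unop ⊗[ℂ] (K.obj U : Type)))

/-- The presheaf of modules `U ↦ r₂⁻¹𝒪(U) ⊗ K(U)` over `r₂⁻¹𝒪`. -/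
def tensorPresheaf (K : TopCat.Presheaf (ModuleCat.{0} ℂ) (Tot p q)) :
    PresheafOfModules.{0} (paramSheaf p q).obj :=
  PresheafOfModules.ofPresheaf (tensorAb K) fun _ _ i r m => tensorRes_smul K i r m

lemma tensorRes_map {K L : TopCat.Presheaf (ModuleCat.{0} ℂ) (Tot p q)} (φ : K ⟶ L)
    {U V : (Opens (Tot p q))ᵒᵖ} (i : U ⟶ V)
    (x : paramSections p q U.unop ⊗[ℂ] (K.obj U : Type)) :
    TensorProduct.AlgebraTensorModule.map (A := paramSections p q V.unop) LinearMap.id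
        (φ.app V).hom (tensorRes K i x) =
      tensorRes L i (TensorProduct.AlgebraTensorModule.map (A := paramSections p q U.unop)
        LinearMap.id (φ.app U).hom x) := by
  induction x using TensorProduct.induction_on with
  | zero => simp
  | add a b ha hb => simp only [map_add, ha, hb]
  | tmul a b =>
    have h := LinearMap.congr_fun (congrArg ModuleCat.Hom.hom (φ.naturality i)) b
    simp only [tensorRes, TensorProduct.map_tmul, TensorProduct.AlgebraTensorModule.map_tmul,
      LinearMap.id_apply]
    exact congrArg _ h

/-- The functor `K ↦ (U ↦ r₂⁻¹𝒪(U) ⊗ K(U))` on presheaves. -/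
def tensorFunctor (p q : ℕ) : TopCat.Presheaf (ModuleCat.{0} ℂ) (Tot p q) ⥤
    PresheafOfModules.{0} (paramSheaf p q).obj where
  obj K := tensorPresheaf K
  map {K L} φ :=
    { app := fun U => ModuleCat.ofHom (R := paramSections p q U.unop)
        (X := paramSections p q U.unop ⊗[ℂ] (K.obj U : Type))
        (Y := paramSections p q U.unop ⊗[ℂ] (L.obj U : Type))
        (TensorProduct.AlgebraTensorModule.map LinearMap.id (φ.app U).hom)
      naturality := by
        intro U V i
        ext x
        exact tensorRes_map φ i x }
  map_id K := by
    apply PresheafOfModules.hom_ext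
    intro U
    ext x
    change TensorProduct.AlgebraTensorModule.map (R := ℂ) (A := paramSections p q U.unop)
      LinearMap.id LinearMap.id x = x
    rw [TensorProduct.AlgebraTensorModule.map_id]
    rfl
  map_comp {K L M} f g := by
    apply PresheafOfModules.hom_ext
    intro U
    ext x
    exact LinearMap.congr_fun (TensorProduct.AlgebraTensorModule.map_comp (R := ℂ)
      (A := paramSections p q U.unop) LinearMap.id LinearMap.id (g.app U).hom (f.app U).hom) x

instance : (tensorFunctor p q).Additive where
  map_add {K L f g} := by
    apply PresheafOfModules.hom_ext
    intro U
    ext x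
    exact LinearMap.congr_fun (TensorProduct.AlgebraTensorModule.map_add_right (R := ℂ)
      (A := paramSections p q U.unop) LinearMap.id (f.app U).hom (g.app U).hom) x

/-- The functor `K ↦ K ⊗_ℂ r₂⁻¹𝒪` from sheaves of complex vector spaces to sheaves of modules over
`r₂⁻¹𝒪`.  It is exact, because `ℂ` is a field, so it computes the derived tensor product. -/
def tensorSheaf (p q : ℕ) :
    TopCat.Sheaf (ModuleCat.{0} ℂ) (Tot p q) ⥤ SheafOfModules.{0} (paramSheaf p q) :=
  TopCat.Sheaf.forget _ _ ⋙ tensorFunctor p q ⋙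
    PresheafOfModules.sheafification (𝟙 (paramSheaf p q).obj)

instance : (PresheafOfModules.sheafification.{0} (𝟙 (paramSheaf p q).obj)).Additive :=
  (PresheafOfModules.sheafificationAdjunction (𝟙 (paramSheaf p q).obj)).left_adjoint_additive

instance : (tensorSheaf p q).Additive := by
  unfold tensorSheaf
  infer_instance

/-! ### The two complexes and the canonical morphism -/

/-- The presheaf of abelian groups `U ↦ Hom_D(P, 𝒜^{<0}(U))`. -/
def homAb (p q : ℕ) (P : ModuleCat.{0} (DAlg p)) : (Opens (Tot p q))ᵒᵖ ⥤ Ab.{0} where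
  obj U := AddCommGrpCat.of (P →ₗ[DAlg p] rapidSections p q U.unop)
  map i := AddCommGrpCat.ofHom
    { toFun := fun φ => (res i.unop.le).comp φ
      map_zero' := LinearMap.comp_zero _
      map_add' := fun _ _ => LinearMap.comp_add _ _ _ }
  map_id _ := rfl
  map_comp _ _ := rfl

instance (P : ModuleCat.{0} (DAlg p)) (U : (Opens (Tot p q))ᵒᵖ) :
    Module ((paramSheaf p q).obj.obj U) ((homAb p q P).obj U) :=
  inferInstanceAs (Module (paramSections p q U.unop) (P →ₗ[DAlg p] rapidSections p q U.unop))

lemma isSheaf_homAb (P : ModuleCat.{0} (DAlg p)) :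
    Presheaf.IsSheaf (Opens.grothendieckTopology (Tot p q)) (homAb p q P) := by
  have h := (rapidSheaf p q).property P
  rw [← isSheaf_iff_isSheaf_of_type] at h
  refine (TopCat.Presheaf.isSheaf_iff_isSheaf_comp (X := Tot p q) (forget Ab.{0}) _).2 ?_
  refine TopCat.Presheaf.isSheaf_of_iso ?_ h
  exact NatIso.ofComponents (fun U =>
    { hom := ↾fun (f : P ⟶ ModuleCat.of (DAlg p) (rapidSections p q U.unop)) => f.hom
      inv := ↾fun (f : P →ₗ[DAlg p] rapidSections p q U.unop) => ModuleCat.ofHom f })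
    (fun _ => rfl)

/-- The functor sending a `D`-module `P`, viewed as a constant sheaf, to the sheaf of
`r₂⁻¹𝒪`-modules `ℋom_D(P, 𝒜^{<0}) : U ↦ Hom_D(P, 𝒜^{<0}(U))`. -/
def homSheaf (p q : ℕ) : (ModuleCat.{0} (DAlg p))ᵒᵖ ⥤ SheafOfModules.{0} (paramSheaf p q) where
  obj P := ⟨PresheafOfModules.ofPresheaf (homAb p q P.unop) (fun _ _ _ _ _ => rfl),
    isSheaf_homAb P.unop⟩
  map {P _} f := ⟨PresheafOfModules.homMk
    { app := fun U => AddCommGrpCat.ofHom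
        { toFun := fun φ : P.unop →ₗ[DAlg p] rapidSections p q U.unop => φ.comp f.unop.hom
          map_zero' := rfl
          map_add' := fun _ _ => rfl }
      naturality := fun _ _ _ => rfl } (fun _ _ _ => rfl)⟩
  map_id _ := rfl
  map_comp _ _ := rfl

instance : (homSheaf p q).Additive where
  map_add {P Q f g} := by
    apply SheafOfModules.hom_ext
    apply PresheafOfModules.hom_ext
    intro U
    ext φ
    exact LinearMap.comp_add f.unop.hom g.unop.hom φ

/-- The multiplication `Hom_D(P, r₁⁻¹𝒜^{<0}(U)) ⊗ r₂⁻¹𝒪(U) ⟶ Hom_D(P, 𝒜^{<0}(U))`, sending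
`g ⊗ φ` to `x ↦ g * φ(x)`. -/
def mulMap (P : ModuleCat.{0} (DAlg p)) (U : Opens (CBar p × Par q)) :
    paramSections p q U ⊗[ℂ]
        (((sheafHom (pullbackSheaf p q)).obj (op P)).presheaf.obj (op U) : Type)
      →ₗ[paramSections p q U] (P →ₗ[DAlg p] rapidSections p q U) :=
  TensorProduct.AlgebraTensorModule.lift
    { toFun := fun g =>
        { toFun := fun φ : P ⟶ ModuleCat.of (DAlg p) (pullbackSections p q U) =>
            g • (pullbackSections p q U).subtype.comp φ.hom
          map_add' := fun φ ψ => by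
            refine LinearMap.ext fun x => ?_
            exact smul_add g (φ.hom x).1 (ψ.hom x).1
          map_smul' := fun c φ => by
            refine LinearMap.ext fun x => Subtype.ext (funext fun z => ?_)
            change g.1 z * (algebraMap ℂ (DAlg p) c • (φ.hom x).1 : rapidSections p q U).1 z =
              c * (g.1 z * (φ.hom x).1.1 z)
            rw [algebraMap_smul']
            exact mul_left_comm _ _ _ }
      map_add' := fun g h => LinearMap.ext fun φ => add_smul g h _
      map_smul' := fun g h => LinearMap.ext fun φ => mul_smul g h _ }

lemma mulMap_tmul (P : ModuleCat.{0} (DAlg p)) (U : Opens (CBar p × Par q))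
    (g : paramSections p q U) (φ : P ⟶ ModuleCat.of (DAlg p) (pullbackSections p q U)) (x : P) :
    mulMap P U (g ⊗ₜ φ) x = g • (φ.hom x).1 := rfl

/-- The multiplication, as a morphism of presheaves of modules over `r₂⁻¹𝒪`. -/
def mulPresheaf (P : (ModuleCat.{0} (DAlg p))ᵒᵖ) :
    (tensorFunctor p q).obj ((sheafHom (pullbackSheaf p q)).obj P).presheaf ⟶
      ((homSheaf p q).obj P).val where
  app U := ModuleCat.ofHom (R := paramSections p q U.unop)
    (X := paramSections p q U.unop ⊗[ℂ]
      (((sheafHom (pullbackSheaf p q)).obj P).presheaf.obj U : Type))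
    (Y := P.unop →ₗ[DAlg p] rapidSections p q U.unop) (mulMap P.unop U.unop)
  naturality {U V} i := by
    ext x
    change mulMap P.unop V.unop (tensorRes _ i x) = (res i.unop.le).comp (mulMap P.unop U.unop x)
    induction x using TensorProduct.induction_on with
    | zero => simp
    | add a b ha hb => rw [map_add, map_add, ha, hb, map_add, LinearMap.comp_add]
    | tmul a b => rfl

lemma mulPresheaf_naturality {P Q : (ModuleCat.{0} (DAlg p))ᵒᵖ} (f : P ⟶ Q) :
    (tensorFunctor p q).map ((sheafHom (pullbackSheaf p q)).map f).hom ≫ mulPresheaf Q =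
      mulPresheaf P ≫ ((homSheaf p q).map f).val := by
  apply PresheafOfModules.hom_ext
  intro U
  ext x
  change mulMap Q.unop U.unop (TensorProduct.AlgebraTensorModule.map LinearMap.id
    (((sheafHom (pullbackSheaf p q)).map f).hom.app U).hom x) =
      (mulMap P.unop U.unop x).comp f.unop.hom
  induction x using TensorProduct.induction_on with
  | zero => simp
  | add a b ha hb => rw [map_add, map_add, ha, hb, map_add, LinearMap.add_comp]
  | tmul a b => rfl

/-- The canonical morphism
`ℋom_D(P, r₁⁻¹𝒜^{<0}) ⊗_ℂ r₂⁻¹𝒪 ⟶ ℋom_D(P, 𝒜^{<0})`, natural in the `D`-module `P`: the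
morphism out of the sheaf tensor product which is induced by the multiplication. -/
def mulSheaf (p q : ℕ) : sheafHom (pullbackSheaf p q) ⋙ tensorSheaf p q ⟶ homSheaf p q where
  app P := ((PresheafOfModules.sheafificationAdjunction (𝟙 (paramSheaf p q).obj)).homEquiv
    _ _).symm (mulPresheaf P)
  naturality {P Q} f := by
    let adj := PresheafOfModules.sheafificationAdjunction (𝟙 (paramSheaf p q).obj)
    have h1 := adj.homEquiv_naturality_left_symm (Y := (homSheaf p q).obj Q)
      ((tensorFunctor p q).map ((sheafHom (pullbackSheaf p q)).map f).hom)
      (mulPresheaf (p := p) (q := q) Q)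
    have h2 := adj.homEquiv_naturality_right_symm (Y := (homSheaf p q).obj P)
      (Y' := (homSheaf p q).obj Q) (mulPresheaf (p := p) (q := q) P) ((homSheaf p q).map f)
    refine Eq.trans h1.symm (Eq.trans ?_ h2)
    exact congrArg _ (mulPresheaf_naturality f)

/-! ### The derived solution complexes, and the canonical morphism between them -/

/-- The complex `Hom(P₀, F) ⟶ Hom(P₁, F) ⟶ ⋯` obtained by applying a contravariant additive
functor to a projective resolution. -/
abbrev applyRes {M : ModuleCat.{0} (DAlg p)} (P : ProjectiveResolution M) {C : Type 1}
    [Category.{0} C] [Preadditive C] (F : (ModuleCat.{0} (DAlg p))ᵒᵖ ⥤ C) [F.Additive] :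
    CochainComplex C ℕ :=
  (F.mapHomologicalComplex (ComplexShape.up ℕ)).obj P.complex.op

/-- `RHom_D(M, F)` for a sheaf of `D`-modules `F` and the constant sheaf with stalk a finitely
generated `D`-module `M`, computed by a projective resolution of `M`. -/
abbrev rhom {M : ModuleCat.{0} (DAlg p)} (P : ProjectiveResolution M) {X : TopCat.{0}}
    (F : TopCat.Sheaf (ModuleCat.{0} (DAlg p)) X) :
    CochainComplex (TopCat.Sheaf (ModuleCat.{0} ℂ) X) ℕ :=
  applyRes P (sheafHom F)

/-- The complex `RHom_D(M, r₁⁻¹𝒜^{<0}) ⊗ r₂⁻¹𝒪` of `r₂⁻¹𝒪`-modules. -/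
abbrev solTensor {M : ModuleCat.{0} (DAlg p)} (P : ProjectiveResolution M) (q : ℕ) :
    CochainComplex (SheafOfModules.{0} (paramSheaf p q)) ℕ :=
  ((tensorSheaf p q).mapHomologicalComplex (ComplexShape.up ℕ)).obj (rhom P (pullbackSheaf p q))

/-- The complex `RHom_D(M, 𝒜^{<0})` of `r₂⁻¹𝒪`-modules. -/
abbrev solParam {M : ModuleCat.{0} (DAlg p)} (P : ProjectiveResolution M) (q : ℕ) :
    CochainComplex (SheafOfModules.{0} (paramSheaf p q)) ℕ :=
  applyRes P (homSheaf p q)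

/-- The canonical morphism `RHom_D(M, r₁⁻¹𝒜^{<0}) ⊗ r₂⁻¹𝒪 ⟶ RHom_D(M, 𝒜^{<0})`, given in each
degree by the multiplication. -/
def canonicalMap {M : ModuleCat.{0} (DAlg p)} (P : ProjectiveResolution M) (q : ℕ) :
    solTensor P q ⟶ solParam P q :=
  (NatTrans.mapHomologicalComplex (mulSheaf p q) (ComplexShape.up ℕ)).app P.complex.op

end

noncomputable section

/-! ### Constructible sheaves on the compactified annulus -/

/-- The restriction to the subset `S` of the sheaf `G` is locally constant of finite rank: locally
there are finitely many sections of `G` whose germs at each point of `S` form a basis of the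
stalk. -/
def IsLocConstOn {X : TopCat.{0}} (G : TopCat.Sheaf (ModuleCat.{0} ℂ) X) (S : Set X) : Prop :=
  ∀ x ∈ S, ∃ V : Opens X, x ∈ V ∧ ∃ (n : ℕ) (s : Fin n → G.presheaf.obj (op V)),
    ∀ (y : X) (hy : y ∈ V), y ∈ S →
      LinearIndependent ℂ (fun i => (G.presheaf.germ V y hy).hom (s i)) ∧
      Submodule.span ℂ (Set.range fun i => (G.presheaf.germ V y hy).hom (s i)) = ⊤

/-- `S` is a (closed) complex analytic subset of `(ℂ*)^p`. -/
def IsAnalyticSubset {p : ℕ} (S : Set (Fin p → ℂ)) : Prop :=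
  S ⊆ {t | ∀ j, t j ≠ 0} ∧ ∀ t : Fin p → ℂ, (∀ j, t j ≠ 0) →
    ∃ V : Set (Fin p → ℂ), IsOpen V ∧ t ∈ V ∧ ∃ (k : ℕ) (g : Fin k → (Fin p → ℂ) → ℂ),
      (∀ i, AnalyticOnNhd ℂ (g i) V) ∧ S ∩ V = {y | y ∈ V ∧ ∀ i, g i y = 0}

/-- The sheaf `G` on `CBar p` is `ℂ`-constructible on `(ℂ*)^p`: there is a locally finite covering
of `(ℂ*)^p` by differences of complex analytic subsets on which `G` is locally constant of finite
rank. -/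
def IsCConstructible {p : ℕ} (G : TopCat.Sheaf (ModuleCat.{0} ℂ) (Base p)) : Prop :=
  ∃ (ι : Type) (A B : ι → Set (Fin p → ℂ)),
    (∀ i, IsAnalyticSubset (A i) ∧ IsAnalyticSubset (B i)) ∧
    (∀ t : Fin p → ℂ, (∀ j, t j ≠ 0) → ∃ U ∈ 𝓝 t, {i | ((A i \ B i) ∩ U).Nonempty}.Finite) ∧
    (⋃ i, A i \ B i) = {t | ∀ j, t j ≠ 0} ∧
    ∀ i, IsLocConstOn G (incl '' (A i \ B i))

section

variable {V : Type} [NormedAddCommGroup V] [NormedSpace ℝ V]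

/-- Semianalytic subsets of a finite dimensional real vector space. -/
def IsSemianalytic (S : Set V) : Prop :=
  ∀ x : V, ∃ U : Set V, IsOpen U ∧ x ∈ U ∧
    ∃ (m k : ℕ) (f : Fin m → V → ℝ) (g : Fin m → Fin k → V → ℝ),
      (∀ i, AnalyticOnNhd ℝ (f i) U) ∧ (∀ i j, AnalyticOnNhd ℝ (g i j) U) ∧
      S ∩ U = {y | y ∈ U ∧ ∃ i, f i y = 0 ∧ ∀ j, 0 < g i j y}

/-- Subanalytic subsets of a finite dimensional real vector space: those which are locally
projections of bounded semianalytic sets. -/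
def IsSubanalytic (S : Set V) : Prop :=
  ∀ x : V, ∃ U : Set V, IsOpen U ∧ x ∈ U ∧ ∃ (n : ℕ) (B : Set (V × (Fin n → ℝ))),
    IsSemianalytic B ∧ Bornology.IsBounded B ∧ S ∩ U = Prod.fst '' B

end

/-- The real analytic embedding of `CBar p` into `(ℂ × ℝ)^p`, given in each factor by
`(θ, r) ↦ (θ, 1 / (1 + r))`. -/
def embed {p : ℕ} (x : CBar p) : Fin p → ℂ × ℝ :=
  fun j => (((x j).1 : ℂ), ((1 + (x j).2)⁻¹).toReal)

/-- The sheaf `G` on `CBar p` is `ℝ`-constructible: the compact space `CBar p` is covered by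
finitely many subanalytic subsets on which `G` is locally constant of finite rank. -/
def IsRConstructible {p : ℕ} (G : TopCat.Sheaf (ModuleCat.{0} ℂ) (Base p)) : Prop :=
  ∃ (k : ℕ) (S : Fin k → Set (CBar p)), (⋃ i, S i) = Set.univ ∧
    ∀ i, IsSubanalytic (embed '' S i) ∧ IsLocConstOn G (S i)

end

end RapidDecay

open CategoryTheory TopologicalSpace Opposite Topology
open scoped ENNReal TensorProduct

/-! ### Quasi-isomorphisms of complexes of sheaves of modules, detected on local sections -/

namespace RapidDecay
universe u

/-! The canonical morphism is, up to an isomorphism, the sheafification of a morphism between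
complexes of presheaves. It is therefore a quasi-isomorphism as soon as multiplication is bijective
on cohomology after shrinking around each point (x, s₀) (`quasiIso_canonicalMap_of_local`).
Constructibility enters through the finite dimension of the stalks of the cohomology sheaves without
parameters: near x there are finitely many cocycles c_j whose classes form a basis of the local
cohomology (`exists_isLocalBasis`).

Surjectivity. Expand a cocycle ξ with parameter s in a Taylor series around s₀. Its coefficients ξ_w
are cocycles without parameter, all defined on one neighbourhood V of x, and Cauchy's inequalities
make them decrease geometrically once rescaled. Each ξ_w is a combination of the c_j plus a
coboundary, but on a neighbourhood which a priori depends on w and with no control on the terms.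
Both defects are cured by an argument of Baire and Grothendieck. The Fréchet space of cocycles with
uniform decay on V is the union, over a countable basis of neighbourhoods W_k of x, of the images of
the Fréchet spaces of triples (cocycle on V, primitive on W_k, coefficients). Hence one of these
images comes from an open map (`exists_open_of_iUnion`), and a null family of cocycles lifts to a
bounded family of primitives and coefficients on one fixed W (`exists_lift_family`). Summing the
series back gives ξ = dy + ∑ H_j(s) c_j with H_j holomorphic (`exists_expansion`).

The Fréchet structure needs countably many seminorms, so this is carried out with modules of
countable dimension over ℂ. The algebra D has countable dimension, hence M has a resolution by free
modules of countable rank (`freeResolution`), and the expansion is carried over to an arbitrary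
projective resolution by a homotopy equivalence (`IsLocalBasis.hasExpansion`).

Injectivity. A cocycle of the tensor product is ∑ g_k ⊗ φ_k with linearly independent g_k, so every
φ_k is a cocycle (`exists_cocycle_repr`). As φ_k does not depend on the parameter over a connected
set of parameters, it expands in the c_j, and the given element becomes ∑ H_j ⊗ c_j plus a
coboundary. If its product is a coboundary, then for each frozen s the combination ∑ H_j(s) c_j is a
coboundary without parameter, so H_j(s) = 0 by independence (`IsLocalBasis.coeff_eq_zero`).

Boundedness. Every D-module has projective dimension at most 2p
(`hasProjectiveDimensionLT_moduleCat`). Two kinds of short exact sequences, 0 → L[y, y⁻¹] → L[y,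
y⁻¹] → L → 0 and 0 → L[x] → L[x] → L → 0, each cost one in dimension. The middle terms are induced
modules, for which lifting problems have to respect fewer generators; after p sequences of each kind
only lifting over the field ℂ remains. Beyond degree 2p the complex of homomorphisms is then exact
on the sections over every open set, and the quasi-isomorphism carries the bound to the tensor
product. -/

lemma shortComplex_quasiIso_map {A B : Type*} [Category* A] [Category* B] [Abelian A] [Abelian B]
    (F : A ⥤ B) [F.Additive] [F.PreservesHomology] {S T : ShortComplex A} (φ : S ⟶ T)
    (h : IsIso (F.map (ShortComplex.homologyMap φ))) :
    ShortComplex.QuasiIso (F.mapShortComplex.map φ) := by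
  rw [ShortComplex.quasiIso_iff]
  have h1 := ShortComplex.mapHomologyIso_hom_naturality φ F
  have hT : IsIso (T.mapHomologyIso F).hom := Iso.isIso_hom _
  have hS : IsIso (S.mapHomologyIso F).hom := Iso.isIso_hom _
  exact @IsIso.of_isIso_fac_right _ _ _ _ _ _ _ _ hT
    (@IsIso.comp_isIso _ _ _ _ _ _ _ hS h) h1

/-- A functor preserving homology which inverts the map induced on homology by `μ` sends `μ` to a
quasi-isomorphism. -/
lemma quasiIsoAt_map_of_isIso {A B : Type*} [Category* A] [Category* B] [Abelian A] [Abelian B]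
    (F : A ⥤ B) [F.Additive] [F.PreservesHomology] {ι : Type*} {c : ComplexShape ι}
    {K L : HomologicalComplex A c} (μ : K ⟶ L) (i : ι)
    [h : IsIso (F.map (HomologicalComplex.homologyMap μ i))] :
    QuasiIsoAt ((F.mapHomologicalComplex c).map μ) i := by
  rw [quasiIsoAt_iff]
  exact shortComplex_quasiIso_map F ((HomologicalComplex.shortComplexFunctor _ c i).map μ) h

section PresheafComplex

variable {C : Type*} [Category* C] {R : Cᵒᵖ ⥤ RingCat.{0}} {ι : Type*} {c : ComplexShape ι}

/-- A section of a complex of presheaves of modules killed by the differential is a cycle. -/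
lemma exists_cycle (K : HomologicalComplex (PresheafOfModules.{0} R) c) (i : ι) (X : Cᵒᵖ)
    (x : (K.X i).obj X) (hx : (K.d i (c.next i)).app X x = 0) :
    ∃ z : (K.cycles i).obj X, (K.iCycles i).app X z = x := by
  let S : ShortComplex (PresheafOfModules.{0} R) :=
    ShortComplex.mk (K.iCycles i) (K.d i (c.next i)) (by simp)
  have hS : S.Exact := ShortComplex.exact_of_f_is_kernel _ (K.cyclesIsKernel i _ rfl)
  have h2 := hS.map (PresheafOfModules.evaluation R X)
  rw [ShortComplex.moduleCat_exact_iff] at h2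
  exact h2 x hx

/-- A cycle with zero homology class is a boundary. -/
lemma exists_boundary (K : HomologicalComplex (PresheafOfModules.{0} R) c) (i : ι) (X : Cᵒᵖ)
    (z : (K.cycles i).obj X) (hz : (K.homologyπ i).app X z = 0) :
    ∃ y : (K.X (c.prev i)).obj X,
      (K.d (c.prev i) i).app X y = (K.iCycles i).app X z := by
  let S : ShortComplex (PresheafOfModules.{0} R) :=
    ShortComplex.mk (K.toCycles (c.prev i) i) (K.homologyπ i) (by simp)
  have hS : S.Exact := ShortComplex.exact_of_g_is_cokernel _ (K.homologyIsCokernel _ i rfl)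
  have h2 := hS.map (PresheafOfModules.evaluation R X)
  rw [ShortComplex.moduleCat_exact_iff] at h2
  obtain ⟨y, hy⟩ := h2 z hz
  refine ⟨y, ?_⟩
  have h3 : (K.d (c.prev i) i) = K.toCycles (c.prev i) i ≫ K.iCycles i := by simp
  rw [h3, ← hy]
  rfl

/-- The inclusion of the cycles is injective on sections, so a primitive of z in the complex already
maps to z itself in the presheaf of cycles. -/
lemma homologyπ_boundary (K : HomologicalComplex (PresheafOfModules.{0} R) c) (i : ι) (X : Cᵒᵖ)
    (z : (K.cycles i).obj X) (y : (K.X (c.prev i)).obj X)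
    (h : (K.d (c.prev i) i).app X y = (K.iCycles i).app X z) : (K.homologyπ i).app X z = 0 := by
  have h3 : (K.d (c.prev i) i) = K.toCycles (c.prev i) i ≫ K.iCycles i := by simp
  have h4 : (K.toCycles (c.prev i) i).app X y = z := by
    apply PresheafOfModules.injective_of_mono (K.iCycles i) X
    rw [← h, h3]; rfl
  rw [← h4]
  have h5 := K.toCycles_comp_homologyπ (c.prev i) i
  exact congrArg (fun f => f.app X y) h5

end PresheafComplex

section

variable {X : TopCat.{0}} {R : Sheaf (Opens.grothendieckTopology X) RingCat.{0}}
  {ι : Type*} {c : ComplexShape ι}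

/-- A morphism of complexes of presheaves of modules which is locally bijective on cohomology
becomes a quasi-isomorphism after sheafification. -/
theorem quasiIso_sheafification {K L : HomologicalComplex (PresheafOfModules.{0} R.obj) c}
    (μ : K ⟶ L)
    (hsurj : ∀ (i : ι) (U : Opens X) (l : (L.X i).obj (op U)),
      (L.d i (c.next i)).app (op U) l = 0 → ∀ z ∈ U, ∃ (V : Opens X) (h : V ≤ U), z ∈ V ∧
        ∃ (k : (K.X i).obj (op V)) (y : (L.X (c.prev i)).obj (op V)),
          (K.d i (c.next i)).app (op V) k = 0 ∧
          (L.X i).map (homOfLE h).op l = (μ.f i).app (op V) k + (L.d (c.prev i) i).app (op V) y)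
    (hinj : ∀ (i : ι) (U : Opens X) (k : (K.X i).obj (op U)) (y : (L.X (c.prev i)).obj (op U)),
      (K.d i (c.next i)).app (op U) k = 0 →
      (μ.f i).app (op U) k = (L.d (c.prev i) i).app (op U) y →
      ∀ z ∈ U, ∃ (V : Opens X) (h : V ≤ U), z ∈ V ∧ ∃ (w : (K.X (c.prev i)).obj (op V)),
        (K.X i).map (homOfLE h).op k = (K.d (c.prev i) i).app (op V) w) :
    QuasiIso (((PresheafOfModules.sheafification.{0} (𝟙 R.obj)).mapHomologicalComplex c).map μ) := by
  rw [quasiIso_iff]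
  intro i
  -- Cohomology of the presheaf complexes is computed over each open set. It is enough that the
  -- induced map there is locally bijective, since sheafification inverts such maps.
  have hW : (Opens.grothendieckTopology X).W
      ((PresheafOfModules.toPresheaf R.obj).map (HomologicalComplex.homologyMap μ i)) := by
    have : Presheaf.IsLocallyInjective (Opens.grothendieckTopology X)
        ((PresheafOfModules.toPresheaf R.obj).map (HomologicalComplex.homologyMap μ i)) := by
      constructor
      intro U (x : (K.homology i).obj U) (y : (K.homology i).obj U) hxy
      replace hxy : (HomologicalComplex.homologyMap μ i).app U x =
        (HomologicalComplex.homologyMap μ i).app U y := hxy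
      -- By additivity it is enough to kill the difference locally: a cycle representing it has a
      -- boundary as its image, which is the situation of `hinj`.
      obtain ⟨z, hz⟩ := PresheafOfModules.surjective_of_epi (K.homologyπ i) U (x - y)
      have h1 : (L.homologyπ i).app U ((HomologicalComplex.cyclesMap μ i).app U z) = 0 := by
        have h2 := HomologicalComplex.homologyπ_naturality μ i
        have h3 := congrArg (fun f => f.app U z) h2
        refine h3.symm.trans ?_
        change (HomologicalComplex.homologyMap μ i).app U ((K.homologyπ i).app U z) = 0
        rw [hz]
        exact ((((HomologicalComplex.homologyMap μ i).app U).hom).map_sub x y).trans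
          (sub_eq_zero.2 hxy)
      obtain ⟨w, hw⟩ := exists_boundary L i U _ h1
      have h4 : (μ.f i).app U ((K.iCycles i).app U z) = (L.d (c.prev i) i).app U w := by
        rw [hw]
        exact (congrArg (fun f => f.app U z) (HomologicalComplex.cyclesMap_i μ i)).symm
      have h5 : (K.d i (c.next i)).app U ((K.iCycles i).app U z) = 0 :=
        congrArg (fun f => f.app U z) (K.iCycles_d i (c.next i))
      intro t ht
      obtain ⟨V, hV, htV, v, hv⟩ := hinj i U.unop _ w h5 h4 t ht
      refine ⟨V, homOfLE hV, ?_, htV⟩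
      change (K.homology i).map (homOfLE hV).op x = (K.homology i).map (homOfLE hV).op y
      refine sub_eq_zero.1 ((((K.homology i).map (homOfLE hV).op).hom.map_sub x y).symm.trans ?_)
      refine (congrArg ((K.homology i).map (homOfLE hV).op).hom hz.symm).trans ?_
      refine (PresheafOfModules.naturality_apply (K.homologyπ i) (homOfLE hV).op z).symm.trans ?_
      refine homologyπ_boundary K i (op V) _ v ?_
      rw [← hv]
      exact (PresheafOfModules.naturality_apply (K.iCycles i) (homOfLE hV).op z).symm
    have : Presheaf.IsLocallySurjective (Opens.grothendieckTopology X)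
        ((PresheafOfModules.toPresheaf R.obj).map (HomologicalComplex.homologyMap μ i)) := by
      constructor
      intro U (s : (L.homology i).obj (op U)) t ht
      obtain ⟨z, hz⟩ := PresheafOfModules.surjective_of_epi (L.homologyπ i) (op U) s
      have h5 : (L.d i (c.next i)).app (op U) ((L.iCycles i).app (op U) z) = 0 :=
        congrArg (fun f => f.app (op U) z) (L.iCycles_d i (c.next i))
      -- The class of `k` is the local preimage; `y` accounts for the difference from the given
      -- representative.
      obtain ⟨V, hV, htV, k, y, hk, hy⟩ := hsurj i U _ h5 t ht
      obtain ⟨k', hk'⟩ := exists_cycle K i (op V) k hk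
      refine ⟨V, homOfLE hV, ⟨(K.homologyπ i).app (op V) k', ?_⟩, htV⟩
      change (HomologicalComplex.homologyMap μ i).app (op V) ((K.homologyπ i).app (op V) k') =
        (L.homology i).map (homOfLE hV).op s
      rw [← hz]
      have h6 := congrArg (fun f => f.app (op V) k') (HomologicalComplex.homologyπ_naturality μ i)
      refine h6.trans ?_
      change (L.homologyπ i).app (op V) ((HomologicalComplex.cyclesMap μ i).app (op V) k') = _
      refine Eq.trans ?_ (PresheafOfModules.naturality_apply (L.homologyπ i) (homOfLE hV).op z)
      symm
      refine sub_eq_zero.1 ((((L.homologyπ i).app (op V)).hom.map_sub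
        ((L.cycles i).map (homOfLE hV).op z) _).symm.trans ?_)
      refine homologyπ_boundary L i (op V) _ y ?_
      have h7 : (L.iCycles i).app (op V) ((HomologicalComplex.cyclesMap μ i).app (op V) k') =
          (μ.f i).app (op V) k := by
        rw [← hk']
        exact congrArg (fun f => f.app (op V) k') (HomologicalComplex.cyclesMap_i μ i)
      have h8 : (L.iCycles i).app (op V) ((L.cycles i).map (homOfLE hV).op z) =
          (μ.f i).app (op V) k + (L.d (c.prev i) i).app (op V) y :=
        (PresheafOfModules.naturality_apply (L.iCycles i) (homOfLE hV).op z).trans hy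
      refine Eq.trans ?_ (((L.iCycles i).app (op V)).hom.map_sub
        ((L.cycles i).map (homOfLE hV).op z) _).symm
      refine (eq_sub_of_add_eq' ?_)
      exact ((congrArg (· + _) h7).trans h8.symm)
    exact GrothendieckTopology.W_of_isLocallyBijective _ _
  have hiso : IsIso ((PresheafOfModules.sheafification.{0} (𝟙 R.obj)).map
      (HomologicalComplex.homologyMap μ i)) := by
    -- Being an isomorphism can be tested on the underlying sheaves of abelian groups.
    rw [← isIso_iff_of_reflects_iso _ (SheafOfModules.toSheaf.{0} R)]
    exact (GrothendieckTopology.W_iff _ _).1 hW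
  have : (PresheafOfModules.sheafification.{0} (𝟙 R.obj)).Additive :=
    (PresheafOfModules.sheafificationAdjunction (𝟙 R.obj)).left_adjoint_additive
  exact quasiIsoAt_map_of_isIso _ μ i

end
end RapidDecay

/-! ### Reduction of the theorem to local statements about sections -/

namespace RapidDecay
noncomputable section
variable {p q : ℕ}

/-- The map `id ⊗ (- ∘ f)` induced by a map `f` of `D`-modules. -/
abbrev tensorPrecomp {P Q : ModuleCat.{0} (DAlg p)} (f : P ⟶ Q) (U : Opens (CBar p × Par q)) :
    paramSections p q U ⊗[ℂ]
        (((sheafHom (pullbackSheaf p q)).obj (op Q)).presheaf.obj (op U) : Type)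
      →ₗ[paramSections p q U] paramSections p q U ⊗[ℂ]
        (((sheafHom (pullbackSheaf p q)).obj (op P)).presheaf.obj (op U) : Type) :=
  TensorProduct.AlgebraTensorModule.map LinearMap.id
    ((((sheafHom (pullbackSheaf p q)).map f.op).hom.app (op U)).hom)

/-- The multiplication as a natural transformation of presheaves. -/
def mulPresheafNat (p q : ℕ) :
    sheafHom (pullbackSheaf p q) ⋙ TopCat.Sheaf.forget _ _ ⋙ tensorFunctor p q ⟶
      homSheaf p q ⋙ SheafOfModules.forget _ where
  app P := mulPresheaf P
  naturality _ _ f := mulPresheaf_naturality f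

instance : (TopCat.Sheaf.forget (ModuleCat.{0} ℂ) (Tot p q)).Additive := ⟨rfl⟩

/-- The multiplication as a morphism of complexes of presheaves. -/
abbrev mulComplex {M : ModuleCat.{0} (DAlg p)} (P : ProjectiveResolution M) (q : ℕ) :=
  (NatTrans.mapHomologicalComplex (mulPresheafNat p q) (ComplexShape.up ℕ)).app P.complex.op

/-- The comparison of a complex of sheaves with its sheafification. -/
def sheafifySolParam {M : ModuleCat.{0} (DAlg p)} (P : ProjectiveResolution M) (q : ℕ) :
    ((PresheafOfModules.sheafification.{0} (𝟙 (paramSheaf p q).obj)).mapHomologicalComplex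
      (ComplexShape.up ℕ)).obj (((homSheaf p q ⋙ SheafOfModules.forget _).mapHomologicalComplex
      (ComplexShape.up ℕ)).obj P.complex.op) ⟶ solParam P q where
  f n := (PresheafOfModules.sheafificationAdjunction (𝟙 (paramSheaf p q).obj)).counit.app
    ((homSheaf p q).obj (op (P.complex.X n)))
  comm' i j _ := ((PresheafOfModules.sheafificationAdjunction
    (𝟙 (paramSheaf p q).obj)).counit.naturality
      ((homSheaf p q).map (P.complex.op.d i j))).symm

instance {M : ModuleCat.{0} (DAlg p)} (P : ProjectiveResolution M) (q : ℕ) :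
    IsIso (sheafifySolParam P q) := by
  have : ∀ n, IsIso ((sheafifySolParam P q).f n) := fun n =>
    inferInstanceAs (IsIso ((PresheafOfModules.sheafificationAdjunction
      (𝟙 (paramSheaf p q).obj)).counit.app ((homSheaf p q).obj (op (P.complex.X n)))))
  exact HomologicalComplex.Hom.isIso_of_components _

/-- In each degree the canonical morphism is the adjoint of the multiplication of presheaves, that
is, its sheafification followed by the counit. The counit is invertible because the target is
already a sheaf. -/
lemma canonicalMap_eq {M : ModuleCat.{0} (DAlg p)} (P : ProjectiveResolution M) (q : ℕ) :
    canonicalMap P q = ((PresheafOfModules.sheafification.{0}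
      (𝟙 (paramSheaf p q).obj)).mapHomologicalComplex _).map (mulComplex P q) ≫
        sheafifySolParam P q := by
  ext n : 1
  exact (PresheafOfModules.sheafificationAdjunction (𝟙 (paramSheaf p q).obj)).homEquiv_counit ..

lemma quasiIso_canonicalMap {M : ModuleCat.{0} (DAlg p)} (P : ProjectiveResolution M)
    (h : QuasiIso (((PresheafOfModules.sheafification.{0}
      (𝟙 (paramSheaf p q).obj)).mapHomologicalComplex _).map (mulComplex P q))) :
    QuasiIso (canonicalMap P q) := by
  rw [canonicalMap_eq]
  exact quasiIso_comp (hφ := h) _ _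

/-- This is the criterion `quasiIso_sheafification` written out for `mulComplex`: the first
hypothesis is local surjectivity on cohomology, the second local injectivity. After this point only
sections over open sets occur. -/
theorem quasiIso_canonicalMap_of_local {M : ModuleCat.{0} (DAlg p)} (P : ProjectiveResolution M)
    (hsurj : ∀ (n : ℕ) (U : Opens (CBar p × Par q)) (ξ : P.complex.X n →ₗ[DAlg p] rapidSections p q U),
      ξ ∘ₗ (P.complex.d ((ComplexShape.up ℕ).next n) n).hom = 0 → ∀ z ∈ U,
      ∃ (V : Opens (CBar p × Par q)) (h : V ≤ U), z ∈ V ∧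
        ∃ (τ : paramSections p q V ⊗[ℂ]
          (((sheafHom (pullbackSheaf p q)).obj (op (P.complex.X n))).presheaf.obj (op V) : Type))
          (y : P.complex.X ((ComplexShape.up ℕ).prev n) →ₗ[DAlg p] rapidSections p q V),
          tensorPrecomp (P.complex.d ((ComplexShape.up ℕ).next n) n) V τ = 0 ∧
          (res h) ∘ₗ ξ = mulMap (P.complex.X n) V τ +
            y ∘ₗ (P.complex.d n ((ComplexShape.up ℕ).prev n)).hom)
    (hinj : ∀ (n : ℕ) (U : Opens (CBar p × Par q)) (τ : paramSections p q U ⊗[ℂ]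
          (((sheafHom (pullbackSheaf p q)).obj (op (P.complex.X n))).presheaf.obj (op U) : Type))
          (y : P.complex.X ((ComplexShape.up ℕ).prev n) →ₗ[DAlg p] rapidSections p q U),
        tensorPrecomp (P.complex.d ((ComplexShape.up ℕ).next n) n) U τ = 0 →
        mulMap (P.complex.X n) U τ = y ∘ₗ (P.complex.d n ((ComplexShape.up ℕ).prev n)).hom →
        ∀ z ∈ U, ∃ (V : Opens (CBar p × Par q)) (h : V ≤ U), z ∈ V ∧
          ∃ w, tensorRes ((sheafHom (pullbackSheaf p q)).obj (op (P.complex.X n))).presheaf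
              (homOfLE h).op τ =
            tensorPrecomp (P.complex.d n ((ComplexShape.up ℕ).prev n)) V w) :
    QuasiIso (canonicalMap P q) := by
  exact quasiIso_canonicalMap P (quasiIso_sheafification (mulComplex P q) hsurj hinj)
end
end RapidDecay

/-! ### Cohomology classes of sections and germs of the homology sheaf -/

namespace RapidDecay
noncomputable section SheafComplex

variable {X : TopCat.{0}} {ι : Type*} {c : ComplexShape ι}

/-- The functor of sections over an open set. -/
abbrev sectionsFunctor (V : Opens X) : TopCat.Sheaf (ModuleCat.{0} ℂ) X ⥤ ModuleCat.{0} ℂ :=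
  sheafToPresheaf (Opens.grothendieckTopology X) (ModuleCat.{0} ℂ) ⋙ (evaluation _ _).obj (op V)

instance (V : Opens X) : (sectionsFunctor V).Additive := ⟨rfl⟩

instance (V : Opens X) : Limits.PreservesFiniteLimits (sectionsFunctor V) := by
  have := (sheafificationAdjunction (Opens.grothendieckTopology X)
    (ModuleCat.{0} ℂ)).rightAdjoint_preservesLimits
  have : Limits.PreservesFiniteLimits
      (sheafToPresheaf (Opens.grothendieckTopology X) (ModuleCat.{0} ℂ)) :=
    Limits.PreservesLimits.preservesFiniteLimits _
  exact @Limits.comp_preservesFiniteLimits _ _ _ _ _ _ _ _ this _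

/-- Sections of a left exact sequence of sheaves. -/
lemma exists_section_of_exact {S : ShortComplex (TopCat.Sheaf (ModuleCat.{0} ℂ) X)} (hS : S.Exact)
    (hm : Mono S.f) (V : Opens X) (x : S.X₂.presheaf.obj (op V)) (hx : S.g.hom.app (op V) x = 0) :
    ∃ z : S.X₁.presheaf.obj (op V), S.f.hom.app (op V) z = x := by
  have h := hS.map_of_mono_of_preservesKernel (sectionsFunctor V) hm inferInstance
  rw [ShortComplex.moduleCat_exact_iff] at h
  exact h x hx

/-- An exact sequence of sheaves is locally exact on sections. -/
lemma exists_local_section_of_exact {S : ShortComplex (TopCat.Sheaf (ModuleCat.{0} ℂ) X)}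
    (hS : S.Exact) (V : Opens X) (x : S.X₂.presheaf.obj (op V)) (hx : S.g.hom.app (op V) x = 0)
    (t : X) (ht : t ∈ V) : ∃ (W : Opens X) (h : W ≤ V), t ∈ W ∧
      ∃ z : S.X₁.presheaf.obj (op W), S.f.hom.app (op W) z = S.X₂.presheaf.map (homOfLE h).op x := by
  have he : Epi (Limits.kernel.lift S.g S.f S.zero) := hS.epi_kernelLift
  let T := ShortComplex.mk (Limits.kernel.ι S.g) S.g (by simp)
  have hT : T.Exact := ShortComplex.exact_of_f_is_kernel _ (Limits.kernelIsKernel S.g)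
  obtain ⟨k, hk⟩ := exists_section_of_exact hT inferInstance V x hx
  have hl : Sheaf.IsLocallySurjective (Limits.kernel.lift S.g S.f S.zero) :=
    (Sheaf.isLocallySurjective_iff_epi' _ _).2 he
  obtain ⟨W, i, ⟨z, hz⟩, htW⟩ := (Opens.mem_grothendieckTopology _).1
    (Presheaf.imageSieve_mem (Opens.grothendieckTopology X)
    (Limits.kernel.lift S.g S.f S.zero).hom (U := op V) k) t ht
  refine ⟨W, i.le, htW, z, ?_⟩
  have h1 : S.f = Limits.kernel.lift S.g S.f S.zero ≫ Limits.kernel.ι S.g := by simp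
  have h2 : S.f.hom.app (op W) z = (Limits.kernel.ι S.g).hom.app (op W)
      ((Limits.kernel.lift S.g S.f S.zero).hom.app (op W) z) :=
    congrArg (fun f => f.hom.app (op W) z) h1
  rw [h2, hz, ← hk]
  exact NatTrans.naturality_apply (Limits.kernel.ι S.g).hom i.op k

variable (K : HomologicalComplex (TopCat.Sheaf (ModuleCat.{0} ℂ) X) c) (n : ι)

/-- The set of germs at `t` of homology classes of cycles. -/
def IsClass (V : Opens X) (t : X) (ht : t ∈ V) (ξ : (K.X n).presheaf.obj (op V))
    (γ : (K.homology n).presheaf.stalk t) : Prop :=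
  ∃ z : (K.cycles n).presheaf.obj (op V), (K.iCycles n).hom.app (op V) z = ξ ∧
    (K.homology n).presheaf.germ V t ht ((K.homologyπ n).hom.app (op V) z) = γ

variable {K n}

/-- Taking sections is left exact, so a section killed by the differential is a section of the sheaf
of cycles, with no shrinking. -/
lemma exists_isClass {V : Opens X} {t : X} (ht : t ∈ V) {ξ : (K.X n).presheaf.obj (op V)}
    (hξ : (K.d n (c.next n)).hom.app (op V) ξ = 0) : ∃ γ, IsClass K n V t ht ξ γ := by
  let S := ShortComplex.mk (K.iCycles n) (K.d n (c.next n)) (by simp)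
  have hS : S.Exact := ShortComplex.exact_of_f_is_kernel _ (K.cyclesIsKernel n _ rfl)
  obtain ⟨z, hz⟩ := exists_section_of_exact hS inferInstance V ξ hξ
  exact ⟨_, z, hz, rfl⟩

/-- A zero germ is a zero section on a smaller neighbourhood. There the cycle lies in the kernel of
the projection to homology, and exactness of a sequence of sheaves provides a primitive after
shrinking once more. -/
lemma IsClass.exists_boundary {V : Opens X} {t : X} {ht : t ∈ V} {ξ : (K.X n).presheaf.obj (op V)}
    (h : IsClass K n V t ht ξ 0) : ∃ (W : Opens X) (h : W ≤ V), t ∈ W ∧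
      ∃ y : (K.X (c.prev n)).presheaf.obj (op W), (K.d (c.prev n) n).hom.app (op W) y =
        (K.X n).presheaf.map (homOfLE h).op ξ := by
  obtain ⟨z, rfl, hz⟩ := h
  have hz' : (K.homology n).presheaf.germ V t ht ((K.homologyπ n).hom.app (op V) z) =
    (K.homology n).presheaf.germ V t ht 0 := hz.trans (map_zero _).symm
  obtain ⟨W, hW, i, j, hij⟩ := (K.homology n).presheaf.germ_eq t ht ht _ _ hz'
  let S := ShortComplex.mk (K.toCycles (c.prev n) n) (K.homologyπ n) (by simp)
  have hS : S.Exact := ShortComplex.exact_of_g_is_cokernel _ (K.homologyIsCokernel _ n rfl)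
  have h0 : (K.homologyπ n).hom.app (op W) ((K.cycles n).presheaf.map i.op z) = 0 := by
    refine (NatTrans.naturality_apply (K.homologyπ n).hom i.op z).trans (hij.trans ?_)
    exact map_zero _
  obtain ⟨W', h', htW', y, hy⟩ := exists_local_section_of_exact hS W _ h0 t hW
  refine ⟨W', h'.trans i.le, htW', y, ?_⟩
  have h3 : (K.d (c.prev n) n) = K.toCycles (c.prev n) n ≫ K.iCycles n := by simp
  have h4 : (K.d (c.prev n) n).hom.app (op W') y =
      (K.iCycles n).hom.app (op W') ((K.toCycles (c.prev n) n).hom.app (op W') y) :=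
    congrArg (fun f => f.hom.app (op W') y) h3
  refine h4.trans ((congrArg ((K.iCycles n).hom.app (op W')) hy).trans ?_)
  refine (NatTrans.naturality_apply (K.iCycles n).hom (homOfLE h').op _).trans ?_
  refine (congrArg _ (NatTrans.naturality_apply (K.iCycles n).hom i.op z)).trans ?_
  exact (Functor.map_comp_apply (K.X n).presheaf i.op (homOfLE h').op
    ((K.iCycles n).hom.app (op V) z)).symm

/-- The cycle that represents ξ is unique, by injectivity on sections of the inclusion of the
cycles; it is therefore the image of y, which dies in homology. -/
lemma IsClass.eq_zero {V : Opens X} {t : X} {ht : t ∈ V} {ξ : (K.X n).presheaf.obj (op V)} {γ}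
    (h : IsClass K n V t ht ξ γ) (y : (K.X (c.prev n)).presheaf.obj (op V))
    (hy : (K.d (c.prev n) n).hom.app (op V) y = ξ) : γ = 0 := by
  obtain ⟨z, rfl, rfl⟩ := h
  have h3 : (K.d (c.prev n) n) = K.toCycles (c.prev n) n ≫ K.iCycles n := by simp
  have h4 : (K.d (c.prev n) n).hom.app (op V) y =
      (K.iCycles n).hom.app (op V) ((K.toCycles (c.prev n) n).hom.app (op V) y) :=
    congrArg (fun f => f.hom.app (op V) y) h3
  have hinj : Function.Injective ((K.iCycles n).hom.app (op V)) := by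
    rw [← ModuleCat.mono_iff_injective]
    exact inferInstanceAs (Mono ((sectionsFunctor V).map (K.iCycles n)))
  have h5 : (K.toCycles (c.prev n) n).hom.app (op V) y = z := hinj (h4.symm.trans hy)
  rw [← h5]
  have h6 := congrArg (fun f => f.hom.app (op V) y) (K.toCycles_comp_homologyπ (c.prev n) n)
  exact (congrArg ((K.homology n).presheaf.germ V t ht) h6).trans (map_zero _)

lemma IsClass.add {V : Opens X} {t : X} {ht : t ∈ V} {ξ ξ' : (K.X n).presheaf.obj (op V)} {γ γ'}
    (h : IsClass K n V t ht ξ γ) (h' : IsClass K n V t ht ξ' γ') :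
    IsClass K n V t ht (ξ + ξ') (γ + γ') := by
  obtain ⟨z, rfl, rfl⟩ := h
  obtain ⟨z', rfl, rfl⟩ := h'
  exact ⟨z + z', map_add _ _ _, by rw [map_add, map_add]⟩

lemma IsClass.smul {V : Opens X} {t : X} {ht : t ∈ V} {ξ : (K.X n).presheaf.obj (op V)} {γ}
    (h : IsClass K n V t ht ξ γ) (a : ℂ) : IsClass K n V t ht (a • ξ) (a • γ) := by
  obtain ⟨z, rfl, rfl⟩ := h
  exact ⟨a • z, map_smul _ _ _, by rw [map_smul, map_smul]⟩

lemma IsClass.zero {V : Opens X} {t : X} {ht : t ∈ V} : IsClass K n V t ht 0 0 :=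
  ⟨0, map_zero _, by rw [map_zero, map_zero]⟩

lemma IsClass.res {V W : Opens X} {t : X} {ht : t ∈ V} {ξ : (K.X n).presheaf.obj (op V)} {γ}
    (h : IsClass K n V t ht ξ γ) (i : W ≤ V) (htW : t ∈ W) :
    IsClass K n W t htW ((K.X n).presheaf.map (homOfLE i).op ξ) γ := by
  obtain ⟨z, rfl, rfl⟩ := h
  refine ⟨(K.cycles n).presheaf.map (homOfLE i).op z,
    NatTrans.naturality_apply (K.iCycles n).hom (homOfLE i).op z, ?_⟩
  refine (congrArg _ (NatTrans.naturality_apply (K.homologyπ n).hom (homOfLE i).op z)).trans ?_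
  exact (K.homology n).presheaf.germ_res_apply (homOfLE i) t htW _

lemma IsClass.sum {V : Opens X} {t : X} {ht : t ∈ V} {κ : Type*} (s : Finset κ)
    {ξ : κ → (K.X n).presheaf.obj (op V)} {γ : κ → (K.homology n).presheaf.stalk t}
    (h : ∀ j ∈ s, IsClass K n V t ht (ξ j) (γ j)) :
    IsClass K n V t ht (∑ j ∈ s, ξ j) (∑ j ∈ s, γ j) := by
  classical
  induction s using Finset.induction_on with
  | empty => simpa using IsClass.zero
  | insert a s ha ih =>
    rw [Finset.sum_insert ha, Finset.sum_insert ha]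
    exact (h a (by simp)).add (ih fun j hj => h j (by simp [hj]))

/-- If the stalk of the homology sheaf is finite dimensional, then there are finitely many cycles
near the point whose classes form a basis of the local homology. -/
theorem exists_local_basis (t : X) [FiniteDimensional ℂ ((K.homology n).presheaf.stalk t)] :
    ∃ (h : ℕ) (V₀ : Opens X) (_ : t ∈ V₀) (e : Fin h → (K.X n).presheaf.obj (op V₀)),
      (∀ j, (K.d n (c.next n)).hom.app (op V₀) (e j) = 0) ∧
      (∀ (V : Opens X) (ξ : (K.X n).presheaf.obj (op V)), t ∈ V →
        (K.d n (c.next n)).hom.app (op V) ξ = 0 → ∃ (W : Opens X) (i : W ≤ V) (i₀ : W ≤ V₀),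
          t ∈ W ∧ ∃ (a : Fin h → ℂ) (y : (K.X (c.prev n)).presheaf.obj (op W)),
            (K.X n).presheaf.map (homOfLE i).op ξ =
              ∑ j, a j • (K.X n).presheaf.map (homOfLE i₀).op (e j) +
                (K.d (c.prev n) n).hom.app (op W) y) ∧
      (∀ (W : Opens X) (i₀ : W ≤ V₀) (a : Fin h → ℂ) (y : (K.X (c.prev n)).presheaf.obj (op W)),
        t ∈ W → ∑ j, a j • (K.X n).presheaf.map (homOfLE i₀).op (e j) =
          (K.d (c.prev n) n).hom.app (op W) y → ∀ j, a j = 0) := by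
  classical
  let T : Set ((K.homology n).presheaf.stalk t) :=
    {γ | ∃ (V : Opens X) (ht : t ∈ V) (ξ : (K.X n).presheaf.obj (op V)), IsClass K n V t ht ξ γ}
  -- The basis is extracted from the germs that are classes of actual cocycles, so that its members
  -- have representatives. It is finite because the stalk is finite dimensional.
  obtain ⟨b, hbT, hspan, hli⟩ := exists_linearIndependent ℂ T
  have hfin : Finite b := hli.finite
  let ι' := Fin (Nat.card b)
  let eqv : ι' ≃ b := (Finite.equivFin b).symm
  have hmem : ∀ j : ι', ∃ (V : Opens X) (ht : t ∈ V) (ξ : (K.X n).presheaf.obj (op V)),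
    IsClass K n V t ht ξ (eqv j).1 := fun j => hbT (eqv j).2
  choose V ht ξ hξ using hmem
  let V₀ : Opens X := Finset.univ.inf V
  have hV₀ : t ∈ V₀ := by
    have : (t ∈ (V₀ : Set X)) := by
      simp only [V₀, Opens.coe_finset_inf]
      simpa using ht
    exact this
  have hle : ∀ j, V₀ ≤ V j := fun j => Finset.inf_le (Finset.mem_univ j)
  have hcl : ∀ j, IsClass K n V₀ t hV₀ ((K.X n).presheaf.map (homOfLE (hle j)).op (ξ j)) (eqv j).1 :=
    fun j => (hξ j).res (hle j) hV₀
  have hcyc : ∀ {W : Opens X} {hW : t ∈ W} {ξ : (K.X n).presheaf.obj (op W)} {γ},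
      IsClass K n W t hW ξ γ → (K.d n (c.next n)).hom.app (op W) ξ = 0 := by
    rintro W hW ξ γ ⟨z, rfl, -⟩
    exact congrArg (fun f => f.hom.app (op W) z) (K.iCycles_d n (c.next n))
  have hli' : LinearIndependent ℂ (fun j : ι' => (eqv j).1) := hli.comp eqv eqv.injective
  refine ⟨Nat.card b, V₀, hV₀, fun j => (K.X n).presheaf.map (homOfLE (hle j)).op (ξ j),
    fun j => hcyc (hcl j), ?_, ?_⟩
  · intro W η hW hη
    obtain ⟨γ, hγ⟩ := exists_isClass hW hη
    have hγ' : γ ∈ Submodule.span ℂ (Set.range fun j : ι' => (eqv j).1) := by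
      have : (Set.range fun j : ι' => (eqv j).1) = b := by
        ext y
        constructor
        · rintro ⟨j, rfl⟩; exact (eqv j).2
        · intro hy; exact ⟨eqv.symm ⟨y, hy⟩, by simp⟩
      rw [this, hspan]
      exact Submodule.subset_span ⟨W, hW, η, hγ⟩
    obtain ⟨a, ha⟩ := (Submodule.mem_span_range_iff_exists_fun ℂ).1 hγ'
    have h1 := hγ.res (inf_le_left : W ⊓ V₀ ≤ W) ⟨hW, hV₀⟩
    -- Subtracting the combination with the coordinates `a` of γ gives a cocycle with zero class,
    -- hence a boundary near t.
    have h2 := IsClass.sum Finset.univ fun j _ =>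
      ((hcl j).res (inf_le_right : W ⊓ V₀ ≤ V₀) ⟨hW, hV₀⟩).smul (- a j)
    have h3 := h1.add h2
    have h4 : γ + ∑ j, (- a j) • (eqv j).1 = 0 := by
      rw [← ha, ← Finset.sum_add_distrib]
      simp
    rw [h4] at h3
    obtain ⟨W', hW', htW', y, hy⟩ := h3.exists_boundary
    refine ⟨W', hW'.trans inf_le_left, hW'.trans inf_le_right, htW', a, y, ?_⟩
    rw [hy, map_add, map_sum]
    have h5 : ∀ j, (K.X n).presheaf.map (homOfLE hW').op ((- a j) •
        (K.X n).presheaf.map (homOfLE (inf_le_right : W ⊓ V₀ ≤ V₀)).op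
          ((K.X n).presheaf.map (homOfLE (hle j)).op (ξ j))) = - (a j •
        (K.X n).presheaf.map (homOfLE (hW'.trans inf_le_right)).op
          ((K.X n).presheaf.map (homOfLE (hle j)).op (ξ j))) := by
      intro j
      rw [map_smul, neg_smul, ← Functor.map_comp_apply]
      rfl
    simp only [h5, Finset.sum_neg_distrib]
    rw [← Functor.map_comp_apply]
    change _ = _ + ((K.X n).presheaf.map (homOfLE (hW'.trans inf_le_left)).op η + _)
    abel
  · intro W i₀ a y hW hy j
    have h2 := IsClass.sum Finset.univ fun j _ => ((hcl j).res i₀ hW).smul (a j)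
    have h3 := h2.eq_zero y hy.symm
    exact Fintype.linearIndependent_iff.1 hli' a h3 j

end SheafComplex
end RapidDecay

/-! ### Local bases of the cohomology without parameters -/

namespace RapidDecay
noncomputable section
variable {p q : ℕ}

/-- The inverse image in `CBar p × {point}` of an open subset of `CBar p`. -/
abbrev baseOpen (V : Opens (CBar p)) : Opens (CBar p × Par 0) :=
  (Opens.map (TopCat.ofHom ⟨Prod.fst, continuous_fst⟩ : Tot p 0 ⟶ Base p)).obj V

lemma baseOpen_mono {V W : Opens (CBar p)} (h : W ≤ V) : baseOpen W ≤ baseOpen V :=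
  fun _ hz => h hz

/-- The maps `e j : P₁ → 𝒜^{<0}(V₀)` form a basis of the cohomology at `x` of the complex
`Hom(P₀, 𝒜^{<0}) → Hom(P₁, 𝒜^{<0}) → Hom(P₂, 𝒜^{<0})`. -/
structure IsLocalBasis {P₂ P₁ P₀ : Type} [AddCommGroup P₂] [AddCommGroup P₁] [AddCommGroup P₀]
    [Module (DAlg p) P₂] [Module (DAlg p) P₁] [Module (DAlg p) P₀]
    (d₁ : P₂ →ₗ[DAlg p] P₁) (d₀ : P₁ →ₗ[DAlg p] P₀) (x : CBar p) {h : ℕ} {V₀ : Opens (CBar p)}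
    (e : Fin h → P₁ →ₗ[DAlg p] rapidSections p 0 (baseOpen V₀)) : Prop where
  mem : x ∈ V₀
  cocycle : ∀ j, e j ∘ₗ d₁ = 0
  span : ∀ (V : Opens (CBar p)) (ξ : P₁ →ₗ[DAlg p] rapidSections p 0 (baseOpen V)), x ∈ V →
    ξ ∘ₗ d₁ = 0 → ∃ (W : Opens (CBar p)) (i : W ≤ V) (i₀ : W ≤ V₀), x ∈ W ∧
      ∃ (a : Fin h → ℂ) (y : P₀ →ₗ[DAlg p] rapidSections p 0 (baseOpen W)),
        ∀ u, res (baseOpen_mono i) (ξ u) =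
          ∑ j, a j • res (baseOpen_mono i₀) (e j u) + y (d₀ u)
  indep : ∀ (W : Opens (CBar p)) (i₀ : W ≤ V₀) (a : Fin h → ℂ)
    (y : P₀ →ₗ[DAlg p] rapidSections p 0 (baseOpen W)), x ∈ W →
    (∀ u, ∑ j, a j • res (baseOpen_mono i₀) (e j u) = y (d₀ u)) → ∀ j, a j = 0

/-- Every point lies in one of the strata, and the definition of local constancy there gives
finitely many germs spanning the stalk. -/
lemma finiteDimensional_stalk {G : TopCat.Sheaf (ModuleCat.{0} ℂ) (Base p)}
    (hG : IsRConstructible G) (x : CBar p) :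
    FiniteDimensional ℂ (TopCat.Presheaf.stalk (C := ModuleCat.{0} ℂ) (X := Base p) G.presheaf x) := by
  obtain ⟨k, S, hS, h⟩ := hG
  obtain ⟨i, hi⟩ := Set.mem_iUnion.1 (hS ▸ Set.mem_univ x : x ∈ ⋃ i, S i)
  obtain ⟨V, hxV, n, s, hs⟩ := (h i).2 x hi
  have := (hs x hxV hi).2
  exact Module.finite_def.2 (this ▸ Submodule.fg_span (Set.finite_range _))

/-- The content is `exists_local_basis` for the complex without parameters, translated from sections
of a sheaf of homomorphisms to linear maps on the terms of the resolution. -/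
theorem exists_isLocalBasis {M : ModuleCat.{0} (DAlg p)} (P : ProjectiveResolution M) (n : ℕ)
    (hR : IsRConstructible ((rhom P (rapidSheafBase p)).homology n)) (x : CBar p) :
    ∃ (h : ℕ) (V₀ : Opens (CBar p))
      (e : Fin h → P.complex.X n →ₗ[DAlg p] rapidSections p 0 (baseOpen V₀)),
      IsLocalBasis (P.complex.d ((ComplexShape.up ℕ).next n) n).hom
        (P.complex.d n ((ComplexShape.up ℕ).prev n)).hom x e := by
  have := finiteDimensional_stalk hR x
  obtain ⟨h, V₀, hx, e, he, hspan, hind⟩ :=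
    exists_local_basis (X := Base p) (K := rhom P (rapidSheafBase p)) (n := n) x
  -- Scalars act on morphisms of D-modules through the structure map ℂ → D, and on sections by
  -- pointwise multiplication; the two actions are identified here, together with evaluation of
  -- sums.
  have hsmul : ∀ (W : Opens (CBar p)) (i₀ : W ≤ V₀) (a : Fin h → ℂ) (u : P.complex.X n),
      ((∑ j, a j • ((rhom P (rapidSheafBase p)).X n).presheaf.map (homOfLE i₀).op (e j) :
        ((rhom P (rapidSheafBase p)).X n).presheaf.obj (op W)) :
        P.complex.X n ⟶ ModuleCat.of (DAlg p) (rapidSections p 0 (baseOpen W))).hom u =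
      ∑ j, a j • res (baseOpen_mono i₀)
        ((e j : P.complex.X n ⟶ ModuleCat.of (DAlg p) (rapidSections p 0 (baseOpen V₀))).hom u) := by
    intro W i₀ a u
    have h1 : ∀ (s : Finset (Fin h)) (f : Fin h → (P.complex.X n ⟶
        ModuleCat.of (DAlg p) (rapidSections p 0 (baseOpen W)))),
        (∑ j ∈ s, f j).hom u = ∑ j ∈ s, (f j).hom u := by
      intro s f
      classical
      induction s using Finset.induction_on with
      | empty => rfl
      | insert a s ha ih => rw [Finset.sum_insert ha, Finset.sum_insert ha, ← ih]; rfl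
    refine (h1 Finset.univ _).trans (Finset.sum_congr rfl fun j _ => ?_)
    exact algebraMap_smul' _ _
  refine ⟨h, V₀, fun j => (e j : P.complex.X n ⟶
    ModuleCat.of (DAlg p) (rapidSections p 0 (baseOpen V₀))).hom, hx, ?_, ?_, ?_⟩
  · intro j
    exact congrArg ModuleCat.Hom.hom (he j)
  · intro V ξ hV hξ
    obtain ⟨W, i, i₀, hW, a, y, hy⟩ := hspan V (ModuleCat.ofHom ξ) hV (ModuleCat.hom_ext hξ)
    refine ⟨W, i, i₀, hW, a, ModuleCat.Hom.hom y, fun u => ?_⟩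
    exact (congrArg (fun f : P.complex.X n ⟶
      ModuleCat.of (DAlg p) (rapidSections p 0 (baseOpen W)) => f.hom u) hy).trans
      (congrArg (· + _) (hsmul W i₀ a u))
  · intro W i₀ a y hW hy
    refine hind W i₀ a (ModuleCat.ofHom y) hW (ModuleCat.hom_ext (LinearMap.ext fun u => ?_))
    exact (hsmul W i₀ a u).trans (hy u)

/-- Sectionwise exactness implies exactness of the complex of sheaves. -/
theorem exactAt_solParam {M : ModuleCat.{0} (DAlg p)} (P : ProjectiveResolution M) (q n : ℕ)
    (h : ∀ (U : Opens (CBar p × Par q)) (ξ : P.complex.X n →ₗ[DAlg p] rapidSections p q U),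
      ξ ∘ₗ (P.complex.d ((ComplexShape.up ℕ).next n) n).hom = 0 →
      ∃ y : P.complex.X ((ComplexShape.up ℕ).prev n) →ₗ[DAlg p] rapidSections p q U,
        y ∘ₗ (P.complex.d n ((ComplexShape.up ℕ).prev n)).hom = ξ) :
    (solParam P q).ExactAt n := by
  let L := (((homSheaf p q ⋙ SheafOfModules.forget _).mapHomologicalComplex
      (ComplexShape.up ℕ)).obj P.complex.op)
  -- For the complex of presheaves, exactness is exactness over each open set. Sheafification
  -- preserves it, and the sheafified complex is isomorphic to the original one.
  have hL : L.ExactAt n := by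
    rw [HomologicalComplex.exactAt_iff_isZero_homology, Limits.IsZero.iff_id_eq_zero]
    apply PresheafOfModules.hom_ext
    intro U
    ext (s : (L.homology n).obj U)
    obtain ⟨z, hz⟩ := PresheafOfModules.surjective_of_epi (L.homologyπ n) U s
    have h5 : (L.d n ((ComplexShape.up ℕ).next n)).app U ((L.iCycles n).app U z) = 0 :=
      congrArg (fun f => f.app U z) (L.iCycles_d n ((ComplexShape.up ℕ).next n))
    obtain ⟨y, hy⟩ := h U.unop _ h5
    have := homologyπ_boundary L n U z y hy
    exact hz.symm.trans this
  have h1 := hL.map (PresheafOfModules.sheafification.{0} (𝟙 (paramSheaf p q).obj))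
  exact (exactAt_iff_of_quasiIsoAt (sheafifySolParam P q) n).1 h1
end
end RapidDecay

namespace RapidDecay
noncomputable section

/-! ### Separately holomorphic continuous functions are analytic -/

open Metric MeasureTheory Real in
lemma torusMap_mem_closedBall {n : ℕ} {r : ℝ} (hr : 0 ≤ r) (θ : Fin n → ℝ) :
    torusMap (0 : Fin n → ℂ) (fun _ => r) θ ∈ closedBall (0 : Fin n → ℂ) r := by
  rw [mem_closedBall_zero_iff, pi_norm_le_iff_of_nonneg hr]
  intro i
  simp [torusMap, Complex.norm_exp_ofReal_mul_I, abs_of_nonneg hr]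

lemma continuous_torusMap {n : ℕ} (c : Fin n → ℂ) (r : Fin n → ℝ) : Continuous (torusMap c r) := by
  unfold torusMap
  fun_prop

lemma continuous_torusMap_apply {n : ℕ} (c : Fin n → ℂ) (r : Fin n → ℝ) (i : Fin n) :
    Continuous fun θ => torusMap c r θ i :=
  (continuous_apply i).comp (continuous_torusMap c r)

lemma torusMap_sub_ne_zero {n : ℕ} {r : ℝ} {w : Fin n → ℂ} (hw : w ∈ Metric.ball 0 r)
    (θ : Fin n → ℝ) (i : Fin n) : torusMap (0 : Fin n → ℂ) (fun _ => r) θ i - w i ≠ 0 := by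
  rw [mem_ball_zero_iff] at hw
  have hr : 0 ≤ r := (norm_nonneg _).trans hw.le
  intro h
  have h1 : ‖torusMap (0 : Fin n → ℂ) (fun _ => r) θ i‖ = r := by
    simp [torusMap, Complex.norm_exp_ofReal_mul_I, abs_of_nonneg hr]
  rw [sub_eq_zero.1 h] at h1
  have := norm_le_pi_norm w i
  linarith

lemma torusIntegrable_cauchy {n : ℕ} {f : (Fin n → ℂ) → ℂ} {r : ℝ} (hr : 0 ≤ r)
    (hc : ContinuousOn f (Metric.closedBall 0 r)) {w : Fin n → ℂ} (hw : w ∈ Metric.ball 0 r) :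
    TorusIntegrable (fun ζ => (∏ i, (ζ i - w i)⁻¹) * f ζ) 0 (fun _ => r) := by
  have hc' : Continuous fun θ => f (torusMap 0 (fun _ => r) θ) :=
    hc.comp_continuous (continuous_torusMap _ _) (torusMap_mem_closedBall hr)
  refine (Continuous.continuousOn ?_).integrableOn_compact isCompact_Icc
  refine Continuous.mul (continuous_finsetProd _ fun i _ => Continuous.inv₀ ?_ ?_) hc'
  · exact (continuous_torusMap_apply _ _ i).sub continuous_const
  · exact fun θ => torusMap_sub_ne_zero hw θ i

/-- The Cauchy integral formula on a polydisc. -/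
theorem torusIntegral_cauchy {n : ℕ} {r : ℝ} (hr : 0 < r) {f : (Fin n → ℂ) → ℂ}
    (hc : ContinuousOn f (Metric.closedBall 0 r))
    (hd : ∀ z ∈ Metric.closedBall (0 : Fin n → ℂ) r, ∀ i,
      DifferentiableOn ℂ (fun ζ => f (Function.update z i ζ)) (Metric.closedBall 0 r))
    {w : Fin n → ℂ} (hw : w ∈ Metric.ball 0 r) :
    torusIntegral (fun ζ => (∏ i, (ζ i - w i)⁻¹) * f ζ) 0 (fun _ => r) =
      (2 * Real.pi * Complex.I) ^ n * f w := by
  induction n with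
  | zero =>
    rw [torusIntegral_dim0]
    simp [Subsingleton.elim w 0]
  | succ n ih =>
    -- With the first variable integrated last, the inner integral is known by induction, and what
    -- is left is Cauchy's formula in one variable.
    rw [torusIntegral_succ (torusIntegrable_cauchy hr.le hc hw)]
    have hw' := hw
    rw [mem_ball_zero_iff, pi_norm_lt_iff hr] at hw'
    have hcons : ∀ x : ℂ, ‖x‖ ≤ r → ∀ y ∈ Metric.closedBall (0 : Fin n → ℂ) r,
        (Fin.cons x y : Fin (n + 1) → ℂ) ∈ Metric.closedBall (0 : Fin (n + 1) → ℂ) r := by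
      intro x hx y hy
      rw [mem_closedBall_zero_iff, pi_norm_le_iff_of_nonneg hr.le] at hy ⊢
      intro i
      refine Fin.cases ?_ (fun i => ?_) i
      · simpa using hx
      · simpa using hy i
    have htail : Fin.tail w ∈ Metric.ball (0 : Fin n → ℂ) r := by
      rw [mem_ball_zero_iff, pi_norm_lt_iff hr]
      exact fun i => hw' i.succ
    have key : Set.EqOn (fun x : ℂ => torusIntegral (fun y : Fin n → ℂ =>
        (∏ i, ((Fin.cons x y : Fin (n + 1) → ℂ) i - w i)⁻¹) * f (Fin.cons x y)) 0 (fun _ => r))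
        (fun x => (x - w 0)⁻¹ • ((2 * Real.pi * Complex.I) ^ n * f (Fin.cons x (Fin.tail w))))
        (Metric.sphere 0 r) := by
      intro x hx
      have hx' : ‖x‖ ≤ r := (mem_sphere_zero_iff_norm.1 hx).le
      have := ih (f := fun y => f (Fin.cons x y))
        (hc.comp (by fun_prop) (hcons x hx')) (fun z hz i => by
          have := hd _ (hcons x hx' z hz) i.succ
          simpa [Fin.cons_update] using this) htail
      have h3 : (fun y : Fin n → ℂ => (∏ i, ((Fin.cons x y : Fin (n + 1) → ℂ) i - w i)⁻¹) *
          f (Fin.cons x y)) = fun y => (x - w 0)⁻¹ *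
            ((∏ i, (y i - Fin.tail w i)⁻¹) * f (Fin.cons x y)) := by
        funext y
        rw [Fin.prod_univ_succ, Fin.cons_zero, mul_assoc]
        rfl
      change torusIntegral _ 0 _ = _
      rw [h3, torusIntegral_const_mul]
      exact congrArg _ this
    refine (circleIntegral.integral_congr hr.le key).trans ?_
    have h0 := hd w (Metric.ball_subset_closedBall hw) 0
    have h1 : ∀ x, Function.update w 0 x = (Fin.cons x (Fin.tail w) : Fin (n + 1) → ℂ) := by
      intro x
      rw [← Fin.update_cons_zero (w 0), Fin.cons_self_tail]
    simp only [h1] at h0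
    have h2 := (h0.const_mul ((2 * Real.pi * Complex.I : ℂ) ^ n)).circleIntegral_sub_inv_smul
      (mem_ball_zero_iff.2 (hw' 0))
    refine h2.trans ?_
    rw [Fin.cons_self_tail, smul_eq_mul, pow_succ]
    ring

/-- Cauchy's formula writes f(w), up to a constant, as L(κ(w)), where L is a continuous linear
functional on the Banach algebra of continuous functions on the compact cube T and κ(w) is the
Cauchy kernel. The kernel is a product of inverses of invertible elements depending affinely on w,
so it is analytic in w as an element of that algebra. -/
theorem analyticAt_of_separately {n : ℕ} {r : ℝ} (hr : 0 < r) {f : (Fin n → ℂ) → ℂ}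
    (hc : ContinuousOn f (Metric.closedBall 0 r))
    (hd : ∀ z ∈ Metric.closedBall (0 : Fin n → ℂ) r, ∀ i,
      DifferentiableOn ℂ (fun ζ => f (Function.update z i ζ)) (Metric.closedBall 0 r)) :
    AnalyticAt ℂ f 0 := by
  let T : Set (Fin n → ℝ) := Set.Icc 0 (fun _ => 2 * Real.pi)
  have hT : IsCompact T := isCompact_Icc
  have : CompactSpace T := isCompact_iff_compactSpace.1 hT
  let μ : MeasureTheory.Measure T := MeasureTheory.Measure.comap Subtype.val MeasureTheory.volume
  have hTm : MeasurableSet T := measurableSet_Icc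
  have : MeasureTheory.IsFiniteMeasure μ := by
    constructor
    rw [MeasureTheory.Measure.comap_apply _ Subtype.val_injective
      (fun s hs => (MeasurableEmbedding.subtype_coe hTm).measurableSet_image.2 hs) _
      MeasurableSet.univ]
    simpa using hT.measure_lt_top
  have hfc : Continuous fun θ => f (torusMap 0 (fun _ => r) θ) :=
    hc.comp_continuous (continuous_torusMap _ _) (torusMap_mem_closedBall hr.le)
  let m : (Fin n → ℝ) → ℂ := fun θ =>
    (∏ i, ((r : ℂ) * Complex.exp (θ i * Complex.I) * Complex.I)) * f (torusMap 0 (fun _ => r) θ)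
  have hm : Continuous m := by
    refine Continuous.mul ?_ hfc
    fun_prop
  have hint : ∀ g : C(T, ℂ), MeasureTheory.Integrable (fun θ : T => m θ * g θ) μ := by
    intro g
    have hcont : Continuous fun θ : T => m θ * g θ :=
      (hm.comp continuous_subtype_val).mul g.continuous
    exact hcont.integrable_of_hasCompactSupport (HasCompactSupport.of_compactSpace _)
  let L₀ : C(T, ℂ) →ₗ[ℂ] ℂ :=
    { toFun := fun g => ∫ θ : T, m θ * g θ ∂μ
      map_add' := fun g h => by
        simp only [ContinuousMap.add_apply, mul_add]
        exact MeasureTheory.integral_add (hint g) (hint h)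
      map_smul' := fun c g => by
        simp only [ContinuousMap.smul_apply, smul_eq_mul, RingHom.id_apply]
        rw [← MeasureTheory.integral_const_mul]
        congr 1
        funext θ
        ring }
  let L : C(T, ℂ) →L[ℂ] ℂ := L₀.mkContinuous (∫ θ : T, ‖m θ‖ ∂μ) (by
    intro g
    have hmi : MeasureTheory.Integrable (fun θ : T => ‖m θ‖) μ :=
      ((hm.comp continuous_subtype_val).norm).integrable_of_hasCompactSupport
        (HasCompactSupport.of_compactSpace _)
    rw [← MeasureTheory.integral_mul_const]
    refine MeasureTheory.norm_integral_le_of_norm_le (hmi.mul_const _)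
      (Filter.Eventually.of_forall fun θ => ?_)
    rw [norm_mul]
    gcongr
    exact g.norm_coe_le_norm θ)
  let Z : Fin n → C(T, ℂ) := fun i =>
    ⟨fun θ => torusMap (0 : Fin n → ℂ) (fun _ => r) θ i,
      by exact (continuous_torusMap_apply (0 : Fin n → ℂ) (fun _ => r) i).comp continuous_subtype_val⟩
  let D : Fin n → (Fin n → ℂ) → C(T, ℂ) := fun i w => Z i - algebraMap ℂ C(T, ℂ) (w i)
  have hDu : ∀ w ∈ Metric.ball (0 : Fin n → ℂ) r, ∀ i, IsUnit (D i w) := by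
    intro w hw i
    rw [ContinuousMap.isUnit_iff_forall_ne_zero]
    exact fun θ => torusMap_sub_ne_zero hw θ i
  -- Inverses are taken in the Banach algebra itself, where inversion is analytic at units; this
  -- avoids expanding the kernel in a power series by hand.
  let κ : (Fin n → ℂ) → C(T, ℂ) := fun w => ∏ i, Ring.inverse (D i w)
  have hκ : AnalyticAt ℂ κ 0 := by
    refine Finset.analyticAt_fun_prod _ fun i _ => ?_
    obtain ⟨u, hu⟩ := hDu 0 (Metric.mem_ball_self hr) i
    have h1 : AnalyticAt ℂ (D i) 0 := by
      refine analyticAt_const.sub ?_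
      exact ((Algebra.linearMap ℂ C(T, ℂ)).toContinuousLinearMap.comp
        (ContinuousLinearMap.proj (R := ℂ) (φ := fun _ : Fin n => ℂ) i)).analyticAt 0
    have h2 := analyticAt_inverse (𝕜 := ℂ) u
    rw [hu] at h2
    exact h2.comp h1
  have hfinal : AnalyticAt ℂ (fun w => ((2 * Real.pi * Complex.I : ℂ) ^ n)⁻¹ * L (κ w)) 0 :=
    analyticAt_const.mul ((L.analyticAt _).comp hκ)
  refine hfinal.congr ?_
  filter_upwards [Metric.ball_mem_nhds (0 : Fin n → ℂ) hr] with w hw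
  have hI := torusIntegral_cauchy hr hc hd hw
  have hpi : (2 * Real.pi * Complex.I : ℂ) ^ n ≠ 0 :=
    pow_ne_zero _ (by simp [Real.pi_ne_zero])
  rw [inv_mul_eq_iff_eq_mul₀ hpi, ← hI]
  change ∫ θ : T, m θ * κ w θ ∂μ = _
  rw [torusIntegral]
  have hsub := MeasureTheory.integral_subtype_comap (μ := MeasureTheory.volume) hTm
    (fun θ : Fin n → ℝ => (∏ i, ((r : ℂ) * Complex.exp (θ i * Complex.I) * Complex.I)) •
      ((∏ i, (torusMap (0 : Fin n → ℂ) (fun _ => r) θ i - w i)⁻¹) *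
        f (torusMap 0 (fun _ => r) θ)))
  refine Eq.trans ?_ hsub
  congr 1
  funext θ
  have hκw : κ w θ = ∏ i, (torusMap (0 : Fin n → ℂ) (fun _ => r) θ i - w i)⁻¹ := by
    simp only [κ, ContinuousMap.coe_prod, Finset.prod_apply]
    refine Finset.prod_congr rfl fun i _ => ?_
    have h := congrArg (fun g : C(T, ℂ) => g θ) (Ring.mul_inverse_cancel _ (hDu w hw i))
    exact eq_inv_of_mul_eq_one_right h
  rw [hκw, smul_eq_mul]
  simp only [m]
  ring

/-- **Osgood's lemma**: a continuous function on an open subset of a finite dimensional complex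
vector space is analytic if it is holomorphic along complex lines. -/
theorem analyticOnNhd_of_lines {E : Type} [NormedAddCommGroup E] [NormedSpace ℂ E]
    [FiniteDimensional ℂ E] {F : E → ℂ} {U : Set E} (hU : IsOpen U) (hc : ContinuousOn F U)
    (hd : ∀ z ∈ U, ∀ v : E, DifferentiableAt ℂ (fun ζ : ℂ => F (z + ζ • v)) 0) :
    AnalyticOnNhd ℂ F U := by
  intro z hz
  obtain ⟨n, ⟨e⟩⟩ : ∃ n, Nonempty (E ≃L[ℂ] (Fin n → ℂ)) :=
    ⟨Module.finrank ℂ E, ⟨ContinuousLinearEquiv.ofFinrankEq (by simp)⟩⟩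
  let g : (Fin n → ℂ) → E := fun w => z + e.symm w
  have hg : Continuous g := by fun_prop
  have h0 : g 0 ∈ U := by simpa [g] using hz
  obtain ⟨r, hr, hrU⟩ := Metric.nhds_basis_closedBall.mem_iff.1
    ((hU.preimage hg).mem_nhds (show (0 : Fin n → ℂ) ∈ g ⁻¹' U from h0))
  have h1 : AnalyticAt ℂ (fun w => F (g w)) 0 := by
    refine analyticAt_of_separately hr (hc.comp hg.continuousOn hrU) ?_
    intro w hw i ζ hζ
    have hmem : Function.update w i ζ ∈ Metric.closedBall (0 : Fin n → ℂ) r := by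
      rw [mem_closedBall_zero_iff, pi_norm_le_iff_of_nonneg hr.le] at hw ⊢
      intro k
      rcases eq_or_ne k i with rfl | hk
      · simpa using hζ
      · simpa [hk] using hw k
    have h2 := hd _ (hrU hmem) (e.symm (Pi.single i 1))
    -- The hypothesis gives differentiability at parameter 0 of a line, so the base point is moved
    -- to the value ζ of the coordinate.
    have h3 : DifferentiableAt ℂ (fun ζ' : ℂ => ζ' - ζ) ζ := by fun_prop
    have h4 : DifferentiableAt ℂ ((fun ζ' : ℂ =>
      F (g (Function.update w i ζ) + ζ' • e.symm (Pi.single i 1))) ∘ fun ζ' => ζ' - ζ) ζ := by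
      refine DifferentiableAt.comp ζ ?_ h3
      simpa using h2
    refine DifferentiableAt.differentiableWithinAt ?_
    convert h4 using 1
    funext ζ'
    simp only [g, Function.comp, add_assoc]
    rw [← map_smul, ← map_add]
    congr 3
    funext k
    rcases eq_or_ne k i with rfl | hk
    · simp
    · simp [hk]
  have h5 : AnalyticAt ℂ (fun y => e (y - z)) z :=
    (e.toContinuousLinearMap.analyticAt _).comp (analyticAt_id.sub analyticAt_const)
  have h6 : AnalyticAt ℂ ((fun w => F (g w)) ∘ fun y => e (y - z)) z :=
    AnalyticAt.comp (by simpa using h1) h5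
  refine h6.congr (Filter.Eventually.of_forall fun y => ?_)
  simp [g]

/-- Locally uniform limits of analytic functions of several variables are analytic. -/
theorem analyticOnNhd_of_tendstoLocallyUniformlyOn {E : Type} [NormedAddCommGroup E]
    [NormedSpace ℂ E] [FiniteDimensional ℂ E] {F : ℕ → E → ℂ} {f : E → ℂ} {U : Set E}
    (hU : IsOpen U) (hF : ∀ n, AnalyticOnNhd ℂ (F n) U)
    (h : TendstoLocallyUniformlyOn F f Filter.atTop U) : AnalyticOnNhd ℂ f U := by
  refine analyticOnNhd_of_lines hU
    (h.continuousOn (Filter.Frequently.of_forall fun n => (hF n).continuousOn)) ?_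
  intro z hz v
  -- On a complex line this is Weierstrass's theorem in one variable; Osgood's lemma recovers
  -- analyticity in all variables.
  let l : ℂ → E := fun ζ => z + ζ • v
  have hl : Continuous l := by fun_prop
  have h1 : TendstoLocallyUniformlyOn (fun n => F n ∘ l) (f ∘ l) Filter.atTop (l ⁻¹' U) :=
    h.comp l (fun _ hx => hx) hl.continuousOn
  have h2 := h1.differentiableOn (Filter.Eventually.of_forall fun n => ?_) (hU.preimage hl)
  · exact h2.differentiableAt ((hU.preimage hl).mem_nhds (by simpa [l] using hz))
  · intro ζ hζ
    exact (((hF n) _ hζ).differentiableAt.comp ζ (by fun_prop)).differentiableWithinAt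
end
end RapidDecay

namespace RapidDecay
noncomputable section
variable {p q : ℕ}

/-! ### Limits of functions with rapid decay -/

/-- The estimate with weight exponent 0 is uniform convergence in the interior, which gives
holomorphy of the limit and convergence of its derivatives. The estimates with exponent N bound the
limit by one member of the sequence plus a constant, which gives decay. -/
lemma rapidDecayOn_of_limit {U : Set (CBar p × Par q)} (hU : IsOpen U)
    {F : ℕ → CBar p × Par q → ℂ} {f : CBar p × Par q → ℂ} (hF : ∀ n, RapidDecayOn U (F n))
    (hb : ∀ z ∈ U, z.1 ∉ torus p → f z = 0)
    (hlim : ∀ N : ℕ, ∃ ε : ℕ → ℝ, Filter.Tendsto ε Filter.atTop (𝓝 0) ∧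
      ∀ n, ∀ z ∈ U, z.1 ∈ torus p → ‖f z - F n z‖ * weight z.1 ^ N ≤ ε n) :
    RapidDecayOn U f ∧ ∀ j, ∀ z ∈ U,
      Filter.Tendsto (fun n => thetaOp j (F n) z) Filter.atTop (𝓝 (thetaOp j f z)) := by
  obtain ⟨ε, hε, hle⟩ := hlim 0
  have hunif : TendstoUniformlyOn F f Filter.atTop {z | z ∈ U ∧ z.1 ∈ torus p} := by
    rw [Metric.tendstoUniformlyOn_iff]
    intro δ hδ
    filter_upwards [hε.eventually (gt_mem_nhds hδ)] with n hn z hz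
    rw [dist_eq_norm]
    have := hle n z hz.1 hz.2
    rw [pow_zero, mul_one] at this
    exact this.trans_lt hn
  refine ⟨⟨hb, ?_, ?_⟩, ?_⟩
  · refine analyticOnNhd_of_tendstoLocallyUniformlyOn (isOpen_liftDom hU) (fun n => (hF n).holo) ?_
    refine TendstoUniformlyOn.tendstoLocallyUniformlyOn ?_
    exact (hunif.comp (fun v : (Fin p → ℂ) × (Fin q → ℂ) => (incl v.1, proj v.2))).mono
      fun v hv => ⟨hv.2, incl_mem_torus hv.1⟩
  · intro z hz N
    obtain ⟨C, hC⟩ := (hF 0).decay z hz N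
    obtain ⟨ε', -, hle'⟩ := hlim N
    refine ⟨ε' 0 + C, ?_⟩
    filter_upwards [hC, hU.mem_nhds hz] with w hw hwU ht
    have hwt := weight_pos ht
    calc ‖f w‖ * weight w.1 ^ N ≤ (‖f w - F 0 w‖ + ‖F 0 w‖) * weight w.1 ^ N := by
          gcongr
          simpa using norm_add_le (f w - F 0 w) (F 0 w)
      _ ≤ ε' 0 + C := by rw [add_mul]; exact add_le_add (hle' 0 w hwU ht) (hw ht)
  · intro j z hz
    by_cases ht : z.1 ∈ torus p
    · simp only [thetaOp, if_pos ht]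
      refine Filter.Tendsto.const_mul _ ?_
      -- The operator t_j ∂/∂t_j only sees the line in the direction of t_j, where derivatives of
      -- locally uniform limits of holomorphic functions converge.
      obtain ⟨s, hs⟩ := QuotientAddGroup.mk_surjective z.2
      let l : ℂ → (Fin p → ℂ) × (Fin q → ℂ) := fun ζ => (Function.update (coord z.1) j ζ, s)
      have hl : ∀ ζ, HasDerivAt l (Pi.single j 1, 0) ζ := fun ζ =>
        (hasDerivAt_update (coord z.1) j ζ).prodMk (hasDerivAt_const _ _)
      have hlc : Continuous l := continuous_iff_continuousAt.2 fun ζ => (hl ζ).continuousAt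
      have hopen : IsOpen (l ⁻¹' liftDom U) := (isOpen_liftDom hU).preimage hlc
      have hz' : (incl (coord z.1), proj s) = z := by rw [incl_coord ht, proj, hs]
      have hmem : coord z.1 j ∈ l ⁻¹' liftDom U := by
        refine ⟨by simpa [l] using coord_ne_zero ht, ?_⟩
        simpa [l, hz'] using hz
      have hfun : ∀ G : CBar p × Par q → ℂ,
          (fun ζ : ℂ => G (incl (Function.update (coord z.1) j ζ), z.2)) = lift G ∘ l := by
        intro G
        funext ζ
        simp [lift, l, ← hs]
      have h1 : TendstoLocallyUniformlyOn (fun n => lift (F n) ∘ l) (lift f ∘ l) Filter.atTop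
          (l ⁻¹' liftDom U) := by
        refine TendstoUniformlyOn.tendstoLocallyUniformlyOn ?_
        exact (hunif.comp (fun ζ => (incl (l ζ).1, proj (l ζ).2))).mono
          fun v hv => ⟨hv.2, incl_mem_torus hv.1⟩
      have h2 := h1.deriv (Filter.Eventually.of_forall fun n => ?_) hopen
      · simp only [hfun]
        exact h2.tendsto_at hmem
      · intro ζ hζ
        exact (((hF n).holo _ hζ).differentiableAt.comp ζ
          (hl ζ).differentiableAt).differentiableWithinAt
    · simp [thetaOp, ht]

/-- A sequence of `D`-linear maps into sections with rapid decay converges, if it converges fast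
enough for each of the seminorms on the sections. -/
theorem exists_limit {B : Type} [AddCommGroup B] [Module (DAlg p) B]
    {U : Opens (CBar p × Par q)} (φ : ℕ → B →ₗ[DAlg p] rapidSections p q U)
    (h : ∀ (b : B) (N : ℕ), ∃ c : ℕ → ℝ, Summable c ∧ ∀ n (z : U), z.1.1 ∈ torus p →
      ‖(φ (n + 1) b).1 z - (φ n b).1 z‖ * weight z.1.1 ^ N ≤ c n) :
    ∃ ψ : B →ₗ[DAlg p] rapidSections p q U,
      (∀ b z, Filter.Tendsto (fun n => (φ n b).1 z) Filter.atTop (𝓝 ((ψ b).1 z))) ∧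
      ∀ (b : B) (N : ℕ) (c : ℕ → ℝ), Summable c → (∀ n (z : U), z.1.1 ∈ torus p →
        ‖(φ (n + 1) b).1 z - (φ n b).1 z‖ * weight z.1.1 ^ N ≤ c n) → ∀ n (z : U),
        z.1.1 ∈ torus p → ‖(ψ b).1 z - (φ n b).1 z‖ * weight z.1.1 ^ N ≤ ∑' m, c (n + m) := by
  have h0 : ∀ b (z : U), ∃ a : ℂ, Filter.Tendsto (fun n => (φ n b).1 z) Filter.atTop (𝓝 a) := by
    intro b z
    by_cases ht : z.1.1 ∈ torus p
    · obtain ⟨c, hc, hle⟩ := h b 0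
      refine cauchySeq_tendsto_of_complete (cauchySeq_of_dist_le_of_summable c (fun n => ?_) hc)
      have := hle n z ht
      rwa [pow_zero, mul_one, ← dist_eq_norm, dist_comm] at this
    · refine ⟨0, ?_⟩
      simp [eq_zero_of_notMem_torus _ z ht]
  choose a ha using h0
  have hbound : ∀ (b : B) (N : ℕ) (c : ℕ → ℝ), Summable c → (∀ n (z : U), z.1.1 ∈ torus p →
        ‖(φ (n + 1) b).1 z - (φ n b).1 z‖ * weight z.1.1 ^ N ≤ c n) → ∀ n (z : U),
        z.1.1 ∈ torus p → ‖a b z - (φ n b).1 z‖ * weight z.1.1 ^ N ≤ ∑' m, c (n + m) := by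
    intro b N c hc hle n z ht
    have hw := weight_pos ht
    have hnorm : ‖((weight z.1.1 ^ N : ℝ) : ℂ)‖ = weight z.1.1 ^ N := by
      rw [Complex.norm_real, Real.norm_of_nonneg (by positivity)]
    have hd : ∀ n, dist ((φ n b).1 z * ((weight z.1.1 ^ N : ℝ) : ℂ))
        ((φ (n + 1) b).1 z * ((weight z.1.1 ^ N : ℝ) : ℂ)) ≤ c n := by
      intro n
      rw [dist_comm, dist_eq_norm, ← sub_mul, norm_mul, hnorm]
      exact hle n z ht
    have := dist_le_tsum_of_dist_le_of_tendsto c hd hc ((ha b z).mul_const _) n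
    rwa [dist_comm, dist_eq_norm, ← sub_mul, norm_mul, hnorm] at this
  have hlim : ∀ b, RapidDecayOn (U : Set (CBar p × Par q)) (ext (a b)) ∧ ∀ j, ∀ z ∈ U,
      Filter.Tendsto (fun n => thetaOp j (ext (φ n b).1) z) Filter.atTop
        (𝓝 (thetaOp j (ext (a b)) z)) := by
    intro b
    refine rapidDecayOn_of_limit U.isOpen (fun n => (φ n b).2) ?_ ?_
    · intro z hz ht
      rw [ext_of_mem _ hz]
      refine tendsto_nhds_unique (ha b ⟨z, hz⟩) ?_
      have : ∀ n, (φ n b).1 ⟨z, hz⟩ = 0 := fun n => eq_zero_of_notMem_torus _ ⟨z, hz⟩ ht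
      simp [this]
    · intro N
      obtain ⟨c, hc, hle⟩ := h b N
      refine ⟨fun n => ∑' m, c (n + m), ?_, ?_⟩
      · exact (tendsto_sum_nat_add c).congr fun n => tsum_congr fun m => by rw [add_comm]
      · intro n z hz ht
        rw [ext_of_mem _ hz, ext_of_mem _ hz]
        exact hbound b N c hc hle n ⟨z, hz⟩ ht
  let ψ₀ : B →+ rapidSections p q U :=
    { toFun := fun b => ⟨a b, (hlim b).1⟩
      map_zero' := by
        refine Subtype.ext (funext fun z => tendsto_nhds_unique (ha 0 z) ?_)
        simp
      map_add' := fun b b' => by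
        refine Subtype.ext (funext fun z => tendsto_nhds_unique (ha (b + b') z) ?_)
        simp only [map_add]
        exact (ha b z).add (ha b' z) }
  -- Linearity over D is checked on generators. Multiplications pass to pointwise limits at once;
  -- for t_j ∂/∂t_j the convergence of derivatives in `hlim` is needed.
  refine ⟨{ toFun := ψ₀, map_add' := ψ₀.map_add, map_smul' := smul_of_gen ψ₀ ?_ ?_ }, ha, hbound⟩
  · intro c b
    refine Subtype.ext (funext fun z => tendsto_nhds_unique (ha _ z) ?_)
    rw [algebraMap_smul']
    refine ((ha b z).const_mul c).congr fun n => ?_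
    rw [map_smul, algebraMap_smul']
    rfl
  · intro g b
    refine Subtype.ext (funext fun z => tendsto_nhds_unique (ha _ z) ?_)
    simp only [map_smul, gen_smul]
    cases g with
    | t j =>
      simp only [genAct, secMul_apply]
      exact (ha b z).const_mul _
    | tInv j =>
      simp only [genAct, secInv_apply]
      exact (ha b z).const_mul _
    | theta j =>
      simp only [genAct, secTheta_apply]
      exact (hlim b).2 j z z.2
end
end RapidDecay

namespace RapidDecay
noncomputable section
variable {p q q' : ℕ}

/-! ### Derivatives with respect to the parameters -/

/-- The derivative with respect to the `i`-th parameter. -/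
def sdOp (i : Fin q) (F : CBar p × Par q → ℂ) : CBar p × Par q → ℂ :=
  fun z => deriv (fun ζ : ℂ => F (z.1, z.2 + proj (Pi.single i ζ))) 0

lemma continuous_shift (i : Fin q) :
    Continuous fun a : ℂ × (CBar p × Par q) => (a.2.1, a.2.2 + proj (Pi.single i a.1)) := by
  refine Continuous.prodMk (by fun_prop) (Continuous.add (by fun_prop) ?_)
  exact QuotientAddGroup.continuous_mk.comp
    ((ContinuousLinearMap.single ℂ (fun _ : Fin q => ℂ) i).continuous.comp continuous_fst)

lemma sdOp_congr {F G : CBar p × Par q → ℂ} {z : CBar p × Par q} (i : Fin q)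
    (h : F =ᶠ[𝓝 z] G) : sdOp i F z = sdOp i G z := by
  refine Filter.EventuallyEq.deriv_eq ?_
  have hc : Continuous fun ζ : ℂ => (z.1, z.2 + proj (Pi.single i ζ)) :=
    (continuous_shift i).comp (f := fun ζ : ℂ => (ζ, z)) (by fun_prop)
  have h0 : (z.1, z.2 + proj (Pi.single i (0 : ℂ))) = z := by simp [proj]
  have h' : ∀ᶠ w in 𝓝 (z.1, z.2 + proj (Pi.single i (0 : ℂ))), F w = G w := by rw [h0]; exact h
  exact (hc.continuousAt (x := 0)).eventually h'

lemma sdOp_mul (i : Fin q) (a : CBar p → ℂ) (F : CBar p × Par q → ℂ) (z : CBar p × Par q) :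
    sdOp i (fun z => a z.1 * F z) z = a z.1 * sdOp i F z := by
  simp only [sdOp]
  exact deriv_const_mul_field _

lemma hasDerivAt_single (i : Fin q) (v : (Fin p → ℂ) × (Fin q → ℂ)) (ζ : ℂ) :
    HasDerivAt (fun ζ : ℂ => (v.1, v.2 + Pi.single i ζ)) (0, Pi.single i 1) ζ :=
  (hasDerivAt_const _ _).prodMk
    (((ContinuousLinearMap.single ℂ (fun _ : Fin q => ℂ) i).hasDerivAt (x := ζ)).const_add v.2)

lemma RapidDecayOn.lift_sdOp {U : Set (CBar p × Par q)} {F : CBar p × Par q → ℂ} (i : Fin q)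
    (hF : RapidDecayOn U F) {v : (Fin p → ℂ) × (Fin q → ℂ)} (hv : v ∈ liftDom U) :
    lift (RapidDecay.sdOp i F) v = fderiv ℂ (lift F) v (0, Pi.single i 1) := by
  have h2 : HasFDerivAt (lift F) (fderiv ℂ (lift F) v)
      ((fun ζ : ℂ => (v.1, v.2 + Pi.single i ζ)) 0) := by
    simpa using (hF.holo v hv).differentiableAt.hasFDerivAt
  exact (h2.comp_hasDerivAt _ (hasDerivAt_single i v 0)).deriv

/-- Cauchy's inequality on a disc of fixed radius c in the parameter direction. The weight does not
involve the parameter, so each decay constant is just divided by c. -/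
lemma RapidDecayOn.sdOp {U : Set (CBar p × Par q)} {F : CBar p × Par q → ℂ} (i : Fin q)
    (hU : IsOpen U) (hF : RapidDecayOn U F) : RapidDecayOn U (sdOp i F) where
  boundary z hz hb := by
    have hc : Continuous fun ζ : ℂ => (z.1, z.2 + proj (Pi.single i ζ)) :=
      (continuous_shift i).comp (f := fun ζ : ℂ => (ζ, z)) (by fun_prop)
    have h0 : (z.1, z.2 + proj (Pi.single i (0 : ℂ))) = z := by simp [proj]
    have h1 : (fun ζ : ℂ => F (z.1, z.2 + proj (Pi.single i ζ))) =ᶠ[𝓝 0] fun _ => 0 := by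
      filter_upwards [hc.continuousAt (by rw [h0]; exact hU.mem_nhds hz)] with ζ hζ
      exact hF.boundary _ hζ hb
    change deriv _ _ = _
    rw [h1.deriv_eq, deriv_const]
  holo := by
    have h1 : AnalyticOnNhd ℂ (fun v : (Fin p → ℂ) × (Fin q → ℂ) =>
        fderiv ℂ (lift F) v (0, Pi.single i 1)) (liftDom U) := fun v hv =>
      ((ContinuousLinearMap.apply ℂ ℂ
        ((0, Pi.single i 1) : (Fin p → ℂ) × (Fin q → ℂ))).analyticAt _).comp (hF.holo v hv).fderiv
    intro v hv
    refine (h1 v hv).congr ?_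
    filter_upwards [(isOpen_liftDom hU).mem_nhds hv] with w hw
    exact (hF.lift_sdOp i hw).symm
  decay z hz N := by
    obtain ⟨C, hC⟩ := hF.decay z hz N
    have h0 : (z.1, z.2 + proj (Pi.single i (0 : ℂ))) = z := by simp [proj]
    have hpre := (continuous_shift (p := p) i).continuousAt (x := ((0 : ℂ), z))
      (by rw [h0]; exact Filter.inter_mem hC (hU.mem_nhds hz))
    rw [Filter.mem_map, nhds_prod_eq, Filter.mem_prod_iff] at hpre
    obtain ⟨A, hA, B, hB, hAB⟩ := hpre
    obtain ⟨c, hc, hcA⟩ := Metric.nhds_basis_closedBall.mem_iff.1 hA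
    refine ⟨C / c, ?_⟩
    filter_upwards [hB] with w hw ht
    have hwt := weight_pos ht
    have hmem : ∀ ζ ∈ Metric.closedBall (0 : ℂ) c,
        ((w.1, w.2 + proj (Pi.single i ζ)) : CBar p × Par q) ∈
          {w | w.1 ∈ torus p → ‖F w‖ * weight w.1 ^ N ≤ C} ∩ U :=
      fun ζ hζ => hAB (Set.mk_mem_prod (hcA hζ) hw)
    obtain ⟨s, hs⟩ := QuotientAddGroup.mk_surjective w.2
    have hdiff : DifferentiableOn ℂ (fun ζ : ℂ => F (w.1, w.2 + proj (Pi.single i ζ)))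
        (Metric.closedBall 0 c) := by
      intro ζ hζ
      have hfun : (fun ζ : ℂ => F (w.1, w.2 + proj (Pi.single i ζ))) =
          lift F ∘ fun ζ : ℂ => (coord w.1, s + Pi.single i ζ) := by
        funext ζ
        simp only [lift, Function.comp, incl_coord ht, ← hs]
        rfl
      rw [hfun]
      refine DifferentiableAt.differentiableWithinAt (DifferentiableAt.comp ζ
        (hF.holo _ ⟨coord_ne_zero ht, ?_⟩).differentiableAt
        (hasDerivAt_single i (coord w.1, s) ζ).differentiableAt)
      have := (hmem ζ hζ).2
      rw [← hs] at this
      simp only [incl_coord ht]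
      exact this
    have hcauchy := Complex.norm_deriv_le_of_forall_mem_sphere_norm_le
      (c := 0) (R := c) (C := C / weight w.1 ^ N) hc
      (DifferentiableOn.diffContOnCl (hdiff.mono Metric.closure_ball_subset_closedBall))
      (fun ζ hζ => by
        rw [le_div_iff₀ (by positivity)]
        exact (hmem ζ (Metric.sphere_subset_closedBall hζ)).1 ht)
    calc ‖RapidDecay.sdOp i F w‖ * weight w.1 ^ N
        ≤ (C / weight w.1 ^ N / c) * weight w.1 ^ N := by gcongr; exact hcauchy
      _ = C / c := by field_simp

/-- Symmetry of the second derivative; the factor t_j does not depend on the parameter. -/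
lemma RapidDecayOn.sdOp_thetaOp {U : Set (CBar p × Par q)} {F : CBar p × Par q → ℂ} (hU : IsOpen U)
    (i : Fin q) (j : Fin p) (hF : RapidDecayOn U F) :
    ∀ z ∈ U, RapidDecay.sdOp i (RapidDecay.thetaOp j F) z =
      RapidDecay.thetaOp j (RapidDecay.sdOp i F) z := by
  refine eq_of_lift ((hF.thetaOp j hU).sdOp i hU) ((hF.sdOp i hU).thetaOp j hU) ?_
  intro v hv
  rw [(hF.thetaOp j hU).lift_sdOp i hv, (hF.sdOp i hU).lift_thetaOp j hv]
  have h1 : lift (RapidDecay.thetaOp j F) =ᶠ[𝓝 v]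
      fun v => v.1 j * fderiv ℂ (lift F) v (Pi.single j 1, 0) := by
    filter_upwards [(isOpen_liftDom hU).mem_nhds hv] with w hw
    exact hF.lift_thetaOp j hw
  have h1' : lift (RapidDecay.sdOp i F) =ᶠ[𝓝 v]
      fun v => fderiv ℂ (lift F) v (0, Pi.single i 1) := by
    filter_upwards [(isOpen_liftDom hU).mem_nhds hv] with w hw
    exact hF.lift_sdOp i hw
  have h2 : HasFDerivAt (fun v : (Fin p → ℂ) × (Fin q → ℂ) => v.1 j)
      ((ContinuousLinearMap.proj (R := ℂ) (φ := fun _ : Fin p => ℂ) j).comp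
        (ContinuousLinearMap.fst ℂ (Fin p → ℂ) (Fin q → ℂ))) v :=
    ((ContinuousLinearMap.proj (R := ℂ) (φ := fun _ : Fin p => ℂ) j).comp
        (ContinuousLinearMap.fst ℂ (Fin p → ℂ) (Fin q → ℂ))).hasFDerivAt
  have h3 : ∀ e : (Fin p → ℂ) × (Fin q → ℂ), HasFDerivAt (fun v => fderiv ℂ (lift F) v e) _ v :=
    fun e => ((hF.holo v hv).fderiv.differentiableAt.hasFDerivAt).clm_apply (hasFDerivAt_const _ _)
  rw [h1.fderiv_eq, h1'.fderiv_eq]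
  refine (congrArg (fun L => L (0, Pi.single i 1)) (h2.mul (h3 _)).fderiv).trans ?_
  refine Eq.trans ?_ (congrArg (fun L => v.1 j * L (Pi.single j 1, 0)) (h3 _).fderiv).symm
  have hsymm := ContDiffAt.isSymmSndFDerivAt_of_omega (𝕜 := ℂ) ((hF.holo v hv).contDiffAt)
  have := hsymm (Pi.single j 1, 0) (0, Pi.single i 1)
  simp [this]

section sections

variable {U : Opens (CBar p × Par q)}

/-- The derivative with respect to the `i`-th parameter, on sections. -/
def secSd (U : Opens (CBar p × Par q)) (i : Fin q) :
    rapidSections p q U →ₗ[DAlg p] rapidSections p q U :=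
  let φ : rapidSections p q U →+ rapidSections p q U :=
    { toFun := fun f => ⟨fun z => sdOp i (ext f.1) z,
        (RapidDecayOn.sdOp i U.isOpen f.2).congr U.isOpen (ext_op_eqOn _ _)⟩
      map_zero' := by
        ext z
        have : (ext (0 : U → ℂ)) = fun _ => 0 := ext_zero
        simp [sdOp, this]
      map_add' := fun f g => by
        ext z
        refine RapidDecayOn.eq_of_lift (U := (U : Set (CBar p × Par q)))
          (F := sdOp i (ext (f + g).1)) (G := sdOp i (ext f.1) + sdOp i (ext g.1))
          ((f + g).2.sdOp i U.isOpen)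
          ((RapidDecayOn.sdOp i U.isOpen f.2).add (RapidDecayOn.sdOp i U.isOpen g.2)) ?_ z z.2
        intro v hv
        have e : lift (ext (f + g).1) = lift (ext f.1) + lift (ext g.1) := by
          funext v
          simp only [lift, Submodule.coe_add, ext_add]
          rfl
        have hf := RapidDecayOn.holo f.2 v hv
        have hg := RapidDecayOn.holo g.2 v hv
        have h1 := RapidDecayOn.lift_sdOp i (f + g).2 hv
        have h2 := RapidDecayOn.lift_sdOp i f.2 hv
        have h3 := RapidDecayOn.lift_sdOp i g.2 hv
        rw [h1, e, fderiv_add hf.differentiableAt hg.differentiableAt]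
        exact congrArg₂ (· + ·) h2.symm h3.symm }
  { toFun := φ
    map_add' := φ.map_add
    map_smul' := by
      refine smul_of_gen φ ?_ ?_
      · intro c f
        rw [algebraMap_smul', algebraMap_smul']
        ext z
        change sdOp i (ext (c • f.1)) z = c * sdOp i (ext f.1) z
        rw [ext_smul]
        exact deriv_const_mul_field _
      · intro g f
        rw [gen_smul, gen_smul]
        ext z
        cases g with
        | t j =>
          change sdOp i (ext (fun w : U => mulOp j (ext f.1) w)) z.1 =
            mulOp j (ext fun w : U => sdOp i (ext f.1) w) z.1
          rw [← sdOp_congr (F := mulOp j (ext f.1)) i (by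
            filter_upwards [U.isOpen.mem_nhds z.2] with w hw
            exact ext_op_eqOn (mulOp j) f.1 w hw)]
          exact (sdOp_mul i (fun y => coord y j) (ext f.1) z.1).trans
            (congrArg _ (ext_op_eqOn (sdOp i) f.1 z.1 z.2))
        | tInv j =>
          change sdOp i (ext (fun w : U => invOp j (ext f.1) w)) z.1 =
            invOp j (ext fun w : U => sdOp i (ext f.1) w) z.1
          rw [← sdOp_congr (F := invOp j (ext f.1)) i (by
            filter_upwards [U.isOpen.mem_nhds z.2] with w hw
            exact ext_op_eqOn (invOp j) f.1 w hw)]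
          exact (sdOp_mul i (fun y => (coord y j)⁻¹) (ext f.1) z.1).trans
            (congrArg _ (ext_op_eqOn (sdOp i) f.1 z.1 z.2))
        | theta j =>
          change sdOp i (ext (fun w : U => thetaOp j (ext f.1) w)) z.1 =
            thetaOp j (ext fun w : U => sdOp i (ext f.1) w) z.1
          rw [← sdOp_congr (F := thetaOp j (ext f.1)) i (by
            filter_upwards [U.isOpen.mem_nhds z.2] with w hw
            exact ext_op_eqOn (thetaOp j) f.1 w hw),
            ← thetaOp_congr (F := sdOp i (ext f.1)) j (by
            filter_upwards [U.isOpen.mem_nhds z.2] with w hw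
            exact ext_op_eqOn (sdOp i) f.1 w hw)]
          exact RapidDecayOn.sdOp_thetaOp U.isOpen i j f.2 z z.2 }

lemma RapidDecayOn.constParam {U : Set (CBar p × Par q)} {V : Set (CBar p × Par q')}
    {F : CBar p × Par q → ℂ} (hF : RapidDecayOn U F) (s : Par q) (h : ∀ z ∈ V, (z.1, s) ∈ U) :
    RapidDecayOn V (fun z => F (z.1, s)) where
  boundary z hz hb := hF.boundary _ (h z hz) hb
  holo v hv := by
    obtain ⟨σ, rfl⟩ := QuotientAddGroup.mk_surjective s
    have h1 : AnalyticAt ℂ (lift F) (v.1, σ) := hF.holo _ ⟨hv.1, h _ hv.2⟩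
    exact AnalyticAt.comp (g := lift F) (f := fun v : (Fin p → ℂ) × (Fin q' → ℂ) => (v.1, σ)) h1
      (analyticAt_fst.prod analyticAt_const)
  decay z hz N := by
    obtain ⟨C, hC⟩ := hF.decay _ (h z hz) N
    refine ⟨C, ?_⟩
    have hc : Continuous fun w : CBar p × Par q' => (w.1, s) := by fun_prop
    exact hc.continuousAt.eventually hC

/-- The section `z ↦ f(z.1, s)`. With `q' = 0` this is the restriction to a value of the parameter,
and with `q = 0` this is the pullback. -/
def constParam (s : Par q) {V : Opens (CBar p × Par q')} (h : ∀ z ∈ V, (z.1, s) ∈ U) :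
    rapidSections p q U →ₗ[DAlg p] rapidSections p q' V :=
  let φ : rapidSections p q U →+ rapidSections p q' V :=
    { toFun := fun f => ⟨fun z => f.1 ⟨(z.1.1, s), h z.1 z.2⟩,
        (RapidDecayOn.constParam f.2 s h).congr V.isOpen (by
          intro z hz
          rw [ext_of_mem _ hz, ext_of_mem _ (h z hz)])⟩
      map_zero' := rfl
      map_add' := fun _ _ => rfl }
  { toFun := φ
    map_add' := φ.map_add
    map_smul' := by
      refine smul_of_gen φ ?_ ?_
      · intro c f
        rw [algebraMap_smul', algebraMap_smul']
        rfl
      · intro g f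
        rw [gen_smul, gen_smul]
        ext z
        cases g with
        | t j => exact (secMul_apply j f _).trans (secMul_apply j (φ f) z).symm
        | tInv j => exact (secInv_apply j f _).trans (secInv_apply j (φ f) z).symm
        | theta j =>
          change thetaOp j (fun z : CBar p × Par q' => ext f.1 (z.1, s)) z.1 =
            thetaOp j (ext (φ f).1) z.1
          refine thetaOp_congr j ?_
          filter_upwards [V.isOpen.mem_nhds z.2] with w hw
          rw [ext_of_mem _ hw, ext_of_mem _ (h w hw)]
          rfl }

instance : Subsingleton (Par 0) :=
  ⟨fun a b => by
    obtain ⟨a, rfl⟩ := QuotientAddGroup.mk_surjective a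
    obtain ⟨b, rfl⟩ := QuotientAddGroup.mk_surjective b
    rw [Subsingleton.elim a b]⟩

lemma constParam_mem_pullbackSections {V : Opens (CBar p × Par 0)}
    (h : ∀ z ∈ U, (z.1, 0) ∈ V) (f : rapidSections p 0 V) :
    constParam 0 h f ∈ pullbackSections p q U := by
  intro z hz
  refine ⟨V, ext f.1, h z hz, f.2, ?_⟩
  filter_upwards [U.isOpen.mem_nhds hz] with w hw
  rw [ext_of_mem _ hw, ext_of_mem _ (h w hw)]
  rfl

end sections
end
end RapidDecay

namespace RapidDecay
noncomputable section

/-! ### An open mapping theorem for spaces with countably many seminorms -/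

section baire

variable {Z : Type} [AddCommGroup Z] [Module ℂ Z]

/-- Completeness with respect to an increasing sequence of seminorms. -/
def FastComplete (P : ℕ → Seminorm ℂ Z) : Prop :=
  ∀ u : ℕ → Z, (∀ m, Summable fun n => P m (u (n + 1) - u n)) →
    ∃ l, ∀ m, Filter.Tendsto (fun n => P m (u n - l)) Filter.atTop (𝓝 0)

/-- The closure of a set with respect to an increasing sequence of seminorms. -/
def seminormClosure (P : ℕ → Seminorm ℂ Z) (S : Set Z) : Set Z :=
  {z | ∀ m, ∀ ε > 0, ∃ y ∈ S, P m (z - y) < ε}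

lemma summable_of_eventually_le_geometric {a : ℕ → ℝ} (h0 : ∀ n, 0 ≤ a n) (m : ℕ)
    (h : ∀ n, m ≤ n → a n ≤ (1 / 2) ^ n) : Summable a := by
  refine Summable.of_norm_bounded_eventually_nat
    (g := fun n => (1 / 2 : ℝ) ^ n) summable_geometric_two ?_
  filter_upwards [Filter.eventually_ge_atTop m] with n hn
  rw [Real.norm_of_nonneg (h0 n)]
  exact h n hn

/-- Baire's theorem. -/
theorem exists_ball_subset_seminormClosure {P : ℕ → Seminorm ℂ Z} (hP : Monotone P)
    (hc : FastComplete P) (A : ℕ → Set Z) (hA : ∀ z, ∃ n, z ∈ A n) :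
    ∃ n z m δ, 0 < δ ∧ ∀ y, P m (y - z) < δ → y ∈ seminormClosure P (A n) := by
  by_contra! hcon
  -- A state is a ball: centre, index of the seminorm, radius. If the closure of `A n` contains no
  -- ball, each ball contains a smaller one missing `A n`. Halving the radius and raising the index
  -- make the centres converge fast for every seminorm.
  have step : ∀ (n : ℕ) (s : Z × ℕ × ℝ), ∃ s' : Z × ℕ × ℝ, 0 < s.2.2 →
      0 < s'.2.2 ∧ s'.2.2 ≤ s.2.2 / 2 ∧ s.2.1 + 1 ≤ s'.2.1 ∧ P s.2.1 (s'.1 - s.1) ≤ s.2.2 / 2 ∧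
      ∀ x ∈ A n, s'.2.2 < P s'.2.1 (x - s'.1) := by
    rintro n ⟨z, m, δ⟩
    by_cases hδ : 0 < δ
    · obtain ⟨y, hy, hyA⟩ := hcon n z m (δ / 2) (by positivity)
      simp only [seminormClosure, Set.mem_ofPred_eq, not_forall, not_exists, not_and, not_lt] at hyA
      obtain ⟨k, ε, hε, hk⟩ := hyA
      -- The new centre stays at distance at least ε from `A n`. The radius ε/2 keeps the inequality
      -- strict, so that a limit on the boundary of the ball is still outside `A n`.
      refine ⟨(y, max k (m + 1), min (ε / 2) (δ / 2)), fun _ => ⟨by positivity, min_le_right _ _,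
        le_max_right _ _, hy.le, fun x hx => ?_⟩⟩
      calc min (ε / 2) (δ / 2) ≤ ε / 2 := min_le_left _ _
        _ < ε := by linarith
        _ ≤ P k (y - x) := hk x hx
        _ = P k (x - y) := map_sub_rev _ _ _
        _ ≤ _ := hP (le_max_left _ _) _
    · exact ⟨(z, m, δ), fun h => absurd h hδ⟩
  choose f hf using step
  let s : ℕ → Z × ℕ × ℝ := fun n => Nat.rec ((0 : Z), (0 : ℕ), (1 : ℝ)) (fun n s => f n s) n
  have hs : ∀ n, s (n + 1) = f n (s n) := fun _ => rfl
  have hpos : ∀ n, 0 < (s n).2.2 := by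
    intro n
    induction n with
    | zero => exact one_pos
    | succ n ih => rw [hs]; exact (hf n _ ih).1
  have hprop := fun n => hf n (s n) (hpos n)
  simp only [← hs] at hprop
  have hδ : ∀ n, (s n).2.2 ≤ (1 / 2) ^ n := by
    intro n
    induction n with
    | zero => exact le_rfl
    | succ n ih => exact (hprop n).2.1.trans (by rw [pow_succ]; linarith)
  have hm : ∀ n, n ≤ (s n).2.1 := by
    intro n
    induction n with
    | zero => exact le_rfl
    | succ n ih => exact (Nat.succ_le_succ ih).trans (hprop n).2.2.1
  have hmm : Monotone fun n => (s n).2.1 :=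
    monotone_nat_of_le_succ fun n => (Nat.le_succ _).trans (hprop n).2.2.1
  obtain ⟨l, hl⟩ := hc (fun n => (s n).1) (fun m =>
    summable_of_eventually_le_geometric (fun n => apply_nonneg _ _) m fun n hn =>
      (hP (hn.trans (hm n)) _).trans ((hprop n).2.2.2.1.trans (by linarith [hδ n, hpos n])))
  -- Each centre moves by at most half of the current radius and each radius is at most half of the
  -- previous one, so the moves are absorbed by the loss of radius.
  have hnest : ∀ n k, P (s n).2.1 ((s (n + k)).1 - (s n).1) ≤ (s n).2.2 - (s (n + k)).2.2 := by
    intro n k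
    induction k with
    | zero => simp
    | succ k ih =>
      have h1 := hprop (n + k)
      have h2 : P (s n).2.1 ((s (n + k + 1)).1 - (s (n + k)).1) ≤ (s (n + k)).2.2 / 2 :=
        (hP (hmm (Nat.le_add_right n k)) _).trans h1.2.2.2.1
      have h3 := map_add_le_add (P (s n).2.1) ((s (n + k + 1)).1 - (s (n + k)).1)
        ((s (n + k)).1 - (s n).1)
      rw [sub_add_sub_cancel] at h3
      have h4 := h1.2.1
      change P (s n).2.1 ((s (n + k + 1)).1 - (s n).1) ≤ (s n).2.2 - (s (n + k + 1)).2.2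
      linarith
  have hlim : ∀ n, P (s n).2.1 (l - (s n).1) ≤ (s n).2.2 := by
    intro n
    refine le_of_forall_pos_le_add fun ε hε => ?_
    obtain ⟨k, hk, hk'⟩ := ((hl (s n).2.1).eventually (gt_mem_nhds hε)).and
      (Filter.eventually_ge_atTop n) |>.exists
    obtain ⟨j, rfl⟩ := Nat.exists_eq_add_of_le hk'
    have h3 := map_add_le_add (P (s n).2.1) (l - (s (n + j)).1) ((s (n + j)).1 - (s n).1)
    rw [sub_add_sub_cancel, map_sub_rev _ l (s (n + j)).1] at h3
    linarith [hnest n j, hpos (n + j)]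
  obtain ⟨n, hn⟩ := hA l
  exact absurd (hlim (n + 1)) (not_le.2 ((hprop n).2.2.2.2 l hn))

end baire

section openMapping

variable {Z : Type} [AddCommGroup Z] [Module ℂ Z] {P : ℕ → Seminorm ℂ Z}

section single

variable {E : Type} [AddCommGroup E] [Module ℂ E] {Q : ℕ → Seminorm ℂ E}

lemma smul_mem_seminormClosure (T : E →ₗ[ℂ] Z) {m : ℕ} {r c : ℝ} (hc : 0 < c) {z : Z}
    (hz : z ∈ seminormClosure P (T '' {e | Q m e ≤ r})) :
    (c : ℂ) • z ∈ seminormClosure P (T '' {e | Q m e ≤ c * r}) := by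
  intro k ε hε
  obtain ⟨_, ⟨e, he, rfl⟩, h⟩ := hz k (ε / c) (by positivity)
  have hn : ‖(c : ℂ)‖ = c := by rw [Complex.norm_real, Real.norm_of_nonneg hc.le]
  refine ⟨_, ⟨(c : ℂ) • e, ?_, rfl⟩, ?_⟩
  · simp only [Set.mem_ofPred_eq, map_smul_eq_mul, hn] at he ⊢
    gcongr
  · rw [map_smul, ← smul_sub, map_smul_eq_mul, hn]
    rwa [lt_div_iff₀ hc, mul_comm] at h

/-- Successive approximations upgrade an almost open map to an open one. The n-th residue is
approximated by the image of an element of size at most 4^{-(n+1)} for the seminorm of index m + n.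
Completeness sums these corrections, and the residues tend to zero for every seminorm. -/
lemma exists_preimage_of_closure (T : E →ₗ[ℂ] Z) (hP : Monotone P) (hQ : Monotone Q)
    (hcE : FastComplete Q) (hT : ∀ m e, P m (T e) ≤ Q m e)
    (hsep : ∀ z, (∀ m, P m z = 0) → z = 0)
    (h : ∀ m, ∃ m' δ, 0 < δ ∧ ∀ z, P m' z < δ → z ∈ seminormClosure P (T '' {e | Q m e ≤ 1}))
    (m : ℕ) : ∃ m' δ, 0 < δ ∧ ∀ z, P m' z < δ → ∃ e, T e = z ∧ Q m e < 1 := by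
  choose m₀ δ₀ hδ₀ h₀ using h
  -- The index is at least n, so that small residues are eventually small for every seminorm, and at
  -- least the one which controls approximation with respect to `Q (m + n)`.
  let M : ℕ → ℕ := fun n => max n (m₀ (m + n))
  -- The factor 4^{-(n+1)} allows the n-th residue to be multiplied by 4^{n+1} and still satisfy the
  -- hypothesis; the minimum with 1 forces the residues to tend to zero.
  let δ : ℕ → ℝ := fun n => min 1 (δ₀ (m + n)) * (1 / 4) ^ (n + 1)
  have hδ : ∀ n, 0 < δ n := fun n => mul_pos (lt_min one_pos (hδ₀ _)) (by positivity)
  have step : ∀ n (r : Z), ∃ e, P (M n) r < δ n →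
      Q (m + n) e ≤ (1 / 4) ^ (n + 1) ∧ P (M (n + 1)) (r - T e) < δ (n + 1) := by
    intro n r
    by_cases hr : P (M n) r < δ n
    · have hpow : (0 : ℝ) < (1 / 4) ^ (n + 1) := by positivity
      have h4 : (0 : ℝ) < 4 ^ (n + 1) := by positivity
      have h1 : P (m₀ (m + n)) (((4 ^ (n + 1) : ℝ) : ℂ) • r) < δ₀ (m + n) := by
        rw [map_smul_eq_mul, Complex.norm_real, Real.norm_of_nonneg h4.le]
        have h2 : P (m₀ (m + n)) r < δ₀ (m + n) * (1 / 4) ^ (n + 1) :=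
          ((hP (le_max_right _ _) r).trans_lt hr).trans_le (by
            simp only [δ]; gcongr; exact min_le_right _ _)
        calc _ < 4 ^ (n + 1) * (δ₀ (m + n) * (1 / 4) ^ (n + 1)) := by gcongr
          _ = δ₀ (m + n) := by rw [mul_left_comm, ← mul_pow]; norm_num
      have h3 := smul_mem_seminormClosure T hpow (h₀ _ _ h1)
      rw [smul_smul, ← Complex.ofReal_mul, ← mul_pow, mul_one] at h3
      norm_num at h3
      obtain ⟨_, ⟨e, he, rfl⟩, he'⟩ := h3 (M (n + 1)) (δ (n + 1)) (hδ _)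
      refine ⟨e, fun _ => ⟨?_, he'⟩⟩
      simpa using he
    · exact ⟨0, fun h => absurd h hr⟩
  choose e he using step
  refine ⟨M 0, δ 0, hδ 0, fun z hz => ?_⟩
  let r : ℕ → Z := fun n => Nat.rec z (fun n r => r - T (e n r)) n
  have hr : ∀ n, r (n + 1) = r n - T (e n (r n)) := fun _ => rfl
  have hreg : ∀ n, P (M n) (r n) < δ n := by
    intro n
    induction n with
    | zero => exact hz
    | succ n ih => rw [hr]; exact (he n _ ih).2
  let u : ℕ → E := fun n => ∑ i ∈ Finset.range n, e i (r i)
  have hu : ∀ n, u (n + 1) - u n = e n (r n) := fun n => by simp [u, Finset.sum_range_succ]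
  have hru : ∀ n, r n = z - T (u n) := by
    intro n
    induction n with
    | zero => simp [u, r]
    | succ n ih => rw [hr, ← hu n, map_sub, ih]; abel_nf
  have hbd : ∀ n, Q (m + n) (e n (r n)) ≤ (1 / 4) ^ (n + 1) := fun n => (he n _ (hreg n)).1
  have hle2 : ∀ n : ℕ, (1 / 4 : ℝ) ^ (n + 1) ≤ (1 / 2) ^ n := by
    intro n
    calc (1 / 4 : ℝ) ^ (n + 1) ≤ (1 / 4) ^ n :=
          pow_le_pow_of_le_one (by norm_num) (by norm_num) (Nat.le_succ n)
      _ ≤ _ := pow_le_pow_left₀ (by norm_num) (by norm_num) n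
  obtain ⟨l, hl⟩ := hcE u (fun k => summable_of_eventually_le_geometric
    (fun n => apply_nonneg _ _) k fun n hn => by
      rw [hu]
      exact (hQ (by omega) _).trans ((hbd n).trans (hle2 n)))
  refine ⟨l, ?_, ?_⟩
  · refine (sub_eq_zero.1 (hsep _ fun j => ?_)).symm
    refine le_antisymm (le_of_forall_pos_le_add fun ε hε => ?_) (apply_nonneg _ _)
    have h1 : Filter.Tendsto (fun n : ℕ => (1 / 2 : ℝ) ^ n) Filter.atTop (𝓝 0) :=
      tendsto_pow_atTop_nhds_zero_of_lt_one (by norm_num) (by norm_num)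
    obtain ⟨n, hn1, hn2, hn3⟩ := ((hl j).eventually (gt_mem_nhds (half_pos hε))).and
      ((h1.eventually (gt_mem_nhds (half_pos hε))).and (Filter.eventually_ge_atTop j)) |>.exists
    have h2 := map_add_le_add (P j) (r n) (T (u n - l))
    have h3 : z - T l = r n + T (u n - l) := by rw [hru, map_sub]; abel
    rw [← h3] at h2
    have h4 : P j (r n) ≤ (1 / 2) ^ n := by
      refine (hP (hn3.trans (le_max_left _ _)) _).trans ((hreg n).le.trans ?_)
      refine le_trans ?_ (hle2 n)
      exact mul_le_of_le_one_left (by positivity) (min_le_left _ _)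
    linarith [hT j (u n - l)]
  -- The geometric series of the powers 4^{-(n+1)} has sum 1/3, which leaves room below 1 for the
  -- distance of the partial sum to its limit.
  · have h5 : ∀ n, Q m (u n) ≤ 1 / 3 := by
      intro n
      have h6 : Q m (u n) ≤ 1 / 3 - 1 / 3 * (1 / 4) ^ n := by
        induction n with
        | zero => simp [u]
        | succ n ih =>
          have h7 := map_add_le_add (Q m) (u n) (u (n + 1) - u n)
          have h8 := (hQ (Nat.le_add_right m n) _).trans (hbd n)
          rw [add_sub_cancel, hu] at h7
          rw [pow_succ] at h8 ⊢
          linarith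
      have : (0 : ℝ) < (1 / 4) ^ n := by positivity
      linarith
    obtain ⟨n, hn⟩ := ((hl m).eventually (gt_mem_nhds (show (0 : ℝ) < 1 / 3 by norm_num))).exists
    have h7 := map_sub_le_add (Q m) (u n) (u n - l)
    rw [sub_sub_cancel] at h7
    linarith [h5 n]

end single

variable {E : ℕ → Type} [∀ k, AddCommGroup (E k)] [∀ k, Module ℂ (E k)]
  {Q : ∀ k, ℕ → Seminorm ℂ (E k)}

/-- If a complete space is the union of the images of countably many complete spaces, then one of
the maps is open. -/
theorem exists_open_of_iUnion (T : ∀ k, E k →ₗ[ℂ] Z) (hP : Monotone P) (hQ : ∀ k, Monotone (Q k))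
    (hcZ : FastComplete P) (hcE : ∀ k, FastComplete (Q k))
    (hT : ∀ k m e, P m (T k e) ≤ Q k m e) (hsep : ∀ z, (∀ m, P m z = 0) → z = 0)
    (hsurj : ∀ z, ∃ k e, T k e = z) :
    ∃ k, ∀ m, ∃ m' δ, 0 < δ ∧ ∀ z, P m' z < δ → ∃ e, T k e = z ∧ Q k m e < 1 := by
  have key : ∃ k, ∀ m, ∃ m' δ, 0 < δ ∧ ∀ z, P m' z < δ →
      z ∈ seminormClosure P (T k '' {e | Q k m e ≤ 1}) := by
    by_contra! hcon
    choose μ hμ using hcon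
    -- Baire's theorem is applied to the countably many images of the balls of integral radius for
    -- the offending seminorms `μ k`. The integer n encodes the pair (k, N).
    obtain ⟨n, z₀, m, δ, hδ, hball⟩ := exists_ball_subset_seminormClosure hP hcZ
      (fun n => T n.unpair.1 '' {e | Q n.unpair.1 (μ n.unpair.1) e ≤ n.unpair.2 + 1}) (by
        intro z
        obtain ⟨k, e, rfl⟩ := hsurj z
        obtain ⟨N, hN⟩ := exists_nat_ge (Q k (μ k) e)
        have hmem : ∀ n : ℕ, n.unpair.1 = k → n.unpair.2 = N → T k e ∈
            T n.unpair.1 '' {e | Q n.unpair.1 (μ n.unpair.1) e ≤ n.unpair.2 + 1} := by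
          rintro n rfl rfl
          exact ⟨e, hN.trans (by simp), rfl⟩
        exact ⟨Nat.pair k N, hmem _ (by simp) (by simp)⟩)
    set k := n.unpair.1
    set N := n.unpair.2
    have hN : (0 : ℝ) < 2 * (N + 1) := by positivity
    obtain ⟨z, hz, hzn⟩ := hμ k m (δ / (2 * (N + 1))) (by positivity)
    refine hzn ?_
    -- Both z₀ and z₀ + 2(N + 1)z lie in the ball. The difference of their approximate preimages,
    -- each of size at most N + 1, approximates 2(N + 1)z; dividing contradicts the choice of z.
    have h1 : (((2 * (N + 1) : ℝ)) : ℂ) • z ∈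
        seminormClosure P (T k '' {e | Q k (μ k) e ≤ 2 * (N + 1)}) := by
      intro j ε hε
      obtain ⟨_, ⟨e, he, rfl⟩, h1⟩ := hball z₀ (by simpa using hδ) j (ε / 2) (by positivity)
      obtain ⟨_, ⟨e', he', rfl⟩, h2⟩ := hball (z₀ + (((2 * (N + 1) : ℝ)) : ℂ) • z) (by
        rw [add_sub_cancel_left, map_smul_eq_mul, Complex.norm_real, Real.norm_of_nonneg hN.le]
        rwa [lt_div_iff₀ hN, mul_comm] at hz) j (ε / 2) (by positivity)
      refine ⟨_, ⟨e' - e, ?_, rfl⟩, ?_⟩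
      · have := map_sub_le_add (Q k (μ k)) e' e
        simp only [Set.mem_ofPred_eq] at he he' ⊢
        linarith
      · have h3 := map_sub_le_add (P j) (z₀ + (((2 * (N + 1) : ℝ)) : ℂ) • z - T k e') (z₀ - T k e)
        have h4 : (((2 * (N + 1) : ℝ)) : ℂ) • z - T k (e' - e) =
            z₀ + (((2 * (N + 1) : ℝ)) : ℂ) • z - T k e' - (z₀ - T k e) := by
          rw [map_sub]; abel
        rw [h4]
        linarith
    have h2 := smul_mem_seminormClosure (T k) (inv_pos.2 hN) h1
    rwa [smul_smul, ← Complex.ofReal_mul, inv_mul_cancel₀ hN.ne', Complex.ofReal_one, one_smul]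
      at h2
  obtain ⟨k, hk⟩ := key
  exact ⟨k, exists_preimage_of_closure (T k) hP (hQ k) (hcE k) (hT k) hsep hk⟩

/-- Null families lift to null families under open maps. -/
theorem exists_lift_null {E : Type} [AddCommGroup E] [Module ℂ E] {Q : ℕ → Seminorm ℂ E}
    (T : E →ₗ[ℂ] Z) (hQ : Monotone Q)
    (h : ∀ m, ∃ m' δ, 0 < δ ∧ ∀ z, P m' z < δ → ∃ e, T e = z ∧ Q m e < 1)
    {ι : Type} (len : ι → ℕ) (z : ι → Z)
    (hz : ∀ m, ∀ ε > 0, ∃ L, ∀ w, L ≤ len w → P m (z w) < ε) :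
    ∃ e : ι → E, (∀ w, T (e w) = z w) ∧ ∀ m, ∃ L, ∀ w, L ≤ len w → Q m (e w) < 1 := by
  classical
  choose m' δ hδ hl using h
  -- An open linear map is onto, since every vector can be scaled into the given neighbourhood of
  -- zero.
  have hsurj : ∀ z, ∃ e, T e = z := by
    intro z
    obtain ⟨c, hc, hcz⟩ : ∃ c : ℝ, 0 < c ∧ c * P (m' 0) z < δ 0 := by
      refine ⟨δ 0 / (P (m' 0) z + 1), div_pos (hδ 0) (by positivity), ?_⟩
      have h1 : (0 : ℝ) ≤ P (m' 0) z := apply_nonneg _ _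
      rw [div_mul_eq_mul_div, div_lt_iff₀ (by positivity)]
      nlinarith [hδ 0]
    obtain ⟨e, he, -⟩ := hl 0 ((c : ℂ) • z) (by
      rwa [map_smul_eq_mul, Complex.norm_real, Real.norm_of_nonneg hc.le])
    refine ⟨(c : ℂ)⁻¹ • e, ?_⟩
    rw [map_smul, he, inv_smul_smul₀ (by exact_mod_cast hc.ne')]
  -- The largest m, searched up to `len w`, for which z w is small enough to have a lift of size
  -- less than 1 for `Q m`. For each fixed m it is at least m as soon as `len w` is large, because
  -- the family is null.
  let μ : ι → ℕ := fun w => Nat.findGreatest (fun m => P (m' m) (z w) < δ m) (len w)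
  have hex : ∀ w, ∃ e, T e = z w ∧ (P (m' (μ w)) (z w) < δ (μ w) → Q (μ w) e < 1) := by
    intro w
    by_cases hw : P (m' (μ w)) (z w) < δ (μ w)
    · obtain ⟨e, he, he'⟩ := hl _ _ hw
      exact ⟨e, he, fun _ => he'⟩
    · obtain ⟨e, he⟩ := hsurj (z w)
      exact ⟨e, he, fun h => absurd h hw⟩
  choose e he he' using hex
  refine ⟨e, he, fun m => ?_⟩
  obtain ⟨L, hL⟩ := hz (m' m) (δ m) (hδ m)
  refine ⟨max m L, fun w hw => ?_⟩
  have h1 := hL w ((le_max_right _ _).trans hw)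
  have h2 : m ≤ len w := (le_max_left _ _).trans hw
  have h3 : m ≤ μ w := Nat.le_findGreatest h2 h1
  have h4 : P (m' (μ w)) (z w) < δ (μ w) :=
    Nat.findGreatest_spec (P := fun m => P (m' m) (z w) < δ m) h2 h1
  exact (hQ h3 _).trans_lt (he' w h4)

end openMapping
end
end RapidDecay

namespace RapidDecay
noncomputable section
variable {p q : ℕ}

/-! ### Seminorms on spaces of solutions -/

lemma weight_nonneg (x : CBar p) : 0 ≤ weight x :=
  Finset.prod_nonneg fun _ _ => le_max_of_le_left (norm_nonneg _)

lemma one_le_weight {x : CBar p} (hx : x ∈ torus p) : 1 ≤ weight x :=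
  Finset.prod_induction _ (fun a => 1 ≤ a) (fun _ _ => one_le_mul_of_one_le_of_one_le) le_rfl
    fun k _ => one_le_max_inv (norm_pos_iff.2 (coord_ne_zero hx k))

/-- The decay constants are local, so finitely many suffice on a compact set. Boundary points need
no estimate because the function vanishes there. -/
lemma RapidDecayOn.bounded_of_isCompact {U : Set (CBar p × Par q)} {F : CBar p × Par q → ℂ}
    (hF : RapidDecayOn U F) {K : Set (CBar p × Par q)} (hK : IsCompact K) (hKU : K ⊆ U) (N : ℕ) :
    ∃ C : ℝ, ∀ z ∈ K, ‖F z‖ * weight z.1 ^ N ≤ C := by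
  refine hK.induction_on (p := fun S => ∃ C : ℝ, ∀ z ∈ S ∩ U, ‖F z‖ * weight z.1 ^ N ≤ C)
    ⟨0, by simp⟩ ?_ ?_ ?_ |>.imp fun C hC z hz => hC z ⟨hz, hKU hz⟩
  · rintro S T hST ⟨C, hC⟩
    exact ⟨C, fun z hz => hC z ⟨hST hz.1, hz.2⟩⟩
  · rintro S T ⟨C, hC⟩ ⟨C', hC'⟩
    refine ⟨max C C', ?_⟩
    rintro z ⟨hz | hz, hzU⟩
    · exact (hC z ⟨hz, hzU⟩).trans (le_max_left _ _)
    · exact (hC' z ⟨hz, hzU⟩).trans (le_max_right _ _)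
  · intro z hz
    obtain ⟨C, hC⟩ := hF.decay z (hKU hz) N
    refine ⟨_, mem_nhdsWithin_of_mem_nhds hC, max C 0, ?_⟩
    rintro w ⟨hw, hwU⟩
    by_cases ht : w.1 ∈ torus p
    · exact (hw ht).trans (le_max_left _ _)
    · rw [hF.boundary w hwU ht]
      simp

variable (B : Type) [AddCommGroup B] [Module (DAlg p) B]

/-- The `D`-linear maps whose values decay rapidly, uniformly on the whole of `V`. -/
def boundedHoms (V : Opens (CBar p × Par q)) : Submodule ℂ (B →ₗ[DAlg p] rapidSections p q V) where
  carrier := {φ | ∀ b (N : ℕ), ∃ C : ℝ, ∀ z : V, ‖(φ b).1 z‖ * weight z.1.1 ^ N ≤ C}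
  zero_mem' b N := ⟨0, fun z => by simp⟩
  add_mem' {φ ψ} hφ hψ b N := by
    obtain ⟨C, hC⟩ := hφ b N
    obtain ⟨C', hC'⟩ := hψ b N
    refine ⟨C + C', fun z => ?_⟩
    have := weight_nonneg z.1.1
    calc ‖(φ b).1 z + (ψ b).1 z‖ * weight z.1.1 ^ N
        ≤ (‖(φ b).1 z‖ + ‖(ψ b).1 z‖) * weight z.1.1 ^ N := by gcongr; exact norm_add_le _ _
      _ ≤ C + C' := by rw [add_mul]; exact add_le_add (hC z) (hC' z)
  smul_mem' c φ hφ b N := by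
    obtain ⟨C, hC⟩ := hφ b N
    refine ⟨‖c‖ * C, fun z => ?_⟩
    change ‖c * (φ b).1 z‖ * weight z.1.1 ^ N ≤ _
    rw [norm_mul, mul_assoc]
    gcongr
    exact hC z

/-- The space of `D`-linear maps whose values decay rapidly, uniformly on the whole of `V`. -/
def BoundedHoms (V : Opens (CBar p × Par q)) : Type := boundedHoms B V

instance (V : Opens (CBar p × Par q)) : AddCommGroup (BoundedHoms B V) :=
  @Submodule.addCommGroup ℂ (B →ₗ[DAlg p] rapidSections p q V) _ inferInstance _ (boundedHoms B V)

instance (V : Opens (CBar p × Par q)) : Module ℂ (BoundedHoms B V) :=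
  inferInstanceAs (Module ℂ (boundedHoms B V))

variable {B} {V : Opens (CBar p × Par q)}

lemma BoundedHoms.sub_apply (φ ψ : BoundedHoms B V) (b : B) (z : V) :
    ((φ - ψ).1 b).1 z = (φ.1 b).1 z - (ψ.1 b).1 z := rfl

/-- The weighted supremum norm of the value at `b`. -/
def supNorm (b : B) (N : ℕ) : Seminorm ℂ (BoundedHoms B V) :=
  Seminorm.of (fun φ => ⨆ z : V, ‖(φ.1 b).1 z‖ * weight z.1.1 ^ N)
    (by
      intro φ ψ
      have bdd : ∀ φ : BoundedHoms B V,
          BddAbove (Set.range fun z : V => ‖(φ.1 b).1 z‖ * weight z.1.1 ^ N) := by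
        intro φ
        obtain ⟨C, hC⟩ := φ.2 b N
        exact ⟨C, by rintro _ ⟨z, rfl⟩; exact hC z⟩
      refine Real.iSup_le (fun z => ?_) (add_nonneg
        (Real.iSup_nonneg fun z => mul_nonneg (norm_nonneg _) (pow_nonneg (weight_nonneg z.1.1) _))
        (Real.iSup_nonneg fun z => mul_nonneg (norm_nonneg _) (pow_nonneg (weight_nonneg z.1.1) _)))
      have := weight_nonneg z.1.1
      calc ‖(φ.1 b).1 z + (ψ.1 b).1 z‖ * weight z.1.1 ^ N
          ≤ (‖(φ.1 b).1 z‖ + ‖(ψ.1 b).1 z‖) * weight z.1.1 ^ N := by gcongr; exact norm_add_le _ _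
        _ ≤ _ := by rw [add_mul]; exact add_le_add (le_ciSup (bdd φ) z) (le_ciSup (bdd ψ) z))
    (by
      intro c φ
      rw [Real.mul_iSup_of_nonneg (norm_nonneg _)]
      congr 1
      funext z
      change ‖c * (φ.1 b).1 z‖ * weight z.1.1 ^ N = _
      rw [norm_mul, mul_assoc])

lemma le_supNorm (b : B) (N : ℕ) (φ : BoundedHoms B V) (z : V) :
    ‖(φ.1 b).1 z‖ * weight z.1.1 ^ N ≤ supNorm b N φ := by
  obtain ⟨C, hC⟩ := φ.2 b N
  exact le_ciSup (f := fun z : V => ‖(φ.1 b).1 z‖ * weight z.1.1 ^ N)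
    ⟨C, by rintro _ ⟨z, rfl⟩; exact hC z⟩ z

lemma supNorm_le {b : B} {N : ℕ} {φ : BoundedHoms B V} {C : ℝ} (hC : 0 ≤ C)
    (h : ∀ z : V, z.1.1 ∈ torus p → ‖(φ.1 b).1 z‖ * weight z.1.1 ^ N ≤ C) :
    supNorm b N φ ≤ C := by
  refine Real.iSup_le (fun z => ?_) hC
  by_cases ht : z.1.1 ∈ torus p
  · exact h z ht
  · rw [eq_zero_of_notMem_torus _ z ht]
    simpa using hC

lemma supNorm_mono (b : B) (φ : BoundedHoms B V) {N N' : ℕ} (h : N ≤ N') :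
    supNorm b N φ ≤ supNorm b N' φ := by
  refine supNorm_le (apply_nonneg _ _) fun z ht => ?_
  refine le_trans ?_ (le_supNorm b N' φ z)
  gcongr
  exact one_le_weight ht

/-- The increasing sequence of seminorms attached to a sequence in `B`. -/
def seqNorm (e : ℕ → B) (m : ℕ) : Seminorm ℂ (BoundedHoms B V) :=
  ∑ i ∈ Finset.range (m + 1), supNorm (e i) m

lemma seqNorm_apply (e : ℕ → B) (m : ℕ) (φ : BoundedHoms B V) :
    seqNorm e m φ = ∑ i ∈ Finset.range (m + 1), supNorm (e i) m φ := by
  unfold seqNorm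
  induction Finset.range (m + 1) using Finset.induction_on with
  | empty => rfl
  | insert a s ha ih => rw [Finset.sum_insert ha, Finset.sum_insert ha, ← ih]; rfl

lemma monotone_seqNorm (e : ℕ → B) : Monotone (seqNorm (V := V) e) := by
  intro m m' h φ
  simp only [seqNorm_apply]
  refine (Finset.sum_le_sum fun i _ => supNorm_mono (e i) φ h).trans ?_
  exact Finset.sum_le_sum_of_subset_of_nonneg (Finset.range_mono (Nat.succ_le_succ h))
    fun i _ _ => apply_nonneg _ _

lemma supNorm_le_seqNorm (e : ℕ → B) (i N : ℕ) (φ : BoundedHoms B V) :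
    supNorm (e i) N φ ≤ seqNorm e (max i N) φ := by
  rw [seqNorm_apply]
  refine (supNorm_mono (e i) φ (le_max_right i N)).trans ?_
  exact Finset.single_le_sum (f := fun k => supNorm (e k) (max i N) φ)
    (fun j _ => apply_nonneg _ _) (Finset.mem_range.2 (Nat.lt_succ_of_le (le_max_left i N)))

variable [Module ℂ B] [IsScalarTower ℂ (DAlg p) B]

lemma apply_complex_smul (φ : B →ₗ[DAlg p] rapidSections p q V) (c : ℂ) (b : B) :
    φ (c • b) = c • φ b := by
  rw [← algebraMap_smul (DAlg p) c b, map_smul, algebraMap_smul']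

/-- The seminorms see only the spanning sequence; convergence of the other values follows by
ℂ-linearity of evaluation. -/
lemma tendsto_apply_of_seqNorm {e : ℕ → B} (he : Submodule.span ℂ (Set.range e) = ⊤)
    {u : ℕ → BoundedHoms B V} {l : BoundedHoms B V}
    (h : ∀ m, Filter.Tendsto (fun n => seqNorm e m (u n - l)) Filter.atTop (𝓝 0)) (b : B) (z : V) :
    Filter.Tendsto (fun n => ((u n).1 b).1 z) Filter.atTop (𝓝 ((l.1 b).1 z)) := by
  have hb : b ∈ Submodule.span ℂ (Set.range e) := he ▸ Submodule.mem_top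
  induction hb using Submodule.span_induction with
  | mem b hb =>
    obtain ⟨i, rfl⟩ := hb
    rw [tendsto_iff_norm_sub_tendsto_zero]
    refine squeeze_zero (fun n => norm_nonneg _) (fun n => ?_) (h (max i 0))
    refine le_trans ?_ (supNorm_le_seqNorm e i 0 (u n - l))
    simpa [BoundedHoms.sub_apply] using le_supNorm (e i) 0 (u n - l) z
  | zero => simp
  | add a b _ _ ha hb =>
    simp only [map_add]
    exact ha.add hb
  | smul c b _ hb =>
    simp only [apply_complex_smul]
    exact hb.const_mul c

lemma eq_zero_of_seqNorm {e : ℕ → B} (he : Submodule.span ℂ (Set.range e) = ⊤)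
    {φ : BoundedHoms B V} (h : ∀ m, seqNorm e m φ = 0) : φ = 0 := by
  refine Subtype.ext (LinearMap.ext fun b => Subtype.ext (funext fun z => ?_))
  have := tendsto_apply_of_seqNorm he (u := fun _ => φ) (l := 0) (by simp [h]) b z
  exact tendsto_nhds_unique tendsto_const_nhds this

/-- Summability of the differences at the spanning vectors spreads to all vectors by linearity, so
`exists_limit` provides a D-linear limit. Its tail bounds give both the uniform decay of the limit
and convergence for the seminorms. -/
lemma fastComplete_boundedHoms {e : ℕ → B} (he : Submodule.span ℂ (Set.range e) = ⊤) :
    FastComplete (seqNorm (V := V) e) := by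
  intro u hu
  have h : ∀ (b : B) (N : ℕ), ∃ c : ℕ → ℝ, Summable c ∧ ∀ n (z : V), z.1.1 ∈ torus p →
      ‖((u (n + 1)).1 b).1 z - ((u n).1 b).1 z‖ * weight z.1.1 ^ N ≤ c n := by
    intro b N
    have hb : b ∈ Submodule.span ℂ (Set.range e) := he ▸ Submodule.mem_top
    induction hb using Submodule.span_induction with
    | mem b hb =>
      obtain ⟨i, rfl⟩ := hb
      refine ⟨_, hu (max i N), fun n z _ => ?_⟩
      exact (le_supNorm (e i) N (u (n + 1) - u n) z).trans (supNorm_le_seqNorm e i N _)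
    | zero => exact ⟨0, summable_zero, fun n z _ => by simp⟩
    | add a b _ _ ha hb =>
      obtain ⟨c, hc, hle⟩ := ha
      obtain ⟨c', hc', hle'⟩ := hb
      refine ⟨c + c', hc.add hc', fun n z ht => ?_⟩
      have := weight_nonneg z.1.1
      simp only [map_add]
      change ‖((u (n + 1)).1 a).1 z + ((u (n + 1)).1 b).1 z -
        (((u n).1 a).1 z + ((u n).1 b).1 z)‖ * _ ≤ c n + c' n
      rw [add_sub_add_comm]
      calc _ ≤ (‖((u (n + 1)).1 a).1 z - ((u n).1 a).1 z‖ +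
            ‖((u (n + 1)).1 b).1 z - ((u n).1 b).1 z‖) * weight z.1.1 ^ N := by
            gcongr; exact norm_add_le _ _
        _ ≤ _ := by rw [add_mul]; exact add_le_add (hle n z ht) (hle' n z ht)
    | smul a b _ hb =>
      obtain ⟨c, hc, hle⟩ := hb
      refine ⟨fun n => ‖a‖ * c n, hc.mul_left _, fun n z ht => ?_⟩
      simp only [apply_complex_smul]
      change ‖a * ((u (n + 1)).1 b).1 z - a * ((u n).1 b).1 z‖ * _ ≤ _
      rw [← mul_sub, norm_mul, mul_assoc]
      gcongr
      exact hle n z ht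
  obtain ⟨ψ, -, hψ⟩ := exists_limit (fun n => (u n).1) h
  have hψb : ψ ∈ boundedHoms B V := by
    intro b N
    obtain ⟨c, hc, hle⟩ := h b N
    obtain ⟨C, hC⟩ := (u 0).2 b N
    -- The limit is compared with the first member of the sequence; the maximum with 0 covers
    -- boundary points, where the value is zero.
    refine ⟨max (∑' m, c (0 + m) + C) 0, fun z => ?_⟩
    by_cases ht : z.1.1 ∈ torus p
    · refine le_trans ?_ (le_max_left _ _)
      have := weight_nonneg z.1.1
      calc _ ≤ (‖(ψ b).1 z - ((u 0).1 b).1 z‖ + ‖((u 0).1 b).1 z‖) * weight z.1.1 ^ N := by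
            gcongr
            simpa using norm_add_le ((ψ b).1 z - ((u 0).1 b).1 z) (((u 0).1 b).1 z)
        _ ≤ _ := by rw [add_mul]; exact add_le_add (hψ b N c hc hle 0 z ht) (hC z)
    · rw [eq_zero_of_notMem_torus _ z ht]
      simp
  refine ⟨⟨ψ, hψb⟩, fun m => ?_⟩
  simp only [seqNorm_apply]
  have h0 : (0 : ℝ) = ∑ i ∈ Finset.range (m + 1), 0 := by simp
  rw [h0]
  refine tendsto_finsetSum _ fun i _ => ?_
  obtain ⟨c, hc, hle⟩ := h (e i) m
  have hc0 : Filter.Tendsto (fun n => ∑' k, c (n + k)) Filter.atTop (𝓝 0) :=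
    (tendsto_sum_nat_add c).congr fun n => tsum_congr fun m => by rw [add_comm]
  refine squeeze_zero (fun n => apply_nonneg _ _) (g := fun n => |∑' k, c (n + k)|) (fun n => ?_)
    (by simpa using hc0.abs)
  refine supNorm_le (abs_nonneg _) fun z ht => le_trans ?_ (le_abs_self _)
  have := hψ (e i) m c hc hle n z ht
  rwa [norm_sub_rev] at this

section lifting

variable {C : Type} [AddCommGroup C] [Module (DAlg p) C] [Module ℂ C] [IsScalarTower ℂ (DAlg p) C]

/-- The solutions `ξ` on `V` together with a representation of the restriction to `W` as the sum of
a boundary and of a combination of given solutions. -/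
def liftSpace (d : B →ₗ[DAlg p] C) {V W V₀ : Opens (CBar p × Par q)} (hW : W ≤ V) (hW₀ : W ≤ V₀)
    {h : ℕ} (c : Fin h → B →ₗ[DAlg p] rapidSections p q V₀) :
    Submodule ℂ (BoundedHoms B V × BoundedHoms C W × (Fin h → ℂ)) where
  carrier := {t | ∀ b (z : W), (t.1.1 b).1 ⟨z.1, hW z.2⟩ =
    (t.2.1.1 (d b)).1 z + ∑ j, t.2.2 j * (c j b).1 ⟨z.1, hW₀ z.2⟩}
  zero_mem' b z := by
    change (0 : ℂ) = 0 + ∑ j, 0 * _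
    simp
  add_mem' {s t} hs ht b z := by
    change (s.1.1 b).1 ⟨z.1, hW z.2⟩ + (t.1.1 b).1 ⟨z.1, hW z.2⟩ =
      ((s.2.1.1 (d b)).1 z + (t.2.1.1 (d b)).1 z) + ∑ j, (s.2.2 j + t.2.2 j) * _
    rw [hs b z, ht b z]
    simp only [add_mul, Finset.sum_add_distrib]
    ring
  smul_mem' a t ht b z := by
    change a * (t.1.1 b).1 ⟨z.1, hW z.2⟩ =
      a * (t.2.1.1 (d b)).1 z + ∑ j, a * t.2.2 j * _
    rw [ht b z]
    simp only [mul_assoc, ← Finset.mul_sum]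
    ring

variable {W V₀ : Opens (CBar p × Par q)} {h : ℕ}

/-- The seminorms on `liftSpace`. -/
def liftNorm (e : ℕ → B) (f : ℕ → C) (m : ℕ) :
    Seminorm ℂ (BoundedHoms B V × BoundedHoms C W × (Fin h → ℂ)) :=
  (seqNorm e m).comp (LinearMap.fst ℂ _ _) +
    ((seqNorm f m).comp (LinearMap.fst ℂ _ _ ∘ₗ LinearMap.snd ℂ _ _) +
      (normSeminorm ℂ (Fin h → ℂ)).comp (LinearMap.snd ℂ _ _ ∘ₗ LinearMap.snd ℂ _ _))

omit [Module ℂ B] [IsScalarTower ℂ (DAlg p) B] [Module ℂ C] [IsScalarTower ℂ (DAlg p) C] in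
lemma liftNorm_apply (e : ℕ → B) (f : ℕ → C) (m : ℕ)
    (t : BoundedHoms B V × BoundedHoms C W × (Fin h → ℂ)) :
    liftNorm e f m t = seqNorm e m t.1 + (seqNorm f m t.2.1 + ‖t.2.2‖) := rfl

/-- The three components converge separately. The defining relation is an identity between values at
points, and these depend continuously on the components, so the limit still satisfies it. -/
lemma fastComplete_liftSpace (d : B →ₗ[DAlg p] C) {e : ℕ → B}
    (he : Submodule.span ℂ (Set.range e) = ⊤) {f : ℕ → C}
    (hf : Submodule.span ℂ (Set.range f) = ⊤) (hW : W ≤ V) (hW₀ : W ≤ V₀)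
    (c : Fin h → B →ₗ[DAlg p] rapidSections p q V₀) :
    FastComplete fun m => (liftNorm e f m).comp (liftSpace d hW hW₀ c).subtype := by
  intro u hu
  have hu' : ∀ m, Summable fun n => liftNorm e f m ((u (n + 1)).1 - (u n).1) := hu
  simp only [liftNorm_apply] at hu'
  obtain ⟨l₁, hl₁⟩ := fastComplete_boundedHoms he (fun n => (u n).1.1) fun m =>
    (hu' m).of_nonneg_of_le (fun n => apply_nonneg _ _) fun n =>
      le_add_of_nonneg_right (add_nonneg (apply_nonneg _ _) (norm_nonneg _))
  obtain ⟨l₂, hl₂⟩ := fastComplete_boundedHoms hf (fun n => (u n).1.2.1) fun m =>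
    (hu' m).of_nonneg_of_le (fun n => apply_nonneg _ _) fun n =>
      (le_add_of_nonneg_right (norm_nonneg _)).trans
        (le_add_of_nonneg_left (apply_nonneg _ _))
  obtain ⟨l₃, hl₃⟩ := cauchySeq_tendsto_of_complete
    (cauchySeq_of_summable_dist (f := fun n => (u n).1.2.2)
      ((hu' 0).of_nonneg_of_le (fun n => dist_nonneg) fun n => by
        rw [dist_comm, dist_eq_norm]
        exact (le_add_of_nonneg_left (apply_nonneg _ _)).trans
          (le_add_of_nonneg_left (apply_nonneg _ _))))
  refine ⟨⟨(l₁, l₂, l₃), fun b z => ?_⟩, fun m => ?_⟩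
  · have h1 := tendsto_apply_of_seqNorm he hl₁ b ⟨z.1, hW z.2⟩
    have h2 := tendsto_apply_of_seqNorm hf hl₂ (d b) z
    have h3 : Filter.Tendsto (fun n => ∑ j, (u n).1.2.2 j * (c j b).1 ⟨z.1, hW₀ z.2⟩)
        Filter.atTop (𝓝 (∑ j, l₃ j * (c j b).1 ⟨z.1, hW₀ z.2⟩)) :=
      tendsto_finsetSum _ fun j _ => ((tendsto_pi_nhds.1 hl₃) j).mul_const _
    exact tendsto_nhds_unique h1 ((h2.add h3).congr fun n => ((u n).2 b z).symm)
  · have h4 := (hl₁ m).add ((hl₂ m).add (tendsto_iff_norm_sub_tendsto_zero.1 hl₃))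
    simp only [add_zero] at h4
    exact h4

end lifting
end
end RapidDecay

/-! ### Lifting null families of solutions on a fixed neighbourhood -/

namespace RapidDecay
noncomputable section
variable {p q : ℕ}

/-- First countability makes the union over neighbourhoods countable. Local compactness puts each
neighbourhood of x around some W_k contained in a compact subset of it, on which local decay becomes
uniform. -/
lemma exists_nhds_seq (x : CBar p) (V : Opens (CBar p)) (hx : x ∈ V) :
    ∃ W : ℕ → Opens (CBar p), (∀ k, x ∈ W k ∧ W k ≤ V) ∧ ∀ W' : Opens (CBar p), x ∈ W' →
      ∃ k, ∃ K : Set (CBar p), IsCompact K ∧ (W k : Set (CBar p)) ⊆ K ∧ K ⊆ W' := by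
  obtain ⟨S, hS⟩ := (𝓝 x).exists_antitone_basis
  refine ⟨fun k => ⟨interior (S k), isOpen_interior⟩ ⊓ V, fun k => ⟨⟨?_, hx⟩, inf_le_right⟩, ?_⟩
  · exact mem_interior_iff_mem_nhds.2 (hS.1.mem_of_mem trivial)
  · intro W' hW'
    obtain ⟨K, hK, hKW, hKc⟩ := local_compact_nhds (W'.isOpen.mem_nhds hW')
    obtain ⟨k, -, hk⟩ := hS.1.mem_iff.1 hK
    exact ⟨k, K, hKc, fun y hy => hk (interior_subset hy.1), hKW⟩

lemma res_mem_boundedHoms {C : Type} [AddCommGroup C] [Module (DAlg p) C]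
    {V W : Opens (CBar p × Par q)} (h : W ≤ V) (φ : C →ₗ[DAlg p] rapidSections p q V)
    {K : Set (CBar p × Par q)} (hK : IsCompact K) (hWK : (W : Set (CBar p × Par q)) ⊆ K)
    (hKV : K ⊆ V) : res h ∘ₗ φ ∈ boundedHoms C W := by
  intro b N
  obtain ⟨c, hc⟩ := RapidDecayOn.bounded_of_isCompact (φ b).2 hK hKV N
  refine ⟨c, fun z => ?_⟩
  have := hc z (hWK z.2)
  rwa [ext_of_mem _ (h z.2)] at this

lemma exists_level_of_finset {ι κ : Type} (len : ι → ℕ) (Pr : κ → ι → Prop)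
    (h : ∀ i, ∃ L, ∀ w, L ≤ len w → Pr i w) (s : Finset κ) :
    ∃ L, ∀ w, L ≤ len w → ∀ i ∈ s, Pr i w := by
  choose L hL using h
  refine ⟨s.sup L, fun w hw i hi => hL i w ((Finset.le_sup hi).trans hw)⟩

/-- The lifting controls all but finitely many members of the family; the exceptional ones are
bounded one at a time. -/
lemma exists_bound_of_finite {ι κ : Type} {S : Set ι} (hS : S.Finite) (F : ι → κ → ℝ)
    (h : ∀ w, ∃ A, ∀ y, F w y ≤ A) (A₀ : ℝ) (h₀ : ∀ w ∉ S, ∀ y, F w y ≤ A₀) :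
    ∃ A, ∀ w y, F w y ≤ A := by
  choose A hA using h
  obtain ⟨M, hM⟩ := (hS.image A).bddAbove
  refine ⟨max A₀ M, fun w y => ?_⟩
  by_cases hw : w ∈ S
  · exact (hA w y).trans ((hM ⟨w, hw, rfl⟩).trans (le_max_right _ _))
  · exact (h₀ w hw y).trans (le_max_left _ _)

/-- Families of solutions with parameters converging to zero lift, on a fixed neighbourhood. -/
theorem exists_lift_family {B C : Type} [AddCommGroup B] [Module (DAlg p) B] [Module ℂ B]
    [IsScalarTower ℂ (DAlg p) B] [AddCommGroup C] [Module (DAlg p) C] [Module ℂ C]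
    [IsScalarTower ℂ (DAlg p) C] (d : B →ₗ[DAlg p] C) {e : ℕ → B}
    (he : Submodule.span ℂ (Set.range e) = ⊤) {f : ℕ → C}
    (hf : Submodule.span ℂ (Set.range f) = ⊤) {x : CBar p} {V V₀ : Opens (CBar p)} (hx : x ∈ V)
    (hV : V ≤ V₀) {h : ℕ} (c : Fin h → B →ₗ[DAlg p] rapidSections p 0 (baseOpen V₀))
    (hspan : ∀ ξ : B →ₗ[DAlg p] rapidSections p 0 (baseOpen V),
      ∃ (W : Opens (CBar p)) (i : W ≤ V), x ∈ W ∧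
        ∃ (a : Fin h → ℂ) (y : C →ₗ[DAlg p] rapidSections p 0 (baseOpen W)),
          ∀ u, res (baseOpen_mono i) (ξ u) =
            ∑ j, a j • res (baseOpen_mono (i.trans hV)) (c j u) + y (d u)) :
    ∃ (W : Opens (CBar p)) (i : W ≤ V), x ∈ W ∧ ∀ {ι : Type} (len : ι → ℕ)
      (z : ι → B →ₗ[DAlg p] rapidSections p 0 (baseOpen V)), (∀ L, {w | len w < L}.Finite) →
      (∀ w, z w ∈ boundedHoms B (baseOpen V)) →
      (∀ (n N : ℕ), ∀ ε > 0, ∃ L, ∀ w, L ≤ len w → ∀ y,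
        ‖(z w (e n)).1 y‖ * weight y.1.1 ^ N ≤ ε) →
      ∃ (g : ι → C →ₗ[DAlg p] rapidSections p 0 (baseOpen W)) (a : ι → Fin h → ℂ),
        (∀ w, g w ∈ boundedHoms C (baseOpen W)) ∧
        (∀ w u, res (baseOpen_mono i) (z w u) =
          ∑ j, a w j • res (baseOpen_mono (i.trans hV)) (c j u) + g w (d u)) ∧
        (∀ u (N : ℕ), ∃ A, ∀ w y, ‖(g w u).1 y‖ * weight y.1.1 ^ N ≤ A) ∧
        ∃ A, ∀ w j, ‖a w j‖ ≤ A := by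
  obtain ⟨W, hW, hWK⟩ := exists_nhds_seq x V hx
  have hWV : ∀ k, baseOpen (W k) ≤ baseOpen V := fun k => baseOpen_mono (hW k).2
  have hWV₀ : ∀ k, baseOpen (W k) ≤ baseOpen V₀ := fun k => baseOpen_mono ((hW k).2.trans hV)
  have hmono : ∀ k, Monotone fun m => (liftNorm (V := baseOpen V) (W := baseOpen (W k)) (h := h)
      e f m).comp (liftSpace d (hWV k) (hWV₀ k) c).subtype := by
    intro k m m' hm t
    change liftNorm e f m t.1 ≤ liftNorm e f m' t.1
    rw [liftNorm_apply, liftNorm_apply]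
    gcongr
    · exact monotone_seqNorm e hm _
    · exact monotone_seqNorm f hm _
  -- The k-th space consists of a solution on V with a decomposition on `W k`, and the k-th map
  -- forgets the decomposition. An open one among these maps fixes the neighbourhood.
  obtain ⟨k, hk⟩ := exists_open_of_iUnion (Z := BoundedHoms B (baseOpen V)) (P := seqNorm e)
    (E := fun k => liftSpace d (hWV k) (hWV₀ k) c)
    (Q := fun k m => (liftNorm e f m).comp (liftSpace d (hWV k) (hWV₀ k) c).subtype)
    (fun k => LinearMap.fst ℂ _ _ ∘ₗ (liftSpace d (hWV k) (hWV₀ k) c).subtype)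
    (monotone_seqNorm e) hmono (fastComplete_boundedHoms he)
    (fun k => fastComplete_liftSpace d he hf (hWV k) (hWV₀ k) c)
    (fun k m t => le_add_of_nonneg_right (add_nonneg (apply_nonneg _ _) (apply_nonneg _ _)))
    (fun z hz => eq_zero_of_seqNorm he hz)
    (by
      intro ξ
      -- A single solution decomposes on some W'. Restricting y to a `W k` inside a compact subset
      -- of W' gives it uniform decay, hence an element of the k-th space.
      obtain ⟨W', i, hxW', a, y, hy⟩ := hspan ξ.1
      obtain ⟨k, K, hK, hKk, hKW⟩ := hWK W' hxW'
      have hkW : W k ≤ W' := hKk.trans hKW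
      refine ⟨k, ⟨(ξ, ⟨res (baseOpen_mono hkW) ∘ₗ y, ?_⟩, a), ?_⟩, rfl⟩
      · refine res_mem_boundedHoms _ y (K := K ×ˢ Set.univ) (hK.prod ?_) ?_ ?_
        · exact (Set.toFinite _).isCompact
        · exact fun z hz => ⟨hKk hz, trivial⟩
        · exact fun z hz => hKW hz.1
      · intro b z
        have h1 := congrArg (fun s : rapidSections p 0 (baseOpen W') => s.1 ⟨z.1, hkW z.2⟩) (hy b)
        have h2 : (∑ j, a j • res (baseOpen_mono (i.trans hV)) (c j b) :
            rapidSections p 0 (baseOpen W')).1 ⟨z.1, hkW z.2⟩ =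
            ∑ j, a j * (c j b).1 ⟨z.1, hWV₀ k z.2⟩ := by
          rw [AddSubmonoidClass.coe_finsetSum, Finset.sum_apply]
          rfl
        change (ξ.1 b).1 ⟨z.1, hWV k z.2⟩ = (_ + _ : rapidSections p 0 (baseOpen W')).1 _ at h1
        rw [Submodule.coe_add, Pi.add_apply, h2, add_comm] at h1
        exact h1)
  refine ⟨W k, (hW k).2, (hW k).1, fun {ι} len z hfin hz hnull => ?_⟩
  let zb : ι → BoundedHoms B (baseOpen V) := fun w => ⟨z w, hz w⟩
  obtain ⟨t, ht, htn⟩ := exists_lift_null _ (hmono k) hk len zb (by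
    intro m ε hε
    have h1 := exists_level_of_finset len (fun n w => ∀ y : baseOpen V,
      ‖(z w (e n)).1 y‖ * weight y.1.1 ^ m ≤ ε / (m + 2)) (fun n => hnull n m _ (by positivity))
      (Finset.range (m + 1))
    obtain ⟨L, hL⟩ := h1
    refine ⟨L, fun w hw => ?_⟩
    -- The seminorm of index m is a sum of m + 1 terms, each at most ε/(m + 2), so the total is
    -- strictly less than ε.
    rw [seqNorm_apply]
    calc ∑ i ∈ Finset.range (m + 1), supNorm (e i) m (zb w)
        ≤ ∑ i ∈ Finset.range (m + 1), ε / (m + 2) :=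
          Finset.sum_le_sum fun i hi => supNorm_le (by positivity) fun y _ => hL w hw i hi y
      _ = (m + 1) * (ε / (m + 2)) := by simp
      _ < ε := by
          rw [mul_div_assoc', div_lt_iff₀ (by positivity)]
          nlinarith)
  have hval : ∀ w b (y : baseOpen (W k)), (z w b).1 ⟨y.1, hWV k y.2⟩ =
      ((t w).1.2.1.1 (d b)).1 y + ∑ j, (t w).1.2.2 j * (c j b).1 ⟨y.1, hWV₀ k y.2⟩ := by
    intro w b y
    have h1 := (t w).2 b y
    have h2 : (t w).1.1 = zb w := ht w
    rw [h2] at h1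
    exact h1
  refine ⟨fun w => (t w).1.2.1.1, fun w => (t w).1.2.2, fun w => (t w).1.2.1.2, ?_, ?_, ?_⟩
  · intro w u
    refine Subtype.ext (funext fun y => (hval w u y).trans ?_)
    have h5 : (∑ j, (t w).1.2.2 j • res (baseOpen_mono ((hW k).2.trans hV)) (c j u) :
        rapidSections p 0 (baseOpen (W k))).1 y =
        ∑ j, (t w).1.2.2 j * (c j u).1 ⟨y.1, hWV₀ k y.2⟩ := by
      rw [AddSubmonoidClass.coe_finsetSum, Finset.sum_apply]
      rfl
    rw [Submodule.coe_add, Pi.add_apply, h5, add_comm]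
  · intro u N
    have hu : u ∈ Submodule.span ℂ (Set.range f) := hf ▸ Submodule.mem_top
    induction hu using Submodule.span_induction with
    | mem u hu =>
      obtain ⟨n, rfl⟩ := hu
      -- Long words have lifts of seminorm less than 1. There are finitely many shorter ones, and
      -- each of them has its own bound because it belongs to `BoundedHoms`.
      obtain ⟨L, hL⟩ := htn (max n N)
      refine exists_bound_of_finite (hfin L) (fun w (y : baseOpen (W k)) =>
        ‖((t w).1.2.1.1 (f n)).1 y‖ * weight y.1.1 ^ N) (fun w => (t w).1.2.1.2 (f n) N) 1
        fun w hw y => ?_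
      refine (le_supNorm (f n) N (t w).1.2.1 y).trans ((supNorm_le_seqNorm f n N _).trans ?_)
      have h1 : liftNorm e f (max n N) (t w).1 < 1 := hL w (not_lt.1 hw)
      rw [liftNorm_apply] at h1
      have h2 : 0 ≤ seqNorm e (max n N) (t w).1.1 := apply_nonneg _ _
      linarith [norm_nonneg (t w).1.2.2]
    | zero => exact ⟨0, fun w y => by simp⟩
    | add a b _ _ ha hb =>
      obtain ⟨A, hA⟩ := ha
      obtain ⟨A', hA'⟩ := hb
      refine ⟨A + A', fun w y => ?_⟩
      have := weight_nonneg y.1.1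
      rw [map_add]
      calc _ ≤ (‖((t w).1.2.1.1 a).1 y‖ + ‖((t w).1.2.1.1 b).1 y‖) * weight y.1.1 ^ N := by
            gcongr; exact norm_add_le _ _
        _ ≤ _ := by rw [add_mul]; exact add_le_add (hA w y) (hA' w y)
    | smul a b _ hb =>
      obtain ⟨A, hA⟩ := hb
      refine ⟨‖a‖ * A, fun w y => ?_⟩
      rw [apply_complex_smul]
      change ‖a * ((t w).1.2.1.1 b).1 y‖ * weight y.1.1 ^ N ≤ _
      rw [norm_mul, mul_assoc]
      gcongr
      exact hA w y
  · obtain ⟨L, hL⟩ := htn 0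
    refine exists_bound_of_finite (hfin L) (fun w (j : Fin h) => ‖(t w).1.2.2 j‖)
      (fun w => ⟨‖(t w).1.2.2‖, fun j => norm_le_pi_norm _ j⟩) 1 fun w hw j => ?_
    refine (norm_le_pi_norm _ j).trans ?_
    have h1 : liftNorm e f 0 (t w).1 < 1 := hL w (not_lt.1 hw)
    rw [liftNorm_apply] at h1
    have h2 : 0 ≤ seqNorm e 0 (t w).1.1 := apply_nonneg _ _
    have h3 : 0 ≤ seqNorm f 0 (t w).1.2.1 := apply_nonneg _ _
    linarith
end
end RapidDecay

namespace RapidDecay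
noncomputable section
variable {q : ℕ}

/-! ### Taylor expansions indexed by words -/

/-- The partial derivatives of higher order. -/
def wordDeriv (G : (Fin q → ℂ) → ℂ) : (k : ℕ) → (Fin k → Fin q) → (Fin q → ℂ) → ℂ
  | 0, _ => G
  | k + 1, w => fun σ => fderiv ℂ (wordDeriv G k (Fin.tail w)) σ (Pi.single (w 0) 1)

lemma analyticOnNhd_wordDeriv {G : (Fin q → ℂ) → ℂ} {O : Set (Fin q → ℂ)}
    (hG : AnalyticOnNhd ℂ G O) (k : ℕ) (w : Fin k → Fin q) :
    AnalyticOnNhd ℂ (wordDeriv G k w) O := by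
  induction k with
  | zero => exact hG
  | succ k ih => exact fun σ hσ => ((ContinuousLinearMap.apply ℂ ℂ
      (Pi.single (w 0) 1 : Fin q → ℂ)).analyticAt _).comp (ih (Fin.tail w) σ hσ).fderiv

lemma hasDerivAt_single_line {H : (Fin q → ℂ) → ℂ} {σ : Fin q → ℂ} {i : Fin q} {ζ : ℂ}
    (hH : DifferentiableAt ℂ H (σ + Pi.single i ζ)) :
    HasDerivAt (fun ζ : ℂ => H (σ + Pi.single i ζ))
      (fderiv ℂ H (σ + Pi.single i ζ) (Pi.single i 1)) ζ :=
  hH.hasFDerivAt.comp_hasDerivAt ζ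
    (((ContinuousLinearMap.single ℂ (fun _ : Fin q => ℂ) i).hasDerivAt (x := ζ)).const_add σ)

lemma norm_pi_single_le (i : Fin q) (ζ : ℂ) : ‖(Pi.single i ζ : Fin q → ℂ)‖ ≤ ‖ζ‖ := by
  rw [pi_norm_le_iff_of_nonneg (norm_nonneg _)]
  intro j
  rcases eq_or_ne j i with rfl | h
  · simp
  · simp [h]

/-- Cauchy's inequality in one coordinate, on a disc of radius ρ that stays inside the larger ball.
-/
lemma norm_fderiv_single_le {H : (Fin q → ℂ) → ℂ} {r ρ A : ℝ} (hρ : 0 < ρ)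
    (hH : AnalyticOnNhd ℂ H (Metric.closedBall 0 (r + ρ)))
    (hA : ∀ σ ∈ Metric.closedBall 0 (r + ρ), ‖H σ‖ ≤ A) {σ : Fin q → ℂ} (hσ : ‖σ‖ ≤ r)
    (i : Fin q) : ‖fderiv ℂ H σ (Pi.single i 1)‖ ≤ A / ρ := by
  have hmem : ∀ ζ ∈ Metric.closedBall (0 : ℂ) ρ,
      σ + Pi.single i ζ ∈ Metric.closedBall (0 : Fin q → ℂ) (r + ρ) := by
    intro ζ hζ
    rw [mem_closedBall_zero_iff] at hζ ⊢
    exact (norm_add_le _ _).trans (add_le_add hσ ((norm_pi_single_le i ζ).trans hζ))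
  have hd : ∀ ζ ∈ Metric.closedBall (0 : ℂ) ρ, HasDerivAt (fun ζ : ℂ => H (σ + Pi.single i ζ))
      (fderiv ℂ H (σ + Pi.single i ζ) (Pi.single i 1)) ζ :=
    fun ζ hζ => hasDerivAt_single_line (hH _ (hmem ζ hζ)).differentiableAt
  have h0 := (hd 0 (by simp [hρ.le])).deriv
  have hdc : DiffContOnCl ℂ (fun ζ : ℂ => H (σ + Pi.single i ζ)) (Metric.ball 0 ρ) :=
    DifferentiableOn.diffContOnCl fun ζ hζ => (hd ζ
      (Metric.closure_ball_subset_closedBall hζ)).differentiableAt.differentiableWithinAt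
  have hcauchy := Complex.norm_deriv_le_of_forall_mem_sphere_norm_le hρ hdc
    (fun ζ hζ => hA _ (hmem ζ (Metric.sphere_subset_closedBall hζ)))
  rw [h0] at hcauchy
  simpa using hcauchy

/-- Cauchy's inequality is applied k times, each time giving up R/k of the radius, so the k
derivatives together use up exactly R and each costs a factor k/R. -/
lemma norm_wordDeriv_le {G : (Fin q → ℂ) → ℂ} {R M : ℝ} (hR : 0 < R)
    (hG : AnalyticOnNhd ℂ G (Metric.closedBall 0 R)) (hM : ∀ σ ∈ Metric.closedBall 0 R, ‖G σ‖ ≤ M)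
    (k : ℕ) (w : Fin k → Fin q) : ‖wordDeriv G k w 0‖ ≤ M * (k / R) ^ k := by
  rcases Nat.eq_zero_or_pos k with rfl | hk
  · simpa [wordDeriv] using hM 0 (by simp [hR.le])
  have hk' : (0 : ℝ) < k := by exact_mod_cast hk
  have hRk : 0 < R / k := by positivity
  have key : ∀ m, m ≤ k → ∀ (w : Fin m → Fin q), ∀ σ ∈ Metric.closedBall (0 : Fin q → ℂ)
      (R - m * (R / k)), ‖wordDeriv G m w σ‖ ≤ M * (k / R) ^ m := by
    intro m
    induction m with
    | zero => intro _ w σ hσ; simpa [wordDeriv] using hM σ (by simpa using hσ)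
    | succ m ih =>
      intro hm w σ hσ
      rw [mem_closedBall_zero_iff] at hσ
      have hr : R - (m + 1 : ℕ) * (R / k) + R / k = R - m * (R / k) := by push_cast; ring
      have han := (analyticOnNhd_wordDeriv hG m (Fin.tail w)).mono
        (Metric.closedBall_subset_closedBall (show R - m * (R / k) ≤ R by
          have : 0 ≤ (m : ℝ) * (R / k) := by positivity
          linarith))
      have hA := ih (by omega) (Fin.tail w)
      rw [← hr] at han hA
      refine (norm_fderiv_single_le hRk han hA hσ (w 0)).trans (le_of_eq ?_)
      rw [pow_succ]
      field_simp
  refine key k le_rfl w 0 ?_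
  rw [mul_div_cancel₀ _ hk'.ne', sub_self]
  simp

lemma hasDerivAt_line {H : (Fin q → ℂ) → ℂ} {σ : Fin q → ℂ} {ζ : ℂ}
    (hH : DifferentiableAt ℂ H (ζ • σ)) :
    HasDerivAt (fun ζ : ℂ => H (ζ • σ)) (∑ i, σ i * fderiv ℂ H (ζ • σ) (Pi.single i 1)) ζ := by
  have h1 : HasDerivAt (fun ζ : ℂ => ζ • σ) σ ζ := by
    simpa using (hasDerivAt_id ζ).smul_const σ
  have h2 := hH.hasFDerivAt.comp_hasDerivAt ζ h1
  have h3 := congrArg (fderiv ℂ H (ζ • σ)) (Finset.univ_sum_single σ)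
  rw [map_sum] at h3
  have h4 : ∑ i, σ i * fderiv ℂ H (ζ • σ) (Pi.single i 1) = fderiv ℂ H (ζ • σ) σ := by
    rw [← h3]
    refine Finset.sum_congr rfl fun i _ => ?_
    rw [← smul_eq_mul, ← map_smul, ← Pi.single_smul, smul_eq_mul, mul_one]
  rw [h4]
  exact h2

/-- Words, rather than multi-indices, make the chain rule along a line an induction without binomial
coefficients: one more derivative adds one more letter. -/
lemma iteratedDeriv_line {G : (Fin q → ℂ) → ℂ} {O : Set (Fin q → ℂ)} (hO : IsOpen O)
    (hG : AnalyticOnNhd ℂ G O) (σ : Fin q → ℂ) (k : ℕ) : ∀ ζ : ℂ, ζ • σ ∈ O →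
    iteratedDeriv k (fun ζ : ℂ => G (ζ • σ)) ζ =
      ∑ w : Fin k → Fin q, (∏ i, σ (w i)) * wordDeriv G k w (ζ • σ) := by
  induction k with
  | zero => intro ζ _; simp [wordDeriv]
  | succ k ih =>
    intro ζ hζ
    rw [iteratedDeriv_succ]
    have hopen : IsOpen {ζ : ℂ | ζ • σ ∈ O} := hO.preimage (by fun_prop)
    have h1 : iteratedDeriv k (fun ζ : ℂ => G (ζ • σ)) =ᶠ[𝓝 ζ]
        fun ζ => ∑ w : Fin k → Fin q, (∏ i, σ (w i)) * wordDeriv G k w (ζ • σ) := by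
      filter_upwards [hopen.mem_nhds hζ] with ζ' hζ'
      exact ih ζ' hζ'
    rw [h1.deriv_eq]
    have h2 := HasDerivAt.fun_sum (u := (Finset.univ : Finset (Fin k → Fin q))) fun w _ =>
      (hasDerivAt_line (σ := σ) (ζ := ζ)
        (analyticOnNhd_wordDeriv hG k w _ hζ).differentiableAt).const_mul (∏ i, σ (w i))
    rw [h2.deriv, ← (Fin.consEquiv fun _ => Fin q).sum_comp, Fintype.sum_prod_type,
      Finset.sum_comm]
    refine Finset.sum_congr rfl fun w _ => ?_
    rw [Finset.mul_sum]
    refine Finset.sum_congr rfl fun i _ => ?_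
    have h3 : Fin.tail (Fin.consEquiv (fun _ : Fin (k + 1) => Fin q) (i, w)) = w := rfl
    simp only [wordDeriv, h3, Fin.consEquiv_apply, Fin.prod_univ_succ, Fin.cons_zero, Fin.cons_succ]
    ring

/-- The Taylor expansion of an analytic function on a polydisc. -/
theorem hasSum_taylor_words {G : (Fin q → ℂ) → ℂ} {R : ℝ}
    (hG : AnalyticOnNhd ℂ G (Metric.ball 0 R)) {σ : Fin q → ℂ} (hσ : ‖σ‖ < R) :
    HasSum (fun k : ℕ => ∑ w : Fin k → Fin q,
      (∏ i, σ (w i)) * ((k.factorial : ℂ)⁻¹ * wordDeriv G k w 0)) (G σ) := by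
  have hR : 0 < R := (norm_nonneg _).trans_lt hσ
  have hRσ : 0 < R + ‖σ‖ := by positivity
  -- The radius 2R/(R + ‖σ‖) exceeds 1 because ‖σ‖ < R, and its product with ‖σ‖ is at most R. The
  -- Taylor series along the line can thus be evaluated at ζ = 1.
  have hmem : ∀ ζ ∈ Metric.ball (0 : ℂ) (2 * R / (R + ‖σ‖)), ζ • σ ∈ Metric.ball 0 R := by
    intro ζ hζ
    rw [mem_ball_zero_iff] at hζ ⊢
    rw [norm_smul]
    rcases (norm_nonneg σ).eq_or_lt with h | h
    · rw [← h, mul_zero]; exact hR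
    calc ‖ζ‖ * ‖σ‖ < 2 * R / (R + ‖σ‖) * ‖σ‖ := by gcongr
      _ ≤ R := by
        rw [div_mul_eq_mul_div, div_le_iff₀ hRσ]
        nlinarith
  have h1 : DifferentiableOn ℂ (fun ζ : ℂ => G (ζ • σ))
      (Metric.ball (0 : ℂ) (2 * R / (R + ‖σ‖))) := fun ζ hζ =>
    (hasDerivAt_line (hG _ (hmem ζ hζ)).differentiableAt).differentiableAt.differentiableWithinAt
  have h2 : (1 : ℂ) ∈ Metric.ball (0 : ℂ) (2 * R / (R + ‖σ‖)) := by
    rw [mem_ball_zero_iff, norm_one, lt_div_iff₀ hRσ]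
    linarith
  have h3 := Complex.hasSum_taylorSeries_on_ball h1 h2
  simp only [sub_zero, one_pow, one_smul] at h3
  refine h3.congr_fun ?_ |> id
  intro k
  rw [iteratedDeriv_line Metric.isOpen_ball hG σ k 0 (by simpa using hR), zero_smul, smul_eq_mul,
    Finset.mul_sum]
  refine Finset.sum_congr rfl fun w _ => ?_
  ring

/-- From k^k / k! ≤ e^k, the k-fold Cauchy estimate becomes geometric with ratio e/R. -/
lemma norm_taylor_word_le {G : (Fin q → ℂ) → ℂ} {R M : ℝ} (hR : 0 < R)
    (hG : AnalyticOnNhd ℂ G (Metric.closedBall 0 R)) (hM : ∀ σ ∈ Metric.closedBall 0 R, ‖G σ‖ ≤ M)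
    (k : ℕ) (w : Fin k → Fin q) :
    ‖(k.factorial : ℂ)⁻¹ * wordDeriv G k w 0‖ ≤ M * (Real.exp 1 / R) ^ k := by
  have hM0 : 0 ≤ M := (norm_nonneg _).trans (hM 0 (by simp [hR.le]))
  have h1 := Real.pow_div_factorial_le_exp (x := k) (by positivity) k
  have h2 := norm_wordDeriv_le hR hG hM k w
  rw [norm_mul, norm_inv, Complex.norm_natCast]
  calc (k.factorial : ℝ)⁻¹ * ‖wordDeriv G k w 0‖ ≤ (k.factorial : ℝ)⁻¹ * (M * (k / R) ^ k) := by
        gcongr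
    _ = M * ((k : ℝ) ^ k / k.factorial) / R ^ k := by rw [div_pow]; ring
    _ ≤ M * Real.exp k / R ^ k := by gcongr
    _ = M * (Real.exp 1 / R) ^ k := by
        rw [div_pow, ← Real.exp_nat_mul, mul_one, mul_div_assoc]
end
end RapidDecay

namespace RapidDecay
noncomputable section
variable {p q : ℕ}

/-! ### Expansion of solutions with parameters -/

lemma continuous_proj : Continuous (proj : (Fin q → ℂ) → Par q) := QuotientAddGroup.continuous_mk

/-- A lattice vector with sup norm less than 1 has integral coordinates of absolute value less than
1, so it is zero. -/
lemma eq_of_proj_eq {s t : Fin q → ℂ} (h : proj s = proj t) (hst : ‖s - t‖ < 1) : s = t := by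
  have h1 : -s + t ∈ lattice q := QuotientAddGroup.eq.1 h
  funext j
  obtain ⟨n, hn⟩ := h1 j
  have h2 : ‖(s - t) j‖ < 1 := (norm_le_pi_norm _ j).trans_lt hst
  have h3 : (s - t) j = -(n : ℂ) := by rw [← hn]; simp; ring
  rw [h3, norm_neg, Complex.norm_intCast] at h2
  have h4 : n = 0 := by
    have : |n| < 1 := by exact_mod_cast h2
    exact Int.abs_lt_one_iff.1 this
  rw [h4] at h3
  simpa [sub_eq_zero] using h3

/-- Local coordinates on the parameter space. -/
lemma exists_chart (σ₀ : Fin q → ℂ) {r : ℝ} (hr : 0 < r) (hr' : r ≤ 1 / 2) :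
    ∃ (O : Opens (Par q)) (τ : Par q → Fin q → ℂ), proj σ₀ ∈ O ∧
      (∀ y ∈ O, ‖τ y‖ < r ∧ proj (σ₀ + τ y) = y) ∧
      ∀ H : (Fin q → ℂ) → ℂ, AnalyticOnNhd ℂ H (Metric.ball 0 r) →
        AnalyticOnNhd ℂ (fun s : Fin q → ℂ => H (τ (proj s))) {s | proj s ∈ O} := by
  have hO : IsOpen (proj '' Metric.ball σ₀ r : Set (Par q)) :=
    QuotientAddGroup.isOpenMap_coe _ Metric.isOpen_ball
  have hex : ∀ y : Par q, ∃ σ : Fin q → ℂ, y ∈ (proj '' Metric.ball σ₀ r : Set (Par q)) →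
      ‖σ‖ < r ∧ proj (σ₀ + σ) = y := by
    intro y
    by_cases hy : y ∈ (proj '' Metric.ball σ₀ r : Set (Par q))
    · obtain ⟨s, hs, rfl⟩ := hy
      refine ⟨s - σ₀, fun _ => ⟨by rwa [← mem_ball_iff_norm], by simp⟩⟩
    · exact ⟨0, fun h => absurd h hy⟩
  choose τ hτ using hex
  refine ⟨⟨_, hO⟩, τ, ⟨σ₀, Metric.mem_ball_self hr, rfl⟩, hτ, fun H hH s hs => ?_⟩
  obtain ⟨h1, h2⟩ := hτ _ hs
  set ℓ := s - (σ₀ + τ (proj s)) with hℓ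
  -- Locally the chosen section τ is a translation: both sides project to the same point, and both
  -- have norm less than r ≤ 1/2, so they differ by less than 1.
  have hev : ∀ᶠ s' in 𝓝 s, τ (proj s') = s' - (s - τ (proj s)) := by
    have hc : ContinuousAt (fun s' : Fin q → ℂ => ‖s' - (s - τ (proj s))‖) s := by fun_prop
    have hlt := hc.eventually_lt (continuousAt_const (y := r)) (by simpa using h1)
    have hmem : ∀ᶠ s' in 𝓝 s, proj s' ∈ (proj '' Metric.ball σ₀ r : Set (Par q)) :=
      continuous_proj.continuousAt.eventually (hO.mem_nhds hs)
    filter_upwards [hlt, hmem] with s' h3 h4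
    obtain ⟨h5, h6⟩ := hτ _ h4
    refine eq_of_proj_eq ?_ ?_
    · have e1 : proj (τ (proj s')) = proj s' - proj σ₀ :=
        eq_sub_of_add_eq (by rw [add_comm]; exact h6)
      have e2 : proj (τ (proj s)) = proj s - proj σ₀ :=
        eq_sub_of_add_eq (by rw [add_comm]; exact h2)
      have e3 : proj (s' - (s - τ (proj s))) = proj s' - (proj s - proj (τ (proj s))) := rfl
      rw [e1, e3, e2]
      abel
    · refine (norm_sub_le _ _).trans_lt ?_
      linarith
  have h7 : AnalyticAt ℂ (fun s' : Fin q → ℂ => H (s' - (s - τ (proj s)))) s := by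
    refine AnalyticAt.fun_comp (f := fun s' : Fin q → ℂ => s' - (s - τ (proj s))) ?_ (by fun_prop)
    refine hH _ ?_
    simpa using h1
  refine h7.congr ?_
  filter_upwards [hev] with s' h
  rw [h]

lemma exists_paramSection {V : Opens (CBar p × Par q)} {O : Opens (Par q)} {g : Par q → ℂ}
    (hg : AnalyticOnNhd ℂ (fun s : Fin q → ℂ => g (proj s)) {s | proj s ∈ O})
    (hV : ∀ z ∈ V, z.2 ∈ O) : ∃ G : paramSections p q V, ∀ z, G.1 z = g z.1.2 :=
  ⟨⟨fun z => g z.1.2, fun z hz => ⟨O, g, hV z hz, hg, by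
    filter_upwards [V.isOpen.mem_nhds hz] with w hw
    rw [ext_of_mem _ hw]⟩⟩, fun _ => rfl⟩

/-- Iterated derivatives of sections with respect to the parameters. -/
def secWord (U : Opens (CBar p × Par q)) :
    (k : ℕ) → (Fin k → Fin q) → rapidSections p q U →ₗ[DAlg p] rapidSections p q U
  | 0, _ => LinearMap.id
  | k + 1, w => secSd U (w 0) ∘ₗ secWord U k (Fin.tail w)

lemma isOpen_fibre (U : Opens (CBar p × Par q)) (y : CBar p) (σ₀ : Fin q → ℂ) :
    IsOpen {σ : Fin q → ℂ | (y, proj (σ₀ + σ)) ∈ U} :=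
  U.isOpen.preimage ((continuous_const (y := y)).prodMk
    (continuous_proj.comp (continuous_const.add continuous_id)))

/-- Over the interior this is holomorphy with t frozen. Over a boundary point the function is zero
along the whole fibre, so no separate case is needed later. -/
lemma analyticOnNhd_fibre {U : Opens (CBar p × Par q)} (f : rapidSections p q U) (y : CBar p)
    (σ₀ : Fin q → ℂ) : AnalyticOnNhd ℂ (fun σ => ext f.1 (y, proj (σ₀ + σ)))
      {σ : Fin q → ℂ | (y, proj (σ₀ + σ)) ∈ U} := by
  intro σ hσ
  by_cases hy : y ∈ torus p
  · have h1 : AnalyticAt ℂ (lift (ext f.1)) (coord y, σ₀ + σ) :=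
      RapidDecayOn.holo f.2 _ ⟨coord_ne_zero hy, by rw [incl_coord hy]; exact hσ⟩
    have h2 := AnalyticAt.fun_comp (f := fun σ : Fin q → ℂ => (coord y, σ₀ + σ)) (x := σ) h1
      (analyticAt_const.prod (by fun_prop))
    simpa only [lift, incl_coord hy] using h2
  · refine (analyticAt_const (v := (0 : ℂ))).congr ?_
    filter_upwards [(isOpen_fibre U y σ₀).mem_nhds hσ] with σ' h
    exact (RapidDecayOn.boundary f.2 _ h hy).symm

/-- The derivatives of sections, which are D-linear operators, are computed fibre by fibre in the
coordinate σ. This links linearity over D to the Taylor formula on the fibre. -/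
lemma ext_secWord {U : Opens (CBar p × Par q)} (f : rapidSections p q U) (y : CBar p)
    (σ₀ : Fin q → ℂ) (k : ℕ) (w : Fin k → Fin q) : ∀ σ, (y, proj (σ₀ + σ)) ∈ U →
      ext (secWord U k w f).1 (y, proj (σ₀ + σ)) =
        wordDeriv (fun σ => ext f.1 (y, proj (σ₀ + σ))) k w σ := by
  induction k with
  | zero => intro σ _; rfl
  | succ k ih =>
    intro σ hσ
    rw [ext_of_mem _ hσ]
    change deriv (fun ζ : ℂ => ext (secWord U k (Fin.tail w) f).1
      (y, proj (σ₀ + σ) + proj (Pi.single (w 0) ζ))) 0 = _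
    have hd := hasDerivAt_single_line (σ := σ) (i := w 0) (ζ := 0)
      (H := wordDeriv (fun σ => ext f.1 (y, proj (σ₀ + σ))) k (Fin.tail w))
      (analyticOnNhd_wordDeriv (analyticOnNhd_fibre f y σ₀) k (Fin.tail w) _
        (by simpa using hσ)).differentiableAt
    have h0 : σ + Pi.single (w 0) (0 : ℂ) = σ := by simp
    rw [h0] at hd
    refine Eq.trans (Filter.EventuallyEq.deriv_eq ?_) hd.deriv
    have hc : Continuous fun ζ : ℂ => σ + Pi.single (w 0) ζ :=
      continuous_const.add (ContinuousLinearMap.single ℂ (fun _ : Fin q => ℂ) (w 0)).continuous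
    have hev := (hc.continuousAt (x := 0)).eventually
      ((isOpen_fibre U y σ₀).mem_nhds (by simpa using hσ))
    filter_upwards [hev] with ζ hζ
    rw [← ih (Fin.tail w) _ hζ, ← add_assoc]
    rfl

/-- The monomial attached to a word, in scaled variables. -/
def wordMonomial (c : ℂ) (k : ℕ) (w : Fin k → Fin q) (σ : Fin q → ℂ) : ℂ := ∏ i, c * σ (w i)

lemma analyticOnNhd_wordMonomial (c : ℂ) (k : ℕ) (w : Fin k → Fin q) (O : Set (Fin q → ℂ)) :
    AnalyticOnNhd ℂ (wordMonomial c k w) O := by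
  intro σ _
  refine Finset.analyticAt_fun_prod _ fun i _ => ?_
  exact analyticAt_const.mul
    ((ContinuousLinearMap.proj (R := ℂ) (φ := fun _ : Fin q => ℂ) (w i)).analyticAt σ)

/-- There are q^k words of length k and each monomial is at most (‖c‖r)^k. The condition on r makes
the product at most 2^{-k}, for any weight ω. -/
lemma norm_sum_wordMonomial_le {c : ℂ} {σ : Fin q → ℂ} {r : ℝ} (hσ : ‖σ‖ ≤ r)
    (hr : q * (‖c‖ * r) ≤ 1 / 2) {k : ℕ} (α : (Fin k → Fin q) → ℂ) {A ω : ℝ} (hω : 0 ≤ ω)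
    (hA0 : 0 ≤ A)
    (hα : ∀ w, ‖α w‖ * ω ≤ A) : ‖∑ w, wordMonomial c k w σ * α w‖ * ω ≤ A * (1 / 2) ^ k := by
  have hr0 : 0 ≤ r := (norm_nonneg _).trans hσ
  have hm : ∀ w, ‖wordMonomial c k w σ‖ ≤ (‖c‖ * r) ^ k := by
    intro w
    rw [wordMonomial, norm_prod]
    have h1 : ∏ _i : Fin k, ‖c‖ * r = (‖c‖ * r) ^ k := by simp
    rw [← h1]
    refine Finset.prod_le_prod (fun i _ => norm_nonneg _) fun i _ => ?_
    rw [norm_mul]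
    gcongr
    exact (norm_le_pi_norm σ _).trans hσ
  have hA : ∀ w, ‖wordMonomial c k w σ * α w‖ * ω ≤ (‖c‖ * r) ^ k * A := by
    intro w
    rw [norm_mul, mul_assoc]
    exact mul_le_mul (hm w) (hα w) (by positivity) (by positivity)
  calc ‖∑ w, wordMonomial c k w σ * α w‖ * ω
      ≤ ∑ w, ‖wordMonomial c k w σ * α w‖ * ω := by
        rw [← Finset.sum_mul]
        gcongr
        exact norm_sum_le _ _
    _ ≤ ∑ _w : Fin k → Fin q, (‖c‖ * r) ^ k * A := Finset.sum_le_sum fun w _ => hA w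
    _ = A * (q * (‖c‖ * r)) ^ k := by
        rw [Finset.sum_const, Finset.card_univ]
        simp [mul_pow]
        ring
    _ ≤ A * (1 / 2) ^ k := by gcongr
end
end RapidDecay

/-! ### Taylor coefficients of sections, and resummation in the parameters -/

namespace RapidDecay
noncomputable section
variable {p q : ℕ}

/-- The scaled Taylor coefficients in the parameters of a section. -/
def taylorCoeff {U : Opens (CBar p × Par q)} {V : Opens (CBar p × Par 0)} (σ₀ : Fin q → ℂ)
    (h : ∀ z ∈ V, (z.1, proj σ₀) ∈ U) (Λ : ℂ) (k : ℕ) (w : Fin k → Fin q) :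
    rapidSections p q U →ₗ[DAlg p] rapidSections p 0 V :=
  (Λ ^ k * (k.factorial : ℂ)⁻¹) • (constParam (proj σ₀) h ∘ₗ secWord U k w)

lemma taylorCoeff_apply {U : Opens (CBar p × Par q)} {V : Opens (CBar p × Par 0)}
    (σ₀ : Fin q → ℂ) (h : ∀ z ∈ V, (z.1, proj σ₀) ∈ U) (Λ : ℂ) (k : ℕ) (w : Fin k → Fin q)
    (f : rapidSections p q U) (y : V) : (taylorCoeff σ₀ h Λ k w f).1 y =
      Λ ^ k * ((k.factorial : ℂ)⁻¹ *
        wordDeriv (fun σ => ext f.1 (y.1.1, proj (σ₀ + σ))) k w 0) := by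
  have h1 := ext_secWord f y.1.1 σ₀ k w 0 (by simpa using h _ y.2)
  rw [add_zero] at h1
  rw [← h1, ext_of_mem _ (h _ y.2), ← mul_assoc]
  rfl

/-- The Taylor coefficients grow at most like (e/R)^k. The scale R/(2e) turns this into 2^{-k} for
every weight exponent at once, which makes the coefficients a null family. -/
lemma norm_taylorCoeff_le {U : Opens (CBar p × Par q)} {V : Opens (CBar p × Par 0)}
    (σ₀ : Fin q → ℂ) (h : ∀ z ∈ V, (z.1, proj σ₀) ∈ U) {R : ℝ} (hR : 0 < R) {N : ℕ} {C : ℝ}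
    (f : rapidSections p q U) (y : V)
    (hU : ∀ σ ∈ Metric.closedBall 0 R, (y.1.1, proj (σ₀ + σ)) ∈ U)
    (hf : ∀ σ ∈ Metric.closedBall 0 R, ‖ext f.1 (y.1.1, proj (σ₀ + σ))‖ * weight y.1.1 ^ N ≤ C)
    (k : ℕ) (w : Fin k → Fin q) :
    ‖(taylorCoeff σ₀ h ((R / (2 * Real.exp 1) : ℝ) : ℂ) k w f).1 y‖ * weight y.1.1 ^ N ≤
      C * (1 / 2) ^ k := by
  have hω : 0 ≤ weight y.1.1 ^ N := pow_nonneg (weight_nonneg _) _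
  have hC : 0 ≤ C := le_trans (by positivity) (hf 0 (by simp [hR.le]))
  rcases hω.eq_or_lt with h0 | hpos
  · rw [← h0, mul_zero]
    positivity
  have h1 := norm_taylor_word_le hR ((analyticOnNhd_fibre f y.1.1 σ₀).mono hU)
    (M := C / weight y.1.1 ^ N) (fun σ hσ => by rw [le_div_iff₀ hpos]; exact hf σ hσ) k w
  rw [taylorCoeff_apply, norm_mul, norm_pow, Complex.norm_real,
    Real.norm_of_nonneg (by positivity)]
  calc _ ≤ (R / (2 * Real.exp 1)) ^ k * (C / weight y.1.1 ^ N * (Real.exp 1 / R) ^ k) *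
        weight y.1.1 ^ N := by gcongr
    _ = C * ((R / (2 * Real.exp 1)) * (Real.exp 1 / R)) ^ k := by
        rw [mul_pow]; field_simp
    _ = C * (1 / 2) ^ k := by
        congr 2
        have := Real.exp_pos 1
        field_simp

/-- The factor Λ^k in the coefficients is cancelled by the monomials in the variables σ/Λ. -/
lemma hasSum_taylorCoeff {U : Opens (CBar p × Par q)} {V : Opens (CBar p × Par 0)}
    (σ₀ : Fin q → ℂ) (h : ∀ z ∈ V, (z.1, proj σ₀) ∈ U) {Λ : ℂ} (hΛ : Λ ≠ 0) {R : ℝ}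
    (f : rapidSections p q U) (y : V)
    (hU : ∀ σ ∈ Metric.ball 0 R, (y.1.1, proj (σ₀ + σ)) ∈ U) {σ : Fin q → ℂ} (hσ : ‖σ‖ < R) :
    HasSum (fun k : ℕ => ∑ w : Fin k → Fin q,
      wordMonomial Λ⁻¹ k w σ * (taylorCoeff σ₀ h Λ k w f).1 y)
      (ext f.1 (y.1.1, proj (σ₀ + σ))) := by
  have h1 := hasSum_taylor_words ((analyticOnNhd_fibre f y.1.1 σ₀).mono hU) hσ
  refine h1.congr_fun ?_ |> id
  intro k
  refine Finset.sum_congr rfl fun w _ => ?_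
  rw [taylorCoeff_apply, wordMonomial, Finset.prod_mul_distrib, Finset.prod_const,
    Finset.card_univ, Fintype.card_fin, inv_pow]
  field_simp

/-- Power series in words with bounded coefficients converge. -/
lemma exists_wordSeries {c : ℂ} {r : ℝ} (hr : q * (‖c‖ * r) ≤ 1 / 2)
    (a : (Σ k : ℕ, Fin k → Fin q) → ℂ) {A : ℝ} (ha : ∀ w, ‖a w‖ ≤ A) :
    ∃ H : (Fin q → ℂ) → ℂ, AnalyticOnNhd ℂ H (Metric.ball 0 r) ∧ ∀ σ ∈ Metric.ball 0 r,
      HasSum (fun k : ℕ => ∑ w : Fin k → Fin q, wordMonomial c k w σ * a ⟨k, w⟩) (H σ) := by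
  have hA : 0 ≤ A := (norm_nonneg _).trans (ha ⟨0, Fin.elim0⟩)
  have hle : ∀ k : ℕ, ∀ σ ∈ Metric.ball 0 r,
      ‖∑ w : Fin k → Fin q, wordMonomial c k w σ * a ⟨k, w⟩‖ ≤ A * (1 / 2) ^ k := by
    intro k σ hσ
    have := norm_sum_wordMonomial_le (mem_ball_zero_iff.1 hσ).le hr (fun w => a ⟨k, w⟩)
      (ω := 1) zero_le_one hA (fun w => by simpa using ha ⟨k, w⟩)
    simpa using this
  have hs : Summable fun k : ℕ => A * (1 / 2 : ℝ) ^ k :=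
    (summable_geometric_of_lt_one (by norm_num) (by norm_num)).mul_left A
  refine ⟨fun σ => ∑' k : ℕ, ∑ w : Fin k → Fin q, wordMonomial c k w σ * a ⟨k, w⟩, ?_, ?_⟩
  · refine analyticOnNhd_of_tendstoLocallyUniformlyOn Metric.isOpen_ball (fun n => ?_)
      (tendstoUniformlyOn_tsum_nat hs hle).tendstoLocallyUniformlyOn
    intro σ hσ
    refine Finset.analyticAt_fun_sum _ fun k _ => Finset.analyticAt_fun_sum _ fun w _ => ?_
    exact (analyticOnNhd_wordMonomial c k w _ σ hσ).mul analyticAt_const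
  · exact fun σ hσ => (Summable.of_norm_bounded hs fun k => hle k σ hσ).hasSum

/-- Resummation of a bounded family of homomorphisms. -/
lemma exists_resum {C : Type} [AddCommGroup C] [Module (DAlg p) C] {W : Opens (CBar p)}
    {O : Opens (Par q)} {τ : Par q → Fin q → ℂ} {c : ℂ} {r : ℝ} (hr : q * (‖c‖ * r) ≤ 1 / 2)
    (hτ : ∀ y ∈ O, ‖τ y‖ < r)
    (hH : ∀ H : (Fin q → ℂ) → ℂ, AnalyticOnNhd ℂ H (Metric.ball 0 r) →
      AnalyticOnNhd ℂ (fun s : Fin q → ℂ => H (τ (proj s))) {s | proj s ∈ O})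
    (g : (Σ k : ℕ, Fin k → Fin q) → C →ₗ[DAlg p] rapidSections p 0 (baseOpen W))
    (hg : ∀ u N, ∃ A : ℝ, ∀ w y, ‖(g w u).1 y‖ * weight y.1.1 ^ N ≤ A)
    {V : Opens (CBar p × Par q)} (hVO : ∀ z ∈ V, z.2 ∈ O)
    (hVW : ∀ z ∈ V, (z.1, (0 : Par 0)) ∈ baseOpen W) :
    ∃ ψ : C →ₗ[DAlg p] rapidSections p q V, ∀ u (z : V), Filter.Tendsto
      (fun n => ∑ k ∈ Finset.range n, ∑ w : Fin k → Fin q,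
        wordMonomial c k w (τ z.1.2) * (g ⟨k, w⟩ u).1 ⟨(z.1.1, 0), hVW z.1 z.2⟩)
      Filter.atTop (𝓝 ((ψ u).1 z)) := by
  have hM : ∀ w : (Σ k : ℕ, Fin k → Fin q), ∃ G : paramSections p q V, ∀ z,
      G.1 z = wordMonomial c w.1 w.2 (τ z.1.2) := fun w =>
    exists_paramSection (g := fun y => wordMonomial c w.1 w.2 (τ y))
      (hH _ (analyticOnNhd_wordMonomial c w.1 w.2 _)) hVO
  choose G hG using hM
  -- The partial sums are D-linear, because functions of the parameter commute with D. Consecutive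
  -- ones differ by the words of one length, a contribution bounded by a multiple of 2^{-n}.
  let φ : ℕ → C →ₗ[DAlg p] rapidSections p q V := fun n => ∑ k ∈ Finset.range n,
    ∑ w : Fin k → Fin q, G ⟨k, w⟩ • (constParam (0 : Par 0) hVW ∘ₗ g ⟨k, w⟩)
  have hφ : ∀ n u (z : V), (φ n u).1 z = ∑ k ∈ Finset.range n, ∑ w : Fin k → Fin q,
      wordMonomial c k w (τ z.1.2) * (g ⟨k, w⟩ u).1 ⟨(z.1.1, 0), hVW z.1 z.2⟩ := by
    intro n u z
    simp only [φ, LinearMap.sum_apply, AddSubmonoidClass.coe_finsetSum, Finset.sum_apply]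
    refine Finset.sum_congr rfl fun k _ => Finset.sum_congr rfl fun w _ => ?_
    exact congrArg (· * (g ⟨k, w⟩ u).1 ⟨(z.1.1, 0), hVW z.1 z.2⟩) (hG ⟨k, w⟩ z)
  obtain ⟨ψ, hψ, -⟩ := exists_limit φ (by
    intro u N
    obtain ⟨A, hA⟩ := hg u N
    refine ⟨fun k => max A 0 * (1 / 2) ^ k,
      (summable_geometric_of_lt_one (by norm_num) (by norm_num)).mul_left _, fun n z _ => ?_⟩
    rw [hφ, hφ, Finset.sum_range_succ, add_sub_cancel_left]
    exact norm_sum_wordMonomial_le (hτ _ (hVO z.1 z.2)).le hr _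
      (pow_nonneg (weight_nonneg _) _) (le_max_right _ _)
      fun w => (hA ⟨n, w⟩ ⟨(z.1.1, 0), hVW z.1 z.2⟩).trans (le_max_left _ _))
  exact ⟨ψ, fun u z => by simpa only [hφ] using hψ u z⟩

/-- The map (y, σ) ↦ (y, σ₀ + σ) is continuous, so a product neighbourhood fits inside its preimage
of U; local compactness makes the first factor compact. -/
lemma exists_polydisc {U : Set (CBar p × Par q)} (hU : IsOpen U) {x : CBar p} {σ₀ : Fin q → ℂ}
    (hx : (x, proj σ₀) ∈ U) {V₀ : Opens (CBar p)} (hx₀ : x ∈ V₀) :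
    ∃ (K : Set (CBar p)) (R : ℝ), IsCompact K ∧ K ∈ 𝓝 x ∧ K ⊆ V₀ ∧ 0 < R ∧
      ∀ y ∈ K, ∀ σ ∈ Metric.closedBall 0 R, (y, proj (σ₀ + σ)) ∈ U := by
  have hc : Continuous fun a : CBar p × (Fin q → ℂ) => (a.1, proj (σ₀ + a.2)) :=
    continuous_fst.prodMk (continuous_proj.comp (continuous_const.add continuous_snd))
  have h1 : (fun a : CBar p × (Fin q → ℂ) => (a.1, proj (σ₀ + a.2))) ⁻¹' U ∈ 𝓝 (x, 0) :=
    hc.continuousAt.preimage_mem_nhds (hU.mem_nhds (by simpa using hx))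
  rw [nhds_prod_eq, Filter.mem_prod_iff] at h1
  obtain ⟨A, hA, B, hB, hAB⟩ := h1
  obtain ⟨R, hR, hRB⟩ := Metric.nhds_basis_closedBall.mem_iff.1 hB
  obtain ⟨K, hK, hKA, hKc⟩ := local_compact_nhds (Filter.inter_mem hA (V₀.isOpen.mem_nhds hx₀))
  exact ⟨K, R, hKc, hK, fun y hy => (hKA hy).2, hR,
    fun y hy σ hσ => hAB (Set.mk_mem_prod (hKA hy).1 (hRB hσ))⟩

/-- If every homomorphism `B → 𝒜^{<0}` without parameters is, near `x`, a combination of the `c j`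
modulo those which factor through `d`, then so is every homomorphism with parameters, with
coefficients that are holomorphic functions of the parameters. -/
theorem exists_expansion {B C : Type} [AddCommGroup B] [AddCommGroup C] [Module (DAlg p) B]
    [Module (DAlg p) C] [Module ℂ B] [Module ℂ C] [IsScalarTower ℂ (DAlg p) B]
    [IsScalarTower ℂ (DAlg p) C] (d : B →ₗ[DAlg p] C) {e : ℕ → B} {f : ℕ → C}
    (he : Submodule.span ℂ (Set.range e) = ⊤) (hf : Submodule.span ℂ (Set.range f) = ⊤)
    {x : CBar p} {V₀ : Opens (CBar p)} (hx₀ : x ∈ V₀) {h : ℕ}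
    (c : Fin h → B →ₗ[DAlg p] rapidSections p 0 (baseOpen V₀))
    (hspan : ∀ (V : Opens (CBar p)) (hV : V ≤ V₀)
      (ξ : B →ₗ[DAlg p] rapidSections p 0 (baseOpen V)), x ∈ V →
      ∃ (W : Opens (CBar p)) (i : W ≤ V), x ∈ W ∧ ∃ (a : Fin h → ℂ)
        (y : C →ₗ[DAlg p] rapidSections p 0 (baseOpen W)), ∀ u, res (baseOpen_mono i) (ξ u) =
          ∑ j, a j • res (baseOpen_mono (i.trans hV)) (c j u) + y (d u))
    {U : Opens (CBar p × Par q)} (ξ : B →ₗ[DAlg p] rapidSections p q U) {s₀ : Par q}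
    (hx : (x, s₀) ∈ U) :
    ∃ (V : Opens (CBar p × Par q)) (i : V ≤ U) (i₀ : ∀ z ∈ V, (z.1, (0 : Par 0)) ∈ baseOpen V₀),
      (x, s₀) ∈ V ∧ ∃ (y : C →ₗ[DAlg p] rapidSections p q V) (H : Fin h → paramSections p q V),
        ∀ b, res i (ξ b) = y (d b) + ∑ j, H j • constParam 0 i₀ (c j b) := by
  obtain ⟨σ₀, rfl⟩ := QuotientAddGroup.mk_surjective s₀
  obtain ⟨K, R, hKc, hK, hKV, hR, hKU⟩ := exists_polydisc U.isOpen hx hx₀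
  let V : Opens (CBar p) := ⟨interior K, isOpen_interior⟩
  have hxV : x ∈ V := mem_interior_iff_mem_nhds.2 hK
  have hVV₀ : V ≤ V₀ := fun y hy => hKV (interior_subset hy)
  have hVU : ∀ z ∈ baseOpen V, (z.1, proj σ₀) ∈ U := fun z hz => by
    simpa using hKU z.1 (interior_subset hz) 0 (by simp [hR.le])
  set Λ : ℝ := R / (2 * Real.exp 1) with hΛ
  have hΛ0 : 0 < Λ := by positivity
  have hbd : ∀ b N, ∃ A : ℝ, ∀ (w : Σ k : ℕ, Fin k → Fin q) (y : baseOpen V),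
      ‖(taylorCoeff σ₀ hVU (Λ : ℂ) w.1 w.2 (ξ b)).1 y‖ * weight y.1.1 ^ N ≤
        A * (1 / 2) ^ w.1 := by
    intro b N
    -- Decay of ξ b is uniform on the compact image of K times the closed polydisc; this one
    -- constant serves all Taylor coefficients on V.
    have hcomp : IsCompact ((fun a : CBar p × (Fin q → ℂ) => (a.1, proj (σ₀ + a.2))) ''
        (K ×ˢ Metric.closedBall 0 R)) :=
      (hKc.prod (isCompact_closedBall 0 R)).image
        (continuous_fst.prodMk (continuous_proj.comp (continuous_const.add continuous_snd)))
    obtain ⟨A, hA⟩ := RapidDecayOn.bounded_of_isCompact (ξ b).2 hcomp (by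
      rintro _ ⟨⟨y, σ⟩, ⟨hy, hσ⟩, rfl⟩
      exact hKU y hy σ hσ) N
    exact ⟨A, fun w y => norm_taylorCoeff_le σ₀ hVU hR (ξ b) y
      (fun σ hσ => hKU _ (interior_subset y.2) σ hσ)
      (fun σ hσ => hA (y.1.1, proj (σ₀ + σ)) ⟨(y.1.1, σ), ⟨interior_subset y.2, hσ⟩, rfl⟩) w.1 w.2⟩
  -- W depends on V and the c_j alone, not on the family to be lifted; all the Taylor coefficients
  -- are decomposed on it.
  obtain ⟨W, i, hxW, hlift⟩ := exists_lift_family d he hf hxV hVV₀ c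
    (fun ξ => hspan V hVV₀ ξ hxV)
  obtain ⟨g, a, -, hga, hg, A, ha⟩ := hlift (ι := Σ k : ℕ, Fin k → Fin q) Sigma.fst
    (fun w => taylorCoeff σ₀ hVU (Λ : ℂ) w.1 w.2 ∘ₗ ξ)
    (fun L => ((Finset.range L).sigma fun k => (Finset.univ : Finset (Fin k → Fin q))).finite_toSet
      |>.subset fun w hw => by simpa using hw)
    (fun w b N => by
      obtain ⟨A, hA⟩ := hbd b N
      exact ⟨_, hA w⟩)
    (fun n N ε hε => by
      obtain ⟨A, hA⟩ := hbd (e n) N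
      obtain ⟨L, hL⟩ := exists_pow_lt_of_lt_one (show 0 < ε / (|A| + 1) by positivity)
        (show (1 / 2 : ℝ) < 1 by norm_num)
      refine ⟨L, fun w hw y => (hA w y).trans ?_⟩
      calc A * (1 / 2) ^ w.1 ≤ (|A| + 1) * (1 / 2) ^ L := by
            refine mul_le_mul ((le_abs_self A).trans (by linarith))
              (pow_le_pow_of_le_one (by norm_num) (by norm_num) hw) (by positivity) (by positivity)
        _ ≤ (|A| + 1) * (ε / (|A| + 1)) := by gcongr
        _ = ε := by field_simp)
  -- The bound 1/2 is needed for the chart of the parameter space. The bound Λ/(2(q + 1)) gives q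
  -- r/Λ ≤ 1/2, the condition for the word series to converge, and also r ≤ R.
  set r : ℝ := min (1 / 2) (Λ / (2 * (q + 1))) with hr
  have hr0 : 0 < r := by positivity
  have hrΛ : q * (‖((Λ : ℂ))⁻¹‖ * r) ≤ 1 / 2 := by
    rw [norm_inv, Complex.norm_real, Real.norm_of_nonneg hΛ0.le]
    calc q * (Λ⁻¹ * r) ≤ q * (Λ⁻¹ * (Λ / (2 * (q + 1)))) := by
          gcongr; exact min_le_right _ _
      _ = q / (q + 1) * (1 / 2) := by field_simp
      _ ≤ 1 * (1 / 2) := by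
          gcongr
          rw [div_le_one (by positivity)]
          linarith
      _ = 1 / 2 := one_mul _
  have hrR : r ≤ R := by
    have h1 : Λ / (2 * (q + 1)) ≤ Λ := div_le_self hΛ0.le (by linarith [(Nat.cast_nonneg q : (0:ℝ) ≤ q)])
    have h2 : Λ ≤ R := div_le_self hR.le (by linarith [Real.add_one_le_exp 1])
    exact (min_le_right _ _).trans (h1.trans h2)
  obtain ⟨O, τ, hO, hτ, hτH⟩ := exists_chart σ₀ hr0 (min_le_left _ _)
  let V' : Opens (CBar p × Par q) :=
    ⟨(W : Set (CBar p)) ×ˢ (O : Set (Par q)), W.isOpen.prod O.isOpen⟩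
  have hV'U : V' ≤ U := by
    rintro ⟨y, s⟩ ⟨hy, hs⟩
    have h1 := hKU y (interior_subset (i hy)) (τ s)
      (by simpa using (hτ s hs).1.le.trans hrR)
    rwa [(hτ s hs).2] at h1
  have hV'W : ∀ z ∈ V', (z.1, (0 : Par 0)) ∈ baseOpen W := fun z hz => hz.1
  have hV'₀ : ∀ z ∈ V', (z.1, (0 : Par 0)) ∈ baseOpen V₀ := fun z hz => hVV₀ (i hz.1)
  obtain ⟨ψ, hψ⟩ := exists_resum hrΛ (fun y hy => (hτ y hy).1) hτH g hg
    (fun (z : CBar p × Par q) (hz : z ∈ V') => hz.2) hV'W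
  have hser := fun j => exists_wordSeries hrΛ (fun w => a w j) (fun w => ha w j)
  choose H hHa hHs using hser
  have hparam := fun j => exists_paramSection (V := V') (g := fun y => H j (τ y))
    (hτH _ (hHa j)) (fun z hz => hz.2)
  choose G hG using hparam
  refine ⟨V', hV'U, hV'₀, ⟨hxW, hO⟩, ψ, G, fun b => Subtype.ext (funext fun z => ?_)⟩
  have hτz := hτ z.1.2 z.2.2
  have hlhs := (hasSum_taylorCoeff σ₀ hVU (Λ := (Λ : ℂ)) (by exact_mod_cast hΛ0.ne') (R := R) (ξ b)
    ⟨(z.1.1, 0), i z.2.1⟩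
    (fun σ hσ => hKU _ (interior_subset (i z.2.1)) σ (Metric.ball_subset_closedBall hσ))
    (hτz.1.trans_le hrR)).tendsto_sum_nat
  have hrhs := (hψ (d b) z).add (tendsto_finsetSum Finset.univ fun j _ =>
    ((hHs j (τ z.1.2) (by simpa using hτz.1)).tendsto_sum_nat).mul_const
      ((c j b).1 ⟨(z.1.1, 0), hV'₀ z.1 z.2⟩))
  have hval : (ψ (d b) + ∑ j, G j • constParam 0 hV'₀ (c j b) : rapidSections p q V').1 z =
      (ψ (d b)).1 z + ∑ j, H j (τ z.1.2) * (c j b).1 ⟨(z.1.1, 0), hV'₀ z.1 z.2⟩ := by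
    rw [Submodule.coe_add, Pi.add_apply, AddSubmonoidClass.coe_finsetSum, Finset.sum_apply]
    refine congrArg _ (Finset.sum_congr rfl fun j _ => ?_)
    rw [← hG j z]
    rfl
  rw [hval]
  have hl : (res hV'U (ξ b)).1 z = ext (ξ b).1 (z.1.1, proj (σ₀ + τ z.1.2)) := by
    rw [hτz.2, ext_of_mem _ (hV'U z.2)]
    rfl
  rw [hl]
  -- Both sides are limits of the same partial sums: the decomposition of each Taylor coefficient is
  -- inserted and the finite sums over words and over j are exchanged.
  refine tendsto_nhds_unique hlhs (hrhs.congr fun n => ?_)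
  simp only [Finset.sum_mul]
  rw [Finset.sum_comm, ← Finset.sum_add_distrib]
  refine Finset.sum_congr rfl fun k _ => ?_
  rw [Finset.sum_comm, ← Finset.sum_add_distrib]
  refine Finset.sum_congr rfl fun w _ => ?_
  have h1 := congrArg (fun s : rapidSections p 0 (baseOpen W) => s.1 ⟨(z.1.1, 0), z.2.1⟩)
    (hga ⟨k, w⟩ b)
  have h2 : (∑ j, a ⟨k, w⟩ j • res (baseOpen_mono (i.trans hVV₀)) (c j b) :
      rapidSections p 0 (baseOpen W)).1 ⟨(z.1.1, 0), z.2.1⟩ =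
      ∑ j, a ⟨k, w⟩ j * (c j b).1 ⟨(z.1.1, 0), hV'₀ z.1 z.2⟩ := by
    rw [AddSubmonoidClass.coe_finsetSum, Finset.sum_apply]
    rfl
  have h3 : (taylorCoeff σ₀ hVU (Λ : ℂ) k w (ξ b)).1 ⟨(z.1.1, 0), i z.2.1⟩ =
      ∑ j, a ⟨k, w⟩ j * (c j b).1 ⟨(z.1.1, 0), hV'₀ z.1 z.2⟩ +
        (g ⟨k, w⟩ (d b)).1 ⟨(z.1.1, 0), hV'W z.1 z.2⟩ := by
    rw [← h2]
    exact h1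
  rw [h3, mul_add, Finset.mul_sum, add_comm]
  simp only [mul_assoc]
end
end RapidDecay

/-! ### Expansion of cocycles, and its transport along homotopy equivalences -/

namespace RapidDecay
noncomputable section
variable {p q : ℕ}

lemma span_map_eq_top {B C : Type} [AddCommGroup B] [AddCommGroup C] [Module (DAlg p) B]
    [Module (DAlg p) C] [Module ℂ B] [Module ℂ C] [IsScalarTower ℂ (DAlg p) B]
    [IsScalarTower ℂ (DAlg p) C] {f : B →ₗ[DAlg p] C} (hf : Function.Surjective f) {e : ℕ → B}
    (he : Submodule.span ℂ (Set.range e) = ⊤) : Submodule.span ℂ (Set.range (f ∘ e)) = ⊤ := by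
  have h1 := congrArg (Submodule.map (f.restrictScalars ℂ)) he
  rw [Submodule.map_span, Submodule.map_top, ← Set.range_comp] at h1
  exact h1.trans (LinearMap.range_eq_top.2 hf)

section
variable {P₂ P₁ P₀ : Type} [AddCommGroup P₂] [AddCommGroup P₁] [AddCommGroup P₀]
    [Module (DAlg p) P₂] [Module (DAlg p) P₁] [Module (DAlg p) P₀]

/-- Expansion of the cocycles with parameters. -/
def HasExpansion (d₁ : P₂ →ₗ[DAlg p] P₁) (d₀ : P₁ →ₗ[DAlg p] P₀) (x : CBar p) {h : ℕ}
    {V₀ : Opens (CBar p)} (c : Fin h → P₁ →ₗ[DAlg p] rapidSections p 0 (baseOpen V₀))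
    (q : ℕ) : Prop :=
  ∀ (U : Opens (CBar p × Par q)) (ξ : P₁ →ₗ[DAlg p] rapidSections p q U), ξ ∘ₗ d₁ = 0 →
    ∀ s₀, (x, s₀) ∈ U → ∃ (V : Opens (CBar p × Par q)) (i : V ≤ U)
      (i₀ : ∀ z ∈ V, (z.1, (0 : Par 0)) ∈ baseOpen V₀), (x, s₀) ∈ V ∧
      ∃ (y : P₀ →ₗ[DAlg p] rapidSections p q V) (H : Fin h → paramSections p q V),
        ∀ b, res i (ξ b) = y (d₀ b) + ∑ j, H j • constParam 0 i₀ (c j b)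

/-- Cocycles are the homomorphisms out of P₁ / im d₁, to which d₀ and the c_j descend.
`exists_expansion`, which knows no cocycle condition, is applied to this quotient; it is still of
countable dimension. -/
lemma hasExpansion_of_span [Module ℂ P₁] [Module ℂ P₀] [IsScalarTower ℂ (DAlg p) P₁]
    [IsScalarTower ℂ (DAlg p) P₀] {d₁ : P₂ →ₗ[DAlg p] P₁} {d₀ : P₁ →ₗ[DAlg p] P₀}
    (hd : d₀ ∘ₗ d₁ = 0) {e : ℕ → P₁} {f : ℕ → P₀}
    (he : Submodule.span ℂ (Set.range e) = ⊤) (hf : Submodule.span ℂ (Set.range f) = ⊤)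
    {x : CBar p} {h : ℕ} {V₀ : Opens (CBar p)} (hx : x ∈ V₀)
    {c : Fin h → P₁ →ₗ[DAlg p] rapidSections p 0 (baseOpen V₀)} (hc : ∀ j, c j ∘ₗ d₁ = 0)
    (hspan : ∀ (V : Opens (CBar p)) (ξ : P₁ →ₗ[DAlg p] rapidSections p 0 (baseOpen V)), x ∈ V →
      ξ ∘ₗ d₁ = 0 → ∃ (W : Opens (CBar p)) (i : W ≤ V) (i₀ : W ≤ V₀), x ∈ W ∧
        ∃ (a : Fin h → ℂ) (y : P₀ →ₗ[DAlg p] rapidSections p 0 (baseOpen W)),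
          ∀ u, res (baseOpen_mono i) (ξ u) =
            ∑ j, a j • res (baseOpen_mono i₀) (c j u) + y (d₀ u)) (q : ℕ) :
    HasExpansion d₁ d₀ x c q := by
  intro U ξ hξ s₀ hs
  have hle : ∀ {N : Type} [AddCommGroup N] [Module (DAlg p) N] {g : P₁ →ₗ[DAlg p] N},
      g ∘ₗ d₁ = 0 → LinearMap.range d₁ ≤ LinearMap.ker g := fun hg =>
    LinearMap.range_le_ker_iff.2 hg
  obtain ⟨V, i, i₀, hV, y, H, hy⟩ := exists_expansion
    ((LinearMap.range d₁).liftQ d₀ (hle hd))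
    (span_map_eq_top (f := (LinearMap.range d₁).mkQ) (Submodule.mkQ_surjective _) he) hf hx
    (fun j => (LinearMap.range d₁).liftQ (c j) (hle (hc j)))
    (fun V hV ξ hxV => by
      obtain ⟨W, i, i₀, hW, a, y, hy⟩ := hspan V (ξ ∘ₗ (LinearMap.range d₁).mkQ) hxV (by
        rw [LinearMap.comp_assoc, LinearMap.range_mkQ_comp, LinearMap.comp_zero])
      refine ⟨W, i, hW, a, y, fun u => ?_⟩
      obtain ⟨u, rfl⟩ := Submodule.mkQ_surjective _ u
      exact hy u)
    ((LinearMap.range d₁).liftQ ξ (hle hξ)) hs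
  exact ⟨V, i, i₀, hV, y, H, fun b => hy ((LinearMap.range d₁).mkQ b)⟩

variable {Q₂ Q₁ Q₀ : Type} [AddCommGroup Q₂] [AddCommGroup Q₁] [AddCommGroup Q₀]
    [Module (DAlg p) Q₂] [Module (DAlg p) Q₁] [Module (DAlg p) Q₀]

/-- The expansion of cocycles can be transported along a homotopy equivalence. -/
theorem IsLocalBasis.hasExpansion [Module ℂ Q₁] [Module ℂ Q₀] [IsScalarTower ℂ (DAlg p) Q₁]
    [IsScalarTower ℂ (DAlg p) Q₀] {d₁ : P₂ →ₗ[DAlg p] P₁} {d₀ : P₁ →ₗ[DAlg p] P₀}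
    {δ₁ : Q₂ →ₗ[DAlg p] Q₁} {δ₀ : Q₁ →ₗ[DAlg p] Q₀} (hδ : δ₀ ∘ₗ δ₁ = 0)
    {φ₂ : P₂ →ₗ[DAlg p] Q₂} {φ₁ : P₁ →ₗ[DAlg p] Q₁} {φ₀ : P₀ →ₗ[DAlg p] Q₀}
    {ψ₂ : Q₂ →ₗ[DAlg p] P₂} {ψ₁ : Q₁ →ₗ[DAlg p] P₁} {ψ₀ : Q₀ →ₗ[DAlg p] P₀}
    (hφ₁ : φ₁ ∘ₗ d₁ = δ₁ ∘ₗ φ₂) (hφ₀ : φ₀ ∘ₗ d₀ = δ₀ ∘ₗ φ₁)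
    (hψ₁ : ψ₁ ∘ₗ δ₁ = d₁ ∘ₗ ψ₂) (hψ₀ : ψ₀ ∘ₗ δ₀ = d₀ ∘ₗ ψ₁)
    {a : P₁ →ₗ[DAlg p] P₂} {b : P₀ →ₗ[DAlg p] P₁} (hP : ∀ u, ψ₁ (φ₁ u) = b (d₀ u) + d₁ (a u) + u)
    {α : Q₁ →ₗ[DAlg p] Q₂} {β : Q₀ →ₗ[DAlg p] Q₁}
    (hQ : ∀ u, φ₁ (ψ₁ u) = β (δ₀ u) + δ₁ (α u) + u)
    {e : ℕ → Q₁} {f : ℕ → Q₀}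
    (he : Submodule.span ℂ (Set.range e) = ⊤) (hf : Submodule.span ℂ (Set.range f) = ⊤)
    {x : CBar p} {h : ℕ} {V₀ : Opens (CBar p)}
    {c : Fin h → P₁ →ₗ[DAlg p] rapidSections p 0 (baseOpen V₀)} (hc : IsLocalBasis d₁ d₀ x c)
    (q : ℕ) : HasExpansion d₁ d₀ x c q := by
  have hcomp : ∀ {N : Type} [AddCommGroup N] [Module (DAlg p) N] {g : P₁ →ₗ[DAlg p] N},
      g ∘ₗ d₁ = 0 → (g ∘ₗ ψ₁) ∘ₗ δ₁ = 0 := fun hg => by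
    rw [LinearMap.comp_assoc, hψ₁, ← LinearMap.comp_assoc, hg, LinearMap.zero_comp]
  have key : HasExpansion δ₁ δ₀ x (fun j => c j ∘ₗ ψ₁) q := by
    refine hasExpansion_of_span hδ he hf hc.mem (fun j => hcomp (hc.cocycle j)) ?_ q
    intro V ξ hxV hξ
    obtain ⟨W, i, i₀, hW, A, y, hy⟩ := hc.span V (ξ ∘ₗ φ₁) hxV (by
      rw [LinearMap.comp_assoc, hφ₁, ← LinearMap.comp_assoc, hξ, LinearMap.zero_comp])
    -- The decomposition of ξ φ₁ is evaluated at ψ₁ u. Since ξ kills im δ₁, replacing φ₁ ψ₁ u by u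
    -- costs the term ξ β δ₀ u, which factors through δ₀ and joins the coboundary.
    refine ⟨W, i, i₀, hW, A, y ∘ₗ ψ₀ - res (baseOpen_mono i) ∘ₗ ξ ∘ₗ β, fun u => ?_⟩
    have h1 := hy (ψ₁ u)
    have h2 : ξ (δ₁ (α u)) = 0 := LinearMap.congr_fun hξ (α u)
    have h3 : ψ₀ (δ₀ u) = d₀ (ψ₁ u) := LinearMap.congr_fun hψ₀ u
    simp only [LinearMap.comp_apply, hQ, map_add, h2, add_zero] at h1
    rw [← h3, ← eq_sub_iff_add_eq'] at h1
    rw [h1, add_sub_assoc]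
    rfl
  intro U ξ hξ s₀ hs
  obtain ⟨V, i, i₀, hV, y, H, hy⟩ := key U (ξ ∘ₗ ψ₁) (hcomp hξ) s₀ hs
  -- Evaluating the expansion of ξ ψ₁ at φ₁ u uses the other homotopy twice: once for ξ and once for
  -- each c_j. Both corrections factor through d₀.
  refine ⟨V, i, i₀, hV, y ∘ₗ φ₀ - res i ∘ₗ ξ ∘ₗ b + ∑ j, H j • (constParam 0 i₀ ∘ₗ c j ∘ₗ b), H,
    fun u => ?_⟩
  have h1 := hy (φ₁ u)
  have h2 : ξ (d₁ (a u)) = 0 := LinearMap.congr_fun hξ (a u)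
  have h3 : φ₀ (d₀ u) = δ₀ (φ₁ u) := LinearMap.congr_fun hφ₀ u
  have h4 : ∀ j, c j (d₁ (a u)) = 0 := fun j => LinearMap.congr_fun (hc.cocycle j) (a u)
  rw [LinearMap.comp_apply, hP, map_add ξ, map_add ξ, h2, add_zero, map_add, ← h3] at h1
  have h5 : ∑ j, H j • constParam 0 i₀ ((c j ∘ₗ ψ₁) (φ₁ u)) =
      (∑ j, H j • (constParam 0 i₀ ∘ₗ c j ∘ₗ b)) (d₀ u) + ∑ j, H j • constParam 0 i₀ (c j u) := by
    rw [LinearMap.sum_apply, ← Finset.sum_add_distrib]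
    refine Finset.sum_congr rfl fun j _ => ?_
    rw [LinearMap.comp_apply, hP, map_add (c j), map_add (c j), h4, add_zero, map_add, smul_add]
    rfl
  rw [h5, ← eq_sub_iff_add_eq'] at h1
  rw [h1, LinearMap.add_apply, LinearMap.sub_apply]
  change _ = y (φ₀ (d₀ u)) - res i (ξ (b (d₀ u))) + _ + _
  abel
end
end
end RapidDecay

namespace RapidDecay
noncomputable section
variable {p q : ℕ}

/-! ### Resolutions of countable dimension -/

instance : Countable (Gen p) := by
  have : Function.Injective (fun g : Gen p => match g with
      | .t j => ((0 : Fin 3), j) | .tInv j => (1, j) | .theta j => (2, j)) := by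
    intro a b h
    cases a <;> cases b <;> simp_all
  exact this.countable

instance countable_freeMonoid {α : Type} [Countable α] : Countable (FreeMonoid α) :=
  inferInstanceAs (Countable (List α))

/-- A complex vector space of countable dimension. -/
def CountablySpanned (V : Type) [AddCommGroup V] [Module ℂ V] : Prop :=
  ∃ e : ℕ → V, Submodule.span ℂ (Set.range e) = ⊤

/-- As a bound on the rank, the condition is visibly inherited by subspaces and quotients. -/
lemma countablySpanned_iff {V : Type} [AddCommGroup V] [Module ℂ V] :
    CountablySpanned V ↔ Module.rank ℂ V ≤ Cardinal.aleph0 := by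
  constructor
  · rintro ⟨e, he⟩
    rw [← rank_top, ← he]
    exact (rank_span_le _).trans ((Cardinal.mk_range_le).trans (by simp))
  · intro h
    let b := Module.Basis.ofVectorSpace ℂ V
    have hc : Countable (Module.Basis.ofVectorSpaceIndex ℂ V) := by
      rw [← Cardinal.mk_le_aleph0_iff, b.mk_eq_rank'']
      exact h
    -- Adding 0 does not change the span and makes the set nonempty, so that a sequence can
    -- enumerate it even for the zero space.
    have : (insert 0 (Set.range b)).Countable := (Set.countable_range b).insert 0
    obtain ⟨e, he⟩ := this.exists_eq_range (Set.insert_nonempty _ _)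
    refine ⟨e, ?_⟩
    rw [← he, Submodule.span_insert_zero, b.span_eq]

lemma CountablySpanned.of_surjective {V W : Type} [AddCommGroup V] [Module ℂ V] [AddCommGroup W]
    [Module ℂ W] (h : CountablySpanned V) (f : V →ₗ[ℂ] W) (hf : Function.Surjective f) :
    CountablySpanned W :=
  countablySpanned_iff.2 ((f.rank_le_of_surjective hf).trans (countablySpanned_iff.1 h))

lemma CountablySpanned.of_injective {V W : Type} [AddCommGroup V] [Module ℂ V] [AddCommGroup W]
    [Module ℂ W] (h : CountablySpanned W) (f : V →ₗ[ℂ] W) (hf : Function.Injective f) :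
    CountablySpanned V :=
  countablySpanned_iff.2 ((f.rank_le_of_injective hf).trans (countablySpanned_iff.1 h))

lemma CountablySpanned.finsupp {V : Type} [AddCommGroup V] [Module ℂ V] (h : CountablySpanned V) :
    CountablySpanned (ℕ →₀ V) := by
  rw [countablySpanned_iff] at h ⊢
  rw [rank_finsupp']
  simpa using Cardinal.mul_le_max_of_aleph0_le_left (b := Module.rank ℂ V) le_rfl |>.trans
    (max_le le_rfl h)

lemma countablySpanned_dAlg (p : ℕ) : CountablySpanned (DAlg p) := by
  have h : CountablySpanned (FreeAlgebra ℂ (Gen p)) := by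
    rw [countablySpanned_iff, ← (FreeAlgebra.basisFreeMonoid ℂ (Gen p)).mk_eq_rank'']
    exact Cardinal.mk_le_aleph0
  exact h.of_surjective (RingQuot.mkAlgHom ℂ (Rel p)).toLinearMap
    (RingQuot.mkAlgHom_surjective ℂ (Rel p))

/-- The free `D`-module of countable rank. -/
def FreeMod (p : ℕ) : Type := ℕ →₀ DAlg p

instance : AddCommGroup (FreeMod p) := inferInstanceAs (AddCommGroup (ℕ →₀ DAlg p))
instance : Module (DAlg p) (FreeMod p) := inferInstanceAs (Module (DAlg p) (ℕ →₀ DAlg p))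
instance : Module ℂ (FreeMod p) := inferInstanceAs (Module ℂ (ℕ →₀ DAlg p))
instance : IsScalarTower ℂ (DAlg p) (FreeMod p) :=
  inferInstanceAs (IsScalarTower ℂ (DAlg p) (ℕ →₀ DAlg p))
instance : Module.Projective (DAlg p) (FreeMod p) :=
  inferInstanceAs (Module.Projective (DAlg p) (ℕ →₀ DAlg p))

lemma countablySpanned_freeMod (p : ℕ) : CountablySpanned (FreeMod p) :=
  (countablySpanned_dAlg p).finsupp

/-- The homomorphism with given values on the standard basis. -/
def FreeMod.lift {B : Type} [AddCommGroup B] [Module (DAlg p) B] (e : ℕ → B) :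
    FreeMod p →ₗ[DAlg p] B :=
  Finsupp.linearCombination (DAlg p) e

lemma FreeMod.range_lift {B : Type} [AddCommGroup B] [Module (DAlg p) B] (e : ℕ → B) :
    LinearMap.range (FreeMod.lift e) = Submodule.span (DAlg p) (Set.range e) :=
  Finsupp.range_linearCombination (DAlg p)

/-- A countable spanning set over ℂ of the submodule generates it over R. This replaces any
noetherian property in the construction of resolutions. -/
lemma CountablySpanned.exists_generators {R B : Type} [Ring R] [Algebra ℂ R] [AddCommGroup B]
    [Module R B] [Module ℂ B] [IsScalarTower ℂ R B] (h : CountablySpanned B) (S : Submodule R B) :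
    ∃ e : ℕ → B, Submodule.span R (Set.range e) = S := by
  have hinj : Function.Injective (S.subtype.restrictScalars ℂ) := S.injective_subtype
  obtain ⟨e, he⟩ := h.of_injective _ hinj
  refine ⟨S.subtype ∘ e, ?_⟩
  have : Submodule.span R (Set.range e) = ⊤ := by
    rw [eq_top_iff]
    intro x _
    have hx : x ∈ Submodule.span ℂ (Set.range e) := he ▸ Submodule.mem_top
    exact Submodule.span_le_restrictScalars ℂ R _ hx
  rw [Set.range_comp, ← Submodule.map_span, this, Submodule.map_top, Submodule.range_subtype]

/-- A homomorphism from a free module of countable rank onto the kernel of `f`. -/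
lemma exists_cover {B C : Type} [AddCommGroup B] [AddCommGroup C] [Module (DAlg p) B]
    [Module (DAlg p) C] [Module ℂ B] [IsScalarTower ℂ (DAlg p) B] (h : CountablySpanned B)
    (f : B →ₗ[DAlg p] C) :
    ∃ g : FreeMod p →ₗ[DAlg p] B, LinearMap.range g = LinearMap.ker f := by
  obtain ⟨e, he⟩ := h.exists_generators (LinearMap.ker f)
  exact ⟨FreeMod.lift e, (FreeMod.range_lift e).trans he⟩

section

variable {M : ModuleCat.{0} (DAlg p)} (f : FreeMod p →ₗ[DAlg p] M)

/-- The differentials of a resolution by free modules of countable rank. -/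
def coverSeq : ℕ → FreeMod p →ₗ[DAlg p] FreeMod p
  | 0 => (exists_cover (countablySpanned_freeMod p) f).choose
  | n + 1 => (exists_cover (countablySpanned_freeMod p) (coverSeq n)).choose

lemma range_coverSeq_zero : LinearMap.range (coverSeq f 0) = LinearMap.ker f :=
  (exists_cover (countablySpanned_freeMod p) f).choose_spec

lemma range_coverSeq_succ (n : ℕ) :
    LinearMap.range (coverSeq f (n + 1)) = LinearMap.ker (coverSeq f n) :=
  (exists_cover (countablySpanned_freeMod p) (coverSeq f n)).choose_spec

lemma coverSeq_comp_succ (n : ℕ) : ModuleCat.ofHom (coverSeq f (n + 1)) ≫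
    ModuleCat.ofHom (coverSeq f n) = 0 :=
  ModuleCat.hom_ext (LinearMap.range_le_ker_iff.1 (range_coverSeq_succ f n).le)

lemma coverSeq_comp_zero : ModuleCat.ofHom (coverSeq f 0) ≫ ModuleCat.ofHom f = 0 :=
  ModuleCat.hom_ext (LinearMap.range_le_ker_iff.1 (range_coverSeq_zero f).le)

/-- The complex of free modules of countable rank. -/
def freeComplex : ChainComplex (ModuleCat.{0} (DAlg p)) ℕ :=
  ChainComplex.of (fun _ => ModuleCat.of (DAlg p) (FreeMod p))
    (fun n => ModuleCat.ofHom (coverSeq f n)) (coverSeq_comp_succ f)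

lemma freeComplex_d (n : ℕ) : (freeComplex f).d (n + 1) n = ModuleCat.ofHom (coverSeq f n) :=
  ChainComplex.of_d (fun _ => ModuleCat.of (DAlg p) (FreeMod p))
    (fun n => ModuleCat.ofHom (coverSeq f n)) n

lemma freeComplex_d_comp : (freeComplex f).d 1 0 ≫ ModuleCat.ofHom f = 0 := by
  rw [freeComplex_d]
  exact coverSeq_comp_zero f

/-- The resolution by free modules of countable rank. -/
def freeResolution (hf : Function.Surjective f) : ProjectiveResolution M where
  complex := freeComplex f
  projective n := by
    have : Projective (ModuleCat.of (DAlg p) (FreeMod p)) :=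
      (IsProjective.iff_projective (FreeMod p)).1 inferInstance
    exact this
  π := (ChainComplex.toSingle₀Equiv (freeComplex f) M).symm
    ⟨ModuleCat.ofHom f, freeComplex_d_comp f⟩
  quasiIso := ⟨fun n => by
    cases n with
    | zero =>
      -- In degree 0 the condition is that M is the cokernel of the first differential; in positive
      -- degrees it is exactness of the free complex.
      rw [ChainComplex.quasiIsoAt₀_iff, ShortComplex.quasiIso_iff_of_zeros']
      · refine (ShortComplex.exact_and_epi_g_iff_of_iso
          (S₂ := ShortComplex.mk _ _ (coverSeq_comp_zero f)) ?_).2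
          ⟨(ShortComplex.moduleCat_exact_iff_range_eq_ker _).2 (range_coverSeq_zero f),
            (ModuleCat.epi_iff_surjective _).2 hf⟩
        refine ShortComplex.isoMk (Iso.refl _) (Iso.refl _) (Iso.refl _) ?_ ?_
        · exact (Category.id_comp _).trans ((freeComplex_d f 0).symm.trans (Category.comp_id _).symm)
        · simp
          rfl
      all_goals rfl
    | succ n =>
      rw [quasiIsoAt_iff_exactAt']
      · rw [HomologicalComplex.exactAt_iff' _ (n + 1 + 1) (n + 1) n (by simp) (by simp),
          ShortComplex.moduleCat_exact_iff_range_eq_ker]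
        change LinearMap.range ((freeComplex f).d (n + 1 + 1) (n + 1)).hom =
          LinearMap.ker ((freeComplex f).d (n + 1) n).hom
        rw [freeComplex_d, freeComplex_d]
        exact range_coverSeq_succ f n
      · apply ChainComplex.exactAt_succ_single_obj⟩

end
end
end RapidDecay

/-! ### Local surjectivity of the multiplication on cohomology -/

namespace RapidDecay
noncomputable section
variable {p q : ℕ}

lemma down_next_eq (n : ℕ) : (ComplexShape.down ℕ).next n = (ComplexShape.up ℕ).prev n := by
  cases n with
  | zero => rw [ChainComplex.next_nat_zero, CochainComplex.prev_nat_zero]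
  | succ n => rw [ChainComplex.next_nat_succ, CochainComplex.prev_nat_succ]

lemma down_prev_eq (n : ℕ) : (ComplexShape.down ℕ).prev n = (ComplexShape.up ℕ).next n := by
  rw [ChainComplex.prev, CochainComplex.next]

lemma homotopy_comm_nat {C : Type 1} [Category.{0} C] [Preadditive C] {K L : ChainComplex C ℕ}
    {F G : K ⟶ L} (h : Homotopy F G) (n : ℕ) :
    F.f n = K.d n ((ComplexShape.up ℕ).prev n) ≫ h.hom ((ComplexShape.up ℕ).prev n) n +
      h.hom n ((ComplexShape.up ℕ).next n) ≫ L.d ((ComplexShape.up ℕ).next n) n + G.f n := by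
  rw [← down_next_eq, ← down_prev_eq]
  exact h.comm n

/-- A finite set of generators, with 0 added so that it is nonempty, is enumerated by ℕ with
repetitions. -/
lemma exists_freeMod_surjective (M : ModuleCat.{0} (DAlg p)) [Module.Finite (DAlg p) M] :
    ∃ f : FreeMod p →ₗ[DAlg p] M, Function.Surjective f := by
  obtain ⟨s, hs⟩ := Module.Finite.fg_top (R := DAlg p) (M := M)
  obtain ⟨e, he⟩ := (s.countable_toSet.insert 0).exists_eq_range (Set.insert_nonempty _ _)
  refine ⟨FreeMod.lift e, LinearMap.range_eq_top.1 ((FreeMod.range_lift e).trans ?_)⟩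
  rw [← he, Submodule.span_insert_zero]
  exact hs

/-- The terms of P may have uncountable dimension, which leaves no Fréchet structure. P is compared
with the free resolution of countable rank, where the analytic argument applies. -/
theorem hasExpansion_resolution {M : ModuleCat.{0} (DAlg p)} [Module.Finite (DAlg p) M]
    (P : ProjectiveResolution M) (n : ℕ) {x : CBar p} {h : ℕ} {V₀ : Opens (CBar p)}
    {c : Fin h → P.complex.X n →ₗ[DAlg p] rapidSections p 0 (baseOpen V₀)}
    (hc : IsLocalBasis (P.complex.d ((ComplexShape.up ℕ).next n) n).hom
      (P.complex.d n ((ComplexShape.up ℕ).prev n)).hom x c) (q : ℕ) :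
    HasExpansion (P.complex.d ((ComplexShape.up ℕ).next n) n).hom
      (P.complex.d n ((ComplexShape.up ℕ).prev n)).hom x c q := by
  obtain ⟨f, hf⟩ := exists_freeMod_surjective M
  let Q := freeResolution f hf
  let E := ProjectiveResolution.homotopyEquiv P Q
  obtain ⟨e, he⟩ := countablySpanned_freeMod p
  let m := (ComplexShape.up ℕ).next n
  -- For n = 0 this index is 0 again and the differential from degree 0 to itself is zero, so the
  -- lowest degree needs no separate treatment.
  let l := (ComplexShape.up ℕ).prev n
  let δ₁ : FreeMod p →ₗ[DAlg p] FreeMod p := (Q.complex.d m n).hom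
  let δ₀ : FreeMod p →ₗ[DAlg p] FreeMod p := (Q.complex.d n l).hom
  let φ : ∀ k, P.complex.X k →ₗ[DAlg p] FreeMod p := fun k => (E.hom.f k).hom
  let ψ : ∀ k, FreeMod p →ₗ[DAlg p] P.complex.X k := fun k => (E.inv.f k).hom
  let a : P.complex.X n →ₗ[DAlg p] P.complex.X m := (E.homotopyHomInvId.hom n m).hom
  let b : P.complex.X l →ₗ[DAlg p] P.complex.X n := (E.homotopyHomInvId.hom l n).hom
  let α : FreeMod p →ₗ[DAlg p] FreeMod p := (E.homotopyInvHomId.hom n m).hom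
  let β : FreeMod p →ₗ[DAlg p] FreeMod p := (E.homotopyInvHomId.hom l n).hom
  have hδ : δ₀ ∘ₗ δ₁ = 0 := congrArg ModuleCat.Hom.hom (Q.complex.d_comp_d m n l)
  have h1 : φ n ∘ₗ (P.complex.d m n).hom = δ₁ ∘ₗ φ m :=
    congrArg ModuleCat.Hom.hom (E.hom.comm m n).symm
  have h2 : φ l ∘ₗ (P.complex.d n l).hom = δ₀ ∘ₗ φ n :=
    congrArg ModuleCat.Hom.hom (E.hom.comm n l).symm
  have h3 : ψ n ∘ₗ δ₁ = (P.complex.d m n).hom ∘ₗ ψ m :=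
    congrArg ModuleCat.Hom.hom (E.inv.comm m n).symm
  have h4 : ψ l ∘ₗ δ₀ = (P.complex.d n l).hom ∘ₗ ψ n :=
    congrArg ModuleCat.Hom.hom (E.inv.comm n l).symm
  have hP : ∀ u, ψ n (φ n u) = b ((P.complex.d n l).hom u) + (P.complex.d m n).hom (a u) + u :=
    fun u => congrArg (fun g => ModuleCat.Hom.hom g u) (homotopy_comm_nat E.homotopyHomInvId n)
  have hQ : ∀ u, φ n (ψ n u) = β (δ₀ u) + δ₁ (α u) + u :=
    fun u => congrArg (fun g => ModuleCat.Hom.hom g u) (homotopy_comm_nat E.homotopyInvHomId n)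
  exact IsLocalBasis.hasExpansion hδ h1 h2 h3 h4 hP hQ he he hc q

/-- The pullback of a homomorphism to `𝒜^{<0}` without parameters. -/
def pullbackHom {P : ModuleCat.{0} (DAlg p)} {V₀ : Opens (CBar p)} {V : Opens (CBar p × Par q)}
    (i₀ : ∀ z ∈ V, (z.1, (0 : Par 0)) ∈ baseOpen V₀)
    (c : P →ₗ[DAlg p] rapidSections p 0 (baseOpen V₀)) :
    ((sheafHom (pullbackSheaf p q)).obj (op P)).presheaf.obj (op V) :=
  (ModuleCat.ofHom ((constParam 0 i₀ ∘ₗ c).codRestrict (pullbackSections p q V)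
      fun u => constParam_mem_pullbackSections i₀ (c u)) :
    P ⟶ ModuleCat.of (DAlg p) (pullbackSections p q V))

/-- Sections of the sheaf of homomorphisms to `r₁⁻¹𝒜^{<0}`. -/
abbrev PullbackHoms (P : ModuleCat.{0} (DAlg p)) (V : Opens (CBar p × Par q)) : Type :=
  (((sheafHom (pullbackSheaf p q)).obj (op P)).presheaf.obj (op V) : Type)

/-- Composition with a homomorphism of `D`-modules. -/
abbrev precompHom {P Q : ModuleCat.{0} (DAlg p)} (f : P ⟶ Q) (U : Opens (CBar p × Par q)) :
    PullbackHoms Q U →ₗ[ℂ] PullbackHoms P U :=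
  (((sheafHom (pullbackSheaf p q)).map f.op).hom.app (op U)).hom

/-- The underlying linear map. -/
def PullbackHoms.lin {P : ModuleCat.{0} (DAlg p)} {V : Opens (CBar p × Par q)}
    (φ : PullbackHoms P V) : P →ₗ[DAlg p] rapidSections p q V :=
  (pullbackSections p q V).subtype ∘ₗ
    (φ : P ⟶ ModuleCat.of (DAlg p) (pullbackSections p q V)).hom

lemma PullbackHoms.hext {P : ModuleCat.{0} (DAlg p)} {V : Opens (CBar p × Par q)}
    {φ ψ : PullbackHoms P V} (h : ∀ u, φ.lin u = ψ.lin u) : φ = ψ :=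
  ModuleCat.hom_ext (LinearMap.ext fun u => Subtype.ext (h u))

lemma PullbackHoms.lin_mem {P : ModuleCat.{0} (DAlg p)} {V : Opens (CBar p × Par q)}
    (φ : PullbackHoms P V) (u : P) : φ.lin u ∈ pullbackSections p q V :=
  ((φ : P ⟶ ModuleCat.of (DAlg p) (pullbackSections p q V)).hom u).2

lemma tensorPrecomp_tmul {P Q : ModuleCat.{0} (DAlg p)} (f : P ⟶ Q) (U : Opens (CBar p × Par q))
    (g : paramSections p q U) (φ : PullbackHoms Q U) :
    tensorPrecomp f U (g ⊗ₜ φ) = g ⊗ₜ precompHom f U φ := rfl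

lemma tensorPrecomp_pullbackHom {P Q : ModuleCat.{0} (DAlg p)} (f : P ⟶ Q) {V₀ : Opens (CBar p)}
    {V : Opens (CBar p × Par q)} (i₀ : ∀ z ∈ V, (z.1, (0 : Par 0)) ∈ baseOpen V₀)
    (c : Q →ₗ[DAlg p] rapidSections p 0 (baseOpen V₀)) (g : paramSections p q V)
    (hc : c ∘ₗ f.hom = 0) : tensorPrecomp f V (g ⊗ₜ pullbackHom i₀ c) = 0 := by
  rw [tensorPrecomp_tmul]
  have : precompHom f V (pullbackHom i₀ c) = 0 := by
    refine PullbackHoms.hext fun u => ?_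
    have h1 : c (f.hom u) = 0 := LinearMap.congr_fun hc u
    change constParam 0 i₀ (c (f.hom u)) = 0
    rw [h1, map_zero]
  rw [this, TensorProduct.tmul_zero]

/-- Cocycles with values in functions with parameters are, locally and up to coboundaries, in the
image of the multiplication. -/
theorem exists_mulMap_eq {M : ModuleCat.{0} (DAlg p)} [Module.Finite (DAlg p) M]
    (P : ProjectiveResolution M)
    (hR : ∀ n : ℕ, IsRConstructible ((rhom P (rapidSheafBase p)).homology n)) (n : ℕ)
    (U : Opens (CBar p × Par q)) (ξ : P.complex.X n →ₗ[DAlg p] rapidSections p q U)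
    (hξ : ξ ∘ₗ (P.complex.d ((ComplexShape.up ℕ).next n) n).hom = 0) (z : CBar p × Par q)
    (hz : z ∈ U) : ∃ (V : Opens (CBar p × Par q)) (i : V ≤ U), z ∈ V ∧
      ∃ (τ : paramSections p q V ⊗[ℂ]
          (((sheafHom (pullbackSheaf p q)).obj (op (P.complex.X n))).presheaf.obj (op V) : Type))
        (y : P.complex.X ((ComplexShape.up ℕ).prev n) →ₗ[DAlg p] rapidSections p q V),
        tensorPrecomp (P.complex.d ((ComplexShape.up ℕ).next n) n) V τ = 0 ∧
        (res i) ∘ₗ ξ = mulMap (P.complex.X n) V τ +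
          y ∘ₗ (P.complex.d n ((ComplexShape.up ℕ).prev n)).hom := by
  obtain ⟨h, V₀, c, hc⟩ := exists_isLocalBasis P n (hR n) z.1
  obtain ⟨V, i, i₀, hV, y, H, hy⟩ := hasExpansion_resolution P n hc q U ξ hξ z.2 hz
  refine ⟨V, i, hV, ∑ j, H j ⊗ₜ pullbackHom i₀ (c j), y, ?_, ?_⟩
  · exact (map_sum _ _ _).trans (Finset.sum_eq_zero fun j _ =>
      tensorPrecomp_pullbackHom _ i₀ (c j) (H j) (hc.cocycle j))
  · refine LinearMap.ext fun u => (hy u).trans ?_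
    rw [map_sum, LinearMap.add_apply, LinearMap.sum_apply, add_comm]
    rfl
end
end RapidDecay

namespace RapidDecay
noncomputable section
variable {p q : ℕ}

/-! ### Injectivity of the multiplication on cohomology -/

/-- Locally such a section depends on the point of the annulus alone, so it is locally constant
along a slice, hence constant on a connected one. -/
lemma pullbackSections_slice {U : Opens (CBar p × Par q)} {f : rapidSections p q U}
    (hf : f ∈ pullbackSections p q U) {y : CBar p} {O : Set (Par q)} (hO : IsPreconnected O)
    (hU : ∀ s ∈ O, (y, s) ∈ U) {s s' : Par q} (hs : s ∈ O) (hs' : s' ∈ O) :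
    f.1 ⟨(y, s), hU s hs⟩ = f.1 ⟨(y, s'), hU s' hs'⟩ := by
  have : PreconnectedSpace O := isPreconnected_iff_preconnectedSpace.1 hO
  have hc : IsLocallyConstant fun s : O => ext f.1 (y, s.1) := by
    rw [IsLocallyConstant.iff_eventually_eq]
    intro t
    obtain ⟨V, H, -, -, h⟩ := hf (y, t.1) (hU t.1 t.2)
    have hcont : Continuous fun s : O => ((y, s.1) : CBar p × Par q) := by fun_prop
    filter_upwards [hcont.continuousAt.eventually h] with s hs
    rw [hs, h.self_of_nhds]
  have := hc.apply_eq_of_isPreconnected isPreconnected_univ (Set.mem_univ ⟨s, hs⟩)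
    (Set.mem_univ ⟨s', hs'⟩)
  rwa [ext_of_mem _ (hU s hs), ext_of_mem _ (hU s' hs')] at this

/-- The product of two open subsets. -/
def prodOpen (W : Opens (CBar p)) (O : Opens (Par q)) : Opens (CBar p × Par q) :=
  ⟨(W : Set (CBar p)) ×ˢ (O : Set (Par q)), W.isOpen.prod O.isOpen⟩

/-- Images of balls under ℂ^q → ℂ^q/ℤ^q are a basis of connected open sets. -/
lemma exists_prodOpen_le {S : Set (CBar p × Par q)} {z : CBar p × Par q} (hz : S ∈ 𝓝 z) :
    ∃ (W : Opens (CBar p)) (O : Opens (Par q)), z ∈ prodOpen W O ∧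
      IsPreconnected (O : Set (Par q)) ∧ (prodOpen W O : Set (CBar p × Par q)) ⊆ S := by
  obtain ⟨U, hUS, hU, hzU⟩ := mem_nhds_iff.1 hz
  obtain ⟨x, s₀⟩ := z
  obtain ⟨σ₀, rfl⟩ := QuotientAddGroup.mk_surjective s₀
  obtain ⟨K, R, -, hK, -, hR, hKU⟩ := exists_polydisc hU hzU (V₀ := ⊤) trivial
  have hO : IsOpen (proj '' Metric.ball σ₀ R : Set (Par q)) :=
    QuotientAddGroup.isOpenMap_coe _ Metric.isOpen_ball
  refine ⟨⟨interior K, isOpen_interior⟩, ⟨_, hO⟩,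
    ⟨mem_interior_iff_mem_nhds.2 hK, σ₀, Metric.mem_ball_self hR, rfl⟩,
    (convex_ball σ₀ R).isPreconnected.image _ continuous_proj.continuousOn, ?_⟩
  rintro ⟨y, s⟩ ⟨hy, σ, hσ, rfl⟩
  refine hUS ?_
  have := hKU y (interior_subset hy) (σ - σ₀) (by
    rw [mem_closedBall_zero_iff, ← dist_eq_norm]; exact (Metric.mem_ball.1 hσ).le)
  rwa [add_sub_cancel] at this

lemma PullbackHoms.lin_smul {P : ModuleCat.{0} (DAlg p)} {V : Opens (CBar p × Par q)} (c : ℂ)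
    (φ : PullbackHoms P V) (u : P) : (c • φ).lin u = c • φ.lin u :=
  algebraMap_smul' c (φ.lin u)

lemma PullbackHoms.lin_sum {P : ModuleCat.{0} (DAlg p)} {V : Opens (CBar p × Par q)} {ι : Type}
    (s : Finset ι) (φ : ι → PullbackHoms P V) (u : P) :
    (∑ j ∈ s, φ j).lin u = ∑ j ∈ s, (φ j).lin u := by
  classical
  induction s using Finset.induction_on with
  | empty => rfl
  | insert a s ha ih =>
    rw [Finset.sum_insert ha, Finset.sum_insert ha, ← ih]
    rfl

/-- Restriction of sections of the sheaf of homomorphisms. -/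
abbrev resHom {P : ModuleCat.{0} (DAlg p)} {U V : Opens (CBar p × Par q)} (h : V ≤ U) :
    PullbackHoms P U →ₗ[ℂ] PullbackHoms P V :=
  (((sheafHom (pullbackSheaf p q)).obj (op P)).presheaf.map (homOfLE h).op).hom

/-- Restriction of sections of the tensor product. -/
abbrev resTensor {P : ModuleCat.{0} (DAlg p)} {U V : Opens (CBar p × Par q)} (h : V ≤ U) :
    paramSections p q U ⊗[ℂ] PullbackHoms P U →ₗ[ℂ] paramSections p q V ⊗[ℂ] PullbackHoms P V :=
  tensorRes ((sheafHom (pullbackSheaf p q)).obj (op P)).presheaf (homOfLE h).op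

lemma resTensor_tmul {P : ModuleCat.{0} (DAlg p)} {U V : Opens (CBar p × Par q)} (h : V ≤ U)
    (g : paramSections p q U) (φ : PullbackHoms P U) :
    resTensor h (g ⊗ₜ φ) = paramRes h g ⊗ₜ resHom h φ := rfl

lemma resTensor_resTensor {P : ModuleCat.{0} (DAlg p)} {U V W : Opens (CBar p × Par q)}
    (h : V ≤ U) (h' : W ≤ V) (τ : paramSections p q U ⊗[ℂ] PullbackHoms P U) :
    resTensor h' (resTensor h τ) = resTensor (h'.trans h) τ := by
  induction τ using TensorProduct.induction_on with
  | zero => simp only [map_zero]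
  | add a b ha hb => simp only [map_add, ha, hb]
  | tmul a b => rfl

lemma tensorPrecomp_resTensor {P Q : ModuleCat.{0} (DAlg p)} (f : P ⟶ Q)
    {U V : Opens (CBar p × Par q)} (h : V ≤ U)
    (τ : paramSections p q U ⊗[ℂ] PullbackHoms Q U) :
    tensorPrecomp f V (resTensor h τ) = resTensor h (tensorPrecomp f U τ) :=
  tensorRes_map ((sheafHom (pullbackSheaf p q)).map f.op).hom (homOfLE h).op τ

lemma mulMap_resTensor {P : ModuleCat.{0} (DAlg p)} {U V : Opens (CBar p × Par q)} (h : V ≤ U)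
    (τ : paramSections p q U ⊗[ℂ] PullbackHoms P U) :
    mulMap P V (resTensor h τ) = res h ∘ₗ mulMap P U τ := by
  induction τ using TensorProduct.induction_on with
  | zero => simp only [map_zero]; rfl
  | add a b ha hb => rw [map_add, map_add, ha, hb, map_add, LinearMap.comp_add]
  | tmul a b => rfl

lemma mulMap_tensorPrecomp {P Q : ModuleCat.{0} (DAlg p)} (f : P ⟶ Q)
    {U : Opens (CBar p × Par q)} (τ : paramSections p q U ⊗[ℂ] PullbackHoms Q U) :
    mulMap P U (tensorPrecomp f U τ) = mulMap Q U τ ∘ₗ f.hom := by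
  induction τ using TensorProduct.induction_on with
  | zero => simp only [map_zero]; rfl
  | add a b ha hb => rw [map_add, map_add, ha, hb, map_add, LinearMap.add_comp]
  | tmul a b => rfl

section
variable {P₂ P₁ P₀ : ModuleCat.{0} (DAlg p)} {d₁ : P₂ ⟶ P₁} {d₀ : P₁ ⟶ P₀} {h : ℕ}
  {V₀ : Opens (CBar p)} {c : Fin h → P₁ →ₗ[DAlg p] rapidSections p 0 (baseOpen V₀)}
  {z : CBar p × Par q}

/-- Over a product with connected parameter set, φ is the pullback of its slice at the parameter of
z. That slice is a cocycle without parameter, so its expansion near the base point of z can be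
pulled back, with constant coefficients. -/
lemma IsLocalBasis.exists_expand (hc : IsLocalBasis d₁.hom d₀.hom z.1 c)
    {U : Opens (CBar p × Par q)} (φ : PullbackHoms P₁ U) (hφ : precompHom d₁ U φ = 0)
    (hz : z ∈ U) : ∃ (V : Opens (CBar p × Par q)) (i : V ≤ U)
      (i₀ : ∀ z ∈ V, (z.1, (0 : Par 0)) ∈ baseOpen V₀), z ∈ V ∧
      ∃ (a : Fin h → ℂ) (ψ : PullbackHoms P₀ V),
        resHom i φ = ∑ j, a j • pullbackHom i₀ (c j) + precompHom d₀ V ψ := by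
  obtain ⟨W, O, hzW, hO, hWU⟩ := exists_prodOpen_le (U.isOpen.mem_nhds hz)
  have hWs : ∀ y ∈ baseOpen W, (y.1, z.2) ∈ U := fun y hy => hWU ⟨hy, hzW.2⟩
  obtain ⟨W', i, i₀, hW', a, y, hy⟩ := hc.span W (constParam z.2 hWs ∘ₗ φ.lin) hzW.1 (by
    refine LinearMap.ext fun u => ?_
    have h1 : φ.lin (d₁.hom u) = 0 :=
      LinearMap.congr_fun (congrArg PullbackHoms.lin hφ) u
    change constParam z.2 hWs (φ.lin (d₁.hom u)) = 0
    rw [h1, map_zero])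
  have hVU : prodOpen W' O ≤ U := fun w hw => hWU ⟨i hw.1, hw.2⟩
  have hV₀ : ∀ w ∈ prodOpen W' O, (w.1, (0 : Par 0)) ∈ baseOpen V₀ := fun w hw => i₀ hw.1
  have hV' : ∀ w ∈ prodOpen W' O, (w.1, (0 : Par 0)) ∈ baseOpen W' := fun w hw => hw.1
  refine ⟨prodOpen W' O, hVU, hV₀, ⟨hW', hzW.2⟩, a, pullbackHom hV' y,
    PullbackHoms.hext fun u => Subtype.ext (funext fun w => ?_)⟩
  have h1 : (φ.lin u).1 ⟨w.1, hVU w.2⟩ = (φ.lin u).1 ⟨(w.1.1, z.2), hWs (w.1.1, 0) (i w.2.1)⟩ :=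
    pullbackSections_slice (φ.lin_mem u) hO (fun s hs => hWU ⟨i w.2.1, hs⟩) w.2.2 hzW.2
  have h2 := congrArg (fun f : rapidSections p 0 (baseOpen W') => f.1 ⟨(w.1.1, 0), w.2.1⟩) (hy u)
  have h3 : PullbackHoms.lin (∑ j, a j • pullbackHom hV₀ (c j) +
      precompHom d₀ (prodOpen W' O) (pullbackHom hV' y)) u =
      ∑ j, a j • constParam 0 hV₀ (c j u) + constParam 0 hV' (y (d₀.hom u)) := by
    refine Eq.trans (b := PullbackHoms.lin (∑ j, a j • pullbackHom hV₀ (c j)) u +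
      constParam 0 hV' (y (d₀.hom u))) rfl ?_
    rw [PullbackHoms.lin_sum]
    refine congrArg (· + _) (Finset.sum_congr rfl fun j _ => ?_)
    rw [PullbackHoms.lin_smul]
    rfl
  rw [h3]
  refine (h1.trans h2).trans ?_
  rw [Submodule.coe_add, Pi.add_apply, Submodule.coe_add, Pi.add_apply,
    AddSubmonoidClass.coe_finsetSum, Finset.sum_apply, AddSubmonoidClass.coe_finsetSum,
    Finset.sum_apply]
  rfl

lemma resTensor_expansion {U V : Opens (CBar p × Par q)} (i : V ≤ U)
    (i₀ : ∀ z ∈ U, (z.1, (0 : Par 0)) ∈ baseOpen V₀) (H : Fin h → paramSections p q U)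
    (w : paramSections p q U ⊗[ℂ] PullbackHoms P₀ U) :
    resTensor i (∑ j, H j ⊗ₜ pullbackHom i₀ (c j) + tensorPrecomp d₀ U w) =
      ∑ j, paramRes i (H j) ⊗ₜ pullbackHom (fun z hz => i₀ z (i hz)) (c j) +
        tensorPrecomp d₀ V (resTensor i w) := by
  rw [map_add, tensorPrecomp_resTensor, map_sum]
  rfl

/-- Multiplying the expansion of each φ_k by g_k turns the constant coefficients into functions of
the parameter. There are finitely many terms, so finitely many shrinkings suffice. -/
lemma IsLocalBasis.exists_expand_sum (hc : IsLocalBasis d₁.hom d₀.hom z.1 c)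
    {U : Opens (CBar p × Par q)} (hz : z ∈ U) {ι : Type} (s : Finset ι)
    (g : ι → paramSections p q U) (φ : ι → PullbackHoms P₁ U)
    (hφ : ∀ k ∈ s, precompHom d₁ U (φ k) = 0) : ∃ (V : Opens (CBar p × Par q)) (i : V ≤ U)
      (i₀ : ∀ z ∈ V, (z.1, (0 : Par 0)) ∈ baseOpen V₀), z ∈ V ∧
      ∃ (H : Fin h → paramSections p q V) (w : paramSections p q V ⊗[ℂ] PullbackHoms P₀ V),
        resTensor i (∑ k ∈ s, g k ⊗ₜ φ k) =
          ∑ j, H j ⊗ₜ pullbackHom i₀ (c j) + tensorPrecomp d₀ V w := by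
  classical
  induction s using Finset.induction_on with
  | empty =>
    refine ⟨U ⊓ prodOpen V₀ ⊤, inf_le_left, fun w hw => hw.2.1, ⟨hz, hc.mem, trivial⟩, 0, 0, ?_⟩
    simp only [Finset.sum_empty, map_zero, Pi.zero_apply, TensorProduct.zero_tmul,
      Finset.sum_const_zero, add_zero]
  | insert k s hk ih =>
    obtain ⟨V, i, i₀, hV, H, w, hw⟩ := ih fun k hk => hφ k (Finset.mem_insert_of_mem hk)
    obtain ⟨V', i', i₀', hV', a, ψ, hψ⟩ := hc.exists_expand (φ k)
      (hφ k (Finset.mem_insert_self _ _)) hz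
    have h1 : resTensor i' (g k ⊗ₜ φ k) = ∑ j, (a j • paramRes i' (g k)) ⊗ₜ
        pullbackHom i₀' (c j) + tensorPrecomp d₀ V' (paramRes i' (g k) ⊗ₜ ψ) := by
      rw [resTensor_tmul, hψ, TensorProduct.tmul_add, TensorProduct.tmul_sum]
      refine congrArg (· + _) (Finset.sum_congr rfl fun j _ => ?_)
      rw [TensorProduct.tmul_smul, TensorProduct.smul_tmul']
    refine ⟨V ⊓ V', inf_le_left.trans i, fun w hw => i₀ w hw.1, ⟨hV, hV'⟩,
      fun j => paramRes inf_le_right (a j • paramRes i' (g k)) + paramRes inf_le_left (H j),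
      resTensor inf_le_right (paramRes i' (g k) ⊗ₜ ψ) + resTensor inf_le_left w, ?_⟩
    have h2 := congrArg (resTensor (inf_le_left : V ⊓ V' ≤ V)) hw
    have h3 := congrArg (resTensor (inf_le_right : V ⊓ V' ≤ V')) h1
    rw [resTensor_expansion, resTensor_resTensor] at h2 h3
    rw [Finset.sum_insert hk, map_add, map_add (tensorPrecomp d₀ (V ⊓ V'))]
    refine (congrArg₂ (· + ·) h3 h2).trans ?_
    simp only [TensorProduct.add_tmul, Finset.sum_add_distrib]
    abel

/-- A combination of the basis with holomorphic coefficients which is a coboundary vanishes. -/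
lemma IsLocalBasis.coeff_eq_zero (hc : IsLocalBasis d₁.hom d₀.hom z.1 c)
    {V : Opens (CBar p × Par q)} (i₀ : ∀ z ∈ V, (z.1, (0 : Par 0)) ∈ baseOpen V₀) (hz : z ∈ V)
    (H : Fin h → paramSections p q V) (y : P₀ →ₗ[DAlg p] rapidSections p q V)
    (hy : ∀ u, ∑ j, H j • constParam 0 i₀ (c j u) = y (d₀.hom u)) :
    ∃ (V' : Opens (CBar p × Par q)) (i : V' ≤ V), z ∈ V' ∧ ∀ j, paramRes i (H j) = 0 := by
  -- Near z every coefficient is a function of the parameter alone, and the neighbourhood is shrunk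
  -- to a product on which this holds for all j.
  choose Vp g _ _ hg using fun j => (H j).2 z hz
  obtain ⟨W, O, hzW, -, hWO⟩ := exists_prodOpen_le
    (Filter.inter_mem (V.isOpen.mem_nhds hz) (Filter.eventually_all.2 hg))
  have hle : prodOpen W O ≤ V := fun w hw => (hWO hw).1
  refine ⟨prodOpen W O, hle, hzW, fun j => Subtype.ext (funext fun w => ?_)⟩
  have hW₀ : W ≤ V₀ := fun x hx => i₀ (x, z.2) (hle ⟨hx, hzW.2⟩)
  have hs : ∀ v ∈ baseOpen W, (v.1, w.1.2) ∈ V := fun v hv => hle ⟨hv, w.2.2⟩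
  -- With the parameter frozen at that of w, the relation becomes one between cocycles without
  -- parameter over W, with constants as coefficients.
  have h0 := hc.indep W hW₀ (fun j => g j w.1.2) (constParam w.1.2 hs ∘ₗ y) hzW.1 (fun u => by
    rw [LinearMap.comp_apply, ← hy u, map_sum]
    refine Finset.sum_congr rfl fun j _ => Subtype.ext (funext fun v => ?_)
    have h1 : ext (H j).1 (v.1.1, w.1.2) = g j w.1.2 := (hWO (a := (v.1.1, w.1.2)) ⟨v.2, w.2.2⟩).2 j
    rw [ext_of_mem _ (hs v.1 v.2)] at h1
    change g j w.1.2 * _ = (H j).1 _ * _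
    rw [h1]
    exact congrArg (fun t => g j w.1.2 * (c j u).1 t)
      (Subtype.ext (Prod.ext rfl (Subsingleton.elim _ _)))) j
  have h1 : ext (H j).1 w.1 = g j w.1.2 := (hWO w.2).2 j
  rw [ext_of_mem _ (hle w.2), h0] at h1
  exact h1

/-- With the first factors taken from a basis over ℂ, the second factors are unique. The
differential acts on them one by one, so each of them is killed. -/
lemma exists_cocycle_repr {U : Opens (CBar p × Par q)}
    (τ : paramSections p q U ⊗[ℂ] PullbackHoms P₁ U) (hτ : tensorPrecomp d₁ U τ = 0) :
    ∃ (ι : Type) (s : Finset ι) (g : ι → paramSections p q U) (φ : ι → PullbackHoms P₁ U),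
      (∀ k ∈ s, precompHom d₁ U (φ k) = 0) ∧ τ = ∑ k ∈ s, g k ⊗ₜ φ k := by
  let b := Module.Basis.ofVectorSpace ℂ (paramSections p q U)
  obtain ⟨f, rfl⟩ := TensorProduct.eq_repr_basis_left b τ
  refine ⟨_, f.support, b, f, fun k _ => ?_, rfl⟩
  have h1 : (f.mapRange (precompHom d₁ U) (map_zero _)).sum (fun k n => b k ⊗ₜ[ℂ] n) = 0 := by
    rw [Finsupp.sum_mapRange_index fun k => TensorProduct.tmul_zero _ _]
    refine Eq.trans ?_ hτ
    rw [Finsupp.sum, Finsupp.sum, map_sum]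
    rfl
  exact DFunLike.congr_fun (TensorProduct.sum_tmul_basis_left_eq_zero b _ h1) k

/-- Modulo coboundaries of the tensor complex the cocycle is ∑ H_j ⊗ c_j. Its product is a
coboundary by hypothesis, which forces H_j = 0 near z. -/
theorem IsLocalBasis.exists_tensorPrecomp_eq (hc : IsLocalBasis d₁.hom d₀.hom z.1 c)
    {U : Opens (CBar p × Par q)} (τ : paramSections p q U ⊗[ℂ] PullbackHoms P₁ U)
    (y : P₀ →ₗ[DAlg p] rapidSections p q U) (hτ : tensorPrecomp d₁ U τ = 0)
    (hy : mulMap P₁ U τ = y ∘ₗ d₀.hom) (hz : z ∈ U) :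
    ∃ (V : Opens (CBar p × Par q)) (i : V ≤ U), z ∈ V ∧
      ∃ w, resTensor i τ = tensorPrecomp d₀ V w := by
  obtain ⟨ι, s, g, φ, hφ, rfl⟩ := exists_cocycle_repr τ hτ
  obtain ⟨V, i, i₀, hV, H, w, hw⟩ := hc.exists_expand_sum hz s g φ hφ
  have h1 := (mulMap_resTensor i _).symm.trans (congrArg (mulMap P₁ V) hw)
  rw [hy, map_add, mulMap_tensorPrecomp, map_sum] at h1
  -- The primitive of ∑ H_j c_j is the given one minus the product of the coboundary part w.
  obtain ⟨V', i', hV', hH⟩ := hc.coeff_eq_zero i₀ hV H (res i ∘ₗ y - mulMap P₀ V w) fun u => by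
    have h2 := LinearMap.congr_fun h1 u
    rw [LinearMap.add_apply, LinearMap.sum_apply] at h2
    exact eq_sub_of_add_eq h2.symm
  refine ⟨V', i'.trans i, hV', resTensor i' w, ?_⟩
  have h3 := congrArg (resTensor i') hw
  rw [resTensor_resTensor, resTensor_expansion] at h3
  rw [h3]
  simp only [hH, TensorProduct.zero_tmul, Finset.sum_const_zero, zero_add]

end

theorem quasiIso_canonicalMap_of_isRConstructible {M : ModuleCat.{0} (DAlg p)}
    [Module.Finite (DAlg p) M] (P : ProjectiveResolution M)
    (hR : ∀ n : ℕ, IsRConstructible ((rhom P (rapidSheafBase p)).homology n)) (q : ℕ) :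
    QuasiIso (canonicalMap P q) := by
  refine quasiIso_canonicalMap_of_local P (exists_mulMap_eq P hR) ?_
  intro n U τ y hτ hy z hz
  obtain ⟨h, V₀, c, hc⟩ := exists_isLocalBasis P n (hR n) z.1
  exact hc.exists_tensorPrecomp_eq τ y hτ hy hz
end
end RapidDecay

namespace RapidDecay
noncomputable section
variable {p : ℕ}

/-! ### Modules over `D` from operators -/

/-- The `D`-module structure given by operators that satisfy the relations. -/
abbrev moduleOfOperators {N : Type} [AddCommGroup N] [Module ℂ N] (g : Gen p → Module.End ℂ N)
    (h : ∀ ⦃a b⦄, Rel p a b → FreeAlgebra.lift ℂ g a = FreeAlgebra.lift ℂ g b) :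
    Module (DAlg p) N :=
  Module.compHom N (RingQuot.liftAlgHom ℂ ⟨FreeAlgebra.lift ℂ g, h⟩ :
    DAlg p →ₐ[ℂ] Module.End ℂ N).toRingHom

lemma moduleOfOperators_gen {N : Type} [AddCommGroup N] [Module ℂ N] (g : Gen p → Module.End ℂ N)
    (h : ∀ ⦃a b⦄, Rel p a b → FreeAlgebra.lift ℂ g a = FreeAlgebra.lift ℂ g b) (i : Gen p) (x : N) :
    letI := moduleOfOperators g h
    DAlg.gen i • x = g i x := by
  change (RingQuot.liftAlgHom ℂ ⟨FreeAlgebra.lift ℂ g, h⟩ : DAlg p →ₐ[ℂ] Module.End ℂ N)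
    (DAlg.gen i) x = g i x
  simp [DAlg.gen]

lemma moduleOfOperators_tower {N : Type} [AddCommGroup N] [Module ℂ N]
    (g : Gen p → Module.End ℂ N)
    (h : ∀ ⦃a b⦄, Rel p a b → FreeAlgebra.lift ℂ g a = FreeAlgebra.lift ℂ g b) :
    letI := moduleOfOperators g h
    IsScalarTower ℂ (DAlg p) N := by
  let := moduleOfOperators g h
  constructor
  intro c d x
  change (RingQuot.liftAlgHom ℂ ⟨FreeAlgebra.lift ℂ g, h⟩ : DAlg p →ₐ[ℂ] Module.End ℂ N)
    (c • d) x = c • (RingQuot.liftAlgHom ℂ ⟨FreeAlgebra.lift ℂ g, h⟩ : DAlg p →ₐ[ℂ] _) d x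
  rw [map_smul]; rfl

namespace DAlg

lemma gen_t_tInv (j : Fin p) : gen (Gen.t j) * gen (Gen.tInv j) = 1 := by
  simpa [gen] using RingQuot.mkAlgHom_rel ℂ (Rel.t_tInv j)

lemma gen_tInv_t (j : Fin p) : gen (Gen.tInv j) * gen (Gen.t j) = 1 := by
  simpa [gen] using RingQuot.mkAlgHom_rel ℂ (Rel.tInv_t j)

lemma gen_t_comm (i j : Fin p) : gen (Gen.t i) * gen (Gen.t j) = gen (Gen.t j) * gen (Gen.t i) := by
  simpa [gen] using RingQuot.mkAlgHom_rel ℂ (Rel.t_comm i j)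

lemma gen_theta_comm (i j : Fin p) :
    gen (Gen.theta i) * gen (Gen.theta j) = gen (Gen.theta j) * gen (Gen.theta i) := by
  simpa [gen] using RingQuot.mkAlgHom_rel ℂ (Rel.theta_comm i j)

lemma gen_theta_t_self (j : Fin p) :
    gen (Gen.theta j) * gen (Gen.t j) = gen (Gen.t j) * gen (Gen.theta j) + gen (Gen.t j) := by
  simpa [gen] using RingQuot.mkAlgHom_rel ℂ (Rel.theta_t_self j)

lemma gen_theta_t {i j : Fin p} (h : i ≠ j) :
    gen (Gen.theta i) * gen (Gen.t j) = gen (Gen.t j) * gen (Gen.theta i) := by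
  simpa [gen] using RingQuot.mkAlgHom_rel ℂ (Rel.theta_t i j h)

/-- The unit `t_j`. -/
def tUnit (j : Fin p) : (DAlg p)ˣ := ⟨gen (Gen.t j), gen (Gen.tInv j), gen_t_tInv j, gen_tInv_t j⟩

lemma commute_tInv {a : DAlg p} {j : Fin p} (h : Commute a (gen (Gen.t j))) :
    Commute a (gen (Gen.tInv j)) :=
  Commute.units_inv_right (u := tUnit j) h

lemma gen_theta_tInv_self (j : Fin p) :
    gen (Gen.theta j) * gen (Gen.tInv j) = gen (Gen.tInv j) * gen (Gen.theta j) - gen (Gen.tInv j) := by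
  have h := congrArg (fun a => gen (Gen.tInv j) * a * gen (Gen.tInv j)) (gen_theta_t_self j)
  simp only [mul_add, add_mul, mul_assoc, gen_t_tInv, mul_one] at h
  rw [← mul_assoc (gen (Gen.tInv j)) (gen (Gen.t j)), gen_tInv_t, one_mul] at h
  rw [h]; abel

end DAlg

section RelProj

/-- A linear map between `D`-modules commutes with the generators in `S`. -/
def CommutesWith (S : Set (Gen p)) {L X : Type} [AddCommGroup L] [AddCommGroup X] [Module ℂ L]
    [Module ℂ X] [Module (DAlg p) L] [Module (DAlg p) X] (f : L →ₗ[ℂ] X) : Prop :=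
  ∀ g ∈ S, ∀ l, f (DAlg.gen g • l) = DAlg.gen g • f l

/-- Maps out of `L` that commute with the generators in `S` lift through surjections of
`D`-modules. -/
def RelProjective (S : Set (Gen p)) (L : Type) [AddCommGroup L] [Module ℂ L]
    [Module (DAlg p) L] : Prop :=
  ∀ (X Y : Type) [AddCommGroup X] [AddCommGroup Y] [Module ℂ X] [Module ℂ Y] [Module (DAlg p) X]
    [Module (DAlg p) Y] [IsScalarTower ℂ (DAlg p) X] [IsScalarTower ℂ (DAlg p) Y]
    (π : X →ₗ[DAlg p] Y) (f : L →ₗ[ℂ] Y), Function.Surjective π → CommutesWith S f →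
    ∃ u : L →ₗ[ℂ] X, CommutesWith S u ∧ ∀ l, π (u l) = f l

/-- With no generator to respect, this is the splitting of surjections of vector spaces. -/
lemma relProjective_empty (L : Type) [AddCommGroup L] [Module ℂ L] [Module (DAlg p) L] :
    RelProjective (p := p) ∅ L := by
  intro X Y _ _ _ _ _ _ _ _ π f hπ _
  obtain ⟨s, hs⟩ := (π.restrictScalars ℂ).exists_rightInverse_of_surjective
    (LinearMap.range_eq_top.2 hπ)
  exact ⟨s ∘ₗ f, fun g hg => hg.elim, fun l => LinearMap.congr_fun hs (f l)⟩

variable {L : Type} [AddCommGroup L] [Module ℂ L] [Module (DAlg p) L] [IsScalarTower ℂ (DAlg p) L]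

/-- The action of an element of `D` as a `ℂ`-linear map. -/
abbrev actLin (d : DAlg p) : Module.End ℂ L := Algebra.lsmul ℂ ℂ L d

open Polynomial

/-- The operators on `L[x]` for the module induced from the subalgebra without `θ_j`. -/
def thetaExtOp (L : Type) [AddCommGroup L] [Module ℂ L] [Module (DAlg p) L]
    [IsScalarTower ℂ (DAlg p) L] (j : Fin p) : Gen p → Module.End ℂ (ℂ[X] ⊗[ℂ] L)
  -- From θ_j t_j = t_j (θ_j + 1) one gets t_j f(θ_j) = f(θ_j - 1) t_j and t_j⁻¹ f(θ_j) = f(θ_j + 1)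
  -- t_j⁻¹, whence the substitutions x - 1 and x + 1.
  | Gen.t i => TensorProduct.map
      (if i = j then (aeval (X - 1 : ℂ[X])).toLinearMap else LinearMap.id) (actLin (DAlg.gen (Gen.t i)))
  | Gen.tInv i => TensorProduct.map
      (if i = j then (aeval (X + 1 : ℂ[X])).toLinearMap else LinearMap.id)
      (actLin (DAlg.gen (Gen.tInv i)))
  | Gen.theta i => if i = j then TensorProduct.map (LinearMap.mulLeft ℂ X) LinearMap.id
      else TensorProduct.map LinearMap.id (actLin (DAlg.gen (Gen.theta i)))

lemma thetaExtOp_rel (j : Fin p) ⦃a b : FreeAlgebra ℂ (Gen p)⦄ (h : Rel p a b) :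
    FreeAlgebra.lift ℂ (thetaExtOp L j) a = FreeAlgebra.lift ℂ (thetaExtOp L j) b := by
  have e1 : ∀ f : ℂ[X], aeval (X - 1 : ℂ[X]) (aeval (X + 1 : ℂ[X]) f) = f := by
    intro f
    induction f using Polynomial.induction_on' with
    | add a b ha hb => simp only [map_add, ha, hb]
    | monomial n c => simp [← C_mul_X_pow_eq_monomial]
  have e2 : ∀ f : ℂ[X], aeval (X + 1 : ℂ[X]) (aeval (X - 1 : ℂ[X]) f) = f := by
    intro f
    induction f using Polynomial.induction_on' with
    | add a b ha hb => simp only [map_add, ha, hb]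
    | monomial n c => simp [← C_mul_X_pow_eq_monomial]
  cases h with
  | t_comm i k =>
    refine TensorProduct.ext' fun f l => ?_
    by_cases hi : i = j <;> by_cases hk : k = j <;>
      simp [thetaExtOp, hi, hk, smul_smul, DAlg.gen_t_comm]
  | t_tInv i =>
    refine TensorProduct.ext' fun f l => ?_
    by_cases hi : i = j <;> simp [thetaExtOp, hi, smul_smul, DAlg.gen_t_tInv, e1]
  | tInv_t i =>
    refine TensorProduct.ext' fun f l => ?_
    by_cases hi : i = j <;> simp [thetaExtOp, hi, smul_smul, DAlg.gen_tInv_t, e2]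
  | theta_comm i k =>
    refine TensorProduct.ext' fun f l => ?_
    by_cases hi : i = j <;> by_cases hk : k = j <;> simp [thetaExtOp, hi, hk, smul_smul]
    rw [DAlg.gen_theta_comm]
  | theta_t_self i =>
    refine TensorProduct.ext' fun f l => ?_
    by_cases hi : i = j
    · simp [thetaExtOp, hi, sub_mul, TensorProduct.sub_tmul]
    · simp [thetaExtOp, hi, smul_smul, DAlg.gen_theta_t_self, add_smul, TensorProduct.tmul_add]
  | theta_t i k hik =>
    refine TensorProduct.ext' fun f l => ?_
    by_cases hi : i = j <;> by_cases hk : k = j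
    · exact absurd (hi.trans hk.symm) hik
    all_goals simp [thetaExtOp, hi, hk, smul_smul]
    all_goals rw [DAlg.gen_theta_t]
    all_goals assumption

end RelProj
end
end RapidDecay

/-! ### Modules induced from the subalgebra without θ_j -/

namespace RapidDecay
noncomputable section
variable {p : ℕ}

section Induction
open Polynomial

/-- A `ℂ`-linear map that commutes with the generators is `D`-linear. -/
def linOfGen {N N' : Type} [AddCommGroup N] [AddCommGroup N'] [Module ℂ N] [Module ℂ N']
    [Module (DAlg p) N] [Module (DAlg p) N'] [IsScalarTower ℂ (DAlg p) N]
    [IsScalarTower ℂ (DAlg p) N'] (φ : N →ₗ[ℂ] N')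
    (h : ∀ (g : Gen p) (x : N), φ (DAlg.gen g • x) = DAlg.gen g • φ x) : N →ₗ[DAlg p] N' where
  toFun := φ
  map_add' := φ.map_add
  map_smul' := smul_of_gen φ.toAddMonoidHom
    (fun c x => by simp only [algebraMap_smul]; exact φ.map_smul c x) h

lemma linOfGen_apply {N N' : Type} [AddCommGroup N] [AddCommGroup N'] [Module ℂ N] [Module ℂ N']
    [Module (DAlg p) N] [Module (DAlg p) N'] [IsScalarTower ℂ (DAlg p) N]
    [IsScalarTower ℂ (DAlg p) N'] (φ : N →ₗ[ℂ] N')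
    (h : ∀ (g : Gen p) (x : N), φ (DAlg.gen g • x) = DAlg.gen g • φ x) (x : N) :
    linOfGen φ h x = φ x := rfl

/-- When all generators are respected, the ℂ-linear lift is D-linear, so lifting is projectivity in
the usual sense. -/
lemma RelProjective.projective {L : Type} [AddCommGroup L] [Module ℂ L] [Module (DAlg p) L]
    [IsScalarTower ℂ (DAlg p) L] (h : RelProjective (p := p) Set.univ L) :
    Projective (ModuleCat.of (DAlg p) L) := by
  refine ⟨fun {X Y} f e he => ?_⟩
  let : Module ℂ X := Module.compHom X (algebraMap ℂ (DAlg p))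
  let : Module ℂ Y := Module.compHom Y (algebraMap ℂ (DAlg p))
  have : IsScalarTower ℂ (DAlg p) X := ⟨fun c d x => by
    rw [Algebra.smul_def, mul_smul]; rfl⟩
  have : IsScalarTower ℂ (DAlg p) Y := ⟨fun c d x => by
    rw [Algebra.smul_def, mul_smul]; rfl⟩
  obtain ⟨u, hu, huf⟩ := h X Y e.hom (f.hom.restrictScalars ℂ)
    ((ModuleCat.epi_iff_surjective e).1 he) (fun g _ l => f.hom.map_smul _ _)
  exact ⟨ModuleCat.ofHom (linOfGen u fun g x => hu g trivial x),
    ModuleCat.hom_ext (LinearMap.ext huf)⟩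

variable {L : Type} [AddCommGroup L] [Module ℂ L]

/-- The module `L[x]` induced from the restriction of `L` to the subalgebra without `θ_j`. -/
def ThetaExt (_ : Fin p) (L : Type) [AddCommGroup L] [Module ℂ L] : Type := ℂ[X] ⊗[ℂ] L

instance (j : Fin p) : AddCommGroup (ThetaExt j L) := inferInstanceAs (AddCommGroup (ℂ[X] ⊗[ℂ] L))
instance (j : Fin p) : Module ℂ (ThetaExt j L) := inferInstanceAs (Module ℂ (ℂ[X] ⊗[ℂ] L))

/-- The element `f ⊗ l` of `L[x]`. -/
def ThetaExt.tmul (j : Fin p) (f : ℂ[X]) : L →ₗ[ℂ] ThetaExt j L := TensorProduct.mk ℂ ℂ[X] L f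

lemma ThetaExt.tmul_add_left (j : Fin p) (f g : ℂ[X]) (l : L) :
    ThetaExt.tmul j (f + g) l = ThetaExt.tmul j f l + ThetaExt.tmul j g l :=
  TensorProduct.add_tmul f g l

lemma ThetaExt.tmul_smul_left (j : Fin p) (c : ℂ) (f : ℂ[X]) (l : L) :
    ThetaExt.tmul j (c • f) l = c • ThetaExt.tmul j f l := rfl

@[elab_as_elim]
lemma ThetaExt.induction_on {j : Fin p} {P : ThetaExt j L → Prop} (x : ThetaExt j L) (zero : P 0)
    (tmul : ∀ f l, P (ThetaExt.tmul j f l)) (add : ∀ a b, P a → P b → P (a + b)) : P x :=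
  TensorProduct.induction_on (motive := P) x zero tmul add

@[elab_as_elim]
lemma ThetaExt.induction_pow {j : Fin p} {P : ThetaExt j L → Prop} (x : ThetaExt j L)
    (zero : P 0) (tmul : ∀ n l, P (ThetaExt.tmul j (X ^ n) l))
    (add : ∀ a b, P a → P b → P (a + b)) : P x := by
  induction x using ThetaExt.induction_on with
  | zero => exact zero
  | add a b ha hb => exact add a b ha hb
  | tmul f l =>
    induction f using Polynomial.induction_on' with
    | add f g hf hg => rw [ThetaExt.tmul_add_left]; exact add _ _ hf hg
    | monomial n c =>
      rw [← C_mul_X_pow_eq_monomial, ← smul_eq_C_mul, ThetaExt.tmul_smul_left, ← map_smul]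
      exact tmul n (c • l)

variable {N : Type} [AddCommGroup N] [Module ℂ N] [Module (DAlg p) N] [IsScalarTower ℂ (DAlg p) N]

/-- The map `x^n ⊗ l ↦ θ_j^n u(l)`. -/
def thetaLift (j : Fin p) (u : L →ₗ[ℂ] N) : ThetaExt j L →ₗ[ℂ] N :=
  TensorProduct.lift ((LinearMap.lcomp ℂ N u) ∘ₗ
    ((Algebra.lsmul ℂ ℂ N).toLinearMap ∘ₗ
      (aeval (DAlg.gen (Gen.theta j)) : ℂ[X] →ₐ[ℂ] DAlg p).toLinearMap))

lemma thetaLift_tmul (j : Fin p) (u : L →ₗ[ℂ] N) (f : ℂ[X]) (l : L) :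
    thetaLift j u (ThetaExt.tmul j f l) = aeval (DAlg.gen (Gen.theta j)) f • u l := rfl

variable [Module (DAlg p) L] [IsScalarTower ℂ (DAlg p) L]

instance (j : Fin p) : Module (DAlg p) (ThetaExt j L) :=
  moduleOfOperators (N := ℂ[X] ⊗[ℂ] L) (thetaExtOp L j) (thetaExtOp_rel j)
instance (j : Fin p) : IsScalarTower ℂ (DAlg p) (ThetaExt j L) :=
  moduleOfOperators_tower (N := ℂ[X] ⊗[ℂ] L) (thetaExtOp L j) (thetaExtOp_rel j)

lemma thetaExt_gen_smul (j : Fin p) (g : Gen p) (x : ThetaExt j L) :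
    DAlg.gen g • x = thetaExtOp L j g x :=
  moduleOfOperators_gen (N := ℂ[X] ⊗[ℂ] L) (thetaExtOp L j) (thetaExtOp_rel j) g x

/-- The index of a generator. -/
def Gen.index : Gen p → Fin p
  | .t j => j
  | .tInv j => j
  | .theta j => j

lemma DAlg.commute_gen {a b : Gen p} (h : a.index ≠ b.index) :
    Commute (DAlg.gen a) (DAlg.gen b) := by
  have ht : ∀ i (b : Gen p), i ≠ b.index → Commute (DAlg.gen (Gen.t i)) (DAlg.gen b) := by
    intro i b hi
    cases b with
    | t j => exact DAlg.gen_t_comm i j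
    | tInv j => exact DAlg.commute_tInv (DAlg.gen_t_comm i j)
    | theta j => exact (DAlg.gen_theta_t hi.symm).symm
  cases a with
  | t i => exact ht i b h
  | tInv i => exact (DAlg.commute_tInv (ht i b h).symm).symm
  | theta i =>
    cases b with
    | t j => exact DAlg.gen_theta_t h
    | tInv j => exact DAlg.commute_tInv (DAlg.gen_theta_t h)
    | theta j => exact DAlg.gen_theta_comm i j

lemma thetaExt_theta (j : Fin p) (f : ℂ[X]) (l : L) :
    DAlg.gen (Gen.theta j) • ThetaExt.tmul j f l = ThetaExt.tmul j (X * f) l := by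
  refine (thetaExt_gen_smul j _ _).trans ?_
  rw [thetaExtOp, if_pos rfl]
  rfl

lemma thetaExt_t (j : Fin p) (f : ℂ[X]) (l : L) : DAlg.gen (Gen.t j) • ThetaExt.tmul j f l =
    ThetaExt.tmul j (aeval (X - 1 : ℂ[X]) f) (DAlg.gen (Gen.t j) • l) := by
  refine (thetaExt_gen_smul j _ _).trans ?_
  rw [thetaExtOp, if_pos rfl]
  rfl

lemma thetaExt_tInv (j : Fin p) (f : ℂ[X]) (l : L) :
    DAlg.gen (Gen.tInv j) • ThetaExt.tmul j f l =
      ThetaExt.tmul j (aeval (X + 1 : ℂ[X]) f) (DAlg.gen (Gen.tInv j) • l) := by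
  refine (thetaExt_gen_smul j _ _).trans ?_
  rw [thetaExtOp, if_pos rfl]
  rfl

lemma thetaExt_of_ne {j : Fin p} {g : Gen p} (h : g.index ≠ j) (f : ℂ[X]) (l : L) :
    DAlg.gen g • ThetaExt.tmul j f l = ThetaExt.tmul j f (DAlg.gen g • l) := by
  refine (thetaExt_gen_smul j _ _).trans ?_
  cases g with
  | t i => rw [thetaExtOp, if_neg (show i ≠ j from h)]; rfl
  | tInv i => rw [thetaExtOp, if_neg (show i ≠ j from h)]; rfl
  | theta i => rw [thetaExtOp, if_neg (show i ≠ j from h)]; rfl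

lemma thetaExt_one {j : Fin p} {g : Gen p} (h : g ≠ Gen.theta j) (l : L) :
    DAlg.gen g • ThetaExt.tmul j 1 l = ThetaExt.tmul j 1 (DAlg.gen g • l) := by
  by_cases hi : g.index = j
  · subst hi
    cases g with
    | t i => exact (thetaExt_t i 1 l).trans (by rw [map_one]; rfl)
    | tInv i => exact (thetaExt_tInv i 1 l).trans (by rw [map_one]; rfl)
    | theta i => exact absurd rfl h
  · exact thetaExt_of_ne hi 1 l

/-- The relation between θ_j and t_j says that t_j intertwines θ_j with θ_j - 1, and therefore
f(θ_j) with f(θ_j - 1). -/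
lemma aeval_theta_mul_t (j : Fin p) (f : ℂ[X]) :
    aeval (DAlg.gen (Gen.theta j)) (aeval (X - 1 : ℂ[X]) f) * DAlg.gen (Gen.t j) =
      DAlg.gen (Gen.t j) * aeval (DAlg.gen (Gen.theta j)) f := by
  induction f using Polynomial.induction_on' with
  | add f g hf hg => simp only [map_add, add_mul, mul_add, hf, hg]
  | monomial n a =>
    have h1 : SemiconjBy (DAlg.gen (Gen.t j)) (DAlg.gen (Gen.theta j))
        (DAlg.gen (Gen.theta j) - 1) := by
      rw [SemiconjBy, sub_mul, DAlg.gen_theta_t_self, one_mul, add_sub_cancel_right]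
    have h2 := (h1.pow_right n).eq
    rw [← C_mul_X_pow_eq_monomial]
    simp only [map_mul, map_pow, aeval_C, aeval_X, map_sub, map_one, Polynomial.algebraMap_eq]
    rw [mul_assoc, ← h2, ← mul_assoc, ← mul_assoc, Algebra.commutes]

lemma aeval_theta_mul_tInv (j : Fin p) (f : ℂ[X]) :
    aeval (DAlg.gen (Gen.theta j)) (aeval (X + 1 : ℂ[X]) f) * DAlg.gen (Gen.tInv j) =
      DAlg.gen (Gen.tInv j) * aeval (DAlg.gen (Gen.theta j)) f := by
  induction f using Polynomial.induction_on' with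
  | add f g hf hg => simp only [map_add, add_mul, mul_add, hf, hg]
  | monomial n a =>
    have h1 : SemiconjBy (DAlg.gen (Gen.tInv j)) (DAlg.gen (Gen.theta j))
        (DAlg.gen (Gen.theta j) + 1) := by
      rw [SemiconjBy, add_mul, DAlg.gen_theta_tInv_self, one_mul, sub_add_cancel]
    have h2 := (h1.pow_right n).eq
    rw [← C_mul_X_pow_eq_monomial]
    simp only [map_mul, map_pow, aeval_C, aeval_X, map_add, map_one, Polynomial.algebraMap_eq]
    rw [mul_assoc, ← h2, ← mul_assoc, ← mul_assoc, Algebra.commutes]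

lemma aeval_commute {a b : DAlg p} (h : Commute a b) (f : ℂ[X]) : Commute (aeval a f) b := by
  induction f using Polynomial.induction_on' with
  | add f g hf hg => rw [map_add]; exact hf.add_left hg
  | monomial n c =>
    rw [← C_mul_X_pow_eq_monomial, map_mul, map_pow, aeval_X, aeval_C]
    exact (Algebra.commute_algebraMap_left c b).mul_left (h.pow_left _)

lemma thetaLift_theta (j : Fin p) (u : L →ₗ[ℂ] N) (x : ThetaExt j L) :
    thetaLift j u (DAlg.gen (Gen.theta j) • x) = DAlg.gen (Gen.theta j) • thetaLift j u x := by
  induction x using ThetaExt.induction_on with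
  | zero => simp only [smul_zero, map_zero]
  | add a b ha hb => simp only [smul_add, map_add, ha, hb]
  | tmul f l => rw [thetaExt_theta, thetaLift_tmul, thetaLift_tmul, map_mul, aeval_X, mul_smul]

lemma thetaLift_gen (j : Fin p) (u : L →ₗ[ℂ] N) {g : Gen p} (hg : g ≠ Gen.theta j)
    (hu : ∀ l, u (DAlg.gen g • l) = DAlg.gen g • u l) (x : ThetaExt j L) :
    thetaLift j u (DAlg.gen g • x) = DAlg.gen g • thetaLift j u x := by
  induction x using ThetaExt.induction_on with
  | zero => simp only [smul_zero, map_zero]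
  | add a b ha hb => simp only [smul_add, map_add, ha, hb]
  | tmul f l =>
    rw [thetaLift_tmul]
    by_cases hi : g.index = j
    · subst hi
      cases g with
      | t i =>
        refine (congrArg (thetaLift i u) (thetaExt_t i f l)).trans ?_
        rw [thetaLift_tmul, hu, smul_smul, aeval_theta_mul_t, mul_smul]
        rfl
      | tInv i =>
        refine (congrArg (thetaLift i u) (thetaExt_tInv i f l)).trans ?_
        rw [thetaLift_tmul, hu, smul_smul, aeval_theta_mul_tInv, mul_smul]
        rfl
      | theta i => exact absurd rfl hg
    · rw [thetaExt_of_ne hi, thetaLift_tmul, hu, smul_smul, smul_smul,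
        (aeval_commute (DAlg.commute_gen (a := Gen.theta j) (b := g) (Ne.symm hi)) f).eq]

/-- The elements 1 ⊗ l generate L[x] under θ_j, so a map commuting with θ_j is determined by its
values on them. -/
lemma thetaLift_restrict (j : Fin p) (f : ThetaExt j L →ₗ[ℂ] N)
    (hf : ∀ x, f (DAlg.gen (Gen.theta j) • x) = DAlg.gen (Gen.theta j) • f x) (x : ThetaExt j L) :
    thetaLift j (f ∘ₗ ThetaExt.tmul j 1) x = f x := by
  induction x using ThetaExt.induction_on with
  | zero => simp only [map_zero]
  | add a b ha hb => simp only [map_add, ha, hb]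
  | tmul P l =>
    rw [thetaLift_tmul]
    induction P using Polynomial.induction_on with
    | C a =>
      rw [aeval_C, algebraMap_smul, ← mul_one (C a), ← smul_eq_C_mul, ThetaExt.tmul_smul_left,
        map_smul]
      rfl
    | add P Q hP hQ => rw [map_add, add_smul, hP, hQ, ThetaExt.tmul_add_left, map_add]
    | monomial n a h =>
      rw [pow_succ', ← mul_assoc, mul_comm (C a), mul_assoc, map_mul, aeval_X, mul_smul, h, ← hf,
        thetaExt_theta]

/-- Induction is adjoint to restriction: maps out of L[x] commuting with S and θ_j correspond to
maps out of L commuting with S. A lifting problem for L[x] is thus one for L with the generator θ_j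
removed. -/
lemma RelProjective.thetaExt (j : Fin p) {S : Set (Gen p)} (hS : Gen.theta j ∉ S)
    (h : RelProjective S L) : RelProjective (insert (Gen.theta j) S) (ThetaExt j L) := by
  intro X Y _ _ _ _ _ _ _ _ π f hπ hf
  have hne : ∀ g ∈ S, g ≠ Gen.theta j := by rintro _ hg rfl; exact hS hg
  have hf0 : CommutesWith S (f ∘ₗ ThetaExt.tmul j 1) := fun g hg l =>
    (congrArg f (thetaExt_one (hne g hg) l).symm).trans (hf g (Set.mem_insert_of_mem _ hg) _)
  obtain ⟨u, hu, huf⟩ := h X Y π _ hπ hf0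
  refine ⟨thetaLift j u, ?_, fun x => ?_⟩
  · rintro g (rfl | hg) x
    · exact thetaLift_theta j u x
    · exact thetaLift_gen j u (hne g hg) (hu g hg) x
  rw [← thetaLift_restrict j f (hf _ (Set.mem_insert _ _))]
  induction x using ThetaExt.induction_on with
  | zero => simp only [map_zero]
  | add a b ha hb => simp only [map_add, ha, hb]
  | tmul P l => rw [thetaLift_tmul, thetaLift_tmul, map_smul, huf]
end Induction
end
end RapidDecay

namespace RapidDecay
noncomputable section
variable {p : ℕ}

/-! ### Projective dimension -/

section Resolution
open Polynomial
variable {L : Type} [AddCommGroup L] [Module ℂ L] [Module (DAlg p) L] [IsScalarTower ℂ (DAlg p) L]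

/-- A relation between projective dimensions in a self-extension with quotient `L`. -/
lemma hasProjectiveDimensionLT_of_quotient {L K : Type} [AddCommGroup L] [Module (DAlg p) L]
    [AddCommGroup K] [Module (DAlg p) K] (δ : K →ₗ[DAlg p] K) (ε : K →ₗ[DAlg p] L)
    (hδ : Function.Injective δ) (hε : Function.Surjective ε) (h : Function.Exact δ ε) {n : ℕ}
    (hK : HasProjectiveDimensionLT (ModuleCat.of (DAlg p) K) n) :
    HasProjectiveDimensionLT (ModuleCat.of (DAlg p) L) (n + 1) := by
  let S : ShortComplex (ModuleCat.{0} (DAlg p)) :=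
    ShortComplex.mk (ModuleCat.ofHom δ) (ModuleCat.ofHom ε)
      (ModuleCat.hom_ext (LinearMap.ext fun x => h.apply_apply_eq_zero x))
  have hS : S.ShortExact :=
    { exact := (ShortComplex.ShortExact.moduleCat_exact_iff_function_exact S).2 h
      mono_f := (ModuleCat.mono_iff_injective _).2 hδ
      epi_g := (ModuleCat.epi_iff_surjective _).2 hε }
  exact hS.hasProjectiveDimensionLT_X₃ (n := n) hK (hasProjectiveDimensionLT_of_ge _ n _ (by lia))

/-- The map `1 ⊗ θ_j`. -/
def thetaRight (j : Fin p) : ThetaExt j L →ₗ[ℂ] ThetaExt j L :=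
  TensorProduct.map (LinearMap.id : ℂ[X] →ₗ[ℂ] ℂ[X]) (actLin (L := L) (DAlg.gen (Gen.theta j)))

/-- The map `x ⊗ 1 - 1 ⊗ θ_j`. -/
def thetaDiffLin (j : Fin p) : ThetaExt j L →ₗ[ℂ] ThetaExt j L :=
  actLin (DAlg.gen (Gen.theta j)) - thetaRight j

lemma thetaDiffLin_tmul (j : Fin p) (f : ℂ[X]) (l : L) :
    thetaDiffLin j (ThetaExt.tmul j f l) =
      ThetaExt.tmul j (X * f) l - ThetaExt.tmul j f (DAlg.gen (Gen.theta j) • l) :=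
  congrArg (fun y => y - ThetaExt.tmul j f (DAlg.gen (Gen.theta j) • l)) (thetaExt_theta j f l)

/-- Neither x ⊗ 1 nor 1 ⊗ θ_j commutes with t_j, but both commutators send f ⊗ l to f(x - 1) ⊗ t_j
l, so they cancel in the difference; similarly for t_j⁻¹. -/
lemma thetaDiffLin_gen (j : Fin p) (g : Gen p) (x : ThetaExt j L) :
    thetaDiffLin j (DAlg.gen g • x) = DAlg.gen g • thetaDiffLin j x := by
  induction x using ThetaExt.induction_on with
  | zero => simp only [smul_zero, map_zero]
  | add a b ha hb => simp only [smul_add, map_add, ha, hb]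
  | tmul f l =>
    rw [thetaDiffLin_tmul, smul_sub]
    by_cases hi : g.index = j
    · subst hi
      cases g with
      | t i =>
        change thetaDiffLin i (DAlg.gen (Gen.t i) • ThetaExt.tmul i f l) =
          DAlg.gen (Gen.t i) • ThetaExt.tmul i (X * f) l -
            DAlg.gen (Gen.t i) • ThetaExt.tmul i f (DAlg.gen (Gen.theta i) • l)
        rw [thetaExt_t, thetaExt_t, thetaExt_t, thetaDiffLin_tmul, smul_smul, smul_smul,
          DAlg.gen_theta_t_self, add_smul, map_add, map_mul, aeval_X, sub_mul, one_mul,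
          sub_eq_add_neg (X * _), ThetaExt.tmul_add_left, ← neg_one_smul ℂ (aeval (X - 1 : ℂ[X]) f),
          ThetaExt.tmul_smul_left, neg_one_smul]
        abel
      | tInv i =>
        change thetaDiffLin i (DAlg.gen (Gen.tInv i) • ThetaExt.tmul i f l) =
          DAlg.gen (Gen.tInv i) • ThetaExt.tmul i (X * f) l -
            DAlg.gen (Gen.tInv i) • ThetaExt.tmul i f (DAlg.gen (Gen.theta i) • l)
        rw [thetaExt_tInv, thetaExt_tInv, thetaExt_tInv, thetaDiffLin_tmul, smul_smul, smul_smul,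
          DAlg.gen_theta_tInv_self, sub_smul, map_sub, map_mul, aeval_X, add_mul, one_mul,
          ThetaExt.tmul_add_left]
        abel
      | theta i =>
        change thetaDiffLin i (DAlg.gen (Gen.theta i) • ThetaExt.tmul i f l) =
          DAlg.gen (Gen.theta i) • ThetaExt.tmul i (X * f) l -
            DAlg.gen (Gen.theta i) • ThetaExt.tmul i f (DAlg.gen (Gen.theta i) • l)
        rw [thetaExt_theta, thetaExt_theta, thetaExt_theta, thetaDiffLin_tmul]
    · rw [thetaExt_of_ne hi, thetaExt_of_ne hi, thetaExt_of_ne hi, thetaDiffLin_tmul, smul_smul,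
        smul_smul, (DAlg.commute_gen (a := Gen.theta j) (b := g) (Ne.symm hi)).eq]

/-- The map `x^n ⊗ l ↦ ∑_{i < n} x^i ⊗ θ_j^{n-1-i} l`. -/
def thetaHomotopy (j : Fin p) : ThetaExt j L →ₗ[ℂ] ThetaExt j L :=
  TensorProduct.lift ((Polynomial.basisMonomials ℂ).constr ℂ fun n =>
    ∑ i ∈ Finset.range n, ThetaExt.tmul j (X ^ i) ∘ₗ
      actLin (L := L) (DAlg.gen (Gen.theta j) ^ (n - 1 - i)))

lemma thetaHomotopy_tmul (j : Fin p) (n : ℕ) (l : L) :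
    thetaHomotopy j (ThetaExt.tmul j (X ^ n) l) = ∑ i ∈ Finset.range n,
      ThetaExt.tmul j (X ^ i) (DAlg.gen (Gen.theta j) ^ (n - 1 - i) • l) := by
  have h : (Polynomial.basisMonomials ℂ).constr ℂ (fun n =>
      ∑ i ∈ Finset.range n, ThetaExt.tmul j (X ^ i) ∘ₗ
        actLin (L := L) (DAlg.gen (Gen.theta j) ^ (n - 1 - i))) (X ^ n) =
      ∑ i ∈ Finset.range n, ThetaExt.tmul j (X ^ i) ∘ₗ
        actLin (L := L) (DAlg.gen (Gen.theta j) ^ (n - 1 - i)) := by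
    rw [X_pow_eq_monomial, ← congrFun (Polynomial.coe_basisMonomials ℂ) n, Module.Basis.constr_basis]
  refine (LinearMap.congr_fun h l).trans ?_
  rw [LinearMap.sum_apply]
  rfl

/-- The sum for x^{n+1} ⊗ l and the one for x^n ⊗ θ_j l have the same terms except for x^n ⊗ l. This
retraction gives the injectivity of x ⊗ 1 - 1 ⊗ θ_j. -/
lemma thetaHomotopy_thetaDiffLin (j : Fin p) (x : ThetaExt j L) :
    thetaHomotopy j (thetaDiffLin j x) = x := by
  induction x using ThetaExt.induction_pow with
  | zero => simp only [map_zero]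
  | add a b ha hb => simp only [map_add, ha, hb]
  | tmul n l =>
    rw [thetaDiffLin_tmul, map_sub, ← pow_succ', thetaHomotopy_tmul, thetaHomotopy_tmul,
      Finset.sum_range_succ, sub_eq_iff_eq_add, add_comm]
    congr 1
    · simp
    · refine Finset.sum_congr rfl fun i hi => ?_
      rw [smul_smul, ← pow_succ]
      congr 3
      have := Finset.mem_range.1 hi
      lia

/-- Modulo the image of x ⊗ 1 - 1 ⊗ θ_j a power of x can be moved to L as a power of θ_j, which
leaves 1 ⊗ L. -/
lemma exists_thetaDiffLin (j : Fin p) (x : ThetaExt j L) :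
    ∃ y, x = thetaDiffLin j y + ThetaExt.tmul j 1 (thetaLift j LinearMap.id x) := by
  induction x using ThetaExt.induction_pow with
  | zero => exact ⟨0, by simp only [map_zero, add_zero]⟩
  | add a b ha hb =>
    obtain ⟨y, hy⟩ := ha
    obtain ⟨z, hz⟩ := hb
    refine ⟨y + z, ?_⟩
    rw [map_add, map_add, map_add]
    nth_rewrite 1 [hy, hz]
    abel
  | tmul n l =>
    rw [thetaLift_tmul, map_pow, aeval_X, LinearMap.id_apply]
    induction n generalizing l with
    | zero => exact ⟨0, by rw [map_zero, zero_add, pow_zero, pow_zero, one_smul]⟩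
    | succ n ih =>
      obtain ⟨y, hy⟩ := ih (DAlg.gen (Gen.theta j) • l)
      refine ⟨ThetaExt.tmul j (X ^ n) l + y, ?_⟩
      rw [map_add, thetaDiffLin_tmul, hy, ← pow_succ', smul_smul, ← pow_succ]
      abel

/-- The short exact sequence is 0 → L[x] → L[x] → L → 0, with first map x ⊗ 1 - 1 ⊗ θ_j and second
map x ↦ θ_j. -/
lemma hasProjectiveDimensionLT_of_thetaExt (j : Fin p) {n : ℕ}
    (h : HasProjectiveDimensionLT (ModuleCat.of (DAlg p) (ThetaExt j L)) n) :
    HasProjectiveDimensionLT (ModuleCat.of (DAlg p) L) (n + 1) := by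
  have hε : ∀ l : L, thetaLift j LinearMap.id (ThetaExt.tmul j 1 l) = l := fun l => by
    rw [thetaLift_tmul, map_one, one_smul, LinearMap.id_apply]
  refine hasProjectiveDimensionLT_of_quotient (linOfGen (thetaDiffLin j) (thetaDiffLin_gen j))
    (linOfGen (thetaLift (L := L) j LinearMap.id) fun g x => ?_) ?_ (fun l => ⟨_, hε l⟩) ?_ h
  · by_cases hg : g = Gen.theta j
    · subst hg; exact thetaLift_theta j _ x
    · exact thetaLift_gen j _ hg (fun _ => rfl) x
  · exact Function.LeftInverse.injective (g := thetaHomotopy j) (thetaHomotopy_thetaDiffLin j)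
  · refine fun x => ⟨fun hx => ?_, ?_⟩
    · obtain ⟨y, hy⟩ := exists_thetaDiffLin j x
      refine ⟨y, ?_⟩
      rw [linOfGen_apply] at hx ⊢
      rw [hx, map_zero, add_zero] at hy
      exact hy.symm
    · rintro ⟨y, rfl⟩
      rw [linOfGen_apply, linOfGen_apply]
      induction y using ThetaExt.induction_on with
      | zero => simp only [map_zero]
      | add a b ha hb => simp only [map_add, ha, hb, add_zero]
      | tmul f l =>
        rw [thetaDiffLin_tmul, map_sub, thetaLift_tmul, thetaLift_tmul, map_mul, aeval_X,
          LinearMap.id_apply, LinearMap.id_apply, smul_smul,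
          (aeval_commute (Commute.refl _) f).eq, sub_self]

end Resolution
end
end RapidDecay

/-! ### Modules of Laurent polynomials and the degree in t_j -/

namespace RapidDecay
noncomputable section
variable {p : ℕ}

section Laurent
variable {L : Type} [AddCommGroup L] [Module ℂ L]

/-- The module `L[y, y⁻¹]` on which `t_j` acts by `y ⊗ t_j`. -/
def LaurentExt (_ : Fin p) (L : Type) [AddCommGroup L] : Type := ℤ →₀ L

instance (j : Fin p) : AddCommGroup (LaurentExt j L) := inferInstanceAs (AddCommGroup (ℤ →₀ L))
instance (j : Fin p) : Module ℂ (LaurentExt j L) := inferInstanceAs (Module ℂ (ℤ →₀ L))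

/-- The element `y^n ⊗ l` of `L[y, y⁻¹]`. -/
def LaurentExt.single (j : Fin p) (n : ℤ) : L →ₗ[ℂ] LaurentExt j L := Finsupp.lsingle n

@[elab_as_elim]
lemma LaurentExt.induction_on {j : Fin p} {P : LaurentExt j L → Prop} (x : LaurentExt j L)
    (zero : P 0) (single : ∀ n l, P (LaurentExt.single j n l))
    (add : ∀ a b, P a → P b → P (a + b)) : P x :=
  Finsupp.induction_linear (motive := P) x zero add single

/-- The linear map given by its values on `y^n ⊗ l`. -/
def LaurentExt.lift (j : Fin p) {N : Type} [AddCommGroup N] [Module ℂ N] (u : ℤ → L →ₗ[ℂ] N) :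
    LaurentExt j L →ₗ[ℂ] N :=
  Finsupp.lsum ℂ u

lemma LaurentExt.lift_single (j : Fin p) {N : Type} [AddCommGroup N] [Module ℂ N]
    (u : ℤ → L →ₗ[ℂ] N) (n : ℤ) (l : L) :
    LaurentExt.lift j u (LaurentExt.single j n l) = u n l :=
  Finsupp.lsum_single ℂ u n l

/-- The coefficient of `y^n`. -/
def LaurentExt.coeff (j : Fin p) (n : ℤ) : LaurentExt j L →ₗ[ℂ] L := Finsupp.lapply n

/-- The map `y - 1`. -/
def laurentDiffLin (j : Fin p) : LaurentExt j L →ₗ[ℂ] LaurentExt j L :=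
  LaurentExt.lift j fun n => LaurentExt.single j (n + 1) - LaurentExt.single j n

lemma laurentDiffLin_single (j : Fin p) (n : ℤ) (l : L) :
    laurentDiffLin j (LaurentExt.single j n l) =
      LaurentExt.single j (n + 1) l - LaurentExt.single j n l :=
  LaurentExt.lift_single j _ n l

/-- The map `y ↦ 1`. -/
def laurentSum (j : Fin p) : LaurentExt j L →ₗ[ℂ] L := LaurentExt.lift j fun _ => LinearMap.id

lemma laurentSum_single (j : Fin p) (n : ℤ) (l : L) :
    laurentSum j (LaurentExt.single j n l) = l :=
  LaurentExt.lift_single j _ n l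

lemma coeff_laurentDiffLin (j : Fin p) (n : ℤ) (x : LaurentExt j L) :
    LaurentExt.coeff j n (laurentDiffLin j x) =
      LaurentExt.coeff j (n - 1) x - LaurentExt.coeff j n x := by
  induction x using LaurentExt.induction_on with
  | zero => simp only [map_zero, sub_zero]
  | add a b ha hb => simp only [map_add, ha, hb]; abel
  | single m l =>
    rw [laurentDiffLin_single, map_sub]
    congr 1
    change (Finsupp.single (m + 1) l : ℤ →₀ L) n = (Finsupp.single m l : ℤ →₀ L) (n - 1)
    rw [Finsupp.single_apply, Finsupp.single_apply]
    exact if_congr (by lia) rfl rfl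

/-- An element killed by y - 1 has the same coefficient in all degrees, and this coefficient is zero
because the support is finite. -/
lemma laurentDiffLin_injective (j : Fin p) :
    Function.Injective (laurentDiffLin (L := L) j) := by
  refine (injective_iff_map_eq_zero _).2 fun x hx => ?_
  have h1 : ∀ n, LaurentExt.coeff j (n - 1) x = LaurentExt.coeff j n x := fun n => by
    rw [← sub_eq_zero, ← coeff_laurentDiffLin, hx, map_zero]
  have h2 : ∀ n, LaurentExt.coeff j n x = LaurentExt.coeff j 0 x := fun n => by
    induction n using Int.induction_on with
    | zero => rfl
    | succ i ih => rw [← ih, ← h1, add_sub_cancel_right]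
    | pred i ih => rw [h1, ih]
  obtain ⟨m, hm⟩ := Infinite.exists_notMem_finset (Finsupp.support (show ℤ →₀ L from x))
  have h3 : LaurentExt.coeff j m x = 0 := Finsupp.notMem_support_iff.1 hm
  exact Finsupp.ext (f := x) (g := 0) fun n => (h2 n).trans ((h2 m).symm.trans h3)

/-- Modulo the image of y - 1 every power of y can be replaced by 1. -/
lemma exists_laurentDiffLin (j : Fin p) (x : LaurentExt j L) :
    ∃ y, x = laurentDiffLin j y + LaurentExt.single j 0 (laurentSum j x) := by
  induction x using LaurentExt.induction_on with
  | zero => exact ⟨0, by simp only [map_zero, add_zero]⟩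
  | add a b ha hb =>
    obtain ⟨y, hy⟩ := ha
    obtain ⟨z, hz⟩ := hb
    refine ⟨y + z, ?_⟩
    rw [map_add, map_add, map_add]
    nth_rewrite 1 [hy, hz]
    abel
  | single n l =>
    rw [laurentSum_single]
    induction n using Int.induction_on with
    | zero => exact ⟨0, by rw [map_zero, zero_add]⟩
    | succ i ih =>
      obtain ⟨y, hy⟩ := ih
      refine ⟨LaurentExt.single j i l + y, ?_⟩
      rw [map_add, laurentDiffLin_single, add_assoc, ← hy]
      abel
    | pred i ih =>
      obtain ⟨y, hy⟩ := ih
      refine ⟨y - LaurentExt.single j (-i - 1) l, ?_⟩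
      rw [map_sub, laurentDiffLin_single, sub_add_cancel, sub_sub_eq_add_sub, hy]
      abel

variable [Module (DAlg p) L] [IsScalarTower ℂ (DAlg p) L]

/-- The operator `y^k ⊗ d` on `L[y, y⁻¹]`. -/
def shiftOp (k : ℤ) (d : DAlg p) : Module.End ℂ (ℤ →₀ L) :=
  Finsupp.lmapDomain L ℂ (fun n => n + k) ∘ₗ Finsupp.mapRange.linearMap (actLin d)

lemma shiftOp_single (k : ℤ) (d : DAlg p) (n : ℤ) (l : L) :
    shiftOp k d (Finsupp.single n l) = Finsupp.single (n + k) (d • l) := by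
  simp [shiftOp]

lemma shiftOp_mul (k m : ℤ) (d e : DAlg p) :
    shiftOp (L := L) k d * shiftOp m e = shiftOp (k + m) (d * e) := by
  refine Finsupp.lhom_ext fun n l => ?_
  rw [Module.End.mul_apply, shiftOp_single, shiftOp_single, shiftOp_single, smul_smul, add_assoc,
    add_comm m]

lemma shiftOp_one : shiftOp (L := L) 0 (1 : DAlg p) = 1 := by
  refine Finsupp.lhom_ext fun n l => ?_
  rw [shiftOp_single, add_zero, one_smul, Module.End.one_apply]

lemma shiftOp_add (k : ℤ) (d e : DAlg p) :
    shiftOp (L := L) k (d + e) = shiftOp k d + shiftOp k e := by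
  refine Finsupp.lhom_ext fun n l => ?_
  rw [LinearMap.add_apply, shiftOp_single, shiftOp_single, shiftOp_single, add_smul,
    Finsupp.single_add]

/-- The degree of a generator in the direction `j`. -/
def Gen.degree (j : Fin p) : Gen p → ℤ
  | t i => if i = j then 1 else 0
  | tInv i => if i = j then -1 else 0
  | theta _ => 0

/-- The operators on `L[y, y⁻¹]` for the grading by the degree in the direction `j`. -/
def laurentOp (L : Type) [AddCommGroup L] [Module ℂ L] [Module (DAlg p) L]
    [IsScalarTower ℂ (DAlg p) L] (j : Fin p) (g : Gen p) : Module.End ℂ (ℤ →₀ L) :=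
  shiftOp (g.degree j) (DAlg.gen g)

lemma laurentOp_rel (j : Fin p) ⦃a b : FreeAlgebra ℂ (Gen p)⦄ (h : Rel p a b) :
    FreeAlgebra.lift ℂ (laurentOp L j) a = FreeAlgebra.lift ℂ (laurentOp L j) b := by
  cases h with
  | t_comm i k =>
    simp only [map_mul, FreeAlgebra.lift_ι_apply, laurentOp, shiftOp_mul, DAlg.gen_t_comm i k,
      add_comm]
  | t_tInv i =>
    simp only [map_mul, map_one, FreeAlgebra.lift_ι_apply, laurentOp, shiftOp_mul, DAlg.gen_t_tInv]
    rw [← shiftOp_one (p := p)]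
    congr 1
    by_cases hi : i = j <;> simp [Gen.degree, hi]
  | tInv_t i =>
    simp only [map_mul, map_one, FreeAlgebra.lift_ι_apply, laurentOp, shiftOp_mul, DAlg.gen_tInv_t]
    rw [← shiftOp_one (p := p)]
    congr 1
    by_cases hi : i = j <;> simp [Gen.degree, hi]
  | theta_comm i k =>
    simp only [map_mul, FreeAlgebra.lift_ι_apply, laurentOp, shiftOp_mul, DAlg.gen_theta_comm i k,
      add_comm]
  | theta_t_self i =>
    simp only [map_mul, map_add, FreeAlgebra.lift_ι_apply, laurentOp, shiftOp_mul,
      DAlg.gen_theta_t_self i, shiftOp_add]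
    simp only [Gen.degree, zero_add, add_zero]
  | theta_t i k hik =>
    simp only [map_mul, FreeAlgebra.lift_ι_apply, laurentOp, shiftOp_mul, DAlg.gen_theta_t hik,
      add_comm]

instance (j : Fin p) : Module (DAlg p) (LaurentExt j L) :=
  moduleOfOperators (N := ℤ →₀ L) (laurentOp L j) (laurentOp_rel j)
instance (j : Fin p) : IsScalarTower ℂ (DAlg p) (LaurentExt j L) :=
  moduleOfOperators_tower (N := ℤ →₀ L) (laurentOp L j) (laurentOp_rel j)

lemma LaurentExt.gen_smul_single (j : Fin p) (g : Gen p) (n : ℤ) (l : L) :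
    DAlg.gen g • LaurentExt.single j n l =
      LaurentExt.single j (n + g.degree j) (DAlg.gen g • l) :=
  (moduleOfOperators_gen (N := ℤ →₀ L) (laurentOp L j) (laurentOp_rel j) g _).trans
    (shiftOp_single _ _ n l)

lemma laurentDiffLin_gen (j : Fin p) (g : Gen p) (x : LaurentExt j L) :
    laurentDiffLin j (DAlg.gen g • x) = DAlg.gen g • laurentDiffLin j x := by
  induction x using LaurentExt.induction_on with
  | zero => simp only [smul_zero, map_zero]
  | add a b ha hb => simp only [smul_add, map_add, ha, hb]
  | single n l =>
    rw [laurentDiffLin_single, smul_sub, LaurentExt.gen_smul_single, LaurentExt.gen_smul_single,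
      laurentDiffLin_single, add_right_comm]

/-- The short exact sequence is 0 → L[y, y⁻¹] → L[y, y⁻¹] → L → 0, given by y - 1 and y ↦ 1. Both
maps are D-linear because y is central for the graded action. -/
lemma hasProjectiveDimensionLT_of_laurentExt (j : Fin p) {n : ℕ}
    (h : HasProjectiveDimensionLT (ModuleCat.of (DAlg p) (LaurentExt j L)) n) :
    HasProjectiveDimensionLT (ModuleCat.of (DAlg p) L) (n + 1) := by
  refine hasProjectiveDimensionLT_of_quotient
    (linOfGen (laurentDiffLin j) (laurentDiffLin_gen j))
    (linOfGen (laurentSum (L := L) j) fun g x => ?_) (laurentDiffLin_injective j)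
    (fun l => ⟨_, laurentSum_single j 0 l⟩) ?_ h
  · induction x using LaurentExt.induction_on with
    | zero => simp only [smul_zero, map_zero]
    | add a b ha hb => simp only [smul_add, map_add, ha, hb]
    | single n l => rw [LaurentExt.gen_smul_single, laurentSum_single, laurentSum_single]
  · refine fun x => ⟨fun hx => ?_, ?_⟩
    · obtain ⟨y, hy⟩ := exists_laurentDiffLin j x
      refine ⟨y, ?_⟩
      rw [linOfGen_apply] at hx ⊢
      rw [hx, map_zero, add_zero] at hy
      exact hy.symm
    · rintro ⟨y, rfl⟩
      rw [linOfGen_apply, linOfGen_apply]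
      induction y using LaurentExt.induction_on with
      | zero => simp only [map_zero]
      | add a b ha hb => simp only [map_add, ha, hb, add_zero]
      | single n l =>
        rw [laurentDiffLin_single, map_sub, laurentSum_single, laurentSum_single, sub_self]

/-- Since y^n ⊗ l = t_j^n (1 ⊗ t_j^{-n} l), a map commuting with t_j and t_j⁻¹ is determined by its
restriction to degree 0. The generators in S have index different from j, so they preserve degree 0
and commute with t_j, and the lifting problem reduces to L and S. -/
lemma RelProjective.laurentExt (j : Fin p) {S : Set (Gen p)} (hS : ∀ g ∈ S, g.index ≠ j)
    (h : RelProjective S L) :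
    RelProjective (insert (Gen.t j) (insert (Gen.tInv j) S)) (LaurentExt j L) := by
  intro X Y _ _ _ _ _ _ _ _ π f hπ hf
  have hdeg : ∀ g ∈ S, g.degree j = 0 := by
    intro g hg
    have := hS g hg
    cases g with
    | t i => exact if_neg this
    | tInv i => exact if_neg this
    | theta i => rfl
  have hf0 : CommutesWith S (f ∘ₗ LaurentExt.single j 0) := fun g hg l => by
    have h1 := hf g (Set.mem_insert_of_mem _ (Set.mem_insert_of_mem _ hg))
      (LaurentExt.single j 0 l)
    rw [LaurentExt.gen_smul_single, hdeg g hg] at h1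
    exact h1
  obtain ⟨u, hu, huf⟩ := h X Y π _ hπ hf0
  let T : ℤ → DAlg p := fun n => ((DAlg.tUnit j ^ n : (DAlg p)ˣ) : DAlg p)
  have hT : ∀ m n, T m * T n = T (m + n) := fun m n => by
    rw [← Units.val_mul, ← zpow_add]
  have hT1 : T 1 = DAlg.gen (Gen.t j) := by
    change ((DAlg.tUnit j ^ (1 : ℤ) : (DAlg p)ˣ) : DAlg p) = _
    rw [zpow_one]; rfl
  have hTn : T (-1) = DAlg.gen (Gen.tInv j) := by
    change ((DAlg.tUnit j ^ (-1 : ℤ) : (DAlg p)ˣ) : DAlg p) = _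
    rw [zpow_neg_one]; rfl
  have hT0 : T 0 = 1 := by
    change ((DAlg.tUnit j ^ (0 : ℤ) : (DAlg p)ˣ) : DAlg p) = _
    rw [zpow_zero]; rfl
  have hTc : ∀ g ∈ S, ∀ n, DAlg.gen g * T n = T n * DAlg.gen g := fun g hg n =>
    (Commute.units_zpow_right (u := DAlg.tUnit j) (DAlg.commute_gen (hS g hg)) n).eq
  -- This is the only extension of u compatible with t_j and t_j⁻¹.
  let w : LaurentExt j L →ₗ[ℂ] X := LaurentExt.lift j fun n => actLin (T n) ∘ₗ u ∘ₗ actLin (T (-n))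
  have hw : ∀ n l, w (LaurentExt.single j n l) = T n • u (T (-n) • l) := fun n l =>
    LaurentExt.lift_single j _ n l
  have key : ∀ (g : Gen p) (n : ℤ) (l : L),
      DAlg.gen g = T (g.degree j) → w (DAlg.gen g • LaurentExt.single j n l) =
        DAlg.gen g • w (LaurentExt.single j n l) := by
    intro g n l hg
    rw [LaurentExt.gen_smul_single, hw, hw, hg, smul_smul, smul_smul, hT, hT]
    congr 2
    · rw [add_comm]
    · congr 2; ring
  have ht : (Gen.t j).degree j = 1 := if_pos rfl
  have htInv : (Gen.tInv j).degree j = -1 := if_pos rfl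
  refine ⟨w, ?_, fun x => ?_⟩
  · intro g hg x
    induction x using LaurentExt.induction_on with
    | zero => simp only [smul_zero, map_zero]
    | add a b ha hb => simp only [smul_add, map_add, ha, hb]
    | single n l =>
      obtain rfl | rfl | hg := hg
      · exact key _ n l (by rw [ht, hT1])
      · exact key _ n l (by rw [htInv, hTn])
      · rw [LaurentExt.gen_smul_single, hw, hw, hdeg g hg, add_zero, smul_smul, ← hTc g hg,
          mul_smul, hu g hg, smul_smul, smul_smul, hTc g hg]
  -- The same formula holds for f, so w lifts f in all degrees once u lifts it in degree 0.
  · have hf1 : ∀ n l, T n • f (LaurentExt.single j 0 (T (-n) • l)) =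
        f (LaurentExt.single j n l) := by
      have ha : ∀ x, T 1 • f x = f (T 1 • x) := fun x => by
        rw [hT1]; exact (hf _ (Set.mem_insert _ _) x).symm
      have hb : ∀ x, T (-1) • f x = f (T (-1) • x) := fun x => by
        rw [hTn]; exact (hf _ (Set.mem_insert_of_mem _ (Set.mem_insert _ _)) x).symm
      have h1 : ∀ (m : ℤ) (l : L), T 1 • LaurentExt.single j m l = LaurentExt.single j (m + 1) (T 1 • l) := by
        intro m l; rw [hT1, LaurentExt.gen_smul_single, ht]
      have h2 : ∀ (m : ℤ) (l : L), T (-1) • LaurentExt.single j m l =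
          LaurentExt.single j (m - 1) (T (-1) • l) := by
        intro m l; rw [hTn, LaurentExt.gen_smul_single, htInv]; rfl
      intro n
      induction n using Int.induction_on with
      | zero => intro l; rw [neg_zero, hT0, one_smul, one_smul]
      | succ i ih =>
        intro l
        rw [add_comm (i : ℤ) 1, ← hT, mul_smul, neg_add, add_comm (-1), ← hT, mul_smul, ih, ha, h1,
          smul_smul, hT, add_neg_cancel, hT0, one_smul, add_comm (i : ℤ) 1]
      | pred i ih =>
        intro l
        have e : (-(i : ℤ) - 1) = -1 + -i := by ring
        have e' : -(-1 + -(i : ℤ)) = - -i + 1 := by ring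
        rw [e, ← hT, mul_smul, e', ← hT, mul_smul, ih, hb, h2,
          smul_smul, hT, neg_add_cancel, hT0, one_smul, ← e]
    induction x using LaurentExt.induction_on with
    | zero => simp only [map_zero]
    | add a b ha hb => simp only [map_add, ha, hb]
    | single n l => rw [hw, map_smul, huf]; exact hf1 n l

end Laurent

/-! ### The global dimension of D and vanishing in high degrees -/

section Dimension

/-- The generators `t_i^{±1}` with `i < a` and `θ_i` with `i < b`. -/
def genSet (p a b : ℕ) : Set (Gen p) :=
  {g | match g with
    | Gen.t i => (i : ℕ) < a
    | Gen.tInv i => (i : ℕ) < a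
    | Gen.theta i => (i : ℕ) < b}

lemma genSet_theta (p a b : ℕ) (hb : b < p) :
    genSet p a (b + 1) = insert (Gen.theta ⟨b, hb⟩) (genSet p a b) := by
  ext g
  cases g <;> simp [genSet, Fin.ext_iff]
  lia

lemma genSet_t (p a b : ℕ) (ha : a < p) :
    genSet p (a + 1) b =
      insert (Gen.t ⟨a, ha⟩) (insert (Gen.tInv ⟨a, ha⟩) (genSet p a b)) := by
  ext g
  cases g <;> simp [genSet, Fin.ext_iff] <;> lia

/-- Induction on the number n of generators θ_i not yet respected. Each passage to L[x] adds one of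
them, at the cost of one dimension; when none is missing the module is projective. -/
lemma hasProjectiveDimensionLT_of_genSet_theta (n b : ℕ) (hb : b + n = p) (L : Type)
    [AddCommGroup L] [Module ℂ L] [Module (DAlg p) L] [IsScalarTower ℂ (DAlg p) L]
    (h : RelProjective (genSet p p b) L) :
    HasProjectiveDimensionLT (ModuleCat.of (DAlg p) L) (n + 1) := by
  induction n generalizing b L with
  | zero =>
    have : genSet p p b = Set.univ := by
      ext g
      cases g <;> simp [genSet]
      lia
    rw [this] at h
    have := h.projective
    infer_instance
  | succ n ih =>
    refine hasProjectiveDimensionLT_of_thetaExt ⟨b, by lia⟩ (ih (b + 1) (by lia) _ ?_)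
    rw [genSet_theta p p b (by lia)]
    exact h.thetaExt _ (by simp [genSet])

/-- The pairs t_i, t_i⁻¹ are added while no θ_i is in the set: the Laurent step needs the generators
already respected to have another index, whereas the step for θ_j allows t_j to be among them. -/
lemma hasProjectiveDimensionLT_of_genSet_t (n a : ℕ) (ha : a + n = p) (L : Type)
    [AddCommGroup L] [Module ℂ L] [Module (DAlg p) L] [IsScalarTower ℂ (DAlg p) L]
    (h : RelProjective (genSet p a 0) L) :
    HasProjectiveDimensionLT (ModuleCat.of (DAlg p) L) (p + 1 + n) := by
  induction n generalizing a L with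
  | zero =>
    obtain rfl : a = p := ha
    exact hasProjectiveDimensionLT_of_genSet_theta a 0 (zero_add a) L h
  | succ n ih =>
    refine hasProjectiveDimensionLT_of_laurentExt ⟨a, by lia⟩ (ih (a + 1) (by lia) _ ?_)
    rw [genSet_t p a 0 (by lia)]
    refine h.laurentExt _ ?_
    intro g hg
    cases g <;> simp [genSet, Gen.index, Fin.ext_iff] at hg ⊢ <;> lia

/-- The projective dimension of a `D`-module is at most `2p`. -/
lemma hasProjectiveDimensionLT_moduleCat (M : ModuleCat.{0} (DAlg p)) :
    HasProjectiveDimensionLT M (p + 1 + p) := by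
  let : Module ℂ M := Module.compHom M (algebraMap ℂ (DAlg p))
  have : IsScalarTower ℂ (DAlg p) M := ⟨fun c d x => by
    rw [Algebra.smul_def, mul_smul]; rfl⟩
  have h : RelProjective (genSet p 0 0) M := by
    have : genSet p 0 0 = ∅ := by
      ext g; cases g <;> simp [genSet]
    rw [this]
    exact relProjective_empty M
  exact hasProjectiveDimensionLT_of_genSet_t p 0 (zero_add p) M h

/-- Over each open U the complex computes Ext over D of M with values in the D-module 𝒜^{<0}(U), and
this vanishes beyond degree 2p. A cocycle thus has a primitive on U itself, without shrinking. -/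
lemma exactAt_solParam_of_lt {M : ModuleCat.{0} (DAlg p)} (P : ProjectiveResolution M) (q n : ℕ)
    (hn : 2 * p < n) : (solParam P q).ExactAt n := by
  obtain ⟨m, rfl⟩ : ∃ m, n = m + 1 := ⟨n - 1, by lia⟩
  have hnext : (ComplexShape.up ℕ).next (m + 1) = m + 1 + 1 := (ComplexShape.up ℕ).next_eq' rfl
  have hprev : (ComplexShape.up ℕ).prev (m + 1) = m := (ComplexShape.up ℕ).prev_eq' rfl
  refine exactAt_solParam P q (m + 1) ?_
  rw [hnext, hprev]
  intro U ξ hξ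
  have := hasProjectiveDimensionLT_moduleCat M
  let Y := ModuleCat.of (DAlg p) (rapidSections p q U)
  let f : P.complex.X (m + 1) ⟶ Y := ModuleCat.ofHom ξ
  have hf : P.complex.d (m + 1 + 1) (m + 1) ≫ f = 0 := ModuleCat.hom_ext hξ
  -- The cocycle is read as an Ext class in degree m + 1 > 2p; its vanishing means that the cocycle
  -- factors through the previous differential.
  have h0 : P.extMk f (m + 1 + 1) rfl hf = 0 :=
    (HasProjectiveDimensionLT.subsingleton M (p + 1 + p) (m + 1) (by lia) Y).elim _ _
  obtain ⟨y, hy⟩ := (P.extMk_eq_zero_iff f (m + 1 + 1) rfl hf m rfl).1 h0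
  exact ⟨y.hom, congrArg ModuleCat.Hom.hom hy⟩

end Dimension
end
end RapidDecay

/-! ### Conclusion -/

theorem theorem2 (p : ℕ) (M : ModuleCat.{0} (RapidDecay.DAlg p))
    [Module.Finite (RapidDecay.DAlg p) M] (P : ProjectiveResolution M)
    (hC : ∀ n : ℕ, RapidDecay.IsCConstructible
      ((RapidDecay.rhom P (RapidDecay.rapidSheafBase p)).homology n))
    (hR : ∀ n : ℕ, RapidDecay.IsRConstructible
      ((RapidDecay.rhom P (RapidDecay.rapidSheafBase p)).homology n)) :
    (∃ N : ℕ, ∀ n > N, (RapidDecay.solTensor P p).ExactAt n ∧ (RapidDecay.solParam P p).ExactAt n) ∧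
      QuasiIso (RapidDecay.canonicalMap P p) := by
  have hq := RapidDecay.quasiIso_canonicalMap_of_isRConstructible P hR p
  -- The bound 2p is proved for the complex of homomorphisms; the quasi-isomorphism passes it to the
  -- tensor product.
  refine ⟨⟨2 * p, fun n hn => ?_⟩, hq⟩
  have h := RapidDecay.exactAt_solParam_of_lt P p n hn
  have := hq.quasiIsoAt n
  exact ⟨(exactAt_iff_of_quasiIsoAt (RapidDecay.canonicalMap P p) n).2 h, h⟩
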